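/- Let $k$ be a field of characteristic zero. All DG algebras are $\mathbb{Z}$-graded associative unital $k$-algebras with a differential of degree $-1$, and a DG algebra $Q$ is called cofibrant if $k\to Q$ has the left lifting property with respect to all surjective quasi-isomorphisms of DG algebras. For a DG algebra $A$ let $A_2$ be the commutative DG algebra representing the functor $B\mapsto \mathrm{Hom}(A,\mathcal{M}_2(B))$ on commutative DG algebras; it is generated by the matrix entries $a_{ij}$ ($a\in A$, $1\le i,j\le 2$) and carries the action of $\mathrm{GL}_2(k)$ given by $\|a_{ij}\|\mapsto g\,\|a_{ij}\|\,g^{-1}$. Let $A_{\natural\natural}$ be the abelianization of $A$, so that $(A_{\natural\natural})^{\otimes 2}$ represents $B\mapsto\mathrm{Hom}(A,B\times B)$ and is generated by the elements $a_1=a\otimes 1$, $a_2=1\otimes a$, and let $S^2(A_{\natural\natural})=[(A_{\natural\natural})^{\otimes 2}]^{S_2}$. The assignment $a_{ij}\mapsto\delta_{ij}a_i$ restricts to a morphism of DG algebras $\Phi_2(A)\colon A_2^{\mathrm{GL}}\to S^2(A_{\natural\natural})$. A cofibrant resolution of $k[x,y]$ is a cofibrant DG algebra $Q$ with a quasi-isomorphism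 $Q\to k[x,y]$, where $k[x,y]$ is placed in degree $0$; then $\mathrm{DRep}_2(k[x,y])$ is represented by $Q_2$, $\mathrm{DRep}_2(k[x,y])^{\mathrm{GL}}$ by $Q_2^{\mathrm{GL}}$, and $\mathrm{H}_\bullet(k[x,y],2)=\mathrm{H}_\bullet(Q_2)$. **Theorem 4.5** (the case $n=2$ of Conjecture 1). 1. The algebra $R=k\langle x,y,\theta\rangle$ with $|x|=|y|=0$, $|\theta|=1$, $dx=dy=0$, $d\theta=-[x,y]$, together with the map $x\mapsto x$, $y\mapsto y$, $\theta\mapsto 0$, is a cofibrant resolution of $k[x,y]$. The canonical map $(R_{\natural\natural})^{\otimes 2}\to k[x_1,x_2,y_1,y_2,\theta_1,\theta_2]$ is an isomorphism of DG algebras, where the target is the free graded commutative algebra with $|x_i|=|y_i|=0$, $|\theta_i|=1$ and zero differential. The resulting map $$\Phi_2\colon \mathrm{DRep}_2(k[x,y])^{\mathrm{GL}}\simeq R_2^{\mathrm{GL}}\longrightarrow k[x_1,x_2,y_1,y_2,\theta_1,\theta_2]^{S_2},$$ the restriction of $x_{ij}\mapsto\delta_{ij}x_i$, $y_{ij}\mapsto\delta_{ij}y_i$,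 $\theta_{ij}\mapsto\delta_{ij}\theta_i$, is a quasi-isomorphism; here $S_2$ permutes the triples $(x_i,y_i,\theta_i)$. 2. For every cofibrant resolution $Q$ of $k[x,y]$, the derived Harish-Chandra homomorphism $\Phi_2(Q)\colon Q_2^{\mathrm{GL}}\to S^2(Q_{\natural\natural})$ is a quasi-isomorphism. Consequently, there is an isomorphism of graded commutative algebras $$\mathrm{H}_\bullet(k[x,y],2)^{\mathrm{GL}}=\mathrm{H}_\bullet(Q_2)^{\mathrm{GL}}\;\cong\; k[x_1,x_2,y_1,y_2,\theta_1,\theta_2]^{S_2}.$$ -/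

import Mathlib

universe u

open scoped DirectSum TensorProduct

/-- An associative unital differential graded algebra over `k`: a `ℤ`-graded `k`-algebra with a
differential of degree `-1` satisfying the graded Leibniz rule. -/
structure DGAlg (k : Type u) [Field k] : Type (u + 1) where
  carrier : Type u
  [ring : Ring carrier]
  [algebra : Algebra k carrier]
  /-- The component of homological degree `i`. -/
  gr : ℤ → Submodule k carrier
  [graded : GradedAlgebra gr]
  d : carrier →ₗ[k] carrier
  d_mem : ∀ (i : ℤ) (a : carrier), a ∈ gr i → d a ∈ gr (i - 1)
  d_d : ∀ a : carrier, d (d a) = 0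
  leibniz : ∀ (i : ℤ) (a b : carrier), a ∈ gr i →
    d (a * b) = d a * b + i.negOnePow • (a * d b)

namespace DGAlg

attribute [instance] DGAlg.ring DGAlg.algebra DGAlg.graded

instance {k : Type u} [Field k] : CoeSort (DGAlg k) (Type u) := ⟨DGAlg.carrier⟩

/-- Graded commutativity (objects of the category of commutative DG algebras; the base field is
of characteristic zero in all applications, so odd elements square to zero). -/
def IsGradedComm {k : Type u} [Field k] (A : DGAlg k) : Prop :=
  ∀ (i j : ℤ) (a b : A), a ∈ A.gr i → b ∈ A.gr j → a * b = (i * j).negOnePow • (b * a)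

/-- Morphisms of DG algebras. -/
structure Hom {k : Type u} [Field k] (A B : DGAlg k) : Type u where
  toAlgHom : A →ₐ[k] B
  map_mem : ∀ (i : ℤ) (a : A), a ∈ A.gr i → toAlgHom a ∈ B.gr i
  map_d : ∀ a : A, toAlgHom (A.d a) = B.d (toAlgHom a)

instance {k : Type u} [Field k] (A B : DGAlg k) : CoeFun (Hom A B) (fun _ => A → B) :=
  ⟨fun f => f.toAlgHom⟩

/-- Composition of morphisms of DG algebras. -/
def Hom.comp {k : Type u} [Field k] {A B C : DGAlg k} (g : Hom B C) (f : Hom A B) : Hom A C where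
  toAlgHom := g.toAlgHom.comp f.toAlgHom
  map_mem i a ha := g.map_mem i _ (f.map_mem i a ha)
  map_d a := by simp [f.map_d, g.map_d]

/-! ### Homology -/

/-- The grading involution `a ↦ (-1)^{|a|} a`. -/
noncomputable def sgn {k : Type u} [Field k] (A : DGAlg k) : A →ₗ[k] A :=
  (DirectSum.toModule k ℤ A fun i => (i.negOnePow : ℤ) • (A.gr i).subtype) ∘ₗ
    (DirectSum.decomposeLinearEquiv A.gr).toLinearMap

theorem sgn_of_mem {k : Type u} [Field k] (A : DGAlg k) {i : ℤ} {a : A} (ha : a ∈ A.gr i) :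
    A.sgn a = i.negOnePow • a := by
  lift a to A.gr i using ha
  simp [sgn, Units.smul_def]

theorem induction_hom {k : Type u} [Field k] (A : DGAlg k) {p : A → Prop}
    (h0 : p 0) (hadd : ∀ a b, p a → p b → p (a + b)) (hhom : ∀ i a, a ∈ A.gr i → p a) (a : A) :
    p a := by
  induction a using DirectSum.Decomposition.inductionOn A.gr with
  | zero => exact h0
  | homogeneous m => exact hhom _ _ m.2
  | add m m' h h' => exact hadd _ _ h h'

theorem d_mul {k : Type u} [Field k] (A : DGAlg k) (a b : A) :
    A.d (a * b) = A.d a * b + A.sgn a * A.d b := by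
  induction a using A.induction_hom with
  | h0 => simp
  | hadd a a' h h' => rw [add_mul, map_add, h, h', map_add, map_add]; noncomm_ring
  | hhom i a ha => rw [A.leibniz i a b ha, A.sgn_of_mem ha, smul_mul_assoc]

theorem d_one {k : Type u} [Field k] (A : DGAlg k) : A.d 1 = 0 := by
  have h := A.leibniz 0 1 1 SetLike.GradedOne.one_mem
  simpa using h

theorem d_algebraMap {k : Type u} [Field k] (A : DGAlg k) (c : k) :
    A.d (algebraMap k A c) = 0 := by
  rw [Algebra.algebraMap_eq_smul_one, map_smul, d_one, smul_zero]

theorem sgn_sgn {k : Type u} [Field k] (A : DGAlg k) (a : A) : A.sgn (A.sgn a) = a := by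
  induction a using A.induction_hom with
  | h0 => simp
  | hadd a a' h h' => rw [map_add, map_add, h, h']
  | hhom i a ha =>
    rw [A.sgn_of_mem ha, Units.smul_def, map_zsmul, A.sgn_of_mem ha, ← Units.smul_def, smul_smul]
    simp

theorem d_sgn {k : Type u} [Field k] (A : DGAlg k) (a : A) : A.d (A.sgn a) = -A.sgn (A.d a) := by
  induction a using A.induction_hom with
  | h0 => simp
  | hadd a a' h h' => rw [map_add, map_add, h, h', map_add, map_add]; abel
  | hhom i a ha =>
    rw [A.sgn_of_mem ha, A.sgn_of_mem (A.d_mem i a ha), Units.smul_def, map_zsmul,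
      ← Units.smul_def, Int.negOnePow_sub]
    simp

/-- The subalgebra of cycles. -/
def cycles {k : Type u} [Field k] (A : DGAlg k) : Subalgebra k A where
  carrier := {a | A.d a = 0}
  mul_mem' {a b} ha hb := by
    simp only [Set.mem_ofPred_eq] at *
    rw [d_mul, ha, hb]; simp
  add_mem' {a b} ha hb := by
    simp only [Set.mem_ofPred_eq] at *
    rw [map_add, ha, hb, add_zero]
  algebraMap_mem' c := A.d_algebraMap c

/-- The ideal of boundaries in the algebra of cycles. -/
def boundaries {k : Type u} [Field k] (A : DGAlg k) : Ideal A.cycles where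
  carrier := {z | ∃ c : A, A.d c = z}
  add_mem' := by
    rintro a b ⟨c, hc⟩ ⟨c', hc'⟩
    exact ⟨c + c', by simp [hc, hc']⟩
  zero_mem' := ⟨0, by simp⟩
  smul_mem' := by
    rintro ⟨z, hz⟩ b ⟨c, hc⟩
    refine ⟨A.sgn z * c, ?_⟩
    have hz' : A.d z = 0 := hz
    rw [d_mul, sgn_sgn, d_sgn, hz']
    simp [hc]

instance {k : Type u} [Field k] (A : DGAlg k) : A.boundaries.IsTwoSided where
  mul_mem_of_left := by
    rintro a ⟨z, hz⟩ ⟨c, hc⟩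
    have hz' : A.d z = 0 := hz
    exact ⟨c * z, by rw [d_mul, hz', hc]; simp⟩

/-- The homology algebra `H_•(A) = ker d / im d`. -/
abbrev homology {k : Type u} [Field k] (A : DGAlg k) : Type u := A.cycles ⧸ A.boundaries

/-- The component `H_i(A)` of the homology algebra. -/
def homologyGr {k : Type u} [Field k] (A : DGAlg k) (i : ℤ) : Submodule k A.homology :=
  ((A.gr i).comap A.cycles.val.toLinearMap).map
    (Ideal.Quotient.mkₐ k A.boundaries).toLinearMap

/-- The map induced on cycles. -/
def Hom.cyclesMap {k : Type u} [Field k] {A B : DGAlg k} (f : Hom A B) :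
    A.cycles →ₐ[k] B.cycles :=
  (f.toAlgHom.comp A.cycles.val).codRestrict B.cycles fun z => by
    have hz : A.d z = 0 := z.2
    change B.d (f.toAlgHom z) = 0
    rw [← f.map_d, hz, map_zero]

/-- The map induced on homology. -/
def Hom.homologyMap {k : Type u} [Field k] {A B : DGAlg k} (f : Hom A B) :
    A.homology →ₐ[k] B.homology :=
  Ideal.quotientMapₐ B.boundaries f.cyclesMap (by
    rintro z ⟨c, hc⟩
    exact ⟨f c, by rw [← f.map_d, hc]; rfl⟩)

/-- Quasi-isomorphisms: the morphisms inducing an isomorphism on homology. -/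
def Hom.QuasiIso {k : Type u} [Field k] {A B : DGAlg k} (f : Hom A B) : Prop :=
  Function.Bijective f.homologyMap

/-- Cofibrant objects of the model category of DG algebras in which the weak equivalences are the
quasi-isomorphisms and the fibrations are the surjections: the morphism from the initial object
`k` has the left lifting property with respect to the acyclic fibrations. -/
def IsCofibrant {k : Type u} [Field k] (Q : DGAlg k) : Prop :=
  ∀ (B C : DGAlg k) (f : Hom B C), Function.Surjective f → f.QuasiIso →
    ∀ g : Hom Q C, ∃ h : Hom Q B, ∀ a : Q, f (h a) = g a

/-! ### Invariants -/

/-- The subalgebra of elements fixed by a family of endomorphisms. -/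
def fixedSubalgebra {k : Type u} [Field k] (A : DGAlg k) {G : Type*} (φ : G → Hom A A) :
    Subalgebra k A where
  carrier := {a | ∀ g, φ g a = a}
  mul_mem' {a b} ha hb g := by rw [map_mul, ha g, hb g]
  add_mem' {a b} ha hb g := by rw [map_add, ha g, hb g]
  algebraMap_mem' c g := by simp

theorem fixed_isInternal {k : Type u} [Field k] (A : DGAlg k) {G : Type*} (φ : G → Hom A A) :
    DirectSum.IsInternal fun i =>
      (A.gr i).comap (A.fixedSubalgebra φ).val.toLinearMap := by
  classical
  set S := A.fixedSubalgebra φ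
  constructor
  · rw [injective_iff_map_eq_zero]
    intro x hx
    have key : ∀ y : (⨁ i, (A.gr i).comap S.val.toLinearMap),
        (DirectSum.coeAddMonoidHom A.gr) (DirectSum.map
          (fun i => ({ toFun := fun z => ⟨z.1.1, z.2⟩, map_zero' := rfl, map_add' := fun _ _ => rfl } :
            ((A.gr i).comap S.val.toLinearMap) →+ A.gr i)) y) =
        ((DirectSum.coeAddMonoidHom (fun i => (A.gr i).comap S.val.toLinearMap) y : S) : A) := by
      intro y
      induction y using DirectSum.induction_on with
      | zero => simp
      | of i z => simp
      | add y y' h h' => simp only [map_add, h, h']; rfl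
    have h1 := key x
    rw [hx] at h1
    have h2 := (DirectSum.Decomposition.isInternal A.gr).1 (h1.trans (map_zero _).symm)
    have h3 : Function.Injective (DirectSum.map
          (fun i => ({ toFun := fun z => ⟨z.1.1, z.2⟩, map_zero' := rfl, map_add' := fun _ _ => rfl } :
            ((A.gr i).comap S.val.toLinearMap) →+ A.gr i))) := by
      rw [DirectSum.map_injective]
      intro i z z' h
      exact Subtype.ext (Subtype.ext (congrArg (fun t : A.gr i => (t : A)) h))
    exact h3 (h2.trans (map_zero _).symm)
  · intro a
    have hfix : ∀ i, ((DirectSum.decompose A.gr (a : A) i : A.gr i) : A) ∈ S := by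
      intro i g
      have hg : φ g (a : A) = a := a.2 g
      have : ∀ b : A, (DirectSum.decompose A.gr (φ g b) i : A) =
          φ g (DirectSum.decompose A.gr b i : A) := by
        intro b
        induction b using A.induction_hom with
        | h0 => simp
        | hadd b b' h h' => simp [DirectSum.decompose_add, h, h']
        | hhom j b hb =>
          by_cases hij : j = i
          · subst hij
            rw [DirectSum.decompose_of_mem_same _ hb,
              DirectSum.decompose_of_mem_same _ ((φ g).map_mem _ _ hb)]
          · rw [DirectSum.decompose_of_mem_ne _ hb hij,
              DirectSum.decompose_of_mem_ne _ ((φ g).map_mem _ _ hb) hij, map_zero]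
      rw [← this, hg]
    refine ⟨∑ i ∈ (DirectSum.decompose A.gr (a : A)).support,
      DirectSum.of (fun i => (A.gr i).comap S.val.toLinearMap) i
        ⟨⟨_, hfix i⟩, (DirectSum.decompose A.gr (a : A) i).2⟩, ?_⟩
    apply Subtype.ext
    rw [map_sum, AddSubmonoidClass.coe_finsetSum]
    simp only [DirectSum.coeAddMonoidHom_of]
    exact DirectSum.sum_support_decompose A.gr (a : A)

/-- The DG subalgebra `A^G` of elements fixed by a family of DG algebra endomorphisms. -/
noncomputable def fixed {k : Type u} [Field k] (A : DGAlg k) {G : Type*} (φ : G → Hom A A) :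
    DGAlg k where
  carrier := A.fixedSubalgebra φ
  gr i := (A.gr i).comap (A.fixedSubalgebra φ).val.toLinearMap
  graded :=
    { one_mem := SetLike.GradedOne.one_mem (A := A.gr)
      mul_mem := fun _ _ _ _ ha hb => SetLike.GradedMul.mul_mem (A := A.gr) ha hb
      toDecomposition := (A.fixed_isInternal φ).chooseDecomposition }
  d := (A.d ∘ₗ (A.fixedSubalgebra φ).val.toLinearMap).codRestrict
    (Subalgebra.toSubmodule (A.fixedSubalgebra φ)) fun a g => by
      have ha : φ g (a : A) = a := a.2 g
      change φ g (A.d (a : A)) = A.d (a : A)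
      rw [(φ g).map_d, ha]
  d_mem i a ha := A.d_mem i _ ha
  d_d a := Subtype.ext (A.d_d _)
  leibniz i a b ha := Subtype.ext (by
    have h := A.leibniz i (a : A) (b : A) ha
    rcases Int.units_eq_one_or i.negOnePow with h' | h'
    · rw [h', one_smul] at h ⊢
      exact h
    · rw [h', Units.neg_smul, one_smul] at h ⊢
      exact h)

/-- A morphism sending `G`-fixed elements to `G'`-fixed elements restricts to the
DG subalgebras of fixed elements. -/
def Hom.onFixed {k : Type u} [Field k] {A B : DGAlg k} (f : Hom A B) {G G' : Type*}
    (φ : G → Hom A A) (ψ : G' → Hom B B)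
    (h : ∀ a : A, (∀ g, φ g a = a) → ∀ g', ψ g' (f a) = f a) :
    Hom (A.fixed φ) (B.fixed ψ) where
  toAlgHom := (f.toAlgHom.comp (A.fixedSubalgebra φ).val).codRestrict (B.fixedSubalgebra ψ)
    fun a => h a a.2
  map_mem i _ ha := f.map_mem i _ ha
  map_d _ := Subtype.ext (f.map_d _)

/-- The invariants `H_•(A)^G` in homology. -/
def homologyFixed {k : Type u} [Field k] (A : DGAlg k) {G : Type*} (φ : G → Hom A A) :
    Subalgebra k A.homology where
  carrier := {a | ∀ g, (φ g).homologyMap a = a}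
  mul_mem' {a b} ha hb g := by rw [map_mul, ha g, hb g]
  add_mem' {a b} ha hb g := by rw [map_add, ha g, hb g]
  algebraMap_mem' c g := by simp

end DGAlg

namespace DGAlg

/-! ### DG algebras given by generators -/

/-- The span of the words of total degree `i` in a family of elements of given degrees. -/
def wordGr {k : Type u} [Field k] {B : Type u} [Ring B] [Algebra k B] {X : Type*}
    (gen : X → B) (deg : X → ℤ) (i : ℤ) : Submodule k B :=
  Submodule.span k {b | ∃ l : List X, (l.map deg).sum = i ∧ (l.map gen).prod = b}

theorem word_mem {k : Type u} [Field k] {B : Type u} [Ring B] [Algebra k B] {X : Type*}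
    (gen : X → B) (deg : X → ℤ) (l : List X) :
    (l.map gen).prod ∈ wordGr (k := k) gen deg (l.map deg).sum :=
  Submodule.subset_span ⟨l, rfl, rfl⟩

theorem gen_mem {k : Type u} [Field k] {B : Type u} [Ring B] [Algebra k B] {X : Type*}
    (gen : X → B) (deg : X → ℤ) (x : X) : gen x ∈ wordGr (k := k) gen deg (deg x) := by
  simpa using word_mem (k := k) gen deg [x]

theorem wordGr_gradedMonoid {k : Type u} [Field k] {B : Type u} [Ring B] [Algebra k B]
    {X : Type*} (gen : X → B) (deg : X → ℤ) :
    SetLike.GradedMonoid (wordGr (k := k) gen deg) where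
  one_mem := by simpa using word_mem (k := k) gen deg []
  mul_mem i j a b ha hb := by
    have h := Submodule.mul_mem_mul ha hb
    rw [wordGr, wordGr, Submodule.span_mul_span] at h
    refine Submodule.span_mono ?_ h
    rintro _ ⟨_, ⟨l, hl, rfl⟩, _, ⟨l', hl', rfl⟩, rfl⟩
    exact ⟨l ++ l', by simp [hl, hl'], by simp⟩

theorem map_mem_wordGr {k : Type u} [Field k] {B C : Type u} [Ring B] [Algebra k B] [Ring C]
    [Algebra k C] {X : Type*} (gen : X → B) (deg : X → ℤ) (f : B →ₐ[k] C)
    (gr : ℤ → Submodule k C) [SetLike.GradedMonoid gr]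
    (h : ∀ x, f (gen x) ∈ gr (deg x)) (i : ℤ) (b : B) (hb : b ∈ wordGr (k := k) gen deg i) :
    f b ∈ gr i := by
  induction hb using Submodule.span_induction with
  | mem b hb =>
    obtain ⟨l, rfl, rfl⟩ := hb
    induction l with
    | nil => simpa using SetLike.GradedOne.one_mem (A := gr)
    | cons x l ih =>
      simp only [List.map_cons, List.prod_cons, List.sum_cons, map_mul]
      exact SetLike.GradedMul.mul_mem (h x) ih
  | zero => simp
  | add a b _ _ h h' => rw [map_add]; exact add_mem h h'
  | smul c a _ h => rw [map_smul]; exact Submodule.smul_mem _ _ h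

/-- The upper triangular matrix `[(-1)^{|x|} x, δ x; 0, x]`: an algebra morphism into triangular
matrices extending this assignment on generators encodes a derivation of degree `-1`. -/
def derMat {k : Type u} [Field k] {B : Type u} [Ring B] [Algebra k B] {X : Type*}
    (gen : X → B) (deg : X → ℤ) (δ : X → B) (x : X) : Matrix (Fin 2) (Fin 2) B :=
  !![(deg x).negOnePow • gen x, δ x; 0, gen x]

theorem derMat_entries {k : Type u} [Field k] {B : Type u} [Ring B] [Algebra k B] {X : Type*}
    {F : Type u} [Ring F] [Algebra k F]
    (genF : X → F) (q : F →ₐ[k] B)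
    (deg : X → ℤ) (δ : X → B) (D : F →ₐ[k] Matrix (Fin 2) (Fin 2) B)
    (hD : ∀ x, D (genF x) = derMat (k := k) (fun x => q (genF x)) deg δ x)
    (i : ℤ) (a : F) (ha : a ∈ wordGr (k := k) genF deg i) :
    D a 1 0 = 0 ∧ D a 1 1 = q a ∧ D a 0 0 = i.negOnePow • q a := by
  induction ha using Submodule.span_induction with
  | mem b hb =>
    obtain ⟨l, rfl, rfl⟩ := hb
    induction l with
    | nil => simp
    | cons x l ih =>
      obtain ⟨h1, h2, h3⟩ := ih
      simp only [List.map_cons, List.prod_cons, List.sum_cons, map_mul, hD, derMat,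
        Matrix.mul_apply, Fin.sum_univ_two, h1, h2, h3, Int.negOnePow_add]
      refine ⟨by simp, by simp, ?_⟩
      simpa [mul_smul, smul_mul_assoc, mul_smul_comm] using smul_comm _ _ _
  | zero => simp
  | add a b _ _ h h' =>
    simp only [map_add, Matrix.add_apply, h.1, h'.1, h.2.1, h'.2.1, h.2.2, h'.2.2, smul_add]
    simp
  | smul c a _ h =>
    simp only [map_smul, Matrix.smul_apply, h.1, h.2.1, h.2.2]
    refine ⟨by simp, by simp, smul_comm _ _ _⟩

theorem dec_of_mem {k : Type u} [Field k] {B : Type u} [Ring B] [Algebra k B] {X : Type*}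
    {F : Type u} [Ring F] [Algebra k F]
    (genF : X → F) (q : F →ₐ[k] B) (deg : X → ℤ) (gr : ℤ → Submodule k B)
    [SetLike.GradedMonoid gr]
    (h : ∀ x, q (genF x) ∈ gr (deg x)) (dec : F →ₐ[k] ⨁ i, gr i)
    (hdec : ∀ x, dec (genF x) = DirectSum.of (fun i => gr i) (deg x) ⟨q (genF x), h x⟩)
    (i : ℤ) (a : F) (ha : a ∈ wordGr (k := k) genF deg i) :
    dec a = DirectSum.of (fun i => gr i) i ⟨q a, map_mem_wordGr genF deg q gr h i a ha⟩ := by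
  induction ha using Submodule.span_induction with
  | mem b hb =>
    obtain ⟨l, rfl, rfl⟩ := hb
    induction l with
    | nil =>
      simp only [List.map_nil, List.prod_nil, map_one]
      rfl
    | cons x l ih =>
      simp only [List.map_cons, List.prod_cons, map_mul]
      rw [hdec, ih, DirectSum.of_mul_of]
      exact DirectSum.of_eq_of_gradedMonoid_eq 
        (Sigma.subtype_ext (List.sum_cons (l := l.map deg) (a := deg x)).symm rfl)
  | zero =>
    rw [map_zero, ← map_zero (DirectSum.of (fun i => gr i) i)]
    congr 1
    exact Subtype.ext (map_zero q).symm
  | add a b ha hb h h' =>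
    rw [map_add, h, h', ← map_add]
    congr 1
    exact Subtype.ext (map_add q a b).symm
  | smul c a ha h =>
    rw [map_smul, h, ← DirectSum.lof_eq_of k, ← DirectSum.lof_eq_of k, ← map_smul]
    congr 1
    exact Subtype.ext (map_smul q c a).symm

/-- Constructor for a DG algebra generated by elements `gen x` of degree `deg x` with
differential `d (gen x) = δ x`. The grading is by total degree of words; `dec` and `D`
witness that the grading and the differential are well defined. -/
noncomputable def ofGens {k : Type u} [Field k] (B : Type u) [Ring B] [Algebra k B] {X : Type*}
    (gen : X → B) (deg : X → ℤ) (δ : X → B)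
    (hgen : Algebra.adjoin k (Set.range gen) = ⊤)
    (gm : SetLike.GradedMonoid (wordGr (k := k) gen deg))
    (dec : B →ₐ[k] ⨁ i, wordGr (k := k) gen deg i)
    (hdec : ∀ x, dec (gen x) =
      DirectSum.of (fun i => wordGr (k := k) gen deg i) (deg x) ⟨gen x, gen_mem gen deg x⟩)
    (D : B →ₐ[k] Matrix (Fin 2) (Fin 2) B)
    (hD : ∀ x, D (gen x) = derMat (k := k) gen deg δ x)
    (hδ : ∀ x, δ x ∈ wordGr (k := k) gen deg (deg x - 1))
    (hδδ : ∀ x, D (δ x) 0 1 = 0) : DGAlg k :=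
  let dl : B →ₗ[k] B :=
    (LinearMap.proj 1 ∘ₗ (LinearMap.proj 0 : (Fin 2 → Fin 2 → B) →ₗ[k] (Fin 2 → B))) ∘ₗ
      D.toLinearMap
  have hent : ∀ i a, a ∈ wordGr (k := k) gen deg i →
      D a 1 0 = 0 ∧ D a 1 1 = a ∧ D a 0 0 = i.negOnePow • a :=
    fun i a ha => derMat_entries gen (AlgHom.id k B) deg δ D hD i a ha
  have hG : GradedAlgebra (wordGr (k := k) gen deg) := GradedAlgebra.ofAlgHom _ dec
    (by
      refine AlgHom.ext_of_adjoin_eq_top hgen ?_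
      rintro _ ⟨x, rfl⟩
      simp [hdec])
    (fun i x => by
      have := dec_of_mem gen (AlgHom.id k B) deg (wordGr (k := k) gen deg)
        (gen_mem gen deg) dec hdec i x x.2
      simpa using this)
  have hD11 : ∀ a, D a 1 1 = a := by
    intro a
    induction a using DirectSum.Decomposition.inductionOn (wordGr (k := k) gen deg) with
    | zero => simp
    | homogeneous m => exact (hent _ _ m.2).2.1
    | add m m' h h' => rw [map_add, Matrix.add_apply, h, h']
  have hleib : ∀ (i : ℤ) (a b : B), a ∈ wordGr (k := k) gen deg i →
      dl (a * b) = dl a * b + i.negOnePow • (a * dl b) := by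
    intro i a b ha
    change D (a * b) 0 1 = D a 0 1 * b + i.negOnePow • (a * D b 0 1)
    rw [map_mul, Matrix.mul_apply, Fin.sum_univ_two, (hent i a ha).2.2, hD11 b, add_comm,
      smul_mul_assoc]
  have hdgen : ∀ x, dl (gen x) = δ x := by
    intro x
    change D (gen x) 0 1 = _
    rw [hD]; rfl
  have hd1 : dl 1 = 0 := by
    change D 1 0 1 = 0
    rw [map_one]; rfl
  have hmem : ∀ (i : ℤ) (a : B), a ∈ wordGr (k := k) gen deg i →
      dl a ∈ wordGr (k := k) gen deg (i - 1) := by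
    intro i a ha
    induction ha using Submodule.span_induction with
    | mem b hb =>
      obtain ⟨l, rfl, rfl⟩ := hb
      induction l with
      | nil => simp [hd1]
      | cons x l ih =>
        simp only [List.map_cons, List.prod_cons, List.sum_cons]
        rw [hleib _ _ _ (gen_mem gen deg x), hdgen]
        refine add_mem ?_ (Submodule.smul_of_tower_mem _ _ ?_)
        · have := SetLike.GradedMul.mul_mem (hδ x) (word_mem (k := k) gen deg l)
          convert this using 2; ring
        · have := SetLike.GradedMul.mul_mem (gen_mem (k := k) gen deg x) ih
          convert this using 2; ring
    | zero => simp
    | add a b _ _ h h' => rw [map_add]; exact add_mem h h'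
    | smul c a _ h => rw [map_smul]; exact Submodule.smul_mem _ _ h
  { carrier := B
    gr := wordGr (k := k) gen deg
    graded := GradedAlgebra.ofAlgHom _ dec
      (by
        refine AlgHom.ext_of_adjoin_eq_top hgen ?_
        rintro _ ⟨x, rfl⟩
        simp [hdec])
      (fun i x => by
        have := dec_of_mem gen (AlgHom.id k B) deg (wordGr (k := k) gen deg)
          (gen_mem gen deg) dec hdec i x x.2
        simpa using this)
    d := dl
    d_mem := hmem
    leibniz := hleib
    d_d := by
      have hw : ∀ l : List X, dl (dl (l.map gen).prod) = 0 := by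
        intro l
        induction l with
        | nil => simp [hd1]
        | cons x l ih =>
          simp only [List.map_cons, List.prod_cons]
          have h0 : dl (δ x) = 0 := hδδ x
          rw [hleib _ _ _ (gen_mem gen deg x), hdgen, map_add, hleib _ _ _ (hδ x), h0,
            Int.negOnePow_sub, Units.smul_def (deg x).negOnePow, map_zsmul,
            hleib _ _ _ (gen_mem gen deg x), hdgen, ih, ← Units.smul_def]
          simp
      intro a
      induction a using DirectSum.Decomposition.inductionOn (wordGr (k := k) gen deg) with
      | zero => simp
      | add m m' h h' => rw [map_add, map_add, h, h', add_zero]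
      | homogeneous m =>
        obtain ⟨a, ha⟩ := m
        change dl (dl a) = 0
        induction ha using Submodule.span_induction with
        | mem b hb => obtain ⟨l, -, rfl⟩ := hb; exact hw l
        | zero => simp
        | add a b _ _ h h' => rw [map_add, map_add, h, h', add_zero]
        | smul c a _ h => rw [map_smul, map_smul, h, smul_zero] }

/-- An algebra morphism is compatible with the differentials if it is so on generators. -/
theorem map_d_of_gens {k : Type u} [Field k] {A B : DGAlg k} {X : Type*} (gen : X → A)
    (hgen : Algebra.adjoin k (Set.range gen) = ⊤)
    (f : A →ₐ[k] B) (hf : ∀ i a, a ∈ A.gr i → f a ∈ B.gr i)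
    (h : ∀ x, f (A.d (gen x)) = B.d (f (gen x))) (a : A) : f (A.d a) = B.d (f a) := by
  have hs : ∀ a, f (A.sgn a) = B.sgn (f a) := by
    intro a
    induction a using A.induction_hom with
    | h0 => simp
    | hadd a b h h' => simp [h, h']
    | hhom i a ha =>
      rw [A.sgn_of_mem ha, B.sgn_of_mem (hf i a ha), Units.smul_def, map_zsmul, Units.smul_def]
  have ha : a ∈ Algebra.adjoin k (Set.range gen) := by rw [hgen]; trivial
  induction ha using Algebra.adjoin_induction with
  | mem a ha => obtain ⟨x, rfl⟩ := ha; exact h x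
  | algebraMap c => rw [A.d_algebraMap, AlgHom.commutes, B.d_algebraMap, map_zero]
  | add a b _ _ h h' => simp [h, h']
  | mul a b _ _ h h' => rw [A.d_mul, map_mul, B.d_mul, map_add, map_mul, map_mul, h, h', hs]

end DGAlg

namespace DGAlg

/-! ### Polynomials in two variables and the minimal resolution -/

/-- An algebra placed in degree zero, with zero differential. -/
noncomputable def ofAlgebra (k : Type u) [Field k] (B : Type u) [Ring B] [Algebra k B] :
    DGAlg k where
  carrier := B
  gr i := if i = 0 then ⊤ else ⊥
  graded :=
    { one_mem := by simp
      mul_mem := fun i j a b ha hb => by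
        by_cases hi : i = 0
        · by_cases hj : j = 0
          · simp [hi, hj]
          · rw [if_neg hj, Submodule.mem_bot] at hb
            rw [hb, mul_zero]; exact zero_mem _
        · rw [if_neg hi, Submodule.mem_bot] at ha
          rw [ha, zero_mul]; exact zero_mem _
      decompose' := fun b =>
        DirectSum.of (fun i : ℤ => ↥(if i = 0 then (⊤ : Submodule k B) else ⊥)) 0 ⟨b, by simp⟩
      left_inv := fun b => by simp
      right_inv := fun x => by
        induction x using DirectSum.induction_on with
        | zero =>
          rw [map_zero, ← map_zero (DirectSum.of _ (0 : ℤ))]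
          rfl
        | of i x =>
          by_cases hi : i = 0
          · subst hi; simp
          · have hx : x = 0 := by
              have h : (if i = 0 then (⊤ : Submodule k B) else ⊥) = ⊥ := if_neg hi
              exact Subtype.ext ((Submodule.mem_bot k).1 (h.le x.2))
            subst hx
            rw [map_zero, map_zero, ← map_zero (DirectSum.of _ (0 : ℤ))]
            rfl
        | add x y hx hy =>
          rw [map_add]
          conv_rhs => rw [← hx, ← hy, ← map_add]
          rfl }
  d := 0
  d_mem i a _ := by simp
  d_d a := rfl
  leibniz i a b _ := by simp

/-- The polynomial algebra `k[x,y]` as a DG algebra in degree zero (`x = X 0`, `y = X 1`). -/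
noncomputable abbrev kxy (k : Type u) [Field k] : DGAlg k := ofAlgebra k (MvPolynomial (Fin 2) k)

/-- The generators of the minimal resolution of `k[x,y]`. -/
inductive Gen : Type
  | x : Gen
  | y : Gen
  | θ : Gen

/-- Degrees of the generators: `x`, `y` have degree `0` and `θ` has degree `1`. -/
def Gen.deg : Gen → ℤ
  | .x => 0
  | .y => 0
  | .θ => 1

/-- The differential on generators: `dx = dy = 0`, `dθ = -[x,y]`. -/
noncomputable def Gen.diff (k : Type u) [Field k] : Gen → FreeAlgebra k Gen
  | .x => 0
  | .y => 0
  | .θ => -(FreeAlgebra.ι k Gen.x * FreeAlgebra.ι k Gen.y -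
      FreeAlgebra.ι k Gen.y * FreeAlgebra.ι k Gen.x)

theorem Gen.diff_mem (k : Type u) [Field k] (g : Gen) :
    Gen.diff k g ∈ wordGr (k := k) (FreeAlgebra.ι k) Gen.deg (g.deg - 1) := by
  have gm := wordGr_gradedMonoid (k := k) (FreeAlgebra.ι k) Gen.deg
  cases g with
  | x => exact zero_mem _
  | y => exact zero_mem _
  | θ =>
    have h : ∀ g h : Gen, FreeAlgebra.ι k g * FreeAlgebra.ι k h ∈
        wordGr (k := k) (FreeAlgebra.ι k) Gen.deg (g.deg + h.deg) := fun g h =>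
      SetLike.GradedMul.mul_mem (gen_mem (k := k) (FreeAlgebra.ι k) Gen.deg g)
        (gen_mem (k := k) (FreeAlgebra.ι k) Gen.deg h)
    have h1 := h .x .y
    have h2 := h .y .x
    simp only [Gen.deg, add_zero] at h1 h2
    simp only [Gen.deg, sub_self, Gen.diff]
    exact neg_mem (sub_mem h1 h2)

theorem Gen.diff_diff (k : Type u) [Field k] (g : Gen) :
    (FreeAlgebra.lift k (derMat (k := k) (FreeAlgebra.ι k) Gen.deg (Gen.diff k)))
      (Gen.diff k g) 0 1 = 0 := by
  have hx : Gen.diff k .x = 0 := rfl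
  have hy : Gen.diff k .y = 0 := rfl
  cases g with
  | x => rw [hx, map_zero]; rfl
  | y => rw [hy, map_zero]; rfl
  | θ =>
    have h : Gen.diff k .θ = -(FreeAlgebra.ι k Gen.x * FreeAlgebra.ι k Gen.y -
      FreeAlgebra.ι k Gen.y * FreeAlgebra.ι k Gen.x) := rfl
    rw [h, map_neg, map_sub, map_mul, map_mul, FreeAlgebra.lift_ι_apply, FreeAlgebra.lift_ι_apply]
    simp [derMat, hx, hy]

/-- The minimal resolution `R = k⟨x,y,θ⟩`, `dθ = -[x,y]`, of `k[x,y]`. -/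
noncomputable def minRes (k : Type u) [Field k] : DGAlg k :=
  haveI gm := wordGr_gradedMonoid (k := k) (FreeAlgebra.ι k) Gen.deg
  ofGens (FreeAlgebra k Gen) (FreeAlgebra.ι k) Gen.deg (Gen.diff k)
    (FreeAlgebra.adjoin_range_ι k Gen)
    gm
    (FreeAlgebra.lift k fun g =>
      DirectSum.of (fun i => wordGr (k := k) (FreeAlgebra.ι k) Gen.deg i) g.deg
        ⟨FreeAlgebra.ι k g, gen_mem _ _ g⟩)
    (fun g => by simp)
    (FreeAlgebra.lift k (derMat (k := k) (FreeAlgebra.ι k) Gen.deg (Gen.diff k)))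
    (fun g => by simp)
    (Gen.diff_mem k)
    (Gen.diff_diff k)

/-- The elements `x, y, θ` of the minimal resolution. -/
noncomputable def minResGen (k : Type u) [Field k] (g : Gen) : minRes k := FreeAlgebra.ι k g

/-- The morphism out of the minimal resolution with given values on `x`, `y`, `θ`. -/
noncomputable def minResLift {k : Type u} [Field k] (B : DGAlg k) (v : Gen → B)
    (hv : ∀ g, v g ∈ B.gr g.deg) (hx : B.d (v .x) = 0) (hy : B.d (v .y) = 0)
    (hθ : B.d (v .θ) = -(v .x * v .y - v .y * v .x)) : Hom (minRes k) B :=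
  have hm : ∀ i (a : minRes k), a ∈ (minRes k).gr i → FreeAlgebra.lift k v a ∈ B.gr i :=
    fun i a ha => map_mem_wordGr (FreeAlgebra.ι k) Gen.deg (FreeAlgebra.lift k v) B.gr
      (fun g => by rw [FreeAlgebra.lift_ι_apply]; exact hv g) i a ha
  { toAlgHom := FreeAlgebra.lift k v
    map_mem := hm
    map_d := map_d_of_gens (A := minRes k) (B := B) (FreeAlgebra.ι k)
      (FreeAlgebra.adjoin_range_ι k Gen) (FreeAlgebra.lift k v) hm (fun g => by
        have h : (minRes k).d (FreeAlgebra.ι k g) = Gen.diff k g := by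
          change (FreeAlgebra.lift k (derMat (k := k) (FreeAlgebra.ι k) Gen.deg (Gen.diff k))
            (FreeAlgebra.ι k g)) 0 1 = _
          rw [FreeAlgebra.lift_ι_apply]; rfl
        have key : FreeAlgebra.lift k v (Gen.diff k g) = B.d (v g) := by
          cases g with
          | x => rw [hx]; exact map_zero _
          | y => rw [hy]; exact map_zero _
          | θ =>
            have h' : Gen.diff k .θ = -(FreeAlgebra.ι k Gen.x * FreeAlgebra.ι k Gen.y -
              FreeAlgebra.ι k Gen.y * FreeAlgebra.ι k Gen.x) := rfl
            rw [hθ, h', map_neg, map_sub, map_mul, map_mul, FreeAlgebra.lift_ι_apply,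
              FreeAlgebra.lift_ι_apply]
        exact (congrArg (FreeAlgebra.lift k v) h).trans
          (key.trans (congrArg B.d (FreeAlgebra.lift_ι_apply (R := k) v g).symm))) }

/-- The resolution map `R → k[x,y]`: `x ↦ x`, `y ↦ y`, `θ ↦ 0`. -/
noncomputable def minResProj (k : Type u) [Field k] : Hom (minRes k) (kxy k) :=
  minResLift (kxy k)
    (fun g => match g with
      | .x => (MvPolynomial.X 0 : MvPolynomial (Fin 2) k)
      | .y => (MvPolynomial.X 1 : MvPolynomial (Fin 2) k)
      | .θ => (0 : MvPolynomial (Fin 2) k))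
    (fun g => by
      cases g with
      | x => exact Submodule.mem_top (R := k) (M := MvPolynomial (Fin 2) k)
      | y => exact Submodule.mem_top (R := k) (M := MvPolynomial (Fin 2) k)
      | θ => exact zero_mem _)
    rfl rfl
    (by
      have h : (0 : MvPolynomial (Fin 2) k) = -((MvPolynomial.X 0 : MvPolynomial (Fin 2) k) *
        MvPolynomial.X 1 - MvPolynomial.X 1 * MvPolynomial.X 0) := by ring
      exact h)

end DGAlg

namespace DGAlg

/-! ### Representation functors -/

/-- The multiplication pattern of a finite dimensional algebra `S` with a basis indexed by `ι`:
in coordinates `a_s` the product is `(ab)_s = ∑_p a_{l(s,p)} b_{r(s,p)}` and the unit is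
`1_s = one s`. -/
structure Pattern (k : Type u) where
  ι : Type
  κ : Type
  [fintype : Fintype κ]
  l : ι → κ → ι
  r : ι → κ → ι
  one : ι → k

attribute [instance] Pattern.fintype

/-- `S = M_n(k)`: `(ab)_{ij} = ∑_p a_{ip} b_{pj}` and `1_{ij} = δ_{ij}`. -/
abbrev matPattern (k : Type u) [Field k] (n : ℕ) : Pattern k where
  ι := Fin n × Fin n
  κ := Fin n
  l s p := (s.1, p)
  r s p := (p, s.2)
  one s := if s.1 = s.2 then 1 else 0

/-- `S = k^n`: `(ab)_i = a_i b_i` and `1_i = 1`. -/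
abbrev diagPattern (k : Type u) [Field k] (n : ℕ) : Pattern k where
  ι := Fin n
  κ := Unit
  l s _ := s
  r s _ := s
  one _ := 1

/-- Generators `a_s`, for `a` homogeneous. -/
abbrev CGen {k : Type u} [Field k] (S : Pattern k) (A : DGAlg k) : Type u :=
  (Σ i : ℤ, A.gr i) × S.ι

/-- The degree of the generator `a_s` is `|a|`. -/
def CGen.deg {k : Type u} [Field k] {S : Pattern k} {A : DGAlg k} (x : CGen S A) : ℤ := x.1.1

/-- The generator `a_s` in the free algebra, for `a` of degree `i`. -/
noncomputable def cgen {k : Type u} [Field k] {S : Pattern k} {A : DGAlg k} (i : ℤ) (a : A.gr i)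
    (s : S.ι) : FreeAlgebra k (CGen S A) := FreeAlgebra.ι k (⟨i, a⟩, s)

/-- The defining relations: the generators `a_s` are linear in `a`, multiplicative according to
the pattern `S`, and graded commutative. -/
inductive CRel {k : Type u} [Field k] (S : Pattern k) (A : DGAlg k) :
    FreeAlgebra k (CGen S A) → FreeAlgebra k (CGen S A) → Prop
  | add (i : ℤ) (a b : A.gr i) (s : S.ι) : CRel S A (cgen i (a + b) s) (cgen i a s + cgen i b s)
  | smul (i : ℤ) (c : k) (a : A.gr i) (s : S.ι) : CRel S A (cgen i (c • a) s) (c • cgen i a s)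
  | mul (i j : ℤ) (a : A.gr i) (b : A.gr j) (s : S.ι) :
      CRel S A (cgen (i + j) ⟨(a : A) * (b : A), SetLike.GradedMul.mul_mem a.2 b.2⟩ s)
        (∑ p, cgen i a (S.l s p) * cgen j b (S.r s p))
  | one (s : S.ι) : CRel S A (cgen 0 ⟨1, SetLike.GradedOne.one_mem⟩ s) (algebraMap k _ (S.one s))
  | comm (i j : ℤ) (a : A.gr i) (b : A.gr j) (s t : S.ι) :
      CRel S A (cgen i a s * cgen j b t) ((i * j).negOnePow • (cgen j b t * cgen i a s))

/-- The quotient of the free algebra by the defining relations. -/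
def CQ {k : Type u} [Field k] (S : Pattern k) (A : DGAlg k) : Type u := RingQuot (CRel S A)

noncomputable instance {k : Type u} [Field k] (S : Pattern k) (A : DGAlg k) : Ring (CQ S A) :=
  inferInstanceAs (Ring (RingQuot (CRel S A)))

noncomputable instance {k : Type u} [Field k] (S : Pattern k) (A : DGAlg k) :
    Algebra k (CQ S A) :=
  inferInstanceAs (Algebra k (RingQuot (CRel S A)))

/-- The quotient map. -/
noncomputable def cmk {k : Type u} [Field k] (S : Pattern k) (A : DGAlg k) :
    FreeAlgebra k (CGen S A) →ₐ[k] CQ S A :=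
  RingQuot.mkAlgHom k (CRel S A)

theorem cmk_rel {k : Type u} [Field k] {S : Pattern k} {A : DGAlg k}
    {x y : FreeAlgebra k (CGen S A)} (h : CRel S A x y) : cmk S A x = cmk S A y :=
  RingQuot.mkAlgHom_rel k h

theorem cmk_surjective {k : Type u} [Field k] (S : Pattern k) (A : DGAlg k) :
    Function.Surjective (cmk S A) :=
  RingQuot.mkAlgHom_surjective k (CRel S A)

/-- Algebra morphisms out of the quotient. -/
noncomputable def clift {k : Type u} [Field k] {S : Pattern k} {A : DGAlg k} {B : Type*} [Semiring B]
    [Algebra k B] (f : FreeAlgebra k (CGen S A) →ₐ[k] B)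
    (hf : ∀ ⦃x y⦄, CRel S A x y → f x = f y) : CQ S A →ₐ[k] B :=
  RingQuot.liftAlgHom k ⟨f, hf⟩

theorem clift_cmk {k : Type u} [Field k] {S : Pattern k} {A : DGAlg k} {B : Type*} [Semiring B]
    [Algebra k B] (f : FreeAlgebra k (CGen S A) →ₐ[k] B)
    (hf : ∀ ⦃x y⦄, CRel S A x y → f x = f y) (x : FreeAlgebra k (CGen S A)) :
    clift f hf (cmk S A x) = f x :=
  RingQuot.liftAlgHom_mkAlgHom_apply k f hf x

/-- The image of the generator `a_s` in the quotient by the relations. -/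
noncomputable def cq {k : Type u} [Field k] {S : Pattern k} {A : DGAlg k} (i : ℤ) (a : A.gr i)
    (s : S.ι) : CQ S A := cmk S A (cgen i a s)

theorem cq_add {k : Type u} [Field k] {S : Pattern k} {A : DGAlg k} (i : ℤ) (a b : A.gr i)
    (s : S.ι) : cq i (a + b) s = cq i a s + cq i b s :=
  (cmk_rel (CRel.add i a b s)).trans (map_add _ _ _)

theorem cq_smul {k : Type u} [Field k] {S : Pattern k} {A : DGAlg k} (i : ℤ) (c : k) (a : A.gr i)
    (s : S.ι) : cq i (c • a) s = c • cq i a s :=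
  (cmk_rel (CRel.smul i c a s)).trans (map_smul _ _ _)

theorem cq_mul {k : Type u} [Field k] {S : Pattern k} {A : DGAlg k} (i j : ℤ) (a : A.gr i)
    (b : A.gr j) (s : S.ι) :
    cq (i + j) ⟨(a : A) * (b : A), SetLike.GradedMul.mul_mem a.2 b.2⟩ s =
      ∑ p, cq i a (S.l s p) * cq j b (S.r s p) :=
  (cmk_rel (CRel.mul i j a b s)).trans (by
    rw [map_sum]
    exact Finset.sum_congr rfl fun p _ => map_mul _ _ _)

theorem cq_one {k : Type u} [Field k] {S : Pattern k} {A : DGAlg k} (s : S.ι) :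
    cq (A := A) 0 ⟨1, SetLike.GradedOne.one_mem⟩ s = algebraMap k _ (S.one s) :=
  (cmk_rel (CRel.one s)).trans (AlgHom.commutes _ _)

theorem cq_comm {k : Type u} [Field k] {S : Pattern k} {A : DGAlg k} (i j : ℤ) (a : A.gr i)
    (b : A.gr j) (s t : S.ι) :
    cq i a s * cq j b t = (i * j).negOnePow • (cq j b t * cq i a s) := by
  have h := cmk_rel (CRel.comm i j a b s t)
  rw [map_mul, Units.smul_def, map_zsmul, map_mul, ← Units.smul_def] at h
  exact h

theorem cq_zero {k : Type u} [Field k] {S : Pattern k} {A : DGAlg k} (i : ℤ) (s : S.ι) :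
    cq (A := A) i 0 s = 0 := by
  have h := cq_smul (A := A) i (0 : k) 0 s
  rwa [zero_smul, zero_smul] at h

/-- Change of the degree index. -/
theorem cq_congr {k : Type u} [Field k] {S : Pattern k} {A : DGAlg k} {i j : ℤ} (h : i = j)
    (a : A.gr i) (b : A.gr j) (hab : (a : A) = b) (s : S.ι) : cq i a s = cq j b s := by
  subst h
  rw [Subtype.ext hab]

theorem cq_neg_one {k : Type u} [Field k] {S : Pattern k} {A : DGAlg k} (m i : ℤ) (a : A.gr i)
    (s : S.ι) : cq i (m.negOnePow • a) s = m.negOnePow • cq i a s := by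
  rcases Int.units_eq_one_or m.negOnePow with h | h
  · rw [h, one_smul, one_smul]
  · have h' := cq_add i a (-a) s
    rw [add_neg_cancel, cq_zero] at h'
    rw [h, Units.neg_smul, one_smul, Units.neg_smul, one_smul]
    exact eq_neg_of_add_eq_zero_right h'.symm

/-- The generators of the quotient. -/
noncomputable def cgenQ {k : Type u} [Field k] (S : Pattern k) (A : DGAlg k) (x : CGen S A) :
    CQ S A := cq x.1.1 x.1.2 x.2

/-- The differential of a homogeneous element of degree `i`. -/
def dGr {k : Type u} [Field k] {A : DGAlg k} (i : ℤ) (a : A.gr i) : A.gr (i - 1) :=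
  ⟨A.d a, A.d_mem i a a.2⟩

/-- The differential on generators: `d(a_s) = (da)_s`. -/
noncomputable def cdiff {k : Type u} [Field k] (S : Pattern k) (A : DGAlg k) (x : CGen S A) :
    CQ S A := cq (x.1.1 - 1) (dGr x.1.1 x.1.2) x.2

theorem cq_mem {k : Type u} [Field k] {S : Pattern k} {A : DGAlg k} (i : ℤ) (a : A.gr i)
    (s : S.ι) : cq i a s ∈ wordGr (k := k) (cgenQ S A) CGen.deg i :=
  gen_mem (k := k) (cgenQ S A) CGen.deg (⟨i, a⟩, s)

theorem cgen_mem {k : Type u} [Field k] {S : Pattern k} {A : DGAlg k} (i : ℤ) (a : A.gr i)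
    (s : S.ι) : cgen i a s ∈ wordGr (k := k) (FreeAlgebra.ι k) (CGen.deg (S := S) (A := A)) i :=
  gen_mem (k := k) (FreeAlgebra.ι k) (CGen.deg (S := S) (A := A)) (⟨i, a⟩, s)

/-- The relations are homogeneous. -/
theorem crel_homogeneous {k : Type u} [Field k] {S : Pattern k} {A : DGAlg k}
    {x y : FreeAlgebra k (CGen S A)} (h : CRel S A x y) :
    ∃ i, x ∈ wordGr (k := k) (FreeAlgebra.ι k) (CGen.deg (S := S) (A := A)) i ∧
      y ∈ wordGr (k := k) (FreeAlgebra.ι k) (CGen.deg (S := S) (A := A)) i := by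
  have gm := wordGr_gradedMonoid (k := k) (FreeAlgebra.ι k) (CGen.deg (S := S) (A := A))
  cases h with
  | add i a b s => exact ⟨i, cgen_mem _ _ _, add_mem (cgen_mem _ _ _) (cgen_mem _ _ _)⟩
  | smul i c a s => exact ⟨i, cgen_mem _ _ _, Submodule.smul_mem _ _ (cgen_mem _ _ _)⟩
  | mul i j a b s =>
    exact ⟨i + j, cgen_mem _ _ _, sum_mem fun p _ =>
      SetLike.GradedMul.mul_mem (cgen_mem _ _ _) (cgen_mem _ _ _)⟩
  | one s => exact ⟨0, cgen_mem _ _ _, SetLike.algebraMap_mem_graded _ _⟩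
  | comm i j a b s t =>
    refine ⟨i + j, SetLike.GradedMul.mul_mem (cgen_mem _ _ _) (cgen_mem _ _ _),
      Submodule.smul_of_tower_mem _ _ ?_⟩
    rw [add_comm i j]
    exact SetLike.GradedMul.mul_mem (cgen_mem _ _ _) (cgen_mem _ _ _)

/-- The algebra morphism into triangular matrices encoding the differential. -/
noncomputable def cD {k : Type u} [Field k] (S : Pattern k) (A : DGAlg k) :
    FreeAlgebra k (CGen S A) →ₐ[k] Matrix (Fin 2) (Fin 2) (CQ S A) :=
  FreeAlgebra.lift k (derMat (k := k) (cgenQ S A) CGen.deg (cdiff S A))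

theorem cD_cgen {k : Type u} [Field k] {S : Pattern k} {A : DGAlg k} (i : ℤ) (a : A.gr i)
    (s : S.ι) : cD S A (cgen i a s) =
      !![i.negOnePow • cq i a s, cq (i - 1) (dGr i a) s; 0, cq i a s] := by
  rw [cD, cgen, FreeAlgebra.lift_ι_apply]
  rfl

theorem cD_entries {k : Type u} [Field k] {S : Pattern k} {A : DGAlg k} (i : ℤ)
    (x : FreeAlgebra k (CGen S A))
    (hx : x ∈ wordGr (k := k) (FreeAlgebra.ι k) (CGen.deg (S := S) (A := A)) i) :
    cD S A x 1 0 = 0 ∧ cD S A x 1 1 = cmk S A x ∧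
      cD S A x 0 0 = i.negOnePow • cmk S A x :=
  derMat_entries (FreeAlgebra.ι k) (cmk S A) CGen.deg (cdiff S A) (cD S A)
    (fun x => by rw [cD, FreeAlgebra.lift_ι_apply]; rfl) i x hx

/-- The differential respects the relations. -/
theorem cD_rel01 {k : Type u} [Field k] {S : Pattern k} {A : DGAlg k}
    {x y : FreeAlgebra k (CGen S A)} (h : CRel S A x y) : cD S A x 0 1 = cD S A y 0 1 := by
  cases h with
  | add i a b s =>
    rw [map_add, cD_cgen, cD_cgen, cD_cgen]
    change cq (i - 1) (dGr i (a + b)) s = cq (i - 1) (dGr i a) s + cq (i - 1) (dGr i b) s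
    rw [← cq_add]
    exact cq_congr rfl _ _ (map_add A.d _ _) s
  | smul i c a s =>
    rw [map_smul, cD_cgen, cD_cgen]
    change cq (i - 1) (dGr i (c • a)) s = c • cq (i - 1) (dGr i a) s
    rw [← cq_smul]
    exact cq_congr rfl _ _ (map_smul A.d _ _) s
  | mul i j a b s =>
    rw [map_sum, Matrix.sum_apply]
    have h1 : ∀ p, (cD S A (cgen i a (S.l s p) * cgen j b (S.r s p))) 0 1 =
        cq (i - 1) (dGr i a) (S.l s p) * cq j b (S.r s p) +
          i.negOnePow • (cq i a (S.l s p) * cq (j - 1) (dGr j b) (S.r s p)) := by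
      intro p
      rw [map_mul, cD_cgen, cD_cgen, Matrix.mul_apply, Fin.sum_univ_two, add_comm]
      simp [smul_mul_assoc]
    simp_rw [h1]
    rw [Finset.sum_add_distrib, ← Finset.smul_sum, ← cq_mul, ← cq_mul, cD_cgen]
    change cq (i + j - 1) (dGr (i + j) _) s = _
    rw [← cq_neg_one]
    have e1 : i - 1 + j = i + j - 1 := by ring
    have e2 : i + (j - 1) = i + j - 1 := by ring
    have m1 : A.d a * b ∈ A.gr (i + j - 1) := by
      rw [← e1]; exact SetLike.GradedMul.mul_mem (A.d_mem i a a.2) b.2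
    have m2 : (a : A) * A.d b ∈ A.gr (i + j - 1) := by
      rw [← e2]; exact SetLike.GradedMul.mul_mem a.2 (A.d_mem j b b.2)
    rw [cq_congr e1 _ ⟨_, m1⟩ rfl s,
      cq_congr e2 _ (i.negOnePow • (⟨_, m2⟩ : A.gr (i + j - 1))) rfl s, ← cq_add]
    refine cq_congr rfl _ _ ?_ s
    exact A.leibniz i a b a.2
  | one s =>
    rw [cD_cgen, AlgHom.commutes]
    change cq (0 - 1) (dGr 0 _) s = _
    rw [cq_congr rfl (dGr 0 ⟨1, SetLike.GradedOne.one_mem⟩) 0 A.d_one s, cq_zero]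
    rfl
  | comm i j a b s t =>
    rw [map_mul, Units.smul_def, map_zsmul, map_mul, cD_cgen, cD_cgen, Matrix.smul_apply,
      ← Units.smul_def, Matrix.mul_apply, Matrix.mul_apply, Fin.sum_univ_two, Fin.sum_univ_two]
    change i.negOnePow • cq i a s * cq (j - 1) (dGr j b) t +
        cq (i - 1) (dGr i a) s * cq j b t =
      (i * j).negOnePow • (j.negOnePow • cq j b t * cq (i - 1) (dGr i a) s +
        cq (j - 1) (dGr j b) t * cq i a s)
    rw [smul_mul_assoc, smul_mul_assoc, cq_comm i (j - 1), cq_comm (i - 1) j, smul_add, smul_smul,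
      smul_smul, add_comm]
    have e1 : ((i - 1) * j).negOnePow = (i * j).negOnePow * j.negOnePow := by
      rw [sub_mul, one_mul, Int.negOnePow_sub]
    have e2 : i.negOnePow * (i * (j - 1)).negOnePow = (i * j).negOnePow := by
      rw [mul_sub, mul_one, Int.negOnePow_sub, mul_comm, mul_assoc, Int.units_mul_self, mul_one]
    rw [e1, e2]

theorem cD_rel {k : Type u} [Field k] {S : Pattern k} {A : DGAlg k}
    ⦃x y : FreeAlgebra k (CGen S A)⦄ (h : CRel S A x y) : cD S A x = cD S A y := by
  obtain ⟨i, hx, hy⟩ := crel_homogeneous h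
  have hq := cmk_rel h
  obtain ⟨x1, x2, x3⟩ := cD_entries i x hx
  obtain ⟨y1, y2, y3⟩ := cD_entries i y hy
  ext a b
  fin_cases a <;> fin_cases b
  · exact x3.trans ((congrArg _ hq).trans y3.symm)
  · exact cD_rel01 h
  · exact x1.trans y1.symm
  · exact x2.trans (hq.trans y2.symm)

/-- The algebra morphism splitting a word according to its degree. -/
noncomputable def cdec {k : Type u} [Field k] (S : Pattern k) (A : DGAlg k)
    (gm : SetLike.GradedMonoid (wordGr (k := k) (cgenQ S A) CGen.deg)) :
    FreeAlgebra k (CGen S A) →ₐ[k] ⨁ i, wordGr (k := k) (cgenQ S A) CGen.deg i :=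
  FreeAlgebra.lift k fun x =>
    DirectSum.of (fun i => wordGr (k := k) (cgenQ S A) CGen.deg i) x.deg
      ⟨cgenQ S A x, gen_mem _ _ x⟩

theorem cdec_rel {k : Type u} [Field k] {S : Pattern k} {A : DGAlg k}
    (gm : SetLike.GradedMonoid (wordGr (k := k) (cgenQ S A) CGen.deg))
    ⦃x y : FreeAlgebra k (CGen S A)⦄ (h : CRel S A x y) : cdec S A gm x = cdec S A gm y := by
  obtain ⟨i, hx, hy⟩ := crel_homogeneous h
  have hq := cmk_rel h
  have hd : ∀ x, cdec S A gm (FreeAlgebra.ι k x) =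
      DirectSum.of (fun i => wordGr (k := k) (cgenQ S A) CGen.deg i) x.deg
        ⟨cmk S A (FreeAlgebra.ι k x), gen_mem (cgenQ S A) CGen.deg x⟩ := by
    intro x
    rw [cdec, FreeAlgebra.lift_ι_apply]
    rfl
  rw [dec_of_mem (FreeAlgebra.ι k) (cmk S A) CGen.deg
      (wordGr (k := k) (cgenQ S A) CGen.deg) (gen_mem (cgenQ S A) CGen.deg) (cdec S A gm) hd i x hx,
    dec_of_mem (FreeAlgebra.ι k) (cmk S A) CGen.deg
      (wordGr (k := k) (cgenQ S A) CGen.deg) (gen_mem (cgenQ S A) CGen.deg) (cdec S A gm) hd i y hy]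
  congr 1
  exact Subtype.ext hq

theorem adjoin_cgenQ {k : Type u} [Field k] (S : Pattern k) (A : DGAlg k) :
    Algebra.adjoin k (Set.range (cgenQ S A)) = ⊤ := by
  have h : Set.range (cgenQ S A) =
      cmk S A '' Set.range (FreeAlgebra.ι k) := by
    rw [← Set.range_comp]; rfl
  rw [h, ← AlgHom.map_adjoin, FreeAlgebra.adjoin_range_ι, Algebra.map_top]
  exact (AlgHom.range_eq_top _).2 (cmk_surjective S A)

/-- The commutative DG algebra (co)representing the functor `B ↦ Hom(A, S ⊗ B)` on commutative
DG algebras: it is generated by the coordinates `a_s` of `a ∈ A`, which are linear in `a`,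
multiply as in `S` and commute in the graded sense, with `d(a_s) = (da)_s`. -/
noncomputable def corep {k : Type u} [Field k] (S : Pattern k) (A : DGAlg k) : DGAlg k :=
  haveI gm := wordGr_gradedMonoid (k := k) (cgenQ S A) CGen.deg
  ofGens (CQ S A) (cgenQ S A) CGen.deg (cdiff S A)
    (adjoin_cgenQ S A)
    gm
    (clift (cdec S A gm) (cdec_rel gm))
    (fun x => by
      refine (clift_cmk _ _ _).trans ?_
      rw [cdec, cgen, FreeAlgebra.lift_ι_apply])
    (clift (cD S A) cD_rel)
    (fun x => by
      exact (clift_cmk _ _ _).trans (cD_cgen _ _ _))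
    (fun x => cq_mem _ _ _)
    (fun x => by
      rw [cdiff, cq, clift_cmk, cD_cgen]
      change cq _ (dGr _ (dGr _ _)) _ = 0
      rw [cq_congr rfl (dGr _ (dGr _ _)) 0 (A.d_d _), cq_zero])

end DGAlg

namespace DGAlg

/-- The coordinate `a_s` of an arbitrary element `a` of `A`. -/
noncomputable def coord {k : Type u} [Field k] (S : Pattern k) (A : DGAlg k) (s : S.ι) :
    A →ₗ[k] corep S A :=
  (DirectSum.toModule k ℤ (CQ S A) fun i =>
    { toFun := fun a => cq i a s
      map_add' := fun a b => cq_add i a b s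
      map_smul' := fun c a => cq_smul i c a s }) ∘ₗ
    (DirectSum.decomposeLinearEquiv A.gr).toLinearMap

theorem coord_of_mem {k : Type u} [Field k] {S : Pattern k} {A : DGAlg k} (s : S.ι) {i : ℤ}
    (a : A.gr i) : coord S A s a = cq i a s := by
  change (DirectSum.toModule k ℤ (CQ S A) fun i =>
    { toFun := fun a => cq i a s
      map_add' := fun a b => cq_add i a b s
      map_smul' := fun c a => cq_smul i c a s }) (DirectSum.decompose A.gr (a : A)) = _
  rw [DirectSum.decompose_coe, ← DirectSum.lof_eq_of k, DirectSum.toModule_lof]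
  rfl

theorem coord_mem {k : Type u} [Field k] {S : Pattern k} {A : DGAlg k} (s : S.ι) (i : ℤ)
    (a : A) (ha : a ∈ A.gr i) : coord S A s a ∈ (corep S A).gr i := by
  lift a to A.gr i using ha
  rw [coord_of_mem]
  exact cq_mem i a s

theorem coord_mul {k : Type u} [Field k] {S : Pattern k} {A : DGAlg k} (s : S.ι) (a b : A) :
    coord S A s (a * b) = ∑ p, coord S A (S.l s p) a * coord S A (S.r s p) b := by
  induction a using A.induction_hom with
  | h0 => simp
  | hadd a a' h h' => simp only [add_mul, map_add, h, h', Finset.sum_add_distrib]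
  | hhom i a ha =>
    induction b using A.induction_hom with
    | h0 => simp
    | hadd b b' h h' => simp only [mul_add, map_add, h, h', Finset.sum_add_distrib]
    | hhom j b hb =>
      lift a to A.gr i using ha
      lift b to A.gr j using hb
      simp only [coord_of_mem]
      have h := coord_of_mem (S := S) s
        (⟨(a : A) * (b : A), SetLike.GradedMul.mul_mem a.2 b.2⟩ : A.gr (i + j))
      exact h.trans (cq_mul i j a b s)

theorem coord_one {k : Type u} [Field k] {S : Pattern k} {A : DGAlg k} (s : S.ι) :
    coord S A s 1 = algebraMap k _ (S.one s) :=
  (coord_of_mem (S := S) s (⟨1, SetLike.GradedOne.one_mem⟩ : A.gr 0)).trans (cq_one s)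

theorem corep_d_gen {k : Type u} [Field k] {S : Pattern k} {A : DGAlg k} (x : CGen S A) :
    (corep S A).d (cgenQ S A x) = cdiff S A x := by
  change (clift (cD S A) cD_rel (cmk S A (cgen x.1.1 x.1.2 x.2))) 0 1 = _
  rw [clift_cmk, cD_cgen]
  rfl

theorem coord_d {k : Type u} [Field k] {S : Pattern k} {A : DGAlg k} (s : S.ι) (a : A) :
    coord S A s (A.d a) = (corep S A).d (coord S A s a) := by
  induction a using A.induction_hom with
  | h0 => simp
  | hadd a a' h h' => simp only [map_add, h, h']
  | hhom i a ha =>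
    lift a to A.gr i using ha
    rw [coord_of_mem]
    have h := coord_of_mem (S := S) s (dGr i a)
    exact h.trans (corep_d_gen (⟨i, a⟩, s)).symm

/-- A DG algebra with graded commuting homogeneous generators is graded commutative. -/
theorem isGradedComm_of_gens {k : Type u} [Field k] {B : DGAlg k} {X : Type*} (gen : X → B)
    (deg : X → ℤ) (hgr : ∀ i, B.gr i = wordGr (k := k) gen deg i)
    (h : ∀ x y, gen x * gen y = (deg x * deg y).negOnePow • (gen y * gen x)) :
    B.IsGradedComm := by
  have h1 : ∀ (x : X) (l : List X), gen x * (l.map gen).prod =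
      (deg x * (l.map deg).sum).negOnePow • ((l.map gen).prod * gen x) := by
    intro x l
    induction l with
    | nil => simp
    | cons y l ih =>
      simp only [List.map_cons, List.prod_cons, List.sum_cons]
      rw [← mul_assoc, h, smul_mul_assoc, mul_assoc, ih, mul_smul_comm, smul_smul, mul_add,
        Int.negOnePow_add, mul_assoc]
  have h2 : ∀ l l' : List X, (l.map gen).prod * (l'.map gen).prod =
      ((l.map deg).sum * (l'.map deg).sum).negOnePow • ((l'.map gen).prod * (l.map gen).prod) := by
    intro l l'
    induction l with
    | nil => simp
    | cons y l ih =>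
      simp only [List.map_cons, List.prod_cons, List.sum_cons]
      rw [mul_assoc, ih, mul_smul_comm, ← mul_assoc, h1, smul_mul_assoc, smul_smul, add_mul,
        Int.negOnePow_add, mul_assoc, mul_comm (Int.negOnePow _)]
  intro i j a b ha hb
  rw [hgr] at ha hb
  induction ha using Submodule.span_induction with
  | zero => simp
  | add a a' _ _ h h' => rw [add_mul, h, h', mul_add, smul_add]
  | smul c a _ h => rw [smul_mul_assoc, h, mul_smul_comm, smul_comm]
  | mem a ha =>
    obtain ⟨l, rfl, rfl⟩ := ha
    induction hb using Submodule.span_induction with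
    | zero => simp
    | add a a' _ _ h h' => rw [add_mul, mul_add, h, h', smul_add]
    | smul c a _ h => rw [smul_mul_assoc, mul_smul_comm, h, smul_comm]
    | mem b hb =>
      obtain ⟨l', rfl, rfl⟩ := hb
      exact h2 l l'

theorem corep_isGradedComm {k : Type u} [Field k] (S : Pattern k) (A : DGAlg k) :
    (corep S A).IsGradedComm :=
  isGradedComm_of_gens (B := corep S A) (cgenQ S A) CGen.deg (fun _ => rfl)
    (fun x y => cq_comm x.1.1 y.1.1 x.1.2 y.1.2 x.2 y.2)

/-- An `S ⊗ B`-valued point of `A`, given in coordinates. -/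
structure Point {k : Type u} [Field k] (S : Pattern k) (A B : DGAlg k) where
  f : S.ι → A →ₗ[k] B
  map_mem : ∀ s i a, a ∈ A.gr i → f s a ∈ B.gr i
  map_mul : ∀ s a b, f s (a * b) = ∑ p, f (S.l s p) a * f (S.r s p) b
  map_one : ∀ s, f s 1 = algebraMap k B (S.one s)
  map_d : ∀ s a, f s (A.d a) = B.d (f s a)

/-- The algebra morphism underlying `corepLift`. -/
noncomputable def corepLiftAlg {k : Type u} [Field k] {S : Pattern k} {A B : DGAlg k}
    (hB : B.IsGradedComm) (F : Point S A B) : CQ S A →ₐ[k] B :=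
  clift (FreeAlgebra.lift k fun x => F.f x.2 x.1.2) (by
    have hg : ∀ (i : ℤ) (a : A.gr i) (s : S.ι),
        FreeAlgebra.lift k (fun x : CGen S A => F.f x.2 (x.1.2 : A)) (cgen i a s) = F.f s a :=
      fun i a s => FreeAlgebra.lift_ι_apply _ _
    intro x y h
    cases h with
    | add i a b s => rw [map_add, hg, hg, hg]; exact map_add _ _ _
    | smul i c a s => rw [map_smul, hg, hg]; exact map_smul _ _ _
    | mul i j a b s =>
      rw [map_sum, hg]
      refine (F.map_mul s a b).trans (Finset.sum_congr rfl fun p _ => ?_)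
      rw [map_mul, hg, hg]
    | one s => rw [hg, AlgHom.commutes]; exact F.map_one s
    | comm i j a b s t =>
      rw [Units.smul_def, map_zsmul, map_mul, map_mul, hg, hg, ← Units.smul_def]
      exact hB i j _ _ (F.map_mem s i a a.2) (F.map_mem t j b b.2))

theorem corepLiftAlg_gen {k : Type u} [Field k] {S : Pattern k} {A B : DGAlg k}
    (hB : B.IsGradedComm) (F : Point S A B) (i : ℤ) (a : A.gr i) (s : S.ι) :
    corepLiftAlg hB F (cq i a s) = F.f s a := by
  rw [corepLiftAlg, cq, clift_cmk, cgen, FreeAlgebra.lift_ι_apply]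

/-- The universal property: an `S ⊗ B`-valued point of `A`, with `B` graded commutative, is induced
by a morphism out of `corep S A`. -/
noncomputable def corepLift {k : Type u} [Field k] {S : Pattern k} {A B : DGAlg k}
    (hB : B.IsGradedComm) (F : Point S A B) : Hom (corep S A) B :=
  have hm : ∀ i (a : corep S A), a ∈ (corep S A).gr i → corepLiftAlg hB F a ∈ B.gr i :=
    fun i a ha => map_mem_wordGr (cgenQ S A) CGen.deg (corepLiftAlg hB F) B.gr
      (fun x => by
        rw [cgenQ, corepLiftAlg_gen]
        exact F.map_mem _ _ _ x.1.2.2) i a ha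
  { toAlgHom := corepLiftAlg hB F
    map_mem := hm
    map_d := map_d_of_gens (A := corep S A) (B := B) (cgenQ S A) (adjoin_cgenQ S A)
      (corepLiftAlg hB F) hm (fun x => by
        refine (congrArg (corepLiftAlg hB F) (corep_d_gen x)).trans ?_
        refine (corepLiftAlg_gen hB F _ _ _).trans ?_
        refine (F.map_d x.2 x.1.2).trans ?_
        exact congrArg B.d (corepLiftAlg_gen hB F x.1.1 x.1.2 x.2).symm) }

theorem corepLift_coord {k : Type u} [Field k] {S : Pattern k} {A B : DGAlg k}
    (hB : B.IsGradedComm) (F : Point S A B) (s : S.ι) (a : A) :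
    corepLift hB F (coord S A s a) = F.f s a := by
  induction a using A.induction_hom with
  | h0 => simp
  | hadd a a' h h' => rw [map_add, map_add, map_add, h, h']
  | hhom i a ha =>
    lift a to A.gr i using ha
    rw [coord_of_mem]
    exact corepLiftAlg_gen hB F i a s

/-- The universal property: uniqueness. -/
theorem corep_hom_ext {k : Type u} [Field k] {S : Pattern k} {A B : DGAlg k}
    (f g : Hom (corep S A) B) (h : ∀ s a, f (coord S A s a) = g (coord S A s a))
    (x : corep S A) : f x = g x := by
  have : f.toAlgHom = g.toAlgHom := by
    refine AlgHom.ext_of_adjoin_eq_top (adjoin_cgenQ S A) ?_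
    rintro _ ⟨x, rfl⟩
    have hx := h x.2 x.1.2
    rw [coord_of_mem] at hx
    exact hx
  rw [this]

/-! ### Representations and diagonal representations -/

/-- `A_n`: the commutative DG algebra representing `B ↦ Hom(A, M_n(B))`. -/
noncomputable abbrev rep {k : Type u} [Field k] (n : ℕ) (A : DGAlg k) : DGAlg k :=
  corep (matPattern k n) A

/-- The tensor power `(A_♮♮)^{⊗ n}` of the abelianization of `A`: the commutative DG algebra
representing `B ↦ Hom(A, B^{× n}) = Hom(A_♮♮, B)^{× n}`. Its generator `a_i` is
`1 ⊗ ⋯ ⊗ a ⊗ ⋯ ⊗ 1` with `a` in the `i`-th factor. -/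
noncomputable abbrev diag {k : Type u} [Field k] (n : ℕ) (A : DGAlg k) : DGAlg k :=
  corep (diagPattern k n) A

/-- The universal representation `a ↦ ‖a_{ij}‖` with values in matrices over `A_n`. -/
noncomputable def coordMat {k : Type u} [Field k] (n : ℕ) (A : DGAlg k) (a : A) :
    Matrix (Fin n) (Fin n) (rep n A) :=
  Matrix.of fun i j => coord (matPattern k n) A (i, j) a

theorem coordMat_mul {k : Type u} [Field k] (n : ℕ) (A : DGAlg k) (a b : A) :
    coordMat n A (a * b) = coordMat n A a * coordMat n A b := by
  ext i j
  exact coord_mul (S := matPattern k n) (i, j) a b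

theorem coordMat_one {k : Type u} [Field k] (n : ℕ) (A : DGAlg k) :
    coordMat n A 1 = 1 := by
  ext i j
  refine (coord_one (S := matPattern k n) (A := A) (i, j)).trans ?_
  by_cases h : i = j
  · subst h
    rw [Matrix.one_apply_eq]
    simp
  · rw [Matrix.one_apply_ne h]
    simp [h]

/-- The scalar matrix `g ∈ GL_n(k)` viewed over `A_n`. -/
noncomputable def scalarMat {k : Type u} [Field k] (n : ℕ) (A : DGAlg k)
    (g : Matrix (Fin n) (Fin n) k) : Matrix (Fin n) (Fin n) (rep n A) :=
  g.map (algebraMap k (rep n A))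

theorem conj_apply {k : Type u} [Field k] (n : ℕ) (A : DGAlg k)
    (g h : Matrix (Fin n) (Fin n) k) (M : Matrix (Fin n) (Fin n) (rep n A)) (i j : Fin n) :
    (scalarMat n A g * M * scalarMat n A h) i j = ∑ q, ∑ p, (g i p * h q j) • M p q := by
  simp only [Matrix.mul_apply, scalarMat, Matrix.map_apply, Finset.sum_mul]
  refine Finset.sum_congr rfl fun q _ => Finset.sum_congr rfl fun p _ => ?_
  rw [← Algebra.smul_def, ← Algebra.commutes, ← Algebra.smul_def, smul_smul, mul_comm]

theorem scalarMat_inv_mul {k : Type u} [Field k] (n : ℕ) (A : DGAlg k) (g : GL (Fin n) k) :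
    scalarMat n A (g⁻¹ : GL (Fin n) k) * scalarMat n A g = 1 := by
  rw [scalarMat, scalarMat, ← Matrix.map_mul, ← Units.val_mul, inv_mul_cancel]
  simp

theorem scalarMat_mul_inv {k : Type u} [Field k] (n : ℕ) (A : DGAlg k) (g : GL (Fin n) k) :
    scalarMat n A g * scalarMat n A (g⁻¹ : GL (Fin n) k) = 1 := by
  rw [scalarMat, scalarMat, ← Matrix.map_mul, ← Units.val_mul, mul_inv_cancel]
  simp

/-- The representation `a ↦ g ‖a_{ij}‖ g⁻¹` with values in matrices over `A_n`. -/
noncomputable def conjPoint {k : Type u} [Field k] (n : ℕ) (A : DGAlg k) (g : GL (Fin n) k) :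
    Point (matPattern k n) A (rep n A) where
  f s := ∑ q, ∑ p, ((g : Matrix (Fin n) (Fin n) k) s.1 p *
    ((g⁻¹ : GL (Fin n) k) : Matrix (Fin n) (Fin n) k) q s.2) • coord (matPattern k n) A (p, q)
  map_mem s i a ha := by
    simp only [LinearMap.sum_apply, LinearMap.smul_apply]
    exact sum_mem fun q _ => sum_mem fun p _ => Submodule.smul_mem _ _ (coord_mem _ i a ha)
  map_mul s a b := by
    have key : ∀ (s : Fin n × Fin n) (a : A),
        (∑ q, ∑ p, ((g : Matrix (Fin n) (Fin n) k) s.1 p *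
          ((g⁻¹ : GL (Fin n) k) : Matrix (Fin n) (Fin n) k) q s.2) •
            coord (matPattern k n) A (p, q) : A →ₗ[k] rep n A) a =
        (scalarMat n A g * coordMat n A a * scalarMat n A (g⁻¹ : GL (Fin n) k)) s.1 s.2 := by
      intro s a
      rw [conj_apply]
      simp only [LinearMap.sum_apply, LinearMap.smul_apply]
      rfl
    have h : scalarMat n A g * coordMat n A (a * b) * scalarMat n A (g⁻¹ : GL (Fin n) k) =
        (scalarMat n A g * coordMat n A a * scalarMat n A (g⁻¹ : GL (Fin n) k)) *
        (scalarMat n A g * coordMat n A b * scalarMat n A (g⁻¹ : GL (Fin n) k)) := by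
      rw [coordMat_mul]
      calc _ = scalarMat n A g * coordMat n A a * 1 * coordMat n A b *
            scalarMat n A (g⁻¹ : GL (Fin n) k) := by simp only [mul_one, mul_assoc]
        _ = _ := by rw [← scalarMat_inv_mul n A g]; simp only [mul_assoc]
    refine (key s (a * b)).trans ?_
    rw [h, Matrix.mul_apply]
    refine Finset.sum_congr rfl fun p _ => ?_
    rw [← key (s.1, p) a, ← key (p, s.2) b]
  map_one s := by
    have key := conj_apply n A g (g⁻¹ : GL (Fin n) k) (coordMat n A 1) s.1 s.2
    simp only [LinearMap.sum_apply, LinearMap.smul_apply]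
    refine key.symm.trans ?_
    rw [coordMat_one, mul_one, scalarMat_mul_inv]
    by_cases h : s.1 = s.2
    · rw [h, Matrix.one_apply_eq, if_pos rfl, map_one]
    · rw [Matrix.one_apply_ne h, if_neg h, map_zero]
  map_d s a := by
    simp only [LinearMap.sum_apply, LinearMap.smul_apply, map_sum, map_smul]
    exact Finset.sum_congr rfl fun q _ => Finset.sum_congr rfl fun p _ =>
      congrArg _ (coord_d (S := matPattern k n) (p, q) a)

/-- The action of `g ∈ GL_n(k)` on `A_n`: the endomorphism of `A_n` corresponding to the
representation `a ↦ g ‖a_{ij}‖ g⁻¹`. -/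
noncomputable def glAct {k : Type u} [Field k] (n : ℕ) (A : DGAlg k) (g : GL (Fin n) k) :
    Hom (rep n A) (rep n A) :=
  corepLift (corep_isGradedComm _ _) (conjPoint n A g)

/-- The action of `S_n` on `(A_♮♮)^{⊗ n}` by permutation of the factors: `a_i ↦ a_{σ(i)}`. -/
noncomputable def permAct {k : Type u} [Field k] (n : ℕ) (A : DGAlg k)
    (σ : Equiv.Perm (Fin n)) : Hom (diag n A) (diag n A) :=
  corepLift (corep_isGradedComm _ _)
    { f := fun i => coord (diagPattern k n) A (σ i)
      map_mem := fun i j a ha => coord_mem (S := diagPattern k n) (σ i) j a ha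
      map_mul := fun i a b => coord_mul (S := diagPattern k n) (σ i) a b
      map_one := fun i => coord_one (S := diagPattern k n) (σ i)
      map_d := fun i a => coord_d (S := diagPattern k n) (σ i) a }

/-- `A_n^{GL}`. -/
noncomputable abbrev repGL {k : Type u} [Field k] (n : ℕ) (A : DGAlg k) : DGAlg k :=
  (rep n A).fixed (glAct n A)

/-- The symmetric power `S^n(A_♮♮) = [(A_♮♮)^{⊗ n}]^{S_n}`. -/
noncomputable abbrev symPow {k : Type u} [Field k] (n : ℕ) (A : DGAlg k) : DGAlg k :=
  (diag n A).fixed (permAct n A)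

/-- The morphism `A_n → (A_♮♮)^{⊗ n}`, `a_{ij} ↦ δ_{ij} a_i`, restricting representations to
diagonal ones. -/
noncomputable def toDiag {k : Type u} [Field k] (n : ℕ) (A : DGAlg k) :
    Hom (rep n A) (diag n A) :=
  corepLift (corep_isGradedComm _ _)
    { f := fun s => if s.1 = s.2 then coord (diagPattern k n) A s.1 else 0
      map_mem := fun s i a ha => by
        split_ifs
        · exact coord_mem (S := diagPattern k n) s.1 i a ha
        · exact zero_mem _
      map_mul := fun s a b => by
        change _ = ∑ p : Fin n,
          (if s.1 = p then coord (diagPattern k n) A s.1 else 0 : A →ₗ[k] diag n A) a *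
          (if p = s.2 then coord (diagPattern k n) A p else 0 : A →ₗ[k] diag n A) b
        rw [Finset.sum_eq_single s.1]
        · by_cases h : s.1 = s.2
          · simp only [h, if_true]
            refine (coord_mul (S := diagPattern k n) s.2 a b).trans ?_
            exact Fintype.sum_unique (ι := Unit) _
          · simp [h]
        · intro p _ hp
          rw [if_neg (Ne.symm hp)]; simp
        · simp
      map_one := fun s => by
        by_cases h : s.1 = s.2
        · rw [if_pos h]
          refine (coord_one (S := diagPattern k n) s.1).trans ?_
          simp [h]
        · simp [h]
      map_d := fun s a => by
        split_ifs
        · exact coord_d (S := diagPattern k n) s.1 a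
        · simp }

/-- The invertible permutation matrix with entries `[q = σ p]`. -/
noncomputable def permGL (k : Type u) [Field k] (n : ℕ) (σ : Equiv.Perm (Fin n)) :
    GL (Fin n) k where
  val := σ.permMatrix k
  inv := (σ⁻¹).permMatrix k
  val_inv := by rw [← Matrix.permMatrix_mul]; simp
  inv_val := by rw [← Matrix.permMatrix_mul]; simp

theorem toDiag_coord {k : Type u} [Field k] (n : ℕ) (A : DGAlg k) (s : Fin n × Fin n) (a : A) :
    toDiag n A (coord (matPattern k n) A s a) =
      if s.1 = s.2 then coord (diagPattern k n) A s.1 a else 0 := by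
  rw [toDiag, corepLift_coord]
  by_cases h : s.1 = s.2 <;> simp [h]

theorem permAct_coord {k : Type u} [Field k] (n : ℕ) (A : DGAlg k) (σ : Equiv.Perm (Fin n))
    (i : Fin n) (a : A) :
    permAct n A σ (coord (diagPattern k n) A i a) = coord (diagPattern k n) A (σ i) a := by
  rw [permAct, corepLift_coord]

theorem glAct_perm_coord {k : Type u} [Field k] (n : ℕ) (A : DGAlg k) (σ : Equiv.Perm (Fin n))
    (s : Fin n × Fin n) (a : A) :
    glAct n A (permGL k n σ) (coord (matPattern k n) A s a) =
      coord (matPattern k n) A (σ s.1, σ s.2) a := by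
  rw [glAct, corepLift_coord]
  simp only [conjPoint, LinearMap.sum_apply, LinearMap.smul_apply]
  have h1 : ∀ i p, ((permGL k n σ : GL (Fin n) k) : Matrix (Fin n) (Fin n) k) i p =
      if σ i = p then 1 else 0 := by
    intro i p
    simp [permGL, Equiv.Perm.permMatrix, PEquiv.toMatrix_apply, eq_comm]
  have h2 : ∀ q j, (((permGL k n σ)⁻¹ : GL (Fin n) k) : Matrix (Fin n) (Fin n) k) q j =
      if q = σ j then 1 else 0 := by
    intro q j
    have : (((permGL k n σ)⁻¹ : GL (Fin n) k) : Matrix (Fin n) (Fin n) k) =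
      (σ⁻¹).permMatrix k := rfl
    rw [this]
    simp [Equiv.Perm.permMatrix, PEquiv.toMatrix_apply, Equiv.eq_symm_apply, eq_comm]
  simp only [h1, h2]
  simp

/-- The derived Harish-Chandra homomorphism on a DG algebra, `Φ_n(A) : A_n^{GL} → S^n(A_♮♮)`. -/
noncomputable def harishChandra {k : Type u} [Field k] (n : ℕ) (A : DGAlg k) :
    Hom (repGL n A) (symPow n A) :=
  (toDiag n A).onFixed (glAct n A) (permAct n A) (fun a ha σ => by
    have h : ∀ x : rep n A, ((permAct n A σ).comp (toDiag n A)) x =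
        ((toDiag n A).comp (glAct n A (permGL k n σ))) x := by
      refine corep_hom_ext _ _ fun s a => ?_
      change permAct n A σ (toDiag n A (coord (matPattern k n) A s a)) =
        toDiag n A (glAct n A (permGL k n σ) (coord (matPattern k n) A s a))
      rw [glAct_perm_coord, toDiag_coord, toDiag_coord]
      by_cases hs : s.1 = s.2
      · rw [if_pos hs, permAct_coord, if_pos (congrArg σ hs)]
      · rw [if_neg hs, map_zero, if_neg (fun h => hs (σ.injective h))]
    have h' := h a
    change permAct n A σ (toDiag n A a) = toDiag n A (glAct n A (permGL k n σ) a) at h'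
    rw [h', ha])

end DGAlg

namespace DGAlg

/-! ### The polynomial algebra `k[x_1, …, x_n, y_1, …, y_n, θ_1, …, θ_n]` -/

/-- An `ℕ`-grading viewed as a `ℤ`-grading. -/
def intGr {k : Type u} [Field k] {B : Type u} [Ring B] [Algebra k B] (𝒜 : ℕ → Submodule k B) :
    ℤ → Submodule k B
  | Int.ofNat n => 𝒜 n
  | Int.negSucc _ => ⊥

theorem intGr_gradedMonoid {k : Type u} [Field k] {B : Type u} [Ring B] [Algebra k B]
    (𝒜 : ℕ → Submodule k B) [SetLike.GradedMonoid 𝒜] : SetLike.GradedMonoid (intGr 𝒜) where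
  one_mem := SetLike.GradedOne.one_mem (A := 𝒜)
  mul_mem i j a b ha hb := by
    cases i with
    | negSucc i =>
      have h : a = 0 := ha
      rw [h, zero_mul]; exact zero_mem _
    | ofNat i =>
      cases j with
      | negSucc j =>
        have h : b = 0 := hb
        rw [h, mul_zero]; exact zero_mem _
      | ofNat j => exact SetLike.GradedMul.mul_mem (A := 𝒜) ha hb

/-- The decomposition into homogeneous components. -/
noncomputable def intGrDecompose {k : Type u} [Field k] {B : Type u} [Ring B] [Algebra k B]
    (𝒜 : ℕ → Submodule k B) : (⨁ n, 𝒜 n) →+ ⨁ i, intGr 𝒜 i :=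
  DirectSum.toAddMonoid fun n => DirectSum.of (fun i => intGr 𝒜 i) (Int.ofNat n)

theorem intGrDecompose_of {k : Type u} [Field k] {B : Type u} [Ring B] [Algebra k B]
    (𝒜 : ℕ → Submodule k B) (n : ℕ) (x : 𝒜 n) :
    intGrDecompose 𝒜 (DirectSum.of (fun n => 𝒜 n) n x) =
      DirectSum.of (fun i => intGr 𝒜 i) (Int.ofNat n) x :=
  DirectSum.toAddMonoid_of _ _ _

/-- The graded algebra structure. -/
noncomputable abbrev intGrGraded {k : Type u} [Field k] {B : Type u} [Ring B] [Algebra k B]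
    (𝒜 : ℕ → Submodule k B) [GradedAlgebra 𝒜] : GradedAlgebra (intGr 𝒜) :=
  { intGr_gradedMonoid 𝒜 with
    decompose' := fun b => intGrDecompose 𝒜 (DirectSum.decompose 𝒜 b)
    left_inv := fun b => by
      induction b using DirectSum.Decomposition.inductionOn 𝒜 with
      | zero => simp
      | homogeneous m =>
        change DirectSum.coeAddMonoidHom (intGr 𝒜)
          (intGrDecompose 𝒜 (DirectSum.decompose 𝒜 (m : B))) = m
        rw [DirectSum.decompose_coe, intGrDecompose_of]
        exact DirectSum.coeAddMonoidHom_of (intGr 𝒜) _ _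
      | add m m' h h' =>
        change DirectSum.coeAddMonoidHom (intGr 𝒜)
          (intGrDecompose 𝒜 (DirectSum.decompose 𝒜 (m + m'))) = m + m'
        rw [DirectSum.decompose_add, map_add, map_add]
        exact congrArg₂ (· + ·) h h'
    right_inv := fun x => by
      induction x using DirectSum.induction_on with
      | zero => simp
      | of i x =>
        rw [DirectSum.coeAddMonoidHom_of]
        cases i with
        | ofNat n =>
          have h : DirectSum.decompose 𝒜 (x : B) = DirectSum.of (fun n => 𝒜 n) n x :=
            DirectSum.decompose_coe 𝒜 (i := n) x
          exact (congrArg (intGrDecompose 𝒜) h).trans (intGrDecompose_of 𝒜 n x)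
        | negSucc n =>
          have h : x = 0 := Subtype.ext x.2
          rw [h, map_zero]
          simp
      | add x y hx hy =>
        change intGrDecompose 𝒜 (DirectSum.decompose 𝒜 (DirectSum.coeAddMonoidHom _ (x + y))) = _
        rw [map_add, DirectSum.decompose_add, map_add]
        exact congrArg₂ (· + ·) hx hy }

/-- The underlying algebra `k[x_1, …, x_n, y_1, …, y_n] ⊗ Λ(θ_1, …, θ_n)`, where
`x_i = X (inl i)`, `y_i = X (inr i)`, and `θ_i` is the `i`-th basis vector. -/
abbrev PolyTheta (k : Type u) [Field k] (n : ℕ) : Type u :=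
  MvPolynomial (Fin n ⊕ Fin n) k ⊗[k] ExteriorAlgebra k (Fin n → k)

/-- The component of degree `m`: polynomials tensored with the `m`-th exterior power. -/
noncomputable abbrev polyThetaGr (k : Type u) [Field k] (n : ℕ) (m : ℕ) :
    Submodule k (PolyTheta k n) :=
  ((⋀[k]^m (Fin n → k)).baseChange (MvPolynomial (Fin n ⊕ Fin n) k)).restrictScalars k

/-- The DG algebra `k[x_1, …, x_n, y_1, …, y_n, θ_1, …, θ_n]`, with `x_i, y_i` of degree `0`,
`θ_i` of degree `1`, and zero differential. -/
noncomputable def polyTheta (k : Type u) [Field k] (n : ℕ) : DGAlg k where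
  carrier := PolyTheta k n
  gr := intGr (polyThetaGr k n)
  graded := intGrGraded (polyThetaGr k n)
  d := 0
  d_mem i a _ := by simp
  d_d a := rfl
  leibniz i a b _ := by simp

/-- The variables `x_i`, `y_i`, `θ_i`. -/
noncomputable def polyVar (k : Type u) [Field k] (n : ℕ) (i : Fin n) : Gen → PolyTheta k n
  | .x => MvPolynomial.X (Sum.inl i) ⊗ₜ 1
  | .y => MvPolynomial.X (Sum.inr i) ⊗ₜ 1
  | .θ => 1 ⊗ₜ ExteriorAlgebra.ι k (Pi.single i 1)

theorem exterior_comm {k : Type u} [Field k] {M : Type u} [AddCommGroup M] [Module k M]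
    (i j : ℕ) (v w : ExteriorAlgebra k M) (hv : v ∈ ⋀[k]^i M) (hw : w ∈ ⋀[k]^j M) :
    v * w = ((-1 : k) ^ (i * j)) • (w * v) := by
  have h1 : ∀ (m : M) (j : ℕ) (w : ExteriorAlgebra k M), w ∈ ⋀[k]^j M →
      ExteriorAlgebra.ι k m * w = ((-1 : k) ^ j) • (w * ExteriorAlgebra.ι k m) := by
    intro m j w hw
    induction hw using Submodule.pow_induction_on_left' with
    | algebraMap c => simp [Algebra.commutes]
    | add x y i hx hy h h' => rw [mul_add, h, h', add_mul, smul_add]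
    | mem_mul a ha i x hx h =>
      obtain ⟨m', rfl⟩ := ha
      have hs : ExteriorAlgebra.ι k m * ExteriorAlgebra.ι k m' =
          -(ExteriorAlgebra.ι k m' * ExteriorAlgebra.ι k m) :=
        eq_neg_of_add_eq_zero_left (ExteriorAlgebra.ι_add_mul_swap m m')
      rw [← mul_assoc, hs, neg_mul, mul_assoc, h, mul_smul_comm, pow_succ, mul_neg_one, neg_smul,
        mul_assoc]
  induction hv using Submodule.pow_induction_on_left' with
  | algebraMap c => simp [Algebra.commutes]
  | add x y i hx hy h h' => rw [add_mul, h, h', mul_add, smul_add]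
  | mem_mul a ha i x hx h =>
    obtain ⟨m, rfl⟩ := ha
    rw [mul_assoc, h, mul_smul_comm, ← mul_assoc, h1 m j w hw, smul_mul_assoc, smul_smul,
      mul_assoc, ← pow_add]
    congr 2
    rw [Nat.succ_mul]

theorem polyTheta_isGradedComm (k : Type u) [Field k] (n : ℕ) : (polyTheta k n).IsGradedComm := by
  have key : ∀ (i j : ℕ) (a b : PolyTheta k n), a ∈ polyThetaGr k n i → b ∈ polyThetaGr k n j →
      a * b = ((-1 : k) ^ (i * j)) • (b * a) := by
    intro i j a b ha hb
    rw [Submodule.restrictScalars_mem, Submodule.baseChange_eq_span] at ha hb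
    induction ha using Submodule.span_induction with
    | zero => simp
    | add x y _ _ h h' => rw [add_mul, h, h', mul_add, smul_add]
    | smul c x _ h => rw [smul_mul_assoc, h, mul_smul_comm, smul_comm]
    | mem x hx =>
      obtain ⟨v, hv, rfl⟩ := hx
      induction hb using Submodule.span_induction with
      | zero => simp
      | add x y _ _ h h' => rw [mul_add, h, h', add_mul, smul_add]
      | smul c x _ h => rw [mul_smul_comm, h, smul_mul_assoc, smul_comm]
      | mem y hy =>
        obtain ⟨w, hw, rfl⟩ := hy
        simp only [TensorProduct.mk_apply, Algebra.TensorProduct.tmul_mul_tmul, mul_one]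
        rw [exterior_comm i j v w hv hw, TensorProduct.tmul_smul]
  intro i j a b ha hb
  cases i with
  | negSucc i =>
    have h : a = 0 := ha
    rw [h]; simp
  | ofNat i =>
    cases j with
    | negSucc j =>
      have h : b = 0 := hb
      rw [h]; simp
    | ofNat j =>
      refine (key i j a b ha hb).trans ?_
      have hc : (Int.ofNat i * Int.ofNat j).negOnePow = (-1 : ℤˣ) ^ (i * j) := by
        change ((i : ℤ) * (j : ℤ)).negOnePow = _
        rw [← Nat.cast_mul, Int.negOnePow_def, zpow_natCast]
      rw [hc]
      rcases Nat.even_or_odd (i * j) with he | ho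
      · rw [he.neg_one_pow, he.neg_one_pow, one_smul, one_smul]
        rfl
      · rw [ho.neg_one_pow, ho.neg_one_pow, Units.neg_smul, one_smul]
        exact neg_one_smul k (M := PolyTheta k n) (b * a)

theorem polyVar_mem (k : Type u) [Field k] (n : ℕ) (i : Fin n) (g : Gen) :
    polyVar k n i g ∈ (polyTheta k n).gr g.deg := by
  have h0 : (1 : ExteriorAlgebra k (Fin n → k)) ∈ ⋀[k]^0 (Fin n → k) :=
    SetLike.GradedOne.one_mem (A := fun m : ℕ => ⋀[k]^m (Fin n → k))
  have h1 : ExteriorAlgebra.ι k (Pi.single i 1) ∈ ⋀[k]^1 (Fin n → k) := by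
    simp
  cases g with
  | x => exact Submodule.tmul_mem_baseChange_of_mem _ h0
  | y => exact Submodule.tmul_mem_baseChange_of_mem _ h0
  | θ => exact Submodule.tmul_mem_baseChange_of_mem _ h1

/-- The morphism `R → k[x_1, …, θ_n]` sending `x, y, θ` to `x_i, y_i, θ_i`. -/
noncomputable def polyPoint (k : Type u) [Field k] (n : ℕ) (i : Fin n) :
    Hom (minRes k) (polyTheta k n) :=
  minResLift (polyTheta k n) (polyVar k n i) (polyVar_mem k n i) rfl rfl (by
    have h : (0 : PolyTheta k n) = -(polyVar k n i .x * polyVar k n i .y -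
        polyVar k n i .y * polyVar k n i .x) := by
      simp [polyVar, mul_comm]
    exact h)

/-- The canonical morphism `(R_♮♮)^{⊗ n} → k[x_1, …, x_n, y_1, …, y_n, θ_1, …, θ_n]`. -/
noncomputable def diagToPoly (k : Type u) [Field k] (n : ℕ) :
    Hom (diag n (minRes k)) (polyTheta k n) :=
  corepLift (polyTheta_isGradedComm k n)
    { f := fun i => (polyPoint k n i).toAlgHom.toLinearMap
      map_mem := fun i j a ha => (polyPoint k n i).map_mem j a ha
      map_mul := fun i a b =>
        (map_mul (polyPoint k n i).toAlgHom a b).trans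
          (Fintype.sum_unique (ι := Unit)
            (fun _ => (polyPoint k n i).toAlgHom a * (polyPoint k n i).toAlgHom b)).symm
      map_one := fun i => (map_one (polyPoint k n i).toAlgHom).trans (map_one _).symm
      map_d := fun i a => (polyPoint k n i).map_d a }

/-- The algebra morphism permuting the triples `(x_i, y_i, θ_i)`. -/
noncomputable def permPolyAlg (k : Type u) [Field k] (n : ℕ) (σ : Equiv.Perm (Fin n)) :
    PolyTheta k n →ₐ[k] PolyTheta k n :=
  Algebra.TensorProduct.map (MvPolynomial.rename (Sum.map σ σ))
    (ExteriorAlgebra.map (LinearMap.funLeft k k σ.symm))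

theorem permPolyAlg_var (k : Type u) [Field k] (n : ℕ) (σ : Equiv.Perm (Fin n)) (i : Fin n)
    (g : Gen) : permPolyAlg k n σ (polyVar k n i g) = polyVar k n (σ i) g := by
  have h : LinearMap.funLeft k k σ.symm (Pi.single i 1) = Pi.single (σ i) 1 := by
    ext j
    simp [LinearMap.funLeft, Pi.single_apply, Equiv.symm_apply_eq]
  cases g with
  | x => simp [permPolyAlg, polyVar]
  | y => simp [permPolyAlg, polyVar]
  | θ => simp [permPolyAlg, polyVar, h]

/-- The action of `S_n` on `k[x_1, …, θ_n]`: `x_i ↦ x_{σ(i)}`, `y_i ↦ y_{σ(i)}`,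
`θ_i ↦ θ_{σ(i)}`. -/
noncomputable def permPoly (k : Type u) [Field k] (n : ℕ) (σ : Equiv.Perm (Fin n)) :
    Hom (polyTheta k n) (polyTheta k n) where
  toAlgHom := permPolyAlg k n σ
  map_mem i a ha := by
    cases i with
    | negSucc i =>
      have h : permPolyAlg k n σ a = 0 :=
        (congrArg (permPolyAlg k n σ) (show a = 0 from ha)).trans (map_zero _)
      exact h
    | ofNat i =>
      have hs : ∀ (c : MvPolynomial (Fin n ⊕ Fin n) k) (x : PolyTheta k n),
          c • x = (c ⊗ₜ[k] (1 : ExteriorAlgebra k (Fin n → k)) : PolyTheta k n) * x := by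
        intro c x
        induction x using TensorProduct.induction_on with
        | zero => simp
        | tmul p v => simp [TensorProduct.smul_tmul']
        | add x y h h' => rw [smul_add, mul_add, h, h']
      have key : ∀ a : PolyTheta k n, a ∈ polyThetaGr k n i →
          permPolyAlg k n σ a ∈ polyThetaGr k n i := by
        intro a ha
        rw [Submodule.restrictScalars_mem, Submodule.baseChange_eq_span] at ha
        induction ha using Submodule.span_induction with
        | zero => rw [map_zero]; exact zero_mem _
        | add x y _ _ h h' => rw [map_add]; exact add_mem h h'
        | smul c x _ h =>
          have hc : permPolyAlg k n σ (c • x) =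
              MvPolynomial.rename (Sum.map σ σ) c • permPolyAlg k n σ x := by
            rw [hs, hs, map_mul]
            simp [permPolyAlg]
          rw [hc]
          exact Submodule.smul_mem
            ((⋀[k]^i (Fin n → k)).baseChange (MvPolynomial (Fin n ⊕ Fin n) k)) _ h
        | mem x hx =>
          obtain ⟨v, hv, rfl⟩ := hx
          simp only [TensorProduct.mk_apply, permPolyAlg, Algebra.TensorProduct.map_tmul, map_one]
          refine Submodule.tmul_mem_baseChange_of_mem _ ?_
          have h := Submodule.mem_map_of_mem
            (f := (ExteriorAlgebra.map (LinearMap.funLeft k k σ.symm)).toLinearMap) hv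
          rw [Submodule.map_pow] at h
          refine pow_le_pow_left' (M := Submodule k (ExteriorAlgebra k (Fin n → k))) ?_ i h
          rintro _ ⟨_, ⟨m, rfl⟩, rfl⟩
          exact ⟨LinearMap.funLeft k k σ.symm m, by simp⟩
      exact key a ha
  map_d a := map_zero (permPolyAlg k n σ)

/-- The DG algebra `k[x_1, …, x_n, y_1, …, y_n, θ_1, …, θ_n]^{S_n}`. -/
noncomputable abbrev polyInv (k : Type u) [Field k] (n : ℕ) : DGAlg k :=
  (polyTheta k n).fixed (permPoly k n)

theorem diagToPoly_coord (k : Type u) [Field k] (n : ℕ) (i : Fin n) (a : minRes k) :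
    diagToPoly k n (coord (diagPattern k n) (minRes k) i a) = polyPoint k n i a := by
  rw [diagToPoly, corepLift_coord]
  exact rfl

theorem permPoly_point (k : Type u) [Field k] (n : ℕ) (σ : Equiv.Perm (Fin n)) (i : Fin n)
    (a : minRes k) : permPoly k n σ (polyPoint k n i a) = polyPoint k n (σ i) a := by
  have h : ((permPolyAlg k n σ).comp (FreeAlgebra.lift k (polyVar k n i)) :
      FreeAlgebra k Gen →ₐ[k] PolyTheta k n) = FreeAlgebra.lift k (polyVar k n (σ i)) := by
    refine FreeAlgebra.hom_ext (funext fun g => ?_)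
    simp [permPolyAlg_var]
  exact DFunLike.congr_fun h a

/-- The map `Φ_n : DRep_n(k[x,y])^{GL} → k[x_1, …, x_n, y_1, …, y_n, θ_1, …, θ_n]^{S_n}` computed
on the minimal resolution `R` of `k[x,y]`: it sends `x_{ij}, y_{ij}, θ_{ij}` to
`δ_{ij} x_i, δ_{ij} y_i, δ_{ij} θ_i`. -/
noncomputable def phiPoly (k : Type u) [Field k] (n : ℕ) :
    Hom (repGL n (minRes k)) (polyInv k n) :=
  ((diagToPoly k n).onFixed (permAct n (minRes k)) (permPoly k n) (fun a ha σ => by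
    have h : ∀ x : diag n (minRes k), ((permPoly k n σ).comp (diagToPoly k n)) x =
        ((diagToPoly k n).comp (permAct n (minRes k) σ)) x := by
      refine corep_hom_ext _ _ fun i a => ?_
      change permPoly k n σ (diagToPoly k n (coord (diagPattern k n) (minRes k) i a)) =
        diagToPoly k n (permAct n (minRes k) σ (coord (diagPattern k n) (minRes k) i a))
      rw [permAct_coord, diagToPoly_coord, diagToPoly_coord, permPoly_point]
    have h' := h a
    change permPoly k n σ (diagToPoly k n a) = diagToPoly k n (permAct n (minRes k) σ a) at h'
    rw [h', ha])).comp (harishChandra n (minRes k))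

end DGAlg

/-!
Let `R = k⟨x, y, θ⟩`, `dθ = -[x, y]`, be the minimal resolution of `k[x, y]`.

*Reduction to `R`.* `R` is cofibrant because it is free on generators of degrees `0`, `0`, `1`
(`minRes_isCofibrant`), and it resolves `k[x, y]` by an induction on the weight that uses Fox
derivatives (`minRes_exact`). For a DG algebra `B` the algebra `B[t, dt]` (`path B`) is a path object,
and lifting a pair of maps to the DG algebra of paths that are constant over `C` shows that two
morphisms from a cofibrant `Q` to `B` that agree after a surjective quasi-isomorphism `B → C` are
homotopic (`exists_homotopy`). So every cofibrant resolution `Q` of `k[x, y]` is homotopy equivalent to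
`R` (`exists_comparison`). A homotopy `A → B[t, dt]` induces one between representation algebras, and
integration over `[0, 1]`, which needs characteristic zero, turns it into a natural and hence
equivariant chain homotopy (`corepMap_homotopic`). So the homology of `Q_2^GL`, of `S^2(Q_♮♮)` and
`H(Q_2)^GL` can be computed with `R`; no averaging over the group is needed.

*The complex `R_2`.* Write the generic matrices as `x_0 + [x_1, x_2; x_3, -x_1]` and similarly for
`y`. Up to scalars the entries of `[x, y]` are the minors of the matrix with rows `(x_1, x_2, x_3)` and
`(y_1, y_2, y_3)`. So `R_2` is the Koszul complex on these three minors over `k[x_i, y_i]`, tensored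
with the exterior algebra on the cycle `η_0 = tr θ / 2` (`exists_koszul`, `koszul_eq_zero`,
`koszul_d`). The minors are prime and their syzygies are generated by the two rows
(`exists_of_dot_minor_eq_zero`), so every cycle without `η_0` is
`p + F (x · η) + G (y · η) + l d(η_1 η_2 η_3)` with unique `p`, `F`, `G`, `l` (`koszulCycle`,
`exists_koszulCycle`). Restriction to diagonal matrices takes it to `p - (x_1 F + y_1 G)(θ_1 - θ_2) / 2`
evaluated on the diagonal.

*Invariant cycles.* By uniqueness, an invariant cycle has invariant coefficients, and invariant
polynomials are polynomials in `x_0`, `y_0` and the inner products `A`, `B`, `C` of the traceless parts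
(`IsConjInv.exists_invHom`). On diagonal matrices these become `s²`, `st`, `t²`. The relations between
`s²`, `st`, `t²` and the relations `s F + t G = 0` are generated by `AC - B²` and by `(B, -A)`,
`(C, -B)` (`dvd_of_eval_squares`, `exists_of_square_relation`), and these are the boundaries of the
invariant elements `tr [x, y] θ`, `tr x θ²`, `tr y θ²`. This gives injectivity of `Φ_2` in homology
(`exists_fixed_d_eq`). Surjectivity holds because symmetric and antisymmetric polynomials in two pairs
of variables are the restrictions of the `P` and of the `x_1 F + y_1 G`, with `P`, `F`, `G` invariant
(`exists_fixed_diagEval_eq`).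

*Invariant classes.* For `H(R_2)^GL` the coefficients are invariant only modulo boundaries. The ideal
of minors is the ideal of the pairs of matrices with proportional traceless parts
(`mem_minorIdeal_of_eval_eq_zero`), and the pairs `(F, G)` of boundaries are those with `s F + t G = 0`
on the points `x_i = s w_i`, `y_i = t w_i` (`exists_of_toric_relation`). There the coefficients are
conjugation invariant functions, so they vanish as soon as they vanish on diagonal matrices
(`eval_eq_zero_of_conj`, `exists_d_eq_of_diagEval`).
-/

namespace DGAlg

/-! ### Homogeneous components, quasi-isomorphisms on the level of elements -/

/-- The projection of a DG algebra onto its component of degree `i`. -/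
noncomputable def proj {k : Type u} [Field k] (A : DGAlg k) (i : ℤ) : A →ₗ[k] A :=
  GradedAlgebra.proj A.gr i

section Components

variable {k : Type u} [Field k]

theorem proj_mem (A : DGAlg k) (i : ℤ) (a : A) : A.proj i a ∈ A.gr i :=
  (DirectSum.decompose A.gr a i).2

theorem proj_of_mem (A : DGAlg k) {i : ℤ} {a : A} (ha : a ∈ A.gr i) : A.proj i a = a :=
  DirectSum.decompose_of_mem_same _ ha

theorem proj_of_mem_ne (A : DGAlg k) {i j : ℤ} {a : A} (ha : a ∈ A.gr j) (h : j ≠ i) :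
    A.proj i a = 0 :=
  DirectSum.decompose_of_mem_ne _ ha h

theorem Hom.map_proj {A B : DGAlg k} (f : Hom A B) (i : ℤ) (a : A) :
    f (A.proj i a) = B.proj i (f a) := by
  induction a using A.induction_hom with
  | h0 => simp
  | hadd a a' h h' => simp only [map_add, h, h']
  | hhom j a ha =>
    by_cases h : j = i
    · subst h
      rw [proj_of_mem _ ha, proj_of_mem _ (f.map_mem _ _ ha)]
    · rw [proj_of_mem_ne _ ha h, proj_of_mem_ne _ (f.map_mem _ _ ha) h, map_zero]

theorem d_proj (A : DGAlg k) (i : ℤ) (a : A) : A.d (A.proj i a) = A.proj (i - 1) (A.d a) := by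
  induction a using A.induction_hom with
  | h0 => simp
  | hadd a a' h h' => simp only [map_add, h, h']
  | hhom j a ha =>
    by_cases h : j = i
    · subst h
      rw [proj_of_mem _ ha, proj_of_mem _ (A.d_mem _ _ ha)]
    · rw [proj_of_mem_ne _ ha h, proj_of_mem_ne _ (A.d_mem _ _ ha) (by omega), map_zero]

theorem sgn_mul (A : DGAlg k) (a b : A) : A.sgn (a * b) = A.sgn a * A.sgn b := by
  induction a using A.induction_hom with
  | h0 => simp
  | hadd a a' h h' => simp only [add_mul, map_add, h, h']
  | hhom i a ha =>
    induction b using A.induction_hom with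
    | h0 => simp
    | hadd a a' h h' => simp only [mul_add, map_add, h, h']
    | hhom j b hb =>
      rw [A.sgn_of_mem ha, A.sgn_of_mem hb,
        A.sgn_of_mem (SetLike.GradedMul.mul_mem (A := A.gr) ha hb), Int.negOnePow_add,
        smul_mul_smul_comm]

theorem sgn_one (A : DGAlg k) : A.sgn 1 = 1 := by
  have h := A.sgn_of_mem (SetLike.GradedOne.one_mem (A := A.gr))
  simpa using h

theorem Hom.map_sgn {A B : DGAlg k} (f : Hom A B) (a : A) : f (A.sgn a) = B.sgn (f a) := by
  induction a using A.induction_hom with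
  | h0 => simp
  | hadd a b h h' => simp [h, h']
  | hhom i a ha =>
    rw [A.sgn_of_mem ha, B.sgn_of_mem (f.map_mem i a ha), Units.smul_def, map_zsmul,
      Units.smul_def]

/-- The grading involution as an algebra endomorphism. -/
noncomputable def sgnAlg (A : DGAlg k) : A →ₐ[k] A :=
  AlgHom.ofLinearMap A.sgn A.sgn_one A.sgn_mul

/-- The homology class of a cycle. -/
def cls (A : DGAlg k) (z : A) (hz : A.d z = 0) : A.homology :=
  Ideal.Quotient.mkₐ k A.boundaries ⟨z, hz⟩

theorem cls_surjective (A : DGAlg k) (a : A.homology) : ∃ z hz, A.cls z hz = a := by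
  obtain ⟨⟨z, hz⟩, rfl⟩ := Ideal.Quotient.mkₐ_surjective k A.boundaries a
  exact ⟨z, hz, rfl⟩

theorem cls_eq_iff (A : DGAlg k) {z z' : A} (hz : A.d z = 0) (hz' : A.d z' = 0) :
    A.cls z hz = A.cls z' hz' ↔ ∃ c, A.d c = z - z' :=
  Ideal.Quotient.eq

theorem homologyMap_cls {A B : DGAlg k} (f : Hom A B) (z : A) (hz : A.d z = 0) :
    f.homologyMap (A.cls z hz) = B.cls (f z) (by rw [← f.map_d, hz, map_zero]) :=
  rfl

theorem quasiIso_iff {A B : DGAlg k} (f : Hom A B) : f.QuasiIso ↔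
    (∀ z, A.d z = 0 → (∃ c, B.d c = f z) → ∃ c, A.d c = z) ∧
    (∀ w, B.d w = 0 → ∃ z c, A.d z = 0 ∧ f z = w + B.d c) := by
  have hcyc : ∀ z, A.d z = 0 → B.d (f z) = 0 := fun z hz => by rw [← f.map_d, hz, map_zero]
  constructor
  · rintro ⟨hi, hs⟩
    refine ⟨fun z hz ⟨c, hc⟩ => ?_, fun w hw => ?_⟩
    · have h : f.homologyMap (A.cls z hz) = f.homologyMap (A.cls 0 (map_zero _)) := by
        rw [homologyMap_cls, homologyMap_cls, cls_eq_iff]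
        exact ⟨c, by simp [hc]⟩
      have h' := (A.cls_eq_iff _ _).1 (hi h)
      simpa using h'
    · obtain ⟨a, ha⟩ := hs (B.cls w hw)
      obtain ⟨z, hz, rfl⟩ := A.cls_surjective a
      rw [homologyMap_cls, cls_eq_iff] at ha
      obtain ⟨c, hc⟩ := ha
      exact ⟨z, c, hz, by rw [hc]; abel⟩
  · rintro ⟨hi, hs⟩
    constructor
    · rw [injective_iff_map_eq_zero]
      intro a ha
      obtain ⟨z, hz, rfl⟩ := A.cls_surjective a
      have h0 : f.homologyMap (A.cls z hz) = B.cls 0 (map_zero _) := ha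
      rw [homologyMap_cls, cls_eq_iff] at h0
      obtain ⟨c, hc⟩ := hi z hz (by simpa using h0)
      exact (A.cls_eq_iff hz (map_zero _)).2 ⟨c, by simpa using hc⟩
    · intro b
      obtain ⟨w, hw, rfl⟩ := B.cls_surjective b
      obtain ⟨z, c, hz, h⟩ := hs w hw
      refine ⟨A.cls z hz, ?_⟩
      rw [homologyMap_cls, cls_eq_iff]
      exact ⟨c, by rw [h]; abel⟩


/-- A surjective morphism with acyclic kernel is a quasi-isomorphism. -/
theorem quasiIso_of_acyclic_ker {A B : DGAlg k} (f : Hom A B) (hf : Function.Surjective f)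
    (h : ∀ z, A.d z = 0 → f z = 0 → ∃ c, A.d c = z ∧ f c = 0) : f.QuasiIso := by
  refine (quasiIso_iff f).2 ⟨fun z hz ⟨c, hc⟩ => ?_, fun w hw => ?_⟩
  · obtain ⟨c, rfl⟩ := hf c
    obtain ⟨e, he, -⟩ := h (z - A.d c) (by rw [map_sub, hz, A.d_d, sub_zero])
      (by rw [map_sub, f.map_d, hc, sub_self])
    exact ⟨e + c, by rw [map_add, he]; abel⟩
  · obtain ⟨b, rfl⟩ := hf w
    obtain ⟨e, he, he'⟩ := h (A.d b) (A.d_d b) (by rw [f.map_d, hw])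
    exact ⟨b - e, 0, by rw [map_sub, he, sub_self], by simp [he']⟩

/-- The kernel of a surjective quasi-isomorphism is acyclic. -/
theorem acyclic_ker_of_quasiIso {A B : DGAlg k} (f : Hom A B) (hf : Function.Surjective f)
    (h : f.QuasiIso) (z : A) (hz : A.d z = 0) (hfz : f z = 0) : ∃ c, A.d c = z ∧ f c = 0 := by
  obtain ⟨hi, hs⟩ := (quasiIso_iff f).1 h
  obtain ⟨c, hc⟩ := hi z hz ⟨0, by simp [hfz]⟩
  have h1 : B.d (f c) = 0 := by rw [← f.map_d, hc, hfz]
  obtain ⟨y, e, hy, he⟩ := hs (f c) h1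
  obtain ⟨e', rfl⟩ := hf e
  refine ⟨c - y + A.d e', ?_, ?_⟩
  · rw [map_add, map_sub, hc, hy, A.d_d]; simp
  · rw [map_add, map_sub, he, f.map_d]; abel

end Components

end DGAlg

namespace DGAlg

/-! ### Products, DG subalgebras and the path object `B[t, dt]` -/

/-- A family of submodules spanning `V` is a grading as soon as it admits projections. -/
theorem isInternal_of_proj {k : Type u} [Field k] {V : Type u} [AddCommGroup V] [Module k V]
    (gr : ℤ → Submodule k V) (π : ℤ → V →ₗ[k] V) (h1 : ∀ i, ∀ v ∈ gr i, π i v = v)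
    (h2 : ∀ i j, ∀ v ∈ gr j, j ≠ i → π i v = 0) (h3 : ∀ v, v ∈ ⨆ i, gr i) :
    DirectSum.IsInternal gr := by
  refine DirectSum.isInternal_submodule_of_iSupIndep_of_iSup_eq_top ?_
    (eq_top_iff.2 fun v _ => h3 v)
  intro i
  rw [Submodule.disjoint_def]
  intro v hv hv'
  have h : (⨆ j, ⨆ _ : j ≠ i, gr j) ≤ LinearMap.ker (π i) :=
    iSup₂_le fun j hj w hw => h2 i j w hw hj
  rw [← h1 i v hv]
  exact h hv'

/-- A grading from projections onto the components. -/
noncomputable abbrev gradedOfProj {k : Type u} [Field k] {V : Type u} [Ring V] [Algebra k V]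
    (gr : ℤ → Submodule k V) (gm : SetLike.GradedMonoid gr) (π : ℤ → V →ₗ[k] V)
    (h1 : ∀ i, ∀ v ∈ gr i, π i v = v)
    (h2 : ∀ i j, ∀ v ∈ gr j, j ≠ i → π i v = 0) (h3 : ∀ v, v ∈ ⨆ i, gr i) :
    GradedAlgebra gr :=
  { gm with toDecomposition := (isInternal_of_proj gr π h1 h2 h3).chooseDecomposition }

theorem mem_iSup_gr {k : Type u} [Field k] (A : DGAlg k) (a : A) : a ∈ ⨆ i, A.gr i := by
  rw [(DirectSum.Decomposition.isInternal A.gr).submodule_iSup_eq_top]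
  trivial

/-- The product of two DG algebras. -/
noncomputable def prod {k : Type u} [Field k] (A B : DGAlg k) : DGAlg k where
  carrier := A × B
  gr i := (A.gr i).prod (B.gr i)
  graded := gradedOfProj _
    { one_mem := ⟨SetLike.GradedOne.one_mem (A := A.gr), SetLike.GradedOne.one_mem (A := B.gr)⟩
      mul_mem := fun _ _ _ _ ha hb => ⟨SetLike.GradedMul.mul_mem (A := A.gr) ha.1 hb.1,
        SetLike.GradedMul.mul_mem (A := B.gr) ha.2 hb.2⟩ }
    (fun i => (A.proj i).prodMap (B.proj i))
    (fun i v hv => Prod.ext (A.proj_of_mem hv.1) (B.proj_of_mem hv.2))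
    (fun i j v hv h => Prod.ext (A.proj_of_mem_ne hv.1 h) (B.proj_of_mem_ne hv.2 h))
    (fun v => by
      have hA : (⨆ i, A.gr i) ≤
          (⨆ i, (A.gr i).prod (B.gr i)).comap (LinearMap.inl k A B) :=
        iSup_le fun i a ha => Submodule.mem_iSup_of_mem i ⟨ha, zero_mem _⟩
      have hB : (⨆ i, B.gr i) ≤
          (⨆ i, (A.gr i).prod (B.gr i)).comap (LinearMap.inr k A B) :=
        iSup_le fun i a ha => Submodule.mem_iSup_of_mem i ⟨zero_mem _, ha⟩
      have h1 : (v.1, (0 : B)) ∈ ⨆ i, (A.gr i).prod (B.gr i) := hA (A.mem_iSup_gr v.1)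
      have h2 : ((0 : A), v.2) ∈ ⨆ i, (A.gr i).prod (B.gr i) := hB (B.mem_iSup_gr v.2)
      have h := add_mem h1 h2
      rwa [Prod.mk_add_mk, add_zero, zero_add] at h)
  d := A.d.prodMap B.d
  d_mem i a ha := ⟨A.d_mem i _ ha.1, B.d_mem i _ ha.2⟩
  d_d a := Prod.ext (A.d_d _) (B.d_d _)
  leibniz i a b ha := Prod.ext (A.leibniz i _ _ ha.1) (B.leibniz i _ _ ha.2)

/-- The first projection of a product of DG algebras. -/
noncomputable def prodFst {k : Type u} [Field k] (A B : DGAlg k) : Hom (prod A B) A where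
  toAlgHom := AlgHom.fst k A B
  map_mem _ _ h := h.1
  map_d _ := rfl

/-- The second projection of a product of DG algebras. -/
noncomputable def prodSnd {k : Type u} [Field k] (A B : DGAlg k) : Hom (prod A B) B where
  toAlgHom := AlgHom.snd k A B
  map_mem _ _ h := h.2
  map_d _ := rfl

/-- The DG subalgebra on a subalgebra closed under the differential and under taking
homogeneous components. -/
noncomputable def sub {k : Type u} [Field k] (A : DGAlg k) (S : Subalgebra k A)
    (hd : ∀ a ∈ S, A.d a ∈ S) (hp : ∀ i, ∀ a ∈ S, A.proj i a ∈ S) : DGAlg k where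
  carrier := S
  gr i := (A.gr i).comap S.val.toLinearMap
  graded := gradedOfProj _
    { one_mem := SetLike.GradedOne.one_mem (A := A.gr)
      mul_mem := fun _ _ _ _ ha hb => SetLike.GradedMul.mul_mem (A := A.gr) ha hb }
    (fun i => (A.proj i ∘ₗ S.val.toLinearMap).codRestrict (Subalgebra.toSubmodule S)
      fun a => hp i _ a.2)
    (fun i v hv => Subtype.ext (A.proj_of_mem hv))
    (fun i j v hv h => Subtype.ext (A.proj_of_mem_ne hv h))
    (fun v => by
      classical
      have h : v = ∑ i ∈ (DirectSum.decompose A.gr (v : A)).support,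
          (⟨A.proj i v, hp i _ v.2⟩ : S) := by
        apply Subtype.ext
        rw [AddSubmonoidClass.coe_finsetSum]
        exact (DirectSum.sum_support_decompose A.gr (v : A)).symm
      rw [h]
      exact sum_mem fun i _ => Submodule.mem_iSup_of_mem i (A.proj_mem i v))
  d := (A.d ∘ₗ S.val.toLinearMap).codRestrict (Subalgebra.toSubmodule S) fun a => hd _ a.2
  d_mem i a ha := A.d_mem i _ ha
  d_d a := Subtype.ext (A.d_d _)
  leibniz i a b ha := Subtype.ext (by
    have h := A.leibniz i (a : A) (b : A) ha
    rcases Int.units_eq_one_or i.negOnePow with h' | h'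
    · rw [h', one_smul] at h ⊢
      exact h
    · rw [h', Units.neg_smul, one_smul] at h ⊢
      exact h)

open Polynomial

section CoeffMap

variable {k : Type u} [Field k] {V W : Type u} [Ring V] [Algebra k V] [Ring W] [Algebra k W]

theorem coeff_sum_monomial (f : V →ₗ[k] W) (p : V[X]) (n : ℕ) :
    (∑ m ∈ p.support, monomial m (f (p.coeff m))).coeff n = f (p.coeff n) := by
  rw [finsetSum_coeff]
  simp only [coeff_monomial]
  rw [Finset.sum_ite_eq' p.support n (fun m => f (p.coeff m))]
  split_ifs with hn
  · rfl
  · rw [notMem_support_iff.1 hn, map_zero]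

/-- The map on polynomials applying a linear map to every coefficient. -/
noncomputable def coeffMap (f : V →ₗ[k] W) : V[X] →ₗ[k] W[X] where
  toFun p := ∑ n ∈ p.support, monomial n (f (p.coeff n))
  map_add' p q := by
    ext n
    rw [coeff_add, coeff_sum_monomial, coeff_sum_monomial, coeff_sum_monomial, coeff_add, map_add]
  map_smul' c p := by
    ext n
    rw [RingHom.id_apply, coeff_smul, coeff_sum_monomial, coeff_sum_monomial, coeff_smul, map_smul]

@[simp]
theorem coeff_coeffMap (f : V →ₗ[k] W) (p : V[X]) (n : ℕ) :
    (coeffMap f p).coeff n = f (p.coeff n) :=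
  coeff_sum_monomial f p n

@[simp]
theorem coeffMap_C (f : V →ₗ[k] W) (v : V) : coeffMap f (C v) = C (f v) := by
  ext n
  rw [coeff_coeffMap, coeff_C, coeff_C]
  split_ifs <;> simp

@[simp]
theorem coeffMap_monomial (f : V →ₗ[k] W) (m : ℕ) (v : V) :
    coeffMap f (monomial m v) = monomial m (f v) := by
  ext n
  rw [coeff_coeffMap, coeff_monomial, coeff_monomial]
  split_ifs <;> simp

theorem coeffMap_mul {ι : Type*} (s : Finset ι) (f : V →ₗ[k] W) (g h : ι → V →ₗ[k] W)
    (hf : ∀ a b, f (a * b) = ∑ p ∈ s, g p a * h p b) (p q : V[X]) :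
    coeffMap f (p * q) = ∑ i ∈ s, coeffMap (g i) p * coeffMap (h i) q := by
  ext n
  rw [coeff_coeffMap, finsetSum_coeff, coeff_mul, map_sum]
  simp only [coeff_mul, coeff_coeffMap, hf]
  exact Finset.sum_comm

theorem coeffMap_derivative (f : V →ₗ[k] W) (p : V[X]) :
    coeffMap f (derivative p) = derivative (coeffMap f p) := by
  ext n
  rw [coeff_coeffMap, coeff_derivative, coeff_derivative, coeff_coeffMap]
  have h : ∀ {Z : Type u} [Ring Z] [Algebra k Z] (z : Z), z * ((n : Z) + 1) = ((n : k) + 1) • z := by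
    intro Z _ _ z
    rw [Algebra.smul_def, Algebra.commutes]; simp
  rw [h, h, map_smul]

end CoeffMap

section Path

variable {k : Type u} [Field k] (B : DGAlg k)

/-- The algebra underlying `B[t, dt]`: the element `p + q dt` is the matrix `[p, q; 0, τ p]` with
`τ` the grading involution applied to the coefficients. -/
noncomputable def pathSub : Subalgebra k (Matrix (Fin 2) (Fin 2) B[X]) where
  carrier := {M | M 1 0 = 0 ∧ M 1 1 = mapAlgHom B.sgnAlg (M 0 0)}
  mul_mem' {M N} hM hN := by
    refine ⟨?_, ?_⟩ <;>
    simp [Matrix.mul_apply, Fin.sum_univ_two, hM.1, hM.2, hN.1, hN.2, Polynomial.map_mul]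
  add_mem' {M N} hM hN := by
    refine ⟨?_, ?_⟩ <;>
    simp [hM.1, hM.2, hN.1, hN.2]
  algebraMap_mem' c := by
    refine ⟨?_, ?_⟩
    · simp [Matrix.algebraMap_matrix_apply]
    · simp only [Matrix.algebraMap_matrix_apply, if_true]
      exact (AlgHom.commutes _ c).symm

/-- The element `p + q dt` of `B[t, dt]`, linearly in `p` and `q`. -/
noncomputable def pathSubMk : B[X] × B[X] →ₗ[k] pathSub B where
  toFun p := ⟨!![p.1, p.2; 0, mapAlgHom B.sgnAlg p.1], rfl, rfl⟩
  map_add' p q := Subtype.ext (by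
    ext i j : 2
    fin_cases i <;> fin_cases j <;> simp)
  map_smul' c p := Subtype.ext (by
    ext i j : 2
    fin_cases i <;> fin_cases j <;> simp)

/-- The coefficient `p` of `p + q dt`. -/
noncomputable def pathSubFst : pathSub B →ₗ[k] B[X] where
  toFun M := M.1 0 0
  map_add' _ _ := rfl
  map_smul' _ _ := rfl

/-- The coefficient `q` of `p + q dt`. -/
noncomputable def pathSubSnd : pathSub B →ₗ[k] B[X] where
  toFun M := M.1 0 1
  map_add' _ _ := rfl
  map_smul' _ _ := rfl

variable {B}

theorem pathSub_ext {M N : pathSub B} (h1 : pathSubFst B M = pathSubFst B N)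
    (h2 : pathSubSnd B M = pathSubSnd B N) : M = N := by
  refine Subtype.ext (Matrix.ext fun i j => ?_)
  fin_cases i <;> fin_cases j
  · exact h1
  · exact h2
  · exact M.2.1.trans N.2.1.symm
  · exact M.2.2.trans ((congrArg _ h1).trans N.2.2.symm)

theorem pathSubMk_eta (M : pathSub B) : pathSubMk B (pathSubFst B M, pathSubSnd B M) = M :=
  pathSub_ext rfl rfl

theorem pathSubFst_mul (M N : pathSub B) : pathSubFst B (M * N) = pathSubFst B M * pathSubFst B N := by
  change (M.1 * N.1) 0 0 = _
  rw [Matrix.mul_apply, Fin.sum_univ_two, N.2.1, mul_zero, add_zero]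
  rfl

theorem pathSubSnd_mul (M N : pathSub B) : pathSubSnd B (M * N) =
    pathSubFst B M * pathSubSnd B N + pathSubSnd B M * coeffMap B.sgn (pathSubFst B N) := by
  change (M.1 * N.1) 0 1 = _
  rw [Matrix.mul_apply, Fin.sum_univ_two, N.2.2]
  have h : ∀ p : B[X], mapAlgHom B.sgnAlg p = coeffMap B.sgn p := fun p => by
    ext n; simp; rfl
  rw [h]
  rfl

theorem pathSubFst_one : pathSubFst B 1 = 1 := rfl

theorem pathSubSnd_one : pathSubSnd B 1 = 0 := rfl

theorem coeffMap_sgn_mul (p q : B[X]) :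
    coeffMap B.sgn (p * q) = coeffMap B.sgn p * coeffMap B.sgn q := by
  have h := coeffMap_mul (Finset.univ : Finset Unit) B.sgn (fun _ => B.sgn) (fun _ => B.sgn)
    (fun a b => by simp [B.sgn_mul]) p q
  simpa using h

theorem coeffMap_d_mul (p q : B[X]) :
    coeffMap B.d (p * q) = coeffMap B.d p * q + coeffMap B.sgn p * coeffMap B.d q := by
  have h := coeffMap_mul (Finset.univ : Finset (Fin 2)) B.d ![B.d, B.sgn] ![LinearMap.id, B.d]
    (fun a b => by simp [B.d_mul]) p q
  have hid : coeffMap (LinearMap.id : B →ₗ[k] B) q = q := by ext n; simp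
  simpa [hid] using h

theorem coeffMap_sgn_sgn (p : B[X]) : coeffMap B.sgn (coeffMap B.sgn p) = p := by
  ext n; simp [B.sgn_sgn]

theorem coeffMap_d_sgn (p : B[X]) :
    coeffMap B.d (coeffMap B.sgn p) = -coeffMap B.sgn (coeffMap B.d p) := by
  ext n; simp [B.d_sgn]

theorem coeffMap_d_d (p : B[X]) : coeffMap B.d (coeffMap B.d p) = 0 := by
  ext n; simp [B.d_d]

/-- The polynomials with coefficients of degree `i`. -/
def polyGr (B : DGAlg k) (i : ℤ) : Submodule k B[X] where
  carrier := {p | ∀ n, p.coeff n ∈ B.gr i}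
  add_mem' hp hq n := by rw [coeff_add]; exact add_mem (hp n) (hq n)
  zero_mem' n := by simp
  smul_mem' c p hp n := by rw [coeff_smul]; exact Submodule.smul_mem _ c (hp n)

theorem polyGr_mul {i j : ℤ} {p q : B[X]} (hp : p ∈ polyGr B i) (hq : q ∈ polyGr B j) :
    p * q ∈ polyGr B (i + j) := fun n => by
  rw [coeff_mul]
  exact sum_mem fun x _ => SetLike.GradedMul.mul_mem (hp _) (hq _)

theorem coeffMap_sgn_of_mem {i : ℤ} {p : B[X]} (hp : p ∈ polyGr B i) :
    coeffMap B.sgn p = i.negOnePow • p := by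
  ext n
  rw [coeff_coeffMap, B.sgn_of_mem (hp n), Units.smul_def, Units.smul_def, coeff_smul]

/-- The graded tensor product `B[t, dt]` of `B` with the polynomial de Rham algebra of the line,
with `|t| = 0` and `|dt| = -1`. Since `τ b` is `(-1)^{|b|} b`, the Leibniz rule gives
`d (p + q dt) = dp + (τ p' + dq) dt`, with `p'` the derivative in `t`. -/
noncomputable def path (B : DGAlg k) : DGAlg k where
  carrier := pathSub B
  gr i := ((polyGr B i).comap (pathSubFst B)) ⊓ ((polyGr B (i + 1)).comap (pathSubSnd B))
  graded := gradedOfProj _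
    { one_mem := by
        refine ⟨fun n => ?_, fun n => ?_⟩
        · rw [pathSubFst_one, coeff_one]
          split_ifs
          · exact SetLike.GradedOne.one_mem
          · exact zero_mem _
        · rw [pathSubSnd_one, coeff_zero]; exact zero_mem _
      mul_mem := fun i j M N hM hN => by
        refine ⟨?_, ?_⟩
        · change pathSubFst B (M * N) ∈ polyGr B (i + j)
          rw [pathSubFst_mul]; exact polyGr_mul hM.1 hN.1
        · change pathSubSnd B (M * N) ∈ polyGr B (i + j + 1)
          rw [pathSubSnd_mul, coeffMap_sgn_of_mem hN.1]
          refine add_mem ?_ ?_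
          · have h := polyGr_mul hM.1 hN.2
            rwa [← add_assoc] at h
          · rw [mul_smul_comm]
            refine Submodule.smul_of_tower_mem _ _ ?_
            have h := polyGr_mul hM.2 hN.1
            rwa [add_right_comm] at h }
    (fun i => pathSubMk B ∘ₗ ((coeffMap (B.proj i) ∘ₗ pathSubFst B).prod
      (coeffMap (B.proj (i + 1)) ∘ₗ pathSubSnd B)))
    (fun i M hM => pathSub_ext
      (by ext n; exact (coeff_coeffMap _ _ _).trans (B.proj_of_mem (hM.1 n)))
      (by ext n; exact (coeff_coeffMap _ _ _).trans (B.proj_of_mem (hM.2 n))))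
    (fun i j M hM h => pathSub_ext
      (by ext n; exact (coeff_coeffMap _ _ _).trans (B.proj_of_mem_ne (hM.1 n) h))
      (by
        ext n
        exact (coeff_coeffMap _ _ _).trans (B.proj_of_mem_ne (hM.2 n) (by omega))))
    (fun M => by
      rw [← pathSubMk_eta M]
      set G := ⨆ i, ((polyGr B i).comap (pathSubFst B)) ⊓ ((polyGr B (i + 1)).comap (pathSubSnd B))
      have hmon : ∀ (i : ℤ) (b : B) (n : ℕ), b ∈ B.gr i → monomial n b ∈ polyGr B i := by
        intro i b n hb m
        rw [coeff_monomial]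
        split_ifs
        · exact hb
        · exact zero_mem _
      have h1 : ∀ p : B[X], pathSubMk B (p, 0) ∈ G := by
        intro p
        induction p using Polynomial.induction_on' with
        | add p q hp hq =>
          have h := add_mem hp hq
          rwa [← map_add, Prod.mk_add_mk, add_zero] at h
        | monomial n b =>
          induction b using B.induction_hom with
          | h0 =>
            rw [map_zero]
            exact (map_zero (pathSubMk B)).symm ▸ zero_mem G
          | hadd a b ha hb =>
            have h := add_mem ha hb
            rwa [← map_add, Prod.mk_add_mk, add_zero, ← map_add] at h
          | hhom i b hb =>
            exact Submodule.mem_iSup_of_mem i ⟨hmon i b n hb, zero_mem (polyGr B (i + 1))⟩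
      have h2 : ∀ p : B[X], pathSubMk B (0, p) ∈ G := by
        intro p
        induction p using Polynomial.induction_on' with
        | add p q hp hq =>
          have h := add_mem hp hq
          rwa [← map_add, Prod.mk_add_mk, add_zero] at h
        | monomial n b =>
          induction b using B.induction_hom with
          | h0 =>
            rw [map_zero]
            exact (map_zero (pathSubMk B)).symm ▸ zero_mem G
          | hadd a b ha hb =>
            have h := add_mem ha hb
            rwa [← map_add, Prod.mk_add_mk, add_zero, ← map_add] at h
          | hhom i b hb =>
            refine Submodule.mem_iSup_of_mem (i - 1) ⟨zero_mem (polyGr B (i - 1)), ?_⟩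
            have h := hmon i b n hb
            rw [← sub_add_cancel i 1] at h
            exact h
      have h := add_mem (h1 (pathSubFst B M)) (h2 (pathSubSnd B M))
      rwa [← map_add, Prod.mk_add_mk, add_zero, zero_add] at h)
  d := pathSubMk B ∘ₗ ((coeffMap B.d ∘ₗ pathSubFst B).prod
      (coeffMap B.sgn ∘ₗ derivative.restrictScalars k ∘ₗ pathSubFst B + coeffMap B.d ∘ₗ pathSubSnd B))
  d_mem i M hM := by
    refine ⟨fun n => ?_, fun n => ?_⟩
    · change (coeffMap B.d (pathSubFst B M)).coeff n ∈ _
      rw [coeff_coeffMap]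
      exact B.d_mem i _ (hM.1 n)
    · change (coeffMap B.sgn (derivative (pathSubFst B M)) + coeffMap B.d (pathSubSnd B M)).coeff n ∈ _
      rw [coeff_add, coeff_coeffMap, coeff_coeffMap, coeff_derivative, sub_add_cancel]
      refine add_mem ?_ ?_
      · have h : (pathSubFst B M).coeff (n + 1) * ((n : B) + 1) =
            ((n + 1 : ℕ) : B) * (pathSubFst B M).coeff (n + 1) := by
          rw [Nat.cast_comm]; simp
        rw [h, ← nsmul_eq_mul, map_nsmul, B.sgn_of_mem (hM.1 _)]
        exact nsmul_mem (Submodule.smul_of_tower_mem _ _ (hM.1 _)) _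
      · have h := B.d_mem (i + 1) _ (hM.2 n)
        rwa [add_sub_cancel_right] at h
  d_d M := by
    refine pathSub_ext ?_ ?_
    · exact coeffMap_d_d _
    · change coeffMap B.sgn (derivative (coeffMap B.d (pathSubFst B M))) +
        coeffMap B.d (coeffMap B.sgn (derivative (pathSubFst B M)) + coeffMap B.d (pathSubSnd B M)) = 0
      rw [map_add, coeffMap_d_d, coeffMap_d_sgn]
      simp only [coeffMap_derivative]
      abel
  leibniz i M N hM := by
    refine pathSub_ext ?_ ?_
    · rw [map_add, Units.smul_def, map_zsmul, pathSubFst_mul, pathSubFst_mul]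
      change coeffMap B.d (pathSubFst B (M * N)) = coeffMap B.d (pathSubFst B M) * pathSubFst B N +
        (i.negOnePow : ℤ) • (pathSubFst B M * coeffMap B.d (pathSubFst B N))
      rw [pathSubFst_mul, coeffMap_d_mul, coeffMap_sgn_of_mem hM.1, smul_mul_assoc, ← Units.smul_def]
    · rw [map_add, Units.smul_def, map_zsmul, pathSubSnd_mul, pathSubSnd_mul]
      change coeffMap B.sgn (derivative (pathSubFst B (M * N))) + coeffMap B.d (pathSubSnd B (M * N)) =
        coeffMap B.d (pathSubFst B M) * pathSubSnd B N +
        (coeffMap B.sgn (derivative (pathSubFst B M)) + coeffMap B.d (pathSubSnd B M)) *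
          coeffMap B.sgn (pathSubFst B N) +
        (i.negOnePow : ℤ) • (pathSubFst B M * (coeffMap B.sgn (derivative (pathSubFst B N)) +
          coeffMap B.d (pathSubSnd B N)) +
            pathSubSnd B M * coeffMap B.sgn (coeffMap B.d (pathSubFst B N)))
      rw [pathSubFst_mul, pathSubSnd_mul, derivative_mul, map_add, map_add, coeffMap_sgn_mul,
        coeffMap_sgn_mul, coeffMap_d_mul, coeffMap_d_mul, coeffMap_d_sgn,
        coeffMap_sgn_of_mem hM.1, coeffMap_sgn_of_mem hM.2, Int.negOnePow_add]
      simp only [Units.smul_def, Int.negOnePow_one, Units.val_neg, smul_add, smul_mul_assoc,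
        add_mul, mul_add, mul_neg, mul_one, neg_smul, neg_mul, neg_neg]
      abel

variable (B) in
/-- The coefficient `p` of an element `p + q dt` of `B[t, dt]`. -/
noncomputable def pathFst : path B →ₐ[k] B[X] :=
  AlgHom.ofLinearMap (pathSubFst B) pathSubFst_one pathSubFst_mul

variable (B) in
/-- The coefficient `q` of an element `p + q dt` of `B[t, dt]`. -/
noncomputable def pathSnd : path B →ₗ[k] B[X] := pathSubSnd B

variable (B) in
/-- The element `p + q dt` of `B[t, dt]`. -/
noncomputable def pathMk : B[X] × B[X] →ₗ[k] path B := pathSubMk B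

@[simp] theorem pathFst_mk (p : B[X] × B[X]) : pathFst B (pathMk B p) = p.1 := rfl

@[simp] theorem pathSnd_mk (p : B[X] × B[X]) : pathSnd B (pathMk B p) = p.2 := rfl

theorem path_ext {M N : path B} (h1 : pathFst B M = pathFst B N)
    (h2 : pathSnd B M = pathSnd B N) : M = N :=
  pathSub_ext h1 h2

theorem pathSnd_mul (M N : path B) : pathSnd B (M * N) =
    pathFst B M * pathSnd B N + pathSnd B M * coeffMap B.sgn (pathFst B N) :=
  pathSubSnd_mul M N

theorem pathSnd_one : pathSnd B 1 = 0 := rfl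

@[simp] theorem pathFst_d (M : path B) : pathFst B ((path B).d M) = coeffMap B.d (pathFst B M) :=
  rfl

@[simp] theorem pathSnd_d (M : path B) : pathSnd B ((path B).d M) =
    coeffMap B.sgn (derivative (pathFst B M)) + coeffMap B.d (pathSnd B M) :=
  rfl

theorem mem_path_gr {i : ℤ} {M : path B} : M ∈ (path B).gr i ↔
    (∀ n, (pathFst B M).coeff n ∈ B.gr i) ∧ ∀ n, (pathSnd B M).coeff n ∈ B.gr (i + 1) :=
  Iff.rfl

end Path

end DGAlg

namespace DGAlg

/-! ### Homotopies -/

open Polynomial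

section Eval

variable {k : Type u} [Field k]

/-- Evaluation of polynomials over a noncommutative algebra at a scalar. -/
noncomputable def evalAt (B : Type u) [Ring B] [Algebra k B] (c : k) : B[X] →ₐ[k] B :=
  eval₂AlgHom (AlgHom.id k B) (algebraMap k B c) fun b => (Algebra.commutes c b).symm

theorem evalAt_monomial (B : Type u) [Ring B] [Algebra k B] (c : k) (n : ℕ) (b : B) :
    evalAt B c (monomial n b) = c ^ n • b := by
  change eval₂ _ _ _ = _
  rw [eval₂_monomial, Algebra.smul_def, ← map_pow]
  exact (Algebra.commutes _ _).symm

theorem evalAt_coeffMap {B C : Type u} [Ring B] [Algebra k B] [Ring C] [Algebra k C]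
    (f : B →ₗ[k] C) (c : k) (p : B[X]) : evalAt C c (coeffMap f p) = f (evalAt B c p) := by
  induction p using Polynomial.induction_on' with
  | add p q hp hq => simp only [map_add, hp, hq]
  | monomial n b => rw [coeffMap_monomial, evalAt_monomial, evalAt_monomial, map_smul]

/-- The integral `∫₀¹ p dt` of a polynomial over a noncommutative algebra. -/
noncomputable def polyInt (B : Type u) [Ring B] [Algebra k B] : B[X] →ₗ[k] B :=
  Polynomial.lsum fun n => ((n : k) + 1)⁻¹ • LinearMap.id

theorem polyInt_monomial (B : Type u) [Ring B] [Algebra k B] (n : ℕ) (b : B) :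
    polyInt (k := k) B (monomial n b) = ((n : k) + 1)⁻¹ • b := by
  simp [polyInt, Polynomial.lsum_apply, Polynomial.sum_monomial_index]

theorem polyInt_coeffMap {B C : Type u} [Ring B] [Algebra k B] [Ring C] [Algebra k C]
    (f : B →ₗ[k] C) (p : B[X]) : polyInt (k := k) C (coeffMap f p) = f (polyInt (k := k) B p) := by
  induction p using Polynomial.induction_on' with
  | add p q hp hq => simp only [map_add, hp, hq]
  | monomial n b => rw [coeffMap_monomial, polyInt_monomial, polyInt_monomial, map_smul]

theorem polyInt_derivative [CharZero k] {B : Type u} [Ring B] [Algebra k B] (p : B[X]) :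
    polyInt (k := k) B (derivative p) = evalAt B (1 : k) p - evalAt B (0 : k) p := by
  induction p using Polynomial.induction_on' with
  | add p q hp hq => simp only [map_add, hp, hq]; abel
  | monomial n b =>
    rw [derivative_monomial, polyInt_monomial, evalAt_monomial, evalAt_monomial]
    cases n with
    | zero => simp
    | succ n =>
      have h : ((n : k) + 1) ≠ 0 := by exact_mod_cast Nat.succ_ne_zero n
      have h2 : b * ((n + 1 : ℕ) : B) = ((n : k) + 1) • b := by
        rw [Algebra.smul_def, Algebra.commutes]; simp
      rw [h2]
      simp only [Nat.add_sub_cancel, one_pow, one_smul]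
      rw [smul_smul, inv_mul_cancel₀ h]
      simp

/-- Evaluation of `B[t, dt]` at `t = c`, `dt = 0`. -/
noncomputable def pathEval (B : DGAlg k) (c : k) : Hom (path B) B where
  toAlgHom := (evalAt B c).comp (pathFst B)
  map_mem i M hM := by
    change evalAt B c (pathFst B M) ∈ _
    have h := (mem_path_gr.1 hM).1
    generalize pathFst B M = p at h
    have hp : ∀ n, p.coeff n ∈ B.gr i := h
    rw [← Polynomial.sum_monomial_eq p, Polynomial.sum_def, map_sum]
    refine sum_mem fun n _ => ?_
    rw [evalAt_monomial]
    exact Submodule.smul_mem _ _ (hp n)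
  map_d M := evalAt_coeffMap B.d c (pathFst B M)

theorem pathEval_apply (B : DGAlg k) (c : k) (M : path B) :
    pathEval B c M = evalAt B c (pathFst B M) := rfl

/-- The endpoints of a cycle of `B[t, dt]` are homologous: they differ by the boundary of its
integral over the unit interval. -/
theorem d_polyInt_of_cycle [CharZero k] {B : DGAlg k} (M : path B) (hM : (path B).d M = 0) :
    B.d (polyInt (k := k) B (coeffMap B.sgn (pathSnd B M))) =
      pathEval B 1 M - pathEval B 0 M := by
  have h : coeffMap B.sgn (derivative (pathFst B M)) + coeffMap B.d (pathSnd B M) = 0 := by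
    rw [← pathSnd_d, hM]; rfl
  rw [pathEval_apply, pathEval_apply, ← polyInt_derivative, ← polyInt_coeffMap, coeffMap_d_sgn,
    ← map_neg, eq_neg_of_add_eq_zero_right h, neg_neg, coeffMap_sgn_sgn]

end Eval

section Lifting

variable {k : Type u} [Field k]

/-- On the kernel of a surjective quasi-isomorphism there is a linear contraction, defined on
cycles. Being linear, it extends coefficientwise to polynomials. -/
theorem exists_contraction {B C : DGAlg k} (p : Hom B C) (hp : Function.Surjective p)
    (hq : p.QuasiIso) : ∃ h : B →ₗ[k] B, ∀ b, B.d b = 0 → p b = 0 → B.d (h b) = b ∧ p (h b) = 0 := by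
  let K : Submodule k B := LinearMap.ker p.toAlgHom.toLinearMap
  let Z : Submodule k B := LinearMap.ker B.d ⊓ K
  let dK : K →ₗ[k] Z := (B.d ∘ₗ K.subtype).codRestrict Z fun b =>
    ⟨B.d_d _, by
      have hb : p b = 0 := b.2
      change p (B.d b) = 0
      rw [p.map_d, hb, map_zero]⟩
  have hs : Function.Surjective dK := by
    rintro ⟨z, hz, hz'⟩
    obtain ⟨c, hc, hc'⟩ := acyclic_ker_of_quasiIso p hp hq z hz hz'
    exact ⟨⟨c, hc'⟩, Subtype.ext hc⟩
  obtain ⟨s, hs⟩ := dK.exists_rightInverse_of_surjective (LinearMap.range_eq_top.2 hs)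
  obtain ⟨h, hh⟩ := LinearMap.exists_extend (K.subtype ∘ₗ s)
  refine ⟨h, fun b hb hb' => ?_⟩
  have e : h b = (s ⟨b, hb, hb'⟩ : B) := LinearMap.congr_fun hh ⟨b, hb, hb'⟩
  have e' := congrArg (fun z : Z => (z : B)) (LinearMap.congr_fun hs ⟨b, hb, hb'⟩)
  rw [e]
  exact ⟨e', (s _).2⟩

/-- The elements of `B[t, dt]` whose image in `C[t, dt]` is constant. -/
noncomputable def relPath {B C : DGAlg k} (p : Hom B C) : DGAlg k :=
  sub (path B)
    { carrier := {M | (∃ c, coeffMap p.toAlgHom.toLinearMap (pathFst B M) = Polynomial.C c) ∧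
        coeffMap p.toAlgHom.toLinearMap (pathSnd B M) = 0}
      mul_mem' := by
        have hm : ∀ q r : B[X], coeffMap p.toAlgHom.toLinearMap (q * r) =
            coeffMap p.toAlgHom.toLinearMap q * coeffMap p.toAlgHom.toLinearMap r := fun q r => by
          have h := coeffMap_mul (Finset.univ : Finset Unit) p.toAlgHom.toLinearMap
            (fun _ => p.toAlgHom.toLinearMap) (fun _ => p.toAlgHom.toLinearMap)
            (fun a b => by simp) q r
          simpa using h
        rintro M N ⟨⟨c, hc⟩, hM⟩ ⟨⟨c', hc'⟩, hN⟩
        refine ⟨⟨c * c', ?_⟩, ?_⟩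
        · rw [map_mul, hm, hc, hc', Polynomial.C_mul]
        · rw [pathSnd_mul, map_add, hm, hm, hM, hN, mul_zero, zero_mul, add_zero]
      add_mem' := by
        rintro M N ⟨⟨c, hc⟩, hM⟩ ⟨⟨c', hc'⟩, hN⟩
        exact ⟨⟨c + c', by rw [map_add, map_add, hc, hc', Polynomial.C_add]⟩,
          by rw [map_add, map_add, hM, hN, add_zero]⟩
      algebraMap_mem' := fun a => by
        have h : algebraMap k (path B) a = a • 1 := Algebra.algebraMap_eq_smul_one a
        refine ⟨⟨a • 1, ?_⟩, ?_⟩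
        · rw [h, map_smul, map_smul, map_one, ← Polynomial.C_1, coeffMap_C, ← Polynomial.smul_C]
          simp
        · rw [h, map_smul, map_smul, pathSnd_one, map_zero, smul_zero] }
    (by
      rintro M ⟨⟨c, hc⟩, hM⟩
      have hd : ∀ q : B[X], coeffMap p.toAlgHom.toLinearMap (coeffMap B.d q) =
          coeffMap C.d (coeffMap p.toAlgHom.toLinearMap q) := fun q => by
        ext n; simpa using p.map_d _
      have hs : ∀ q : B[X], coeffMap p.toAlgHom.toLinearMap (coeffMap B.sgn q) =
          coeffMap C.sgn (coeffMap p.toAlgHom.toLinearMap q) := fun q => by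
        ext n; simpa using p.map_sgn _
      refine ⟨⟨C.d c, ?_⟩, ?_⟩
      · rw [pathFst_d, hd, hc, coeffMap_C]
      · rw [pathSnd_d, map_add, hd, hM, hs, coeffMap_derivative, hc]
        simp)
    (by
      rintro i M ⟨⟨c, hc⟩, hM⟩
      have hpr : ∀ j (q : B[X]), coeffMap p.toAlgHom.toLinearMap (coeffMap (B.proj j) q) =
          coeffMap (C.proj j) (coeffMap p.toAlgHom.toLinearMap q) := fun j q => by
        ext n; simpa using p.map_proj j _
      have key : ∀ M : path B, (path B).proj i M =
          pathMk B (coeffMap (B.proj i) (pathFst B M), coeffMap (B.proj (i + 1)) (pathSnd B M)) := by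
        intro M
        induction M using (path B).induction_hom with
        | h0 => exact path_ext (by simp) (by simp)
        | hadd M N h h' =>
          rw [map_add, h, h', ← map_add]
          exact congrArg _ (Prod.ext (by simp) (by simp))
        | hhom j M hM =>
          by_cases h : j = i
          · subst h
            rw [proj_of_mem _ hM]
            refine path_ext ?_ ?_
            · ext n; exact ((coeff_coeffMap _ _ _).trans (B.proj_of_mem (hM.1 n))).symm
            · ext n; exact ((coeff_coeffMap _ _ _).trans (B.proj_of_mem (hM.2 n))).symm
          · rw [proj_of_mem_ne _ hM h]
            refine path_ext ?_ ?_
            · ext n; exact ((coeff_coeffMap _ _ _).trans (B.proj_of_mem_ne (hM.1 n) h)).symm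
            · ext n
              exact ((coeff_coeffMap _ _ _).trans (B.proj_of_mem_ne (hM.2 n) (by omega))).symm
      refine ⟨⟨C.proj i c, ?_⟩, ?_⟩
      · rw [key, pathFst_mk, hpr, hc, coeffMap_C]
      · rw [key, pathSnd_mk, hpr, hM, map_zero])

/-- The fibre product `B ×_C B`. -/
noncomputable def fibreSquare {B C : DGAlg k} (p : Hom B C) : DGAlg k :=
  sub (prod B B)
    (AlgHom.equalizer (p.comp (prodFst B B)).toAlgHom (p.comp (prodSnd B B)).toAlgHom)
    (by
      rintro ⟨a, b⟩ h
      have h' : p a = p b := h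
      change p (B.d a) = p (B.d b)
      rw [p.map_d, p.map_d, h'])
    (by
      rintro i ⟨a, b⟩ h
      have h' : p a = p b := h
      have h1 : ((prod B B).proj i (a, b)).1 = B.proj i a := (prodFst B B).map_proj i (a, b)
      have h2 : ((prod B B).proj i (a, b)).2 = B.proj i b := (prodSnd B B).map_proj i (a, b)
      change p ((prod B B).proj i (a, b)).1 = p ((prod B B).proj i (a, b)).2
      rw [h1, h2, p.map_proj, p.map_proj, h'])

/-- The endpoints of a relative path. -/
noncomputable def endpoints {B C : DGAlg k} (p : Hom B C) : Hom (relPath p) (fibreSquare p) where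
  toAlgHom := (((pathEval B 0).toAlgHom.prod (pathEval B 1).toAlgHom).comp
    (Subalgebra.val _)).codRestrict _ (by
      rintro ⟨M, ⟨c, hc⟩, hM⟩
      change p (evalAt B 0 (pathFst B M)) = p (evalAt B 1 (pathFst B M))
      have h := fun a : k => evalAt_coeffMap p.toAlgHom.toLinearMap a (pathFst B M)
      have h0 := h 0
      have h1 := h 1
      rw [hc, ← Polynomial.monomial_zero_left, evalAt_monomial] at h0 h1
      rw [pow_zero] at h0 h1
      exact h0.symm.trans h1)
  map_mem i M hM := ⟨(pathEval B 0).map_mem i _ hM, (pathEval B 1).map_mem i _ hM⟩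
  map_d M := Subtype.ext (Prod.ext ((pathEval B 0).map_d _) ((pathEval B 1).map_d _))

theorem endpoints_surjective {B C : DGAlg k} (p : Hom B C) :
    Function.Surjective (endpoints p) := by
  rintro ⟨⟨a, b⟩, h⟩
  have h' : p a = p b := h
  refine ⟨⟨pathMk B (Polynomial.C a + monomial 1 (b - a), 0), ⟨p a, ?_⟩, ?_⟩, ?_⟩
  · rw [pathFst_mk, map_add, coeffMap_C, coeffMap_monomial]
    have : p.toAlgHom.toLinearMap (b - a) = 0 := by
      rw [map_sub]; exact sub_eq_zero.2 h'.symm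
    rw [this, map_zero, add_zero]
    rfl
  · rw [pathSnd_mk, map_zero]
  · refine Subtype.ext (Prod.ext ?_ ?_)
    · change evalAt B 0 (Polynomial.C a + monomial 1 (b - a)) = a
      rw [map_add, ← Polynomial.monomial_zero_left, evalAt_monomial, evalAt_monomial]
      simp
    · change evalAt B 1 (Polynomial.C a + monomial 1 (b - a)) = b
      rw [map_add, ← Polynomial.monomial_zero_left, evalAt_monomial, evalAt_monomial]
      simp

/-- The relative path object factors the diagonal `B → B ×_C B`: a cycle `p + q dt` with zero
endpoints is the boundary obtained by contracting the coefficients. -/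
theorem endpoints_quasiIso {B C : DGAlg k} (p : Hom B C) (hp : Function.Surjective p)
    (hq : p.QuasiIso) : (endpoints p).QuasiIso := by
  obtain ⟨h, hh⟩ := exists_contraction p hp hq
  refine quasiIso_of_acyclic_ker _ (endpoints_surjective p) ?_
  rintro ⟨M, ⟨c, hc⟩, hM⟩ hd he
  have hd' : (path B).d M = 0 := congrArg Subtype.val hd
  have he0 : evalAt B (0 : k) (pathFst B M) = 0 :=
    congrArg (fun x : fibreSquare p => x.1.1) he
  have he1 : evalAt B (1 : k) (pathFst B M) = 0 :=
    congrArg (fun x : fibreSquare p => x.1.2) he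
  have hd1 : coeffMap B.d (pathFst B M) = 0 := by rw [← pathFst_d, hd']; rfl
  have hd2 : coeffMap B.sgn (derivative (pathFst B M)) + coeffMap B.d (pathSnd B M) = 0 := by
    rw [← pathSnd_d, hd']; rfl
  -- the coefficients of `M` lie in the kernel of `p`
  have hc0 : c = 0 := by
    have h0 := evalAt_coeffMap p.toAlgHom.toLinearMap (0 : k) (pathFst B M)
    rw [hc, ← Polynomial.monomial_zero_left, evalAt_monomial, pow_zero, one_smul, he0,
      map_zero] at h0
    exact h0
  have hco : ∀ q : B[X], coeffMap B.d q = 0 → coeffMap p.toAlgHom.toLinearMap q = 0 →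
      coeffMap B.d (coeffMap h q) = q ∧ coeffMap p.toAlgHom.toLinearMap (coeffMap h q) = 0 := by
    intro q h1 h2
    have key : ∀ n, B.d (h (q.coeff n)) = q.coeff n ∧ p (h (q.coeff n)) = 0 := fun n =>
      hh _ (by rw [← coeff_coeffMap, h1, coeff_zero])
        (by
          have := congrArg (fun r => r.coeff n) h2
          simpa using this)
    exact ⟨by ext n; simpa using (key n).1, by ext n; simpa using (key n).2⟩
  obtain ⟨hr1, hr2⟩ := hco (pathFst B M) hd1 (by rw [hc, hc0, Polynomial.C_0])
  set r := coeffMap h (pathFst B M) with hr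
  have hs : ∀ q : B[X], coeffMap p.toAlgHom.toLinearMap (coeffMap B.sgn q) =
      coeffMap C.sgn (coeffMap p.toAlgHom.toLinearMap q) := fun q => by
    ext n; simpa using p.map_sgn _
  obtain ⟨hs1, hs2⟩ := hco (pathSnd B M - coeffMap B.sgn (derivative r))
    (by
      rw [map_sub, coeffMap_d_sgn, coeffMap_derivative, hr1, sub_neg_eq_add, add_comm]
      exact hd2)
    (by rw [map_sub, hM, hs, coeffMap_derivative, hr2]; simp)
  refine ⟨⟨pathMk B (r, coeffMap h (pathSnd B M - coeffMap B.sgn (derivative r))),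
    ⟨0, by rw [pathFst_mk, hr2, Polynomial.C_0]⟩, hs2⟩, Subtype.ext (path_ext ?_ ?_), ?_⟩
  · exact hr1
  · change coeffMap B.sgn (derivative r) + coeffMap B.d (coeffMap h _) = _
    rw [hs1]; abel
  · refine Subtype.ext (Prod.ext ?_ ?_)
    · change evalAt B 0 r = 0
      rw [hr, evalAt_coeffMap, he0, map_zero]
    · change evalAt B 1 r = 0
      rw [hr, evalAt_coeffMap, he1, map_zero]

/-- Two morphisms from a cofibrant DG algebra that agree after composition with a surjective
quasi-isomorphism are homotopic. -/
theorem exists_homotopy {Q B C : DGAlg k} (hQ : Q.IsCofibrant) (p : Hom B C)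
    (hp : Function.Surjective p) (hq : p.QuasiIso) (f g : Hom Q B)
    (hfg : ∀ a, p (f a) = p (g a)) :
    ∃ H : Hom Q (path B), (∀ a, pathEval B 0 (H a) = f a) ∧ ∀ a, pathEval B 1 (H a) = g a := by
  let F : Hom Q (fibreSquare p) :=
    { toAlgHom := (f.toAlgHom.prod g.toAlgHom).codRestrict _ hfg
      map_mem := fun i a ha => ⟨f.map_mem i a ha, g.map_mem i a ha⟩
      map_d := fun a => Subtype.ext (Prod.ext (f.map_d a) (g.map_d a)) }
  obtain ⟨G, hG⟩ := hQ _ _ (endpoints p) (endpoints_surjective p) (endpoints_quasiIso p hp hq) F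
  let ι : Hom (relPath p) (path B) :=
    { toAlgHom := Subalgebra.val _
      map_mem := fun i a ha => ha
      map_d := fun a => rfl }
  exact ⟨ι.comp G, fun a => congrArg (fun x : fibreSquare p => x.1.1) (hG a),
    fun a => congrArg (fun x : fibreSquare p => x.1.2) (hG a)⟩

end Lifting

end DGAlg

namespace DGAlg

/-! ### Functoriality and homotopy invariance of representation functors -/

open Polynomial

section Functor

variable {k : Type u} [Field k]

/-- The identity morphism. -/
def Hom.id (A : DGAlg k) : Hom A A where
  toAlgHom := AlgHom.id k A
  map_mem _ _ h := h
  map_d _ := rfl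

/-- The morphism `corep S A → corep S B` induced by a morphism `A → B`. -/
noncomputable def corepMap (S : Pattern k) {A B : DGAlg k} (f : Hom A B) :
    Hom (corep S A) (corep S B) :=
  corepLift (corep_isGradedComm S B)
    { f := fun s => coord S B s ∘ₗ f.toAlgHom.toLinearMap
      map_mem := fun s i a ha => coord_mem s i _ (f.map_mem i a ha)
      map_mul := fun s a b => by
        have h := coord_mul (S := S) s (f a) (f b)
        rw [← map_mul] at h
        exact h
      map_one := fun s => by
        have h := coord_one (S := S) (A := B) s
        rw [← map_one f.toAlgHom] at h
        exact h
      map_d := fun s a => by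
        have h := coord_d (S := S) s (f a)
        rw [← f.map_d] at h
        exact h }

theorem corepMap_coord (S : Pattern k) {A B : DGAlg k} (f : Hom A B) (s : S.ι) (a : A) :
    corepMap S f (coord S A s a) = coord S B s (f a) :=
  corepLift_coord _ _ s a

theorem coord_sgn {S : Pattern k} {A : DGAlg k} (s : S.ι) (a : A) :
    coord S A s (A.sgn a) = (corep S A).sgn (coord S A s a) := by
  induction a using A.induction_hom with
  | h0 => simp
  | hadd a b h h' => simp only [map_add, h, h']
  | hhom i a ha =>
    rw [A.sgn_of_mem ha, (corep S A).sgn_of_mem (coord_mem s i a ha), Units.smul_def, map_zsmul,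
      Units.smul_def]

theorem polyGr_comm {B : DGAlg k} (hB : B.IsGradedComm) {i j : ℤ} {p q : B[X]}
    (hp : ∀ n, p.coeff n ∈ B.gr i) (hq : ∀ n, q.coeff n ∈ B.gr j) :
    p * q = (i * j).negOnePow • (q * p) := by
  ext n
  rw [Units.smul_def, coeff_smul, coeff_mul, coeff_mul, ← Finset.Nat.sum_antidiagonal_swap,
    Finset.smul_sum]
  exact Finset.sum_congr rfl fun x _ => hB i j _ _ (hp _) (hq _)

theorem path_isGradedComm {B : DGAlg k} (hB : B.IsGradedComm) : (path B).IsGradedComm := by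
  intro i j M N hM hN
  obtain ⟨hM1, hM2⟩ := mem_path_gr.1 hM
  obtain ⟨hN1, hN2⟩ := mem_path_gr.1 hN
  refine path_ext ?_ ?_
  · rw [Units.smul_def, map_zsmul, map_mul, map_mul, polyGr_comm hB hM1 hN1, Units.smul_def]
  · rw [Units.smul_def, map_zsmul, pathSnd_mul, pathSnd_mul, coeffMap_sgn_of_mem hM1,
      coeffMap_sgn_of_mem hN1, polyGr_comm hB hM1 hN2, mul_smul_comm, mul_smul_comm,
      polyGr_comm hB hM2 hN1, ← Units.smul_def, smul_add, smul_smul, smul_smul, add_comm]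
    congr 2
    · rw [← Int.negOnePow_add, show j + (i + 1) * j = i * j + 2 * j by ring, Int.negOnePow_add,
        Int.negOnePow_two_mul, mul_one]
    · rw [← Int.negOnePow_add, mul_add, mul_one]

/-- A homotopy `A → B[t, dt]` induces a homotopy `corep S A → (corep S B)[t, dt]`. -/
noncomputable def corepHomotopy (S : Pattern k) {A B : DGAlg k} (H : Hom A (path B)) :
    Hom (corep S A) (path (corep S B)) :=
  corepLift (path_isGradedComm (corep_isGradedComm S B))
    { f := fun s => pathMk (corep S B) ∘ₗ
        ((coeffMap (coord S B s) ∘ₗ (pathFst B).toLinearMap).prod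
          (coeffMap (coord S B s) ∘ₗ pathSnd B)) ∘ₗ H.toAlgHom.toLinearMap
      map_mem := fun s i a ha => by
        obtain ⟨h1, h2⟩ := mem_path_gr.1 (H.map_mem i a ha)
        refine mem_path_gr.2 ⟨fun n => ?_, fun n => ?_⟩
        · change (coeffMap (coord S B s) (pathFst B (H a))).coeff n ∈ _
          rw [coeff_coeffMap]
          exact coord_mem s i _ (h1 n)
        · change (coeffMap (coord S B s) (pathSnd B (H a))).coeff n ∈ _
          rw [coeff_coeffMap]
          exact coord_mem s _ _ (h2 n)
      map_mul := fun s a b => by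
        have hc : ∀ p q : B[X], coeffMap (coord S B s) (p * q) =
            ∑ i, coeffMap (coord S B (S.l s i)) p * coeffMap (coord S B (S.r s i)) q :=
          coeffMap_mul Finset.univ (coord S B s) (fun i => coord S B (S.l s i))
            (fun i => coord S B (S.r s i)) (coord_mul s)
        have hs : ∀ s (p : B[X]), coeffMap (coord S B s) (coeffMap B.sgn p) =
            coeffMap (corep S B).sgn (coeffMap (coord S B s) p) := fun s p => by
          ext n; simp [coord_sgn]
        refine path_ext ?_ ?_
        · rw [map_sum]
          simp only [map_mul]
          change coeffMap (coord S B s) (pathFst B (H (a * b))) = ∑ i,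
            coeffMap (coord S B (S.l s i)) (pathFst B (H a)) *
            coeffMap (coord S B (S.r s i)) (pathFst B (H b))
          rw [map_mul, map_mul, hc]
        · rw [map_sum]
          simp only [pathSnd_mul]
          change coeffMap (coord S B s) (pathSnd B (H (a * b))) = ∑ i,
            (coeffMap (coord S B (S.l s i)) (pathFst B (H a)) *
              coeffMap (coord S B (S.r s i)) (pathSnd B (H b)) +
            coeffMap (coord S B (S.l s i)) (pathSnd B (H a)) *
              coeffMap (corep S B).sgn (coeffMap (coord S B (S.r s i)) (pathFst B (H b))))
          rw [map_mul, pathSnd_mul, map_add, hc, hc, Finset.sum_add_distrib]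
          simp only [hs]
      map_one := fun s => by
        refine path_ext ?_ ?_
        · change coeffMap (coord S B s) (pathFst B (H 1)) = _
          rw [map_one, map_one, AlgHom.commutes, ← C_1, coeffMap_C, coord_one]
          rfl
        · change coeffMap (coord S B s) (pathSnd B (H 1)) = _
          rw [map_one, pathSnd_one, map_zero, Algebra.algebraMap_eq_smul_one, map_smul,
            pathSnd_one, smul_zero]
      map_d := fun s a => by
        have hd : ∀ p : B[X], coeffMap (coord S B s) (coeffMap B.d p) =
            coeffMap (corep S B).d (coeffMap (coord S B s) p) := fun p => by
          ext n; simp [coord_d]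
        have hs : ∀ p : B[X], coeffMap (coord S B s) (coeffMap B.sgn p) =
            coeffMap (corep S B).sgn (coeffMap (coord S B s) p) := fun p => by
          ext n; simp [coord_sgn]
        refine path_ext ?_ ?_
        · change coeffMap (coord S B s) (pathFst B (H (A.d a))) =
            coeffMap (corep S B).d (coeffMap (coord S B s) (pathFst B (H a)))
          rw [H.map_d, pathFst_d, hd]
        · change coeffMap (coord S B s) (pathSnd B (H (A.d a))) =
            coeffMap (corep S B).sgn (derivative (coeffMap (coord S B s) (pathFst B (H a)))) +
            coeffMap (corep S B).d (coeffMap (coord S B s) (pathSnd B (H a)))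
          rw [H.map_d, pathSnd_d, map_add, hd, hs, coeffMap_derivative] }

theorem corepHomotopy_coord (S : Pattern k) {A B : DGAlg k} (H : Hom A (path B)) (s : S.ι)
    (a : A) : corepHomotopy S H (coord S A s a) = pathMk (corep S B)
      (coeffMap (coord S B s) (pathFst B (H a)), coeffMap (coord S B s) (pathSnd B (H a))) :=
  corepLift_coord _ _ s a

/-- The morphism `A[t, dt] → B[t, dt]` induced by a morphism `A → B`. -/
noncomputable def pathMap {A B : DGAlg k} (f : Hom A B) : Hom (path A) (path B) where
  toAlgHom := AlgHom.ofLinearMap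
    (pathMk B ∘ₗ ((coeffMap f.toAlgHom.toLinearMap ∘ₗ (pathFst A).toLinearMap).prod
      (coeffMap f.toAlgHom.toLinearMap ∘ₗ pathSnd A)))
    (path_ext
      (by
        change coeffMap f.toAlgHom.toLinearMap (pathFst A 1) = _
        rw [map_one (pathFst A), map_one (pathFst B), ← C_1, coeffMap_C]
        simp)
      (by
        change coeffMap f.toAlgHom.toLinearMap (pathSnd A 1) = _
        rw [pathSnd_one, pathSnd_one, map_zero]))
    (fun M N => by
      have hm : ∀ q r : A[X], coeffMap f.toAlgHom.toLinearMap (q * r) =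
          coeffMap f.toAlgHom.toLinearMap q * coeffMap f.toAlgHom.toLinearMap r := fun q r => by
        have h := coeffMap_mul (Finset.univ : Finset Unit) f.toAlgHom.toLinearMap
          (fun _ => f.toAlgHom.toLinearMap) (fun _ => f.toAlgHom.toLinearMap)
          (fun a b => by simp) q r
        simpa using h
      have hs : ∀ q : A[X], coeffMap f.toAlgHom.toLinearMap (coeffMap A.sgn q) =
          coeffMap B.sgn (coeffMap f.toAlgHom.toLinearMap q) := fun q => by
        ext n; simpa using f.map_sgn _
      refine path_ext ?_ ?_
      · rw [map_mul (pathFst B)]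
        change coeffMap f.toAlgHom.toLinearMap (pathFst A (M * N)) =
          coeffMap f.toAlgHom.toLinearMap (pathFst A M) *
            coeffMap f.toAlgHom.toLinearMap (pathFst A N)
        rw [map_mul, hm]
      · rw [pathSnd_mul]
        change coeffMap f.toAlgHom.toLinearMap (pathSnd A (M * N)) =
          coeffMap f.toAlgHom.toLinearMap (pathFst A M) *
            coeffMap f.toAlgHom.toLinearMap (pathSnd A N) +
          coeffMap f.toAlgHom.toLinearMap (pathSnd A M) *
            coeffMap B.sgn (coeffMap f.toAlgHom.toLinearMap (pathFst A N))
        rw [pathSnd_mul, map_add, hm, hm, hs])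
  map_mem i M hM := by
    obtain ⟨h1, h2⟩ := mem_path_gr.1 hM
    refine mem_path_gr.2 ⟨fun n => ?_, fun n => ?_⟩
    · change (coeffMap f.toAlgHom.toLinearMap (pathFst A M)).coeff n ∈ _
      rw [coeff_coeffMap]
      exact f.map_mem i _ (h1 n)
    · change (coeffMap f.toAlgHom.toLinearMap (pathSnd A M)).coeff n ∈ _
      rw [coeff_coeffMap]
      exact f.map_mem _ _ (h2 n)
  map_d M := by
    have hd : ∀ q : A[X], coeffMap f.toAlgHom.toLinearMap (coeffMap A.d q) =
        coeffMap B.d (coeffMap f.toAlgHom.toLinearMap q) := fun q => by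
      ext n; simpa using f.map_d _
    have hs : ∀ q : A[X], coeffMap f.toAlgHom.toLinearMap (coeffMap A.sgn q) =
        coeffMap B.sgn (coeffMap f.toAlgHom.toLinearMap q) := fun q => by
      ext n; simpa using f.map_sgn _
    refine path_ext ?_ ?_
    · exact hd _
    · change coeffMap f.toAlgHom.toLinearMap (coeffMap A.sgn (derivative (pathFst A M)) +
        coeffMap A.d (pathSnd A M)) =
        coeffMap B.sgn (derivative (coeffMap f.toAlgHom.toLinearMap (pathFst A M))) +
        coeffMap B.d (coeffMap f.toAlgHom.toLinearMap (pathSnd A M))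
      rw [map_add, hd, hs, coeffMap_derivative]

theorem pathFst_map {A B : DGAlg k} (f : Hom A B) (M : path A) :
    pathFst B (pathMap f M) = coeffMap f.toAlgHom.toLinearMap (pathFst A M) := rfl

theorem pathSnd_map {A B : DGAlg k} (f : Hom A B) (M : path A) :
    pathSnd B (pathMap f M) = coeffMap f.toAlgHom.toLinearMap (pathSnd A M) := rfl

/-- Homotopic morphisms `A → B` induce the same map on the homology of `corep S`, and a bounding
chain can be chosen invariant under linear changes of coordinates that fix the given cycle: the
integral along the homotopy is natural. -/
theorem corepMap_homotopic [CharZero k] (S : Pattern k) [Fintype S.ι] {A B : DGAlg k}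
    (H : Hom A (path B)) (f g : Hom A B) (hf : ∀ a, pathEval B 0 (H a) = f a)
    (hg : ∀ a, pathEval B 1 (H a) = g a) (z : corep S A) (hz : (corep S A).d z = 0) :
    ∃ c, (corep S B).d c = corepMap S g z - corepMap S f z ∧
      ∀ (m : S.ι → S.ι → k) (φ : Hom (corep S A) (corep S A)) (ψ : Hom (corep S B) (corep S B)),
        (∀ s a, φ (coord S A s a) = ∑ t, m s t • coord S A t a) →
        (∀ s a, ψ (coord S B s a) = ∑ t, m s t • coord S B t a) → φ z = z → ψ c = c := by
  have h0 : ∀ x, ((pathEval (corep S B) 0).comp (corepHomotopy S H)) x = corepMap S f x := by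
    refine corep_hom_ext _ _ fun s a => ?_
    change pathEval (corep S B) 0 (corepHomotopy S H (coord S A s a)) = _
    rw [corepHomotopy_coord, pathEval_apply, pathFst_mk, evalAt_coeffMap, corepMap_coord, ← hf]
    rfl
  have h1 : ∀ x, ((pathEval (corep S B) 1).comp (corepHomotopy S H)) x = corepMap S g x := by
    refine corep_hom_ext _ _ fun s a => ?_
    change pathEval (corep S B) 1 (corepHomotopy S H (coord S A s a)) = _
    rw [corepHomotopy_coord, pathEval_apply, pathFst_mk, evalAt_coeffMap, corepMap_coord, ← hg]
    rfl
  refine ⟨polyInt (k := k) (corep S B) (coeffMap (corep S B).sgn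
    (pathSnd (corep S B) (corepHomotopy S H z))), ?_, ?_⟩
  · rw [d_polyInt_of_cycle, ← h0, ← h1]
    · rfl
    · rw [← (corepHomotopy S H).map_d, hz, map_zero]
  · intro m φ ψ hφ hψ hφz
    have hc : ∀ x, ((pathMap ψ).comp (corepHomotopy S H)) x =
        ((corepHomotopy S H).comp φ) x := by
      refine corep_hom_ext _ _ fun s a => ?_
      change pathMap ψ (corepHomotopy S H (coord S A s a)) =
        corepHomotopy S H (φ (coord S A s a))
      rw [hφ, map_sum, corepHomotopy_coord]
      simp only [map_smul, corepHomotopy_coord]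
      refine path_ext ?_ ?_
      · rw [pathFst_map, pathFst_mk, map_sum]
        simp only [map_smul, pathFst_mk]
        ext n
        simp only [coeff_coeffMap, finsetSum_coeff, coeff_smul]
        exact hψ s _
      · rw [pathSnd_map, pathSnd_mk, map_sum]
        simp only [map_smul, pathSnd_mk]
        ext n
        simp only [coeff_coeffMap, finsetSum_coeff, coeff_smul]
        exact hψ s _
    have hz' : pathMap ψ (corepHomotopy S H z) = corepHomotopy S H z :=
      (hc z).trans (congrArg _ hφz)
    have h2 := polyInt_coeffMap (k := k) ψ.toAlgHom.toLinearMap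
      (coeffMap (corep S B).sgn (pathSnd (corep S B) (corepHomotopy S H z)))
    refine h2.symm.trans (congrArg _ ?_)
    have hs : ∀ q : (corep S B)[X],
        coeffMap ψ.toAlgHom.toLinearMap (coeffMap (corep S B).sgn q) =
        coeffMap (corep S B).sgn (coeffMap ψ.toAlgHom.toLinearMap q) := fun q => by
      ext n; simpa using ψ.map_sgn _
    rw [hs, ← pathSnd_map, hz']

end Functor

end DGAlg

namespace DGAlg

/-! ### The minimal resolution of `k[x,y]` -/

section MinRes

instance : DecidableEq Gen := fun g h => by
  cases g <;> cases h <;> first | exact isTrue rfl | exact isFalse (by simp)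

variable {k : Type u} [Field k]

theorem minRes_d_gen (g : Gen) : (minRes k).d (minResGen k g) = Gen.diff k g := by
  change (FreeAlgebra.lift k (derMat (k := k) (FreeAlgebra.ι k) Gen.deg (Gen.diff k))
    (FreeAlgebra.ι k g)) 0 1 = _
  rw [FreeAlgebra.lift_ι_apply]
  rfl

theorem minRes_d_x : (minRes k).d (minResGen k .x) = 0 := minRes_d_gen .x

theorem minRes_d_y : (minRes k).d (minResGen k .y) = 0 := minRes_d_gen .y

theorem minRes_d_θ : (minRes k).d (minResGen k .θ) =
    -(minResGen k .x * minResGen k .y - minResGen k .y * minResGen k .x) := minRes_d_gen .θ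

theorem minResGen_mem (g : Gen) : minResGen k g ∈ (minRes k).gr g.deg :=
  gen_mem (k := k) (FreeAlgebra.ι k) Gen.deg g

theorem minResLift_gen (B : DGAlg k) (v : Gen → B) (hv : ∀ g, v g ∈ B.gr g.deg)
    (hx : B.d (v .x) = 0) (hy : B.d (v .y) = 0)
    (hθ : B.d (v .θ) = -(v .x * v .y - v .y * v .x)) (g : Gen) :
    minResLift B v hv hx hy hθ (minResGen k g) = v g :=
  FreeAlgebra.lift_ι_apply v g

theorem minRes_algHom_ext {B : Type*} [Semiring B] [Algebra k B] {f g : minRes k →ₐ[k] B}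
    (h : ∀ t, f (minResGen k t) = g (minResGen k t)) : f = g := by
  have h' : (f : FreeAlgebra k Gen →ₐ[k] B) = (g : FreeAlgebra k Gen →ₐ[k] B) :=
    FreeAlgebra.hom_ext (funext h)
  exact h'

/-- Lifting of a chain with prescribed boundary along a surjective quasi-isomorphism. -/
theorem exists_lift {B C : DGAlg k} (f : Hom B C) (hf : Function.Surjective f) (hq : f.QuasiIso)
    (i : ℤ) (y : B) (hy : B.d y = 0) (hyi : y ∈ B.gr (i - 1)) (c : C) (hc : c ∈ C.gr i)
    (hyc : f y = C.d c) : ∃ b ∈ B.gr i, B.d b = y ∧ f b = c := by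
  obtain ⟨b, rfl⟩ := hf c
  obtain ⟨e, he, he'⟩ := acyclic_ker_of_quasiIso f hf hq (y - B.d b)
    (by rw [map_sub, hy, B.d_d, sub_zero]) (by rw [map_sub, f.map_d, hyc, sub_self])
  refine ⟨B.proj i (b + e), B.proj_mem i _, ?_, ?_⟩
  · rw [B.d_proj, map_add, he, add_sub_cancel, B.proj_of_mem hyi]
  · rw [f.map_proj, map_add, he', add_zero, C.proj_of_mem hc]

theorem minRes_isCofibrant (k : Type u) [Field k] : (minRes k).IsCofibrant := by
  intro B C f hf hq g
  have hg : ∀ t : Gen, g (minResGen k t) ∈ C.gr t.deg := fun t => g.map_mem _ _ (minResGen_mem t)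
  obtain ⟨bx, hx1, hx2, hx3⟩ := exists_lift f hf hq 0 0 (map_zero _) (zero_mem _) _ (hg .x)
    (by rw [← g.map_d, minRes_d_x]; simp)
  obtain ⟨by', hy1, hy2, hy3⟩ := exists_lift f hf hq 0 0 (map_zero _) (zero_mem _) _ (hg .y)
    (by rw [← g.map_d, minRes_d_y]; simp)
  have hm : ∀ a b : B, a ∈ B.gr 0 → b ∈ B.gr 0 → a * b ∈ B.gr (1 - 1) := fun a b ha hb => by
    have h := SetLike.GradedMul.mul_mem (A := B.gr) ha hb
    rwa [add_zero] at h
  obtain ⟨bθ, hθ1, hθ2, hθ3⟩ := exists_lift f hf hq 1 (-(bx * by' - by' * bx))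
    (by simp [B.d_mul, hx2, hy2]) (neg_mem (sub_mem (hm _ _ hx1 hy1) (hm _ _ hy1 hx1)))
    _ (hg .θ) (by rw [← g.map_d, minRes_d_θ]; simp [hx3, hy3])
  let v : Gen → B := fun t => match t with
    | .x => bx
    | .y => by'
    | .θ => bθ
  have hv : ∀ t, v t ∈ B.gr t.deg := fun t => by
    cases t with
    | x => exact hx1
    | y => exact hy1
    | θ => exact hθ1
  refine ⟨minResLift B v hv hx2 hy2 hθ2, fun a => ?_⟩
  have h : f.toAlgHom.comp (minResLift B v hv hx2 hy2 hθ2).toAlgHom = g.toAlgHom := by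
    refine minRes_algHom_ext fun t => ?_
    change f (minResLift B v hv hx2 hy2 hθ2 (minResGen k t)) = _
    rw [minResLift_gen]
    cases t with
    | x => exact hx3
    | y => exact hy3
    | θ => exact hθ3
  exact DFunLike.congr_fun h a

/-- Weights of the generators, chosen so that the differential of the minimal resolution preserves
the total weight. -/
def Gen.wt : Gen → ℤ
  | .x => 1
  | .y => 1
  | .θ => 2

/-- The span of the words of weight at most `w`. -/
noncomputable def minResFil (k : Type u) [Field k] (w : ℤ) : Submodule k (minRes k) :=
  Submodule.span k {b | ∃ l : List Gen, (l.map Gen.wt).sum ≤ w ∧ (l.map (minResGen k)).prod = b}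

theorem minRes_word_induction {P : minRes k → Prop} (h0 : P 0)
    (hadd : ∀ a b, P a → P b → P (a + b)) (hsmul : ∀ (c : k) a, P a → P (c • a))
    (hnil : P 1) (hcons : ∀ g a, P a → P (minResGen k g * a)) (a : minRes k) : P a := by
  induction a using (minRes k).induction_hom with
  | h0 => exact h0
  | hadd a b ha hb => exact hadd a b ha hb
  | hhom i a ha =>
    have ha' : a ∈ wordGr (k := k) (FreeAlgebra.ι k) Gen.deg i := ha
    induction ha' using Submodule.span_induction with
    | zero => exact h0
    | add a b ha' hb' ha'' hb'' => exact hadd a b (ha'' ha') (hb'' hb')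
    | smul c a ha' ha'' => exact hsmul c a (ha'' ha')
    | mem a ha' =>
      obtain ⟨l, -, rfl⟩ := ha'
      clear ha
      induction l with
      | nil => exact hnil
      | cons g l ih => exact hcons g _ ih

theorem minResFil_mono {v w : ℤ} (h : v ≤ w) : minResFil k v ≤ minResFil k w :=
  Submodule.span_mono fun _ ⟨l, hl, hb⟩ => ⟨l, hl.trans h, hb⟩

theorem gen_mul_mem_fil (g : Gen) {w : ℤ} {a : minRes k} (ha : a ∈ minResFil k w) :
    minResGen k g * a ∈ minResFil k (w + g.wt) := by
  induction ha using Submodule.span_induction with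
  | zero => rw [mul_zero]; exact zero_mem _
  | add a b _ _ h h' => rw [mul_add]; exact add_mem h h'
  | smul c a _ h => rw [mul_smul_comm]; exact Submodule.smul_mem _ c h
  | mem a ha =>
    obtain ⟨l, hl, rfl⟩ := ha
    exact Submodule.subset_span ⟨g :: l, by simp only [List.map_cons, List.sum_cons]; omega,
      by simp⟩

theorem one_mem_fil {w : ℤ} (hw : 0 ≤ w) : 1 ∈ minResFil k w :=
  Submodule.subset_span ⟨[], by simpa using hw, by simp⟩

theorem minResFil_neg {w : ℤ} (hw : w < 0) : minResFil k w = ⊥ := by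
  refine le_bot_iff.1 (Submodule.span_le.2 ?_)
  rintro _ ⟨l, hl, rfl⟩
  have h : 0 ≤ (l.map Gen.wt).sum := List.sum_nonneg (by
    intro n hn
    obtain ⟨g, -, rfl⟩ := List.mem_map.1 hn
    cases g <;> simp [Gen.wt])
  omega

theorem exists_mem_fil (a : minRes k) : ∃ w, a ∈ minResFil k w := by
  induction a using minRes_word_induction with
  | h0 => exact ⟨0, zero_mem _⟩
  | hadd a b ha hb =>
    obtain ⟨v, hv⟩ := ha
    obtain ⟨w, hw⟩ := hb
    exact ⟨max v w, add_mem (minResFil_mono (le_max_left v w) hv)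
      (minResFil_mono (le_max_right v w) hw)⟩
  | hsmul c a ha => exact ha.imp fun w hw => Submodule.smul_mem _ c hw
  | hnil => exact ⟨0, one_mem_fil le_rfl⟩
  | hcons g a ha => exact ha.elim fun w hw => ⟨w + g.wt, gen_mul_mem_fil g hw⟩

/-- The algebra morphism `a ↦ [ε(a), ∂_g a; 0, a]`, with `ε` the augmentation and `∂_g` the left
Fox derivative. -/
noncomputable def foxMat (k : Type u) [Field k] (g : Gen) :
    minRes k →ₐ[k] Matrix (Fin 2) (Fin 2) (minRes k) :=
  FreeAlgebra.lift k fun h => !![0, Pi.single (M := fun _ => minRes k) g 1 h; 0, minResGen k h]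

/-- The Fox derivative `∂_g`: every element is `a = ε(a) + ∑_g g ∂_g a`. -/
noncomputable def fox (g : Gen) (a : minRes k) : minRes k := foxMat k g a 0 1

theorem foxMat_gen (g h : Gen) : foxMat k g (minResGen k h) =
    !![0, Pi.single (M := fun _ => minRes k) g 1 h; 0, minResGen k h] :=
  FreeAlgebra.lift_ι_apply _ h

theorem foxMat_one_one (g : Gen) (a : minRes k) : foxMat k g a 1 1 = a := by
  induction a using minRes_word_induction with
  | h0 => simp
  | hadd a b ha hb => simp [ha, hb]
  | hsmul c a ha => simp [ha]
  | hnil => simp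
  | hcons h a ha => rw [map_mul, foxMat_gen]; simp [Matrix.mul_apply, ha]

theorem fox_add (g : Gen) (a b : minRes k) : fox g (a + b) = fox g a + fox g b := by
  simp [fox]

theorem fox_smul (g : Gen) (c : k) (a : minRes k) : fox g (c • a) = c • fox g a := by
  simp [fox]

theorem fox_one (g : Gen) : fox g (1 : minRes k) = 0 := by simp [fox]

theorem fox_zero (g : Gen) : fox g (0 : minRes k) = 0 := by simp [fox]

theorem fox_gen_mul (g h : Gen) (a : minRes k) :
    fox g (minResGen k h * a) = Pi.single (M := fun _ => minRes k) g 1 h * a := by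
  rw [fox, map_mul, foxMat_gen]
  simp [Matrix.mul_apply, foxMat_one_one]

theorem fox_mem_fil (g : Gen) {w : ℤ} {a : minRes k} (ha : a ∈ minResFil k w) :
    fox g a ∈ minResFil k (w - g.wt) := by
  induction ha using Submodule.span_induction with
  | zero => rw [fox_zero]; exact zero_mem _
  | add a b _ _ h h' => rw [fox_add]; exact add_mem h h'
  | smul c a _ h => rw [fox_smul]; exact Submodule.smul_mem _ c h
  | mem a ha =>
    obtain ⟨l, hl, rfl⟩ := ha
    cases l with
    | nil => simp only [List.map_nil, List.prod_nil, fox_one]; exact zero_mem _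
    | cons h l =>
      simp only [List.map_cons, List.prod_cons, fox_gen_mul, List.sum_cons] at hl ⊢
      by_cases hg : h = g
      · subst hg
        rw [Pi.single_eq_same, one_mul]
        exact Submodule.subset_span ⟨l, by omega, rfl⟩
      · rw [Pi.single_eq_of_ne hg, zero_mul]; exact zero_mem _

theorem fox_decomposition (a : minRes k) : ∃ c : k, a = algebraMap k _ c +
    minResGen k .x * fox .x a + minResGen k .y * fox .y a + minResGen k .θ * fox .θ a := by
  induction a using minRes_word_induction with
  | h0 => exact ⟨0, by simp [fox_zero]⟩
  | hadd a b ha hb =>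
    obtain ⟨c, hc⟩ := ha
    obtain ⟨e, he⟩ := hb
    refine ⟨c + e, ?_⟩
    conv_lhs => rw [hc, he]
    simp only [fox_add, map_add]
    noncomm_ring
  | hsmul c a ha =>
    obtain ⟨e, he⟩ := ha
    refine ⟨c * e, ?_⟩
    conv_lhs => rw [he]
    simp only [fox_smul, smul_add, mul_smul_comm, Algebra.algebraMap_eq_smul_one, mul_smul]
  | hnil => exact ⟨1, by simp [fox_one]⟩
  | hcons g a ha =>
    refine ⟨0, ?_⟩
    simp only [fox_gen_mul]
    cases g <;> simp

open MvPolynomial in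
theorem minResProj_x : minResProj k (minResGen k .x) = (X 0 : MvPolynomial (Fin 2) k) :=
  minResLift_gen _ _ _ _ _ _ _

open MvPolynomial in
theorem minResProj_y : minResProj k (minResGen k .y) = (X 1 : MvPolynomial (Fin 2) k) :=
  minResLift_gen _ _ _ _ _ _ _

theorem minResProj_θ : minResProj k (minResGen k .θ) = (0 : MvPolynomial (Fin 2) k) :=
  minResLift_gen _ _ _ _ _ _ _

/-- The resolution map as an algebra morphism to the polynomial ring. -/
noncomputable def minResProjAlg (k : Type u) [Field k] : minRes k →ₐ[k] MvPolynomial (Fin 2) k :=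
  (minResProj k).toAlgHom

open MvPolynomial

theorem totalDegree_minResProj {n : ℕ} {a : minRes k} (ha : a ∈ minResFil k n) :
    (minResProjAlg k a).totalDegree ≤ n := by
  rw [← mem_restrictTotalDegree]
  have h : minResFil k n ≤
      (restrictTotalDegree (Fin 2) k n).comap (minResProjAlg k).toLinearMap := by
    refine Submodule.span_le.2 ?_
    rintro _ ⟨l, hl, rfl⟩
    change minResProjAlg k _ ∈ restrictTotalDegree (Fin 2) k n
    rw [mem_restrictTotalDegree]
    have key : ∀ l : List Gen,
        ((minResProjAlg k (l.map (minResGen k)).prod).totalDegree : ℤ) ≤ (l.map Gen.wt).sum := by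
      intro l
      induction l with
      | nil => simp
      | cons g l ih =>
        simp only [List.map_cons, List.prod_cons, List.sum_cons, map_mul]
        have h1 : ((minResProjAlg k (minResGen k g)).totalDegree : ℤ) ≤ g.wt := by
          cases g with
          | x => exact (congrArg (fun p => (totalDegree p : ℤ)) minResProj_x).trans_le (by simp [Gen.wt])
          | y => exact (congrArg (fun p => (totalDegree p : ℤ)) minResProj_y).trans_le (by simp [Gen.wt])
          | θ => exact (congrArg (fun p => (totalDegree p : ℤ)) minResProj_θ).trans_le (by simp [Gen.wt])
        have h2 := totalDegree_mul (minResProjAlg k (minResGen k g))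
          (minResProjAlg k (l.map (minResGen k)).prod)
        omega
    have := key l
    omega
  exact h ha

theorem monomial_mem_fil (a b : ℕ) :
    minResGen k .x ^ a * minResGen k .y ^ b ∈ minResFil k ((a + b : ℕ) : ℤ) := by
  induction a with
  | zero =>
    rw [pow_zero, one_mul]
    induction b with
    | zero => simpa using one_mem_fil (k := k) le_rfl
    | succ b ih =>
      rw [pow_succ']
      have h := gen_mul_mem_fil .y ih
      exact minResFil_mono (by simp [Gen.wt]) h
  | succ a ih =>
    rw [pow_succ', mul_assoc]
    have h := gen_mul_mem_fil .x ih
    exact minResFil_mono (by simp [Gen.wt, add_right_comm]) h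

/-- Normally ordered words give a linear section of `k⟨x, y, θ⟩ → k[x, y]` by cycles. -/
theorem exists_polynomial_lift (p : MvPolynomial (Fin 2) k) :
    ∃ a ∈ minResFil k p.totalDegree, (minRes k).d a = 0 ∧ minResProjAlg k a = p := by
  refine ⟨∑ m ∈ p.support, p.coeff m • (minResGen k .x ^ m 0 * minResGen k .y ^ m 1), ?_, ?_, ?_⟩
  · refine sum_mem fun m hm => Submodule.smul_mem _ _ (minResFil_mono ?_ (monomial_mem_fil _ _))
    have h := le_totalDegree hm
    rw [Finsupp.sum_fintype _ _ (by simp), Fin.sum_univ_two] at h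
    exact_mod_cast h
  · rw [map_sum]
    refine Finset.sum_eq_zero fun m _ => ?_
    rw [map_smul]
    have hx : minResGen k .x ∈ (minRes k).cycles := minRes_d_x
    have hy : minResGen k .y ∈ (minRes k).cycles := minRes_d_y
    have h : (minRes k).d (minResGen k .x ^ m 0 * minResGen k .y ^ m 1) = 0 :=
      mul_mem (pow_mem hx _) (pow_mem hy _)
    rw [h, smul_zero]
  · have hx : minResProjAlg k (minResGen k .x) = X 0 := minResProj_x
    have hy : minResProjAlg k (minResGen k .y) = X 1 := minResProj_y
    simp only [map_sum, map_smul, map_mul, map_pow, hx, hy]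
    conv_rhs => rw [p.as_sum]
    refine Finset.sum_congr rfl fun m _ => ?_
    rw [monomial_eq, Finsupp.prod_fintype _ _ (by simp), Fin.prod_univ_two, smul_eq_C_mul]

theorem minResProjAlg_d (a : minRes k) : minResProjAlg k ((minRes k).d a) = 0 :=
  (minResProj k).map_d a

theorem minRes_sgn_of_deg_zero {g : Gen} (hg : g.deg = 0) :
    (minRes k).sgn (minResGen k g) = minResGen k g := by
  rw [(minRes k).sgn_of_mem (minResGen_mem g), hg]
  simp

theorem minRes_sgn_θ : (minRes k).sgn (minResGen k .θ) = -minResGen k .θ := by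
  rw [(minRes k).sgn_of_mem (minResGen_mem .θ)]
  simp [Gen.deg]

/-- A syzygy of the regular sequence `x, y`. -/
theorem exists_of_X_mul_add {p q : MvPolynomial (Fin 2) k} (h : X 0 * p + X 1 * q = 0) :
    ∃ r, p = X 1 * r ∧ q = -(X 0 * r) := by
  have h1 : (X 0 : MvPolynomial (Fin 2) k) ∣ X 1 * q :=
    ⟨-p, by rw [mul_neg]; exact eq_neg_of_add_eq_zero_right h⟩
  rcases X_dvd_mul_iff.1 h1 with h2 | ⟨r, rfl⟩
  · exact absurd (X_dvd_X.1 h2) (by decide)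
  · refine ⟨-r, ?_, by ring⟩
    have h3 : (X 0 : MvPolynomial (Fin 2) k) * (p + X 1 * r) = 0 := by rw [← h]; ring
    have h4 := (mul_eq_zero.1 h3).resolve_left (X_ne_zero 0)
    rw [eq_neg_of_add_eq_zero_left h4]
    ring

/-- Cycles of the minimal resolution that vanish in `k[x,y]` are boundaries. The induction on the
weight writes a cycle as `z = xa + yb + θc`: then `c` is a cycle of smaller weight, hence a
boundary, and modulo a boundary `z` becomes `xa' + yb'` with `a'`, `b'` cycles. -/
theorem minRes_exact (n : ℕ) : ∀ w : ℤ, w < n → ∀ z ∈ minResFil k w, (minRes k).d z = 0 →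
    minResProjAlg k z = 0 → ∃ c ∈ minResFil k w, (minRes k).d c = z := by
  have hπx : minResProjAlg k (minResGen k .x) = X 0 := minResProj_x
  have hπy : minResProjAlg k (minResGen k .y) = X 1 := minResProj_y
  have hπθ : minResProjAlg k (minResGen k .θ) = 0 := minResProj_θ
  have hdx : ∀ a : minRes k, (minRes k).d (minResGen k .x * a) =
      minResGen k .x * (minRes k).d a := fun a => by
    rw [d_mul, minRes_d_x, minRes_sgn_of_deg_zero rfl, zero_mul, zero_add]
  have hdy : ∀ a : minRes k, (minRes k).d (minResGen k .y * a) =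
      minResGen k .y * (minRes k).d a := fun a => by
    rw [d_mul, minRes_d_y, minRes_sgn_of_deg_zero rfl, zero_mul, zero_add]
  have hdθ : ∀ a : minRes k, (minRes k).d (minResGen k .θ * a) =
      minResGen k .y * (minResGen k .x * a) - minResGen k .x * (minResGen k .y * a) -
        minResGen k .θ * (minRes k).d a := fun a => by
    rw [d_mul, minRes_d_θ, minRes_sgn_θ]; noncomm_ring
  induction n with
  | zero =>
    intro w hw z hz _ _
    rw [minResFil_neg (by simpa using hw)] at hz
    exact ⟨0, zero_mem _, by rw [map_zero, (Submodule.mem_bot k).1 hz]⟩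
  | succ n ih =>
    intro w hw z hz hdz hπz
    rcases lt_or_ge w 0 with hw0 | hw0
    · rw [minResFil_neg hw0] at hz
      exact ⟨0, zero_mem _, by rw [map_zero, (Submodule.mem_bot k).1 hz]⟩
    obtain ⟨e, he⟩ := fox_decomposition z
    have hfa : fox .x z ∈ minResFil k (w - 1) := fox_mem_fil .x hz
    have hfb : fox .y z ∈ minResFil k (w - 1) := fox_mem_fil .y hz
    have hfc : fox .θ z ∈ minResFil k (w - 2) := fox_mem_fil .θ hz
    generalize fox .x z = a at he hfa
    generalize fox .y z = b at he hfb
    generalize fox .θ z = c at he hfc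
    -- compare the components of `d z = 0`
    have hd : minResGen k .x * ((minRes k).d a - minResGen k .y * c) +
        minResGen k .y * ((minRes k).d b + minResGen k .x * c) +
        minResGen k .θ * (-(minRes k).d c) = 0 := by
      rw [← hdz, he, map_add, map_add, map_add, d_algebraMap, hdx, hdy, hdθ]
      noncomm_ring
    have hcomp : ∀ g, fox g (minResGen k .x * ((minRes k).d a - minResGen k .y * c) +
        minResGen k .y * ((minRes k).d b + minResGen k .x * c) +
        minResGen k .θ * (-(minRes k).d c)) = 0 := fun g => by rw [hd, fox_zero]
    simp only [fox_add, fox_gen_mul] at hcomp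
    have hda : (minRes k).d a = minResGen k .y * c := by
      have h := hcomp .x
      simp at h
      exact sub_eq_zero.1 h
    have hdb : (minRes k).d b = -(minResGen k .x * c) := by
      have h := hcomp .y
      simp at h
      exact eq_neg_of_add_eq_zero_left h
    have hdc : (minRes k).d c = 0 := by
      have h := hcomp .θ
      simpa [Pi.single_apply] using h
    have hπc : minResProjAlg k c = 0 := by
      have h := minResProjAlg_d a
      rw [hda, map_mul, hπy] at h
      exact (mul_eq_zero.1 h).resolve_left (X_ne_zero 1)
    have hπ : C e + X 0 * minResProjAlg k a + X 1 * minResProjAlg k b = 0 := by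
      rw [he, map_add, map_add, map_add, map_mul, map_mul, map_mul, hπx, hπy, hπθ, zero_mul,
        add_zero, AlgHom.commutes] at hπz
      exact hπz
    have he0 : e = 0 := by
      have h := congrArg (eval (0 : Fin 2 → k)) hπ
      simpa using h
    rw [he0, map_zero, zero_add] at he
    rw [he0, map_zero, zero_add] at hπ
    obtain ⟨c', hc', hdc'⟩ := ih (w - 2) (by push_cast at hw; omega) c hfc hdc hπc
    -- correct `a` and `b` to cycles
    have ha1 : minResProjAlg k (a - minResGen k .y * c') =
        minResProjAlg k a - X 1 * minResProjAlg k c' := by rw [map_sub, map_mul, hπy]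
    have hb1 : minResProjAlg k (b + minResGen k .x * c') =
        minResProjAlg k b + X 0 * minResProjAlg k c' := by rw [map_add, map_mul, hπx]
    have hyc : minResGen k .y * c' ∈ minResFil k (w - 1) :=
      minResFil_mono (by simp only [Gen.wt]; omega) (gen_mul_mem_fil .y hc')
    have hxc : minResGen k .x * c' ∈ minResFil k (w - 1) :=
      minResFil_mono (by simp only [Gen.wt]; omega) (gen_mul_mem_fil .x hc')
    obtain ⟨r, hr1, hr2⟩ := exists_of_X_mul_add
      (p := minResProjAlg k (a - minResGen k .y * c'))
      (q := minResProjAlg k (b + minResGen k .x * c')) (by rw [ha1, hb1, ← hπ]; ring)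
    have hrt : ∃ t ∈ minResFil k (w - 2), (minRes k).d t = 0 ∧ minResProjAlg k t = r := by
      by_cases hr0 : r = 0
      · exact ⟨0, zero_mem _, map_zero _, by rw [hr0, map_zero]⟩
      · obtain ⟨t, ht, ht'⟩ := exists_polynomial_lift r
        refine ⟨t, minResFil_mono ?_ ht, ht'⟩
        rcases lt_or_ge (w - 1) 0 with hw1 | hw1
        · exfalso
          have h := sub_mem hfa hyc
          rw [minResFil_neg hw1, Submodule.mem_bot] at h
          rw [h, map_zero] at hr1
          exact hr0 ((mul_eq_zero.1 hr1.symm).resolve_left (X_ne_zero 1))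
        · obtain ⟨m, hm⟩ := Int.eq_ofNat_of_zero_le hw1
          have h := sub_mem hfa hyc
          rw [hm] at h
          have h' := totalDegree_minResProj h
          rw [hr1, totalDegree_mul_of_isDomain (X_ne_zero 1) hr0, totalDegree_X] at h'
          omega
    obtain ⟨t, ht, hdt, hπt⟩ := hrt
    have hyt : minResGen k .y * t ∈ minResFil k (w - 1) :=
      minResFil_mono (by simp only [Gen.wt]; omega) (gen_mul_mem_fil .y ht)
    have hxt : minResGen k .x * t ∈ minResFil k (w - 1) :=
      minResFil_mono (by simp only [Gen.wt]; omega) (gen_mul_mem_fil .x ht)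
    obtain ⟨a', ha', hda'⟩ := ih (w - 1) (by push_cast at hw; omega)
      (a - minResGen k .y * c' - minResGen k .y * t) (sub_mem (sub_mem hfa hyc) hyt)
      (by rw [map_sub, map_sub, hda, hdy, hdy, hdc', hdt]; simp)
      (by rw [map_sub, hr1, map_mul, hπy, hπt, sub_self])
    obtain ⟨b', hb', hdb'⟩ := ih (w - 1) (by push_cast at hw; omega)
      (b + minResGen k .x * c' + minResGen k .x * t) (add_mem (add_mem hfb hxc) hxt)
      (by rw [map_add, map_add, hdb, hdx, hdx, hdc', hdt]; simp)
      (by rw [map_add, hr2, map_mul, hπx, hπt]; ring)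
    refine ⟨minResGen k .x * a' + minResGen k .y * b' - minResGen k .θ * (c' + t), ?_, ?_⟩
    · refine sub_mem (add_mem ?_ ?_) ?_
      · exact minResFil_mono (by simp [Gen.wt]) (gen_mul_mem_fil .x ha')
      · exact minResFil_mono (by simp [Gen.wt]) (gen_mul_mem_fil .y hb')
      · exact minResFil_mono (by simp [Gen.wt]) (gen_mul_mem_fil .θ (add_mem hc' ht))
    · rw [map_sub, map_add, hdx, hdy, hdθ, hda', hdb', map_add, hdc', hdt, he]
      noncomm_ring

theorem minResProj_surjective (k : Type u) [Field k] : Function.Surjective (minResProj k) :=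
  fun p => (exists_polynomial_lift p).imp fun _ h => h.2.2

theorem minResProj_quasiIso (k : Type u) [Field k] : (minResProj k).QuasiIso := by
  refine (quasiIso_iff _).2 ⟨fun z hz ⟨c, hc⟩ => ?_, fun p _ => ?_⟩
  · obtain ⟨w, hw⟩ := exists_mem_fil z
    obtain ⟨c', -, hc'⟩ := minRes_exact (w + 1).toNat w
      (by have := Int.self_le_toNat (w + 1); omega) z hw hz hc.symm
    exact ⟨c', hc'⟩
  · obtain ⟨a, -, ha, ha'⟩ := exists_polynomial_lift (k := k) p
    exact ⟨a, 0, ha, by rw [map_zero, add_zero]; exact ha'⟩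

end MinRes

end DGAlg

namespace DGAlg

/-! ### The ideal of minors of a generic `2 × 3` matrix -/

section Minors

open MvPolynomial

variable {k : Type u} [Field k]

/-- The coordinate ring of pairs of `2 × 2` matrices: `X (inl i)` and `X (inr i)` are the
coordinates `x_i`, `y_i` of the matrices `[x_0 + x_1, x_2; x_3, x_0 - x_1]` and
`[y_0 + y_1, y_2; y_3, y_0 - y_1]`. -/
abbrev PairPoly (k : Type u) [Field k] : Type u := MvPolynomial (Fin 4 ⊕ Fin 4) k

/-- The coordinate `x_i`. -/
noncomputable abbrev px (k : Type u) [Field k] (i : Fin 4) : PairPoly k := X (Sum.inl i)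

/-- The coordinate `y_i`. -/
noncomputable abbrev py (k : Type u) [Field k] (i : Fin 4) : PairPoly k := X (Sum.inr i)

/-- The minor `x_i y_j - x_j y_i`. -/
noncomputable def minor (k : Type u) [Field k] (i j : Fin 4) : PairPoly k :=
  px k i * py k j - px k j * py k i

/-- The ideal generated by the minors with indices in `{1, 2, 3}`. -/
noncomputable def minorIdeal (k : Type u) [Field k] : Ideal (PairPoly k) :=
  Ideal.span {minor k 2 3, minor k 3 1, minor k 1 2}

theorem mem_minorIdeal {p : PairPoly k} : p ∈ minorIdeal k ↔
    ∃ a b c, p = a * minor k 2 3 + b * minor k 3 1 + c * minor k 1 2 := by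
  rw [minorIdeal, Ideal.mem_span_insert]
  constructor
  · rintro ⟨a, z, hz, rfl⟩
    obtain ⟨b, c, rfl⟩ := Ideal.mem_span_pair.1 hz
    exact ⟨a, b, c, by ring⟩
  · rintro ⟨a, b, c, rfl⟩
    exact ⟨a, b * minor k 3 1 + c * minor k 1 2, Ideal.mem_span_pair.2 ⟨b, c, rfl⟩, by ring⟩

theorem algHom_sub_mem {σ : Type*} (φ : MvPolynomial σ k →ₐ[k] MvPolynomial σ k)
    (I : Ideal (MvPolynomial σ k)) (h : ∀ i, φ (X i) - X i ∈ I) (p : MvPolynomial σ k) :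
    φ p - p ∈ I := by
  induction p using MvPolynomial.induction_on with
  | C c => simp [← algebraMap_eq]
  | add p q hp hq => rw [map_add, add_sub_add_comm]; exact add_mem hp hq
  | mul_X p i hp =>
    have h1 : φ (p * X i) - p * X i = φ p * (φ (X i) - X i) + (φ p - p) * X i := by
      rw [map_mul]; ring
    rw [h1]
    exact add_mem (I.mul_mem_left _ (h i)) (I.mul_mem_right _ hp)

/-- The endomorphism setting two variables to zero; a single one is set to zero by taking
`a = b`. -/
noncomputable def kill (k : Type u) [Field k] {σ : Type*} [DecidableEq σ] (a b : σ) :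
    MvPolynomial σ k →ₐ[k] MvPolynomial σ k :=
  aeval fun i => if i = a ∨ i = b then 0 else X i

theorem kill_X {σ : Type*} [DecidableEq σ] (a b i : σ) :
    kill k a b (X i) = if i = a ∨ i = b then 0 else X i := aeval_X _ _

theorem exists_of_kill_eq_zero {σ : Type*} [DecidableEq σ] {a b : σ} {p : MvPolynomial σ k}
    (h : kill k a b p = 0) : ∃ f g, p = f * X a + g * X b := by
  have h1 := algHom_sub_mem (kill k a b) (Ideal.span {X a, X b}) (fun i => by
    rw [kill_X]
    split_ifs with hi
    · rcases hi with rfl | rfl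
      · exact sub_mem (zero_mem _) (Ideal.subset_span (by simp))
      · exact sub_mem (zero_mem _) (Ideal.subset_span (by simp))
    · simp) p
  rw [h, zero_sub, neg_mem_iff] at h1
  obtain ⟨f, g, hfg⟩ := Ideal.mem_span_pair.1 h1
  exact ⟨f, g, hfg.symm⟩

theorem minor_ne_zero {i j : Fin 4} (h : i ≠ j) : minor k i j ≠ 0 := by
  intro h0
  have h1 := congrArg (eval (Sum.elim (Pi.single i (1 : k)) (Pi.single j (1 : k)))) h0
  simp [minor, h, h.symm] at h1

theorem minor_prime {i j : Fin 4} (h : i ≠ j) : Prime (minor k i j) := by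
  have h1 : minor k i j = px k i * X (Sum.inr j) + -(px k j * py k i) := by rw [minor]; ring
  rw [h1]
  refine (irreducible_mul_X_add _ _ _ (X_ne_zero _) (by simp [vars_X]) ?_ ?_).prime
  · rw [vars_neg]
    intro hmem
    have h2 := vars_mul _ _ hmem
    simp [vars_X, h.symm] at h2
  · refine ((Irreducible.isRelPrime_iff_not_dvd (X_prime (R := k)).irreducible).2 ?_)
    rw [dvd_neg, X_dvd_mul_iff, X_dvd_X, X_dvd_X]
    simp [h]

theorem not_minor_dvd_minor {i j l : Fin 4} (hij : i ≠ j) (hil : i ≠ l) (hjl : j ≠ l) :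
    ¬ minor k i j ∣ minor k l i := by
  rintro ⟨c, hc⟩
  have h1 := congrArg (eval (Sum.elim (Pi.single l (1 : k)) (Pi.single i (1 : k)))) hc
  simp [minor, hij, hil, hil.symm, hjl] at h1

theorem px_dot_minor (k : Type u) [Field k] :
    px k 1 * minor k 2 3 + px k 2 * minor k 3 1 + px k 3 * minor k 1 2 = 0 := by
  simp only [minor]; ring

theorem py_dot_minor (k : Type u) [Field k] :
    py k 1 * minor k 2 3 + py k 2 * minor k 3 1 + py k 3 * minor k 1 2 = 0 := by
  simp only [minor]; ring

/-- The syzygies of the minors are generated by the rows of the matrix. Setting `x_1 = y_1 = 0`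
kills two of the minors, so `v_1` lies in the ideal `(x_1, y_1)`; after subtracting multiples of the
rows one is left with a relation between two coprime minors. -/
theorem exists_of_dot_minor_eq_zero {v1 v2 v3 : PairPoly k}
    (h : v1 * minor k 2 3 + v2 * minor k 3 1 + v3 * minor k 1 2 = 0) :
    ∃ f g : PairPoly k, v1 = f * px k 1 + g * py k 1 ∧ v2 = f * px k 2 + g * py k 2 ∧
      v3 = f * px k 3 + g * py k 3 := by
  obtain ⟨f, g, hv1⟩ : ∃ f g, v1 = f * px k 1 + g * py k 1 := by
    refine exists_of_kill_eq_zero ?_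
    have h1 := congrArg (kill k (Sum.inl 1) (Sum.inr 1)) h
    simp only [map_add, map_mul, minor, map_sub, kill_X, map_zero] at h1
    simp at h1
    rcases h1 with h1 | h1
    · exact h1
    · exact absurd h1 (minor_ne_zero (by decide))
  have h2 : (v2 - f * px k 2 - g * py k 2) * minor k 3 1 =
      minor k 1 2 * -(v3 - f * px k 3 - g * py k 3) := by
    rw [hv1] at h
    linear_combination h - f * px_dot_minor k - g * py_dot_minor k
  obtain ⟨c, hc⟩ := ((minor_prime (by decide)).dvd_or_dvd ⟨_, h2⟩).resolve_right
    (not_minor_dvd_minor (k := k) (i := 1) (j := 2) (l := 3) (by decide) (by decide) (by decide))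
  have hc' : v3 - f * px k 3 - g * py k 3 = -(minor k 3 1 * c) := by
    refine mul_left_cancel₀ (minor_ne_zero (k := k) (i := 1) (j := 2) (by decide)) ?_
    rw [hc] at h2
    linear_combination h2
  refine ⟨f - c * py k 1, g + c * px k 1, ?_, ?_, ?_⟩
  · rw [hv1]; ring
  · rw [minor] at hc
    linear_combination hc
  · rw [minor] at hc'
    linear_combination hc'

/-- The vectors proportional to the vector of minors are its multiples, as the minors are
pairwise coprime. -/
theorem exists_of_cross_minor_eq_zero {w1 w2 w3 : PairPoly k}
    (h2 : w3 * minor k 2 3 = w1 * minor k 1 2) (h3 : w1 * minor k 3 1 = w2 * minor k 2 3) :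
    ∃ l : PairPoly k, w1 = l * minor k 2 3 ∧ w2 = l * minor k 3 1 ∧ w3 = l * minor k 1 2 := by
  have hm := minor_ne_zero (k := k) (i := 2) (j := 3) (by decide)
  obtain ⟨l, rfl⟩ := ((minor_prime (by decide)).dvd_or_dvd
    (show minor k 2 3 ∣ w1 * minor k 1 2 from ⟨w3, by rw [← h2]; ring⟩)).resolve_right
    (not_minor_dvd_minor (by decide) (by decide) (by decide))
  refine ⟨l, mul_comm _ _, mul_left_cancel₀ hm ?_, mul_left_cancel₀ hm ?_⟩
  · linear_combination -h3
  · linear_combination h2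

theorem exists_of_px_mul_add {a b : PairPoly k} {i : Fin 4} (h : px k i * a + py k i * b = 0) :
    ∃ n, a = n * py k i ∧ b = -(n * px k i) := by
  have h1 : px k i ∣ py k i * b := ⟨-a, by linear_combination h⟩
  rcases X_dvd_mul_iff.1 h1 with h2 | ⟨n, rfl⟩
  · exact absurd (X_dvd_X.1 h2) (by simp)
  · refine ⟨-n, ?_, by ring⟩
    refine mul_left_cancel₀ (X_ne_zero (Sum.inl i : Fin 4 ⊕ Fin 4)) ?_
    linear_combination h

/-- The variable `x_1` is a nonzerodivisor modulo the ideal of minors. -/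
theorem mem_minorIdeal_of_px_mul {p : PairPoly k} (h : px k 1 * p ∈ minorIdeal k) :
    p ∈ minorIdeal k := by
  obtain ⟨c1, c2, c3, h⟩ := mem_minorIdeal.1 h
  -- reduction modulo `x_1`
  let φ := kill k (Sum.inl 1 : Fin 4 ⊕ Fin 4) (Sum.inl 1)
  have hφ : ∀ q : PairPoly k, ∃ r, q = φ q + px k 1 * r := fun q => by
    have h1 : φ (q - φ q) = 0 := by
      have h2 : φ.comp φ = φ := by
        refine MvPolynomial.algHom_ext fun i => ?_
        by_cases hi : i = Sum.inl 1 <;> simp [φ, kill_X, hi]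
      have h3 : φ (φ q) = φ q := DFunLike.congr_fun h2 q
      rw [map_sub, h3, sub_self]
    obtain ⟨f, g, hfg⟩ := exists_of_kill_eq_zero h1
    exact ⟨f + g, by linear_combination hfg⟩
  obtain ⟨r1, hr1⟩ := hφ c1
  obtain ⟨r2, hr2⟩ := hφ c2
  obtain ⟨r3, hr3⟩ := hφ c3
  have h1 := congrArg φ h
  simp only [map_add, map_mul, minor, map_sub, φ, kill_X] at h1
  simp at h1
  change 0 = φ c1 * (px k 2 * py k 3 - px k 3 * py k 2) + φ c2 * (px k 3 * py k 1) +
    -(φ c3 * (px k 2 * py k 1)) at h1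
  generalize φ c1 = d1 at *
  generalize φ c2 = d2 at *
  generalize φ c3 = d3 at *
  -- `d_1 = y_1 e`
  have h2 : py k 1 ∣ minor k 2 3 * d1 :=
    ⟨d3 * px k 2 - d2 * px k 3, by rw [minor]; linear_combination -h1⟩
  obtain ⟨e, rfl⟩ : py k 1 ∣ d1 := by
    refine ((X_prime (R := k)).dvd_or_dvd h2).resolve_left ?_
    rintro ⟨c, hc⟩
    have h3 := congrArg (eval (Sum.elim (Pi.single 2 (1 : k)) (Pi.single 3 (1 : k)))) hc
    simp [minor] at h3
  have h3 : px k 2 * (e * py k 3 - d3) = px k 3 * (e * py k 2 - d2) := by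
    refine mul_left_cancel₀ (X_ne_zero (Sum.inr 1 : Fin 4 ⊕ Fin 4)) ?_
    linear_combination -h1
  obtain ⟨n, hn⟩ : px k 3 ∣ e * py k 3 - d3 := by
    have h4 : px k 3 ∣ px k 2 * (e * py k 3 - d3) := ⟨_, h3⟩
    refine (X_dvd_mul_iff.1 h4).resolve_left fun h5 => ?_
    exact absurd (X_dvd_X.1 h5) (by simp)
  have hn' : e * py k 2 - d2 = px k 2 * n := by
    refine mul_left_cancel₀ (X_ne_zero (Sum.inl 3 : Fin 4 ⊕ Fin 4)) ?_
    rw [hn] at h3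
    linear_combination -h3
  refine mem_minorIdeal.2 ⟨r1 + n, r2, r3, ?_⟩
  refine mul_left_cancel₀ (X_ne_zero (Sum.inl 1 : Fin 4 ⊕ Fin 4)) ?_
  rw [h, hr1, hr2, hr3]
  linear_combination e * py_dot_minor k - n * px_dot_minor k - minor k 1 2 * hn -
    minor k 3 1 * hn'

/-- Pairs of matrices with proportional traceless parts: `x_i = s w_i`, `y_i = t w_i`. -/
def toricPt (a b s t : k) (w : Fin 3 → k) : Fin 4 ⊕ Fin 4 → k :=
  Sum.elim (Fin.cons a fun i => s * w i) (Fin.cons b fun i => t * w i)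

theorem eval_toricPt_of_mem_minorIdeal {q : PairPoly k} (hq : q ∈ minorIdeal k) (a b s t : k)
    (w : Fin 3 → k) : eval (toricPt a b s t w) q = 0 := by
  obtain ⟨c1, c2, c3, rfl⟩ := mem_minorIdeal.1 hq
  have e1 : ∀ i : Fin 3, toricPt a b s t w (Sum.inl i.succ) = s * w i := fun i => rfl
  have e2 : ∀ i : Fin 3, toricPt a b s t w (Sum.inr i.succ) = t * w i := fun i => rfl
  have f1 := e1 0
  have f2 := e1 1
  have f3 := e1 2
  have f4 := e2 0
  have f5 := e2 1
  have f6 := e2 2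
  simp only [Fin.succ_zero_eq_one, Fin.succ_one_eq_two, Fin.reduceSucc] at f1 f2 f3 f4 f5 f6
  simp only [minor, map_add, map_sub, map_mul, eval_X, f1, f2, f3, f4, f5, f6]
  ring

/-- The ideal of minors is the ideal of the pairs of matrices with proportional traceless parts:
after multiplication by a power of `x_1` a polynomial is congruent to one that does not involve
`y_2`, `y_3`. -/
theorem mem_minorIdeal_of_eval_eq_zero [CharZero k] {p : PairPoly k}
    (h : ∀ a b s t w, eval (toricPt a b s t w) p = 0) : p ∈ minorIdeal k := by
  have hred : ∃ (n : ℕ) (r : PairPoly k), (∀ pt pt' : Fin 4 ⊕ Fin 4 → k,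
      (∀ i, i ≠ Sum.inr 2 → i ≠ Sum.inr 3 → pt i = pt' i) → eval pt r = eval pt' r) ∧
      px k 1 ^ n * p - r ∈ minorIdeal k := by
    clear h
    induction p using MvPolynomial.induction_on with
    | C c => exact ⟨0, C c, by simp, by simp⟩
    | add p q hp hq =>
      obtain ⟨n, r, hr, hr'⟩ := hp
      obtain ⟨m, s, hs, hs'⟩ := hq
      refine ⟨n + m, px k 1 ^ m * r + px k 1 ^ n * s, fun pt pt' hpt => ?_, ?_⟩
      · have e := hpt (Sum.inl 1) (by simp) (by simp)
        simp only [map_add, map_mul, map_pow, eval_X, hr pt pt' hpt, hs pt pt' hpt, e]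
      · have e : px k 1 ^ (n + m) * (p + q) - (px k 1 ^ m * r + px k 1 ^ n * s) =
            px k 1 ^ m * (px k 1 ^ n * p - r) + px k 1 ^ n * (px k 1 ^ m * q - s) := by ring
        rw [e]
        exact add_mem (Ideal.mul_mem_left _ _ hr') (Ideal.mul_mem_left _ _ hs')
    | mul_X p i hp =>
      obtain ⟨n, r, hr, hr'⟩ := hp
      by_cases hi2 : i = Sum.inr 2
      · subst hi2
        refine ⟨n + 1, r * (px k 2 * py k 1), fun pt pt' hpt => ?_, ?_⟩
        · have e := hpt (Sum.inl 2) (by simp) (by simp)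
          have e' := hpt (Sum.inr 1) (by simp) (by simp)
          simp only [map_mul, eval_X, hr pt pt' hpt, e, e']
        · have e : px k 1 ^ (n + 1) * (p * py k 2) - r * (px k 2 * py k 1) =
              (px k 1 * py k 2) * (px k 1 ^ n * p - r) + r * minor k 1 2 := by
            rw [minor]; ring
          rw [e]
          exact add_mem (Ideal.mul_mem_left _ _ hr')
            (Ideal.mul_mem_left _ _ (Ideal.subset_span (by simp)))
      by_cases hi3 : i = Sum.inr 3
      · subst hi3
        refine ⟨n + 1, r * (px k 3 * py k 1), fun pt pt' hpt => ?_, ?_⟩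
        · have e := hpt (Sum.inl 3) (by simp) (by simp)
          have e' := hpt (Sum.inr 1) (by simp) (by simp)
          simp only [map_mul, eval_X, hr pt pt' hpt, e, e']
        · have e : px k 1 ^ (n + 1) * (p * py k 3) - r * (px k 3 * py k 1) =
              (px k 1 * py k 3) * (px k 1 ^ n * p - r) + -r * minor k 3 1 := by
            rw [minor]; ring
          rw [e]
          exact add_mem (Ideal.mul_mem_left _ _ hr')
            (Ideal.mul_mem_left _ _ (Ideal.subset_span (by simp)))
      · refine ⟨n, r * X i, fun pt pt' hpt => ?_, ?_⟩
        · simp only [map_mul, eval_X, hr pt pt' hpt, hpt i hi2 hi3]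
        · have e : px k 1 ^ n * (p * X i) - r * X i = X i * (px k 1 ^ n * p - r) := by ring
          rw [e]
          exact Ideal.mul_mem_left _ _ hr'
  obtain ⟨n, r, hr, hnr⟩ := hred
  have hr0 : px k 1 * r = 0 := by
    refine MvPolynomial.funext fun pt => ?_
    rw [map_mul, map_zero, eval_X]
    by_cases h1 : pt (Sum.inl 1) = 0
    · rw [h1, zero_mul]
    · let w : Fin 3 → k := fun i => pt (Sum.inl i.succ)
      have h2 := eval_toricPt_of_mem_minorIdeal hnr (pt (Sum.inl 0)) (pt (Sum.inr 0)) 1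
        (pt (Sum.inr 1) / pt (Sum.inl 1)) w
      rw [map_sub, map_mul, h, mul_zero, zero_sub, neg_eq_zero] at h2
      rw [hr pt _ ?_, h2, mul_zero]
      rintro (i | i) hi hi'
      · fin_cases i <;> simp [toricPt, w] <;> rfl
      · fin_cases i
        · rfl
        · change _ = pt (Sum.inr 1) / pt (Sum.inl 1) * pt (Sum.inl 1)
          rw [div_mul_cancel₀ _ h1]; rfl
        · exact absurd rfl hi
        · exact absurd rfl hi'
  have hr1 : r = 0 := (mul_eq_zero.1 hr0).resolve_left (X_ne_zero _)
  rw [hr1, sub_zero] at hnr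
  clear hr hr0 hr1
  induction n with
  | zero => simpa using hnr
  | succ n ih =>
    rw [pow_succ', mul_assoc] at hnr
    exact ih (mem_minorIdeal_of_px_mul hnr)

/-- The pairs `(f, g)` with `s f + t g = 0` on the matrices with proportional traceless parts are
generated by the `(y_i, -x_i)`. -/
theorem exists_of_toric_relation [CharZero k] {f g : PairPoly k}
    (h : ∀ a b s t w, s * eval (toricPt a b s t w) f + t * eval (toricPt a b s t w) g = 0) :
    ∃ u1 u2 u3 : PairPoly k, f = u1 * py k 1 + u2 * py k 2 + u3 * py k 3 ∧
      g = -(u1 * px k 1 + u2 * px k 2 + u3 * px k 3) := by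
  obtain ⟨c1, c2, c3, hc⟩ := mem_minorIdeal.1 (mem_minorIdeal_of_eval_eq_zero
    (p := px k 1 * f + py k 1 * g) fun a b s t w => by
      have e1 : toricPt a b s t w (Sum.inl 1) = s * w 0 := rfl
      have e2 : toricPt a b s t w (Sum.inr 1) = t * w 0 := rfl
      rw [map_add, map_mul, map_mul, eval_X, eval_X, e1, e2]
      linear_combination w 0 * h a b s t w)
  obtain ⟨a, b, hab⟩ : ∃ a b, c1 = a * px k 1 + b * py k 1 := by
    refine exists_of_kill_eq_zero ?_
    have h1 := congrArg (kill k (Sum.inl 1) (Sum.inr 1)) hc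
    simp only [map_add, map_mul, minor, map_sub, kill_X] at h1
    simp at h1
    rcases h1 with h1 | h1
    · exact h1
    · exact absurd h1 (minor_ne_zero (by decide))
  obtain ⟨n, hn, hn'⟩ := exists_of_px_mul_add (i := 1)
    (a := f + c2 * py k 3 - c3 * py k 2 - a * minor k 2 3)
    (b := g - c2 * px k 3 + c3 * px k 2 - b * minor k 2 3) (by
      rw [hab] at hc
      rw [minor, minor, minor] at *
      linear_combination hc)
  refine ⟨n, c3 - a * px k 3 - b * py k 3, -c2 + a * px k 2 + b * py k 2, ?_, ?_⟩
  · rw [minor] at hn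
    linear_combination hn
  · rw [minor] at hn'
    linear_combination hn'

end Minors

end DGAlg

namespace DGAlg

/-! ### Invariant polynomials on pairs of `2 × 2` matrices -/

section InvariantPolynomials

open MvPolynomial

variable {k : Type u} [Field k]

/-- If a polynomial vanishes along a nonconstant curve parallel to a coordinate axis, except
possibly at finitely many parameters, then it vanishes on the whole line. -/
theorem eval_update_eq_zero [CharZero k] {σ : Type*} [DecidableEq σ] (f : MvPolynomial σ k)
    (i : σ) (pt : σ → k) (c D : Polynomial k) (hc : c.natDegree ≠ 0) (hD : D ≠ 0)
    (h : ∀ q, D.eval q ≠ 0 → eval (Function.update pt i (c.eval q)) f = 0) (t : k) :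
    eval (Function.update pt i t) f = 0 := by
  let H : Polynomial k := aeval (Function.update (fun j => Polynomial.C (pt j)) i Polynomial.X) f
  have hH : ∀ t, H.eval t = eval (Function.update pt i t) f := fun t => by
    have h1 : (Polynomial.aeval t : Polynomial k →ₐ[k] k).comp
        (aeval (Function.update (fun j => Polynomial.C (pt j)) i Polynomial.X)) =
        aeval (Function.update pt i t) := by
      refine MvPolynomial.algHom_ext fun j => ?_
      by_cases hj : j = i
      · subst hj; simp
      · simp [hj]
    have h2 := DFunLike.congr_fun h1 f
    rw [aeval_eq_eval] at h2
    rw [← Polynomial.coe_aeval_eq_eval]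
    exact h2
  have h0 : H.comp c * D = 0 := by
    refine Polynomial.funext fun q => ?_
    rw [Polynomial.eval_mul, Polynomial.eval_comp, hH, Polynomial.eval_zero]
    by_cases hq : D.eval q = 0
    · rw [hq, mul_zero]
    · rw [h q hq, zero_mul]
  have h1 : H = 0 := by
    rcases Polynomial.comp_eq_zero_iff.1 ((mul_eq_zero.1 h0).resolve_right hD) with h2 | ⟨-, h2⟩
    · exact h2
    · rw [h2, Polynomial.natDegree_C] at hc
      exact absurd rfl hc
  rw [← hH, h1, Polynomial.eval_zero]

/-- The polynomial ring in the variables `x_0, y_0, A, B, C`, where `A`, `B`, `C` stand for the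
inner products of the traceless parts of a pair of `2 × 2` matrices. -/
abbrev InvPoly (k : Type u) [Field k] : Type u := MvPolynomial (Fin 5) k

theorem infinite_nonzero_squares (k : Type u) [Field k] [CharZero k] :
    {c : k | ∃ s, s ≠ 0 ∧ c = s ^ 2}.Infinite := by
  refine Set.infinite_of_injective_forall_mem (f := fun n : ℕ => ((n + 1 : ℕ) : k) ^ 2) ?_
    fun n => ⟨_, Nat.cast_ne_zero.2 n.succ_ne_zero, rfl⟩
  intro m n h
  replace h : ((m + 1 : ℕ) : k) ^ 2 = ((n + 1 : ℕ) : k) ^ 2 := h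
  have h1 : (m + 1) ^ 2 = (n + 1) ^ 2 := by exact_mod_cast h
  have h2 := Nat.pow_left_injective (n := 2) (by norm_num) h1
  omega

/-- The kernel of `A ↦ s²`, `B ↦ st`, `C ↦ t²` is generated by `AC - B²`. -/
theorem dvd_of_eval_squares [CharZero k] {F : InvPoly k}
    (h : ∀ a b s t : k, eval ![a, b, s ^ 2, s * t, t ^ 2] F = 0) :
    ∃ R, F = (X 2 * X 4 - X 3 ^ 2) * R := by
  obtain ⟨P, Q, R, hP, hQ, hF⟩ : ∃ P Q R : InvPoly k,
      (∀ pt pt' : Fin 5 → k, (∀ i, i ≠ 3 → pt i = pt' i) → eval pt P = eval pt' P) ∧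
      (∀ pt pt' : Fin 5 → k, (∀ i, i ≠ 3 → pt i = pt' i) → eval pt Q = eval pt' Q) ∧
      F = P + X 3 * Q + (X 2 * X 4 - X 3 ^ 2) * R := by
    clear h
    induction F using MvPolynomial.induction_on with
    | C c => exact ⟨C c, 0, 0, by simp, by simp, by simp⟩
    | add F G hF hG =>
      obtain ⟨P, Q, R, hP, hQ, rfl⟩ := hF
      obtain ⟨P', Q', R', hP', hQ', rfl⟩ := hG
      refine ⟨P + P', Q + Q', R + R', fun pt pt' hpt => ?_, fun pt pt' hpt => ?_, by ring⟩
      · rw [map_add, map_add, hP pt pt' hpt, hP' pt pt' hpt]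
      · rw [map_add, map_add, hQ pt pt' hpt, hQ' pt pt' hpt]
    | mul_X F i hF =>
      obtain ⟨P, Q, R, hP, hQ, rfl⟩ := hF
      by_cases hi : i = 3
      · subst hi
        refine ⟨X 2 * X 4 * Q, P, X 3 * R - Q, fun pt pt' hpt => ?_, hP, by ring⟩
        simp only [map_mul, eval_X, hQ pt pt' hpt, hpt 2 (by decide), hpt 4 (by decide)]
      · refine ⟨P * X i, Q * X i, R * X i, fun pt pt' hpt => ?_, fun pt pt' hpt => ?_, by ring⟩
        · rw [map_mul, map_mul, hP pt pt' hpt, eval_X, eval_X, hpt i hi]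
        · rw [map_mul, map_mul, hQ pt pt' hpt, eval_X, eval_X, hpt i hi]
  have key : ∀ a b s t : k, s ≠ 0 → t ≠ 0 → ∀ c, eval ![a, b, s ^ 2, c, t ^ 2] P = 0 ∧
      eval ![a, b, s ^ 2, c, t ^ 2] Q = 0 := by
    intro a b s t hs ht c
    have e : ∀ d c : k, ∀ i : Fin 5, i ≠ 3 → (![a, b, s ^ 2, d, t ^ 2] : Fin 5 → k) i =
        (![a, b, s ^ 2, c, t ^ 2] : Fin 5 → k) i := fun d c i hi => by
      fin_cases i <;> first | rfl | exact absurd rfl hi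
    have h1 := h a b s t
    have h2 := h a b (-s) t
    rw [hF] at h1 h2
    rw [neg_sq] at h2
    simp only [map_add, map_mul, map_sub, map_pow, eval_X, hP _ _ (e _ c), hQ _ _ (e _ c)] at h1 h2
    simp at h1 h2
    have h3 : s * t * eval ![a, b, s ^ 2, c, t ^ 2] Q = 0 := by linear_combination (h1 - h2) / 2
    have h4 := (mul_eq_zero.1 h3).resolve_left (mul_ne_zero hs ht)
    exact ⟨by linear_combination h1 - s * t * h4, h4⟩
  have hzero : ∀ G : InvPoly k, (∀ a b s t : k, s ≠ 0 → t ≠ 0 → ∀ c,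
      eval ![a, b, s ^ 2, c, t ^ 2] G = 0) → G = 0 := by
    intro G hG
    refine MvPolynomial.funext_set (![Set.univ, Set.univ, {c : k | ∃ s, s ≠ 0 ∧ c = s ^ 2},
      Set.univ, {c : k | ∃ s, s ≠ 0 ∧ c = s ^ 2}] : Fin 5 → Set k) ?_ ?_
    · intro i
      fin_cases i
      · exact Set.infinite_univ
      · exact Set.infinite_univ
      · exact infinite_nonzero_squares k
      · exact Set.infinite_univ
      · exact infinite_nonzero_squares k
    · intro pt hpt
      obtain ⟨s, hs, hs'⟩ := hpt 2 trivial
      obtain ⟨t, ht, ht'⟩ := hpt 4 trivial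
      have e : pt = ![pt 0, pt 1, s ^ 2, pt 3, t ^ 2] := by
        funext i
        fin_cases i <;> first | rfl | assumption
      rw [map_zero, e]
      exact hG _ _ s t hs ht _
  refine ⟨R, ?_⟩
  rw [hzero P fun a b s t hs ht c => (key a b s t hs ht c).1,
    hzero Q fun a b s t hs ht c => (key a b s t hs ht c).2] at hF
  rw [hF]; ring

/-- The relations `s F + t G = 0` with `F`, `G` polynomials in `A = s²`, `B = st`, `C = t²` are
generated by `(B, -A)` and `(C, -B)`. -/
theorem exists_of_square_relation [CharZero k] {F G : InvPoly k}
    (h : ∀ a b s t : k, s * eval ![a, b, s ^ 2, s * t, t ^ 2] F +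
      t * eval ![a, b, s ^ 2, s * t, t ^ 2] G = 0) :
    ∃ l n : InvPoly k, F = l * X 3 + n * X 4 ∧ G = -(l * X 2 + n * X 3) := by
  obtain ⟨R, hR⟩ := dvd_of_eval_squares (F := X 2 * F + X 3 * G) fun a b s t => by
    simp only [map_add, map_mul, eval_X]
    simp only [Matrix.cons_val]
    linear_combination s * h a b s t
  obtain ⟨N, hN⟩ : (X 2 : InvPoly k) ∣ G + X 3 * R := by
    have h1 : (X 2 : InvPoly k) ∣ X 3 * (G + X 3 * R) :=
      ⟨X 4 * R - F, by linear_combination hR⟩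
    exact (X_dvd_mul_iff.1 h1).resolve_left fun h2 => absurd (X_dvd_X.1 h2) (by decide)
  refine ⟨-N, R, ?_, by linear_combination hN⟩
  refine mul_left_cancel₀ (X_ne_zero (2 : Fin 5)) ?_
  linear_combination hR - X 3 * hN

/-- The inner product `A` of the traceless part of the first matrix with itself. -/
noncomputable def invA (k : Type u) [Field k] : PairPoly k := px k 1 ^ 2 + px k 2 * px k 3

/-- The inner product `B` of the traceless parts of the two matrices. -/
noncomputable def invB (k : Type u) [Field k] : PairPoly k :=
  px k 1 * py k 1 + C (1 / 2) * (px k 2 * py k 3 + px k 3 * py k 2)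

/-- The inner product `C` of the traceless part of the second matrix with itself. -/
noncomputable def invC (k : Type u) [Field k] : PairPoly k := py k 1 ^ 2 + py k 2 * py k 3

/-- Substitution of the invariants `x_0, y_0, A, B, C`. -/
noncomputable def invHom (k : Type u) [Field k] : InvPoly k →ₐ[k] PairPoly k :=
  aeval ![px k 0, py k 0, invA k, invB k, invC k]

theorem eval_invHom (pt : Fin 4 ⊕ Fin 4 → k) (P : InvPoly k) :
    eval pt (invHom k P) = eval ![pt (.inl 0), pt (.inr 0), pt (.inl 1) ^ 2 + pt (.inl 2) * pt (.inl 3),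
      pt (.inl 1) * pt (.inr 1) + 1 / 2 * (pt (.inl 2) * pt (.inr 3) + pt (.inl 3) * pt (.inr 2)),
      pt (.inr 1) ^ 2 + pt (.inr 2) * pt (.inr 3)] P := by
  have h : (aeval pt : PairPoly k →ₐ[k] k).comp (invHom k) = aeval
      ![pt (.inl 0), pt (.inr 0), pt (.inl 1) ^ 2 + pt (.inl 2) * pt (.inl 3),
      pt (.inl 1) * pt (.inr 1) + 1 / 2 * (pt (.inl 2) * pt (.inr 3) + pt (.inl 3) * pt (.inr 2)),
      pt (.inr 1) ^ 2 + pt (.inr 2) * pt (.inr 3)] := by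
    refine MvPolynomial.algHom_ext fun i => ?_
    fin_cases i <;> simp [invHom, invA, invB, invC, ← algebraMap_eq]
  exact DFunLike.congr_fun h P

/-- The `2 × 2` matrix `[v_0 + v_1, v_2; v_3, v_0 - v_1]`. -/
def ptMat {R : Type*} [Ring R] (v : Fin 4 → R) : Matrix (Fin 2) (Fin 2) R :=
  !![v 0 + v 1, v 2; v 3, v 0 - v 1]

/-- A polynomial on pairs of `2 × 2` matrices taking equal values at conjugate pairs. -/
def IsConjInv (p : PairPoly k) : Prop :=
  ∀ (g : Matrix (Fin 2) (Fin 2) k) (pt pt' : Fin 4 ⊕ Fin 4 → k), g.det ≠ 0 →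
    ptMat (pt' ∘ Sum.inl) * g = g * ptMat (pt ∘ Sum.inl) →
    ptMat (pt' ∘ Sum.inr) * g = g * ptMat (pt ∘ Sum.inr) → eval pt' p = eval pt p

/-- The slice consisting of the pairs `[a, α; 1, a]`, `[b + q, 2β; 0, b - q]`. -/
def slicePt {R : Type*} [CommRing R] (a b α β q : R) : Fin 4 ⊕ Fin 4 → R :=
  Sum.elim ![a, 0, α, 1] ![b, q, 2 * β, 0]

/-- Pairs of `2 × 2` matrices are generically conjugate to elements of the slice, provided that
`C` is a square. -/
theorem IsConjInv.eval_eq_slice {p : PairPoly k} (hp : IsConjInv p) (pt : Fin 4 ⊕ Fin 4 → k) (q : k)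
    (hq : pt (.inr 1) ^ 2 + pt (.inr 2) * pt (.inr 3) = q ^ 2)
    (hdet : pt (.inl 3) * (q + pt (.inr 1)) ^ 2 -
      2 * pt (.inl 1) * pt (.inr 3) * (q + pt (.inr 1)) - pt (.inl 2) * pt (.inr 3) ^ 2 ≠ 0)
    [CharZero k] :
    eval pt p = eval (slicePt (pt (.inl 0)) (pt (.inr 0)) (pt (.inl 1) ^ 2 + pt (.inl 2) * pt (.inl 3))
      (pt (.inl 1) * pt (.inr 1) + 1 / 2 * (pt (.inl 2) * pt (.inr 3) + pt (.inl 3) * pt (.inr 2)))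
      q) p := by
  -- the columns are an eigenvector of the second matrix and its image under the first one
  refine hp !![q + pt (.inr 1), pt (.inl 1) * (q + pt (.inr 1)) + pt (.inl 2) * pt (.inr 3);
    pt (.inr 3), pt (.inl 3) * (q + pt (.inr 1)) - pt (.inl 1) * pt (.inr 3)] _ _ ?_ ?_ ?_
  · rw [Matrix.det_fin_two_of]
    intro h0
    exact hdet (by linear_combination h0)
  · ext i j
    fin_cases i <;> fin_cases j <;> simp [ptMat, slicePt, Matrix.mul_apply] <;> ring
  · ext i j
    fin_cases i <;> fin_cases j <;> simp [ptMat, slicePt, Matrix.mul_apply]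
    · linear_combination hq
    · linear_combination -pt (.inl 1) * hq
    · ring
    · linear_combination -pt (.inl 3) * hq

/-- Conjugation invariant polynomials are polynomials in the invariants `x_0, y_0, A, B, C`. -/
theorem IsConjInv.exists_invHom [CharZero k] {p : PairPoly k} (hp : IsConjInv p) :
    ∃ P, p = invHom k P := by
  let sl : PairPoly k →ₐ[k] InvPoly k := aeval (slicePt (X 0) (X 1) (X 2) (X 3) (X 4))
  have hsl : ∀ a b α β q, eval ![a, b, α, β, q] (sl p) = eval (slicePt a b α β q) p := by
    intro a b α β q
    have h : (aeval ![a, b, α, β, q] : InvPoly k →ₐ[k] k).comp sl = aeval (slicePt a b α β q) := by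
      refine MvPolynomial.algHom_ext fun i => ?_
      rcases i with i | i <;> fin_cases i <;> simp [sl, slicePt]
    exact DFunLike.congr_fun h p
  let sq : InvPoly k →ₐ[k] InvPoly k := aeval ![X 0, X 1, X 2, X 3, X 4 ^ 2]
  have hsq : ∀ a b α β q P, eval ![a, b, α, β, q] (sq P) = eval ![a, b, α, β, q ^ 2] P := by
    intro a b α β q P
    have h : (aeval ![a, b, α, β, q] : InvPoly k →ₐ[k] k).comp sq =
        aeval ![a, b, α, β, q ^ 2] := by
      refine MvPolynomial.algHom_ext fun i => ?_
      fin_cases i <;> simp [sq]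
    exact DFunLike.congr_fun h P
  obtain ⟨P, Q, hPQ⟩ : ∃ P Q, sl p = sq P + X 4 * sq Q := by
    generalize sl p = F
    induction F using MvPolynomial.induction_on with
    | C c => exact ⟨C c, 0, by simp [sq]⟩
    | add F G hF hG =>
      obtain ⟨P, Q, rfl⟩ := hF
      obtain ⟨P', Q', rfl⟩ := hG
      exact ⟨P + P', Q + Q', by rw [map_add, map_add]; ring⟩
    | mul_X F i hF =>
      obtain ⟨P, Q, rfl⟩ := hF
      by_cases hi : i = 4
      · subst hi
        refine ⟨X 4 * Q, P, ?_⟩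
        have h : sq (X 4) = X 4 ^ 2 := by simp [sq]
        rw [map_mul, h]; ring
      · refine ⟨X i * P, X i * Q, ?_⟩
        have h : sq (X i) = X i := by
          fin_cases i <;> first | exact absurd rfl hi | simp [sq]
        rw [map_mul, map_mul, h]; ring
  -- the restriction to the slice is even in `q`, as the points with parameters `q` and `-q` are
  -- conjugate
  have hQ : sq Q = 0 := by
    have h1 : sq Q * (X 4 * (X 3 ^ 2 - X 2 * X 4 ^ 2)) = 0 := by
      refine MvPolynomial.funext fun pt => ?_
      have hpt : pt = ![pt 0, pt 1, pt 2, pt 3, pt 4] := by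
        funext i; fin_cases i <;> rfl
      rw [hpt]
      generalize pt 0 = a
      generalize pt 1 = b
      generalize pt 2 = α
      generalize pt 3 = β
      generalize pt 4 = q
      by_cases hdet : β ^ 2 - α * q ^ 2 = 0
      · simp only [map_mul, map_sub, map_pow, eval_X, map_zero, Matrix.cons_val]
        rw [hdet]; simp
      · have h2 : eval (slicePt a b α β (-q)) p = eval (slicePt a b α β q) p := by
          refine hp !![β, q * α; q, β] _ _ ?_ ?_ ?_
          · rw [Matrix.det_fin_two_of]
            intro h0
            exact hdet (by linear_combination h0)
          · ext i j
            fin_cases i <;> fin_cases j <;> simp [ptMat, slicePt, Matrix.mul_apply] <;> ring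
          · ext i j
            fin_cases i <;> fin_cases j <;> simp [ptMat, slicePt, Matrix.mul_apply] <;> ring
        rw [← hsl, ← hsl, hPQ] at h2
        simp only [map_add, map_mul, hsq, eval_X, Matrix.cons_val, neg_sq] at h2
        simp only [map_mul, map_sub, map_pow, eval_X, map_zero, hsq, Matrix.cons_val]
        linear_combination -(β ^ 2 - α * q ^ 2) / 2 * h2
    refine (mul_eq_zero.1 h1).resolve_right (mul_ne_zero (X_ne_zero _) fun h2 => ?_)
    have h3 := congrArg (eval ![0, 0, 0, 1, 0]) h2
    simp at h3
  refine ⟨P, ?_⟩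
  -- `p - P(x_0, y_0, A, B, C)` vanishes generically
  have hgen : ∀ pt : Fin 4 ⊕ Fin 4 → k, pt (.inl 3) ≠ 0 → pt (.inr 3) ≠ 0 →
      eval pt (p - invHom k P) = 0 := by
    intro pt ha hb
    have h := eval_update_eq_zero (p - invHom k P) (.inr 2) pt
      (Polynomial.C (pt (.inr 3))⁻¹ * (Polynomial.X ^ 2 - Polynomial.C (pt (.inr 1) ^ 2)))
      (Polynomial.C (pt (.inl 3)) * (Polynomial.X + Polynomial.C (pt (.inr 1))) ^ 2 -
        Polynomial.C (2 * pt (.inl 1) * pt (.inr 3)) * (Polynomial.X + Polynomial.C (pt (.inr 1))) -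
        Polynomial.C (pt (.inl 2) * pt (.inr 3) ^ 2)) ?_ ?_ ?_ (pt (.inr 2))
    · rwa [Function.update_eq_self] at h
    · rw [Polynomial.natDegree_C_mul (inv_ne_zero hb), Polynomial.natDegree_X_pow_sub_C]
      norm_num
    · intro h0
      have h1 := congrArg (fun f => (f.comp (Polynomial.X - Polynomial.C (pt (.inr 1)))).coeff 2) h0
      simp at h1
      rw [← Polynomial.C_pow, Polynomial.coeff_C] at h1
      exact ha (by simpa using h1)
    · intro q hq
      simp only [Polynomial.eval_mul, Polynomial.eval_sub, Polynomial.eval_C, Polynomial.eval_pow,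
        Polynomial.eval_X, Polynomial.eval_add] at hq ⊢
      rw [map_sub, eval_invHom, hp.eval_eq_slice _ q ?_ ?_, ← hsl, hPQ, hQ, mul_zero, add_zero,
        hsq, sub_eq_zero]
      · congr 2
        simp
        field_simp
        ring
      · simp
        field_simp
        ring
      · simpa using hq
  have h1 : (p - invHom k P) * (px k 3 * py k 3) = 0 := by
    refine MvPolynomial.funext fun pt => ?_
    rw [map_mul, map_mul, eval_X, eval_X, map_zero]
    by_cases ha : pt (.inl 3) = 0
    · rw [ha]; simp
    by_cases hb : pt (.inr 3) = 0
    · rw [hb]; simp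
    · rw [hgen pt ha hb, zero_mul]
  exact sub_eq_zero.1 ((mul_eq_zero.1 h1).resolve_right
    (mul_ne_zero (X_ne_zero _) (X_ne_zero _)))

/-- A polynomial family of conjugation invariant functions on traceless matrices that vanish on
the diagonal ones is zero: a traceless matrix is conjugate to a diagonal one when its determinant
is `-q²` with `q ≠ 0`. -/
theorem eval_eq_zero_of_conj [CharZero k] {τ : Type*} (H : MvPolynomial (τ ⊕ Fin 3) k)
    (hinv : ∀ (v : τ → k) (g : Matrix (Fin 2) (Fin 2) k) (w w' : Fin 3 → k), g.det ≠ 0 →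
      !![w' 0, w' 1; w' 2, -w' 0] * g = g * !![w 0, w 1; w 2, -w 0] →
      eval (Sum.elim v w') H = eval (Sum.elim v w) H)
    (hdiag : ∀ (v : τ → k) (c : k), eval (Sum.elim v ![c, 0, 0]) H = 0)
    (v : τ → k) (w : Fin 3 → k) : eval (Sum.elim v w) H = 0 := by
  classical
  have hgen : ∀ pt : τ ⊕ Fin 3 → k, pt (.inr 2) ≠ 0 → eval pt H = 0 := by
    intro pt hc
    have h := eval_update_eq_zero H (.inr 1) pt
      (Polynomial.C (pt (.inr 2))⁻¹ * (Polynomial.X ^ 2 - Polynomial.C (pt (.inr 0) ^ 2)))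
      Polynomial.X ?_ Polynomial.X_ne_zero ?_ (pt (.inr 1))
    · rwa [Function.update_eq_self] at h
    · rw [Polynomial.natDegree_C_mul (inv_ne_zero hc), Polynomial.natDegree_X_pow_sub_C]
      norm_num
    · intro q hq
      rw [Polynomial.eval_X] at hq
      simp only [Polynomial.eval_mul, Polynomial.eval_sub, Polynomial.eval_C, Polynomial.eval_pow,
        Polynomial.eval_X]
      rw [← hdiag (pt ∘ Sum.inl) q]
      -- the columns are eigenvectors
      have h := hinv (pt ∘ Sum.inl) !![q + pt (.inr 0), -q + pt (.inr 0);
        pt (.inr 2), pt (.inr 2)] ![q, 0, 0]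
        ![pt (.inr 0), (pt (.inr 2))⁻¹ * (q ^ 2 - pt (.inr 0) ^ 2), pt (.inr 2)] ?_ ?_
      · rw [← h]
        congr 2
        funext i
        rcases i with i | i
        · simp
        · fin_cases i <;> simp
      · rw [Matrix.det_fin_two_of]
        have e : (q + pt (.inr 0)) * pt (.inr 2) - (-q + pt (.inr 0)) * pt (.inr 2) =
          2 * (q * pt (.inr 2)) := by ring
        rw [e]
        exact mul_ne_zero two_ne_zero (mul_ne_zero hq hc)
      · ext i j
        fin_cases i <;> fin_cases j <;> simp [Matrix.mul_apply] <;> field_simp <;> ring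
  have h1 : H * X (.inr 2) = 0 := by
    refine MvPolynomial.funext fun pt => ?_
    rw [map_mul, eval_X, map_zero]
    by_cases hc : pt (.inr 2) = 0
    · rw [hc, mul_zero]
    · rw [hgen pt hc, zero_mul]
  rw [(mul_eq_zero.1 h1).resolve_right (X_ne_zero _), map_zero]

end InvariantPolynomials

end DGAlg

namespace DGAlg

/-! ### Graded commutative algebras -/

section GradedCommutative

variable {k : Type u} [Field k] {B : DGAlg k}

theorem IsGradedComm.even_mul (hB : B.IsGradedComm) {a : B} (ha : a ∈ B.gr 0) (b : B) :
    a * b = b * a := by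
  induction b using B.induction_hom with
  | h0 => simp
  | hadd b b' h h' => rw [mul_add, h, h', add_mul]
  | hhom j b hb => simpa using hB 0 j a b ha hb

theorem IsGradedComm.odd_mul (hB : B.IsGradedComm) {e : B} (he : e ∈ B.gr 1) (b : B) :
    e * b = B.sgn b * e := by
  induction b using B.induction_hom with
  | h0 => simp
  | hadd b b' h h' => rw [mul_add, h, h', map_add, add_mul]
  | hhom j b hb =>
    rw [hB 1 j e b he hb, one_mul, B.sgn_of_mem hb, smul_mul_assoc]

theorem sgn_even {a : B} (ha : a ∈ B.gr 0) : B.sgn a = a := by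
  rw [B.sgn_of_mem ha]; simp

theorem sgn_odd {e : B} (he : e ∈ B.gr 1) : B.sgn e = -e := by
  rw [B.sgn_of_mem he]; simp

theorem IsGradedComm.odd_mul_odd (hB : B.IsGradedComm) {e e' : B} (he : e ∈ B.gr 1)
    (he' : e' ∈ B.gr 1) : e * e' = -(e' * e) := by
  rw [hB.odd_mul he, sgn_odd he', neg_mul]

theorem IsGradedComm.odd_sq [CharZero k] (hB : B.IsGradedComm) {e : B} (he : e ∈ B.gr 1) :
    e * e = 0 := by
  have h : (2 : k) • (e * e) = 0 := by
    rw [two_smul]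
    nth_rw 1 [hB.odd_mul_odd he he]
    exact neg_add_cancel _
  exact (smul_eq_zero.1 h).resolve_left two_ne_zero

open scoped IsMulCommutative in
/-- The morphism from a polynomial ring to a graded commutative algebra with prescribed values of
degree `0` on the variables. -/
noncomputable def IsGradedComm.polyHom (hB : B.IsGradedComm) {σ : Type*} (v : σ → B)
    (hv : ∀ i, v i ∈ B.gr 0) : MvPolynomial σ k →ₐ[k] B :=
  have : IsMulCommutative (Algebra.adjoin k (Set.range v)) :=
    Algebra.isMulCommutative_adjoin k (by
      rintro _ ⟨i, rfl⟩ _ ⟨j, rfl⟩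
      exact hB.even_mul (hv i) _)
  (Algebra.adjoin k (Set.range v)).val.comp
    (MvPolynomial.aeval (R := k) (S₁ := Algebra.adjoin k (Set.range v)) fun i =>
      ⟨v i, Algebra.subset_adjoin ⟨i, rfl⟩⟩)

open scoped IsMulCommutative in
theorem IsGradedComm.polyHom_X (hB : B.IsGradedComm) {σ : Type*} (v : σ → B)
    (hv : ∀ i, v i ∈ B.gr 0) (i : σ) : hB.polyHom v hv (MvPolynomial.X i) = v i := by
  have : IsMulCommutative (Algebra.adjoin k (Set.range v)) :=
    Algebra.isMulCommutative_adjoin k (by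
      rintro _ ⟨i, rfl⟩ _ ⟨j, rfl⟩
      exact hB.even_mul (hv i) _)
  exact congrArg (Algebra.adjoin k (Set.range v)).val
    (MvPolynomial.aeval_X (R := k) (S₁ := Algebra.adjoin k (Set.range v))
      (fun i => ⟨v i, Algebra.subset_adjoin ⟨i, rfl⟩⟩) i)

theorem algHom_mem_gr_zero {σ : Type*} (f : MvPolynomial σ k →ₐ[k] B)
    (hf : ∀ i, f (MvPolynomial.X i) ∈ B.gr 0) (p : MvPolynomial σ k) : f p ∈ B.gr 0 := by
  induction p using MvPolynomial.induction_on with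
  | C c =>
    rw [← MvPolynomial.algebraMap_eq, AlgHom.commutes]
    exact SetLike.algebraMap_mem_graded (A := B.gr) c
  | add p q hp hq => rw [map_add]; exact add_mem hp hq
  | mul_X p i hp =>
    rw [map_mul]
    have h := SetLike.GradedMul.mul_mem (A := B.gr) hp (hf i)
    rwa [add_zero] at h

theorem algHom_poly_ext {σ : Type*} {R : Type*} [Semiring R] [Algebra k R]
    {f g : MvPolynomial σ k →ₐ[k] R}
    (h : ∀ i, f (MvPolynomial.X i) = g (MvPolynomial.X i)) : f = g := by
  refine AlgHom.ext fun p => ?_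
  induction p using MvPolynomial.induction_on with
  | C c => rw [← MvPolynomial.algebraMap_eq, AlgHom.commutes, AlgHom.commutes]
  | add p q hp hq => rw [map_add, map_add, hp, hq]
  | mul_X p i hp => rw [map_mul, map_mul, hp, h]

/-- Adjoining an odd element `e` to a subalgebra of a graded commutative algebra: as `e² = 0`, the
elements are the `a + b e`. -/
noncomputable def IsGradedComm.adjoinOdd [CharZero k] (hB : B.IsGradedComm) (A : Subalgebra k B)
    (hA : ∀ a ∈ A, B.sgn a ∈ A) (e : B) (he : e ∈ B.gr 1) : Subalgebra k B where
  carrier := {z | ∃ a ∈ A, ∃ b ∈ A, z = a + b * e}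
  mul_mem' := by
    rintro _ _ ⟨a, ha, b, hb, rfl⟩ ⟨a', ha', b', hb', rfl⟩
    refine ⟨a * a', mul_mem ha ha', a * b' + b * B.sgn a',
      add_mem (mul_mem ha hb') (mul_mem hb (hA _ ha')), ?_⟩
    have h1 : b * e * a' = b * B.sgn a' * e := by rw [mul_assoc, hB.odd_mul he, mul_assoc]
    have h2 : b * e * (b' * e) = 0 := by
      rw [mul_assoc, ← mul_assoc e, hB.odd_mul he, mul_assoc, hB.odd_sq he, mul_zero, mul_zero]
    rw [add_mul, mul_add, mul_add, h1, h2, add_mul, mul_assoc a]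
    abel
  add_mem' := by
    rintro _ _ ⟨a, ha, b, hb, rfl⟩ ⟨a', ha', b', hb', rfl⟩
    exact ⟨a + a', add_mem ha ha', b + b', add_mem hb hb', by rw [add_mul]; abel⟩
  algebraMap_mem' c := ⟨_, A.algebraMap_mem c, 0, zero_mem _, by simp⟩

theorem IsGradedComm.adjoinOdd_sgn [CharZero k] (hB : B.IsGradedComm) (A : Subalgebra k B)
    (hA : ∀ a ∈ A, B.sgn a ∈ A) (e : B) (he : e ∈ B.gr 1) :
    ∀ z ∈ hB.adjoinOdd A hA e he, B.sgn z ∈ hB.adjoinOdd A hA e he := by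
  rintro _ ⟨a, ha, b, hb, rfl⟩
  refine ⟨B.sgn a, hA _ ha, -B.sgn b, neg_mem (hA _ hb), ?_⟩
  rw [map_add, sgn_mul, sgn_odd he, mul_neg, neg_mul]

theorem IsGradedComm.le_adjoinOdd [CharZero k] (hB : B.IsGradedComm) (A : Subalgebra k B)
    (hA : ∀ a ∈ A, B.sgn a ∈ A) (e : B) (he : e ∈ B.gr 1) : A ≤ hB.adjoinOdd A hA e he :=
  fun a ha => ⟨a, ha, 0, zero_mem _, by simp⟩

theorem IsGradedComm.mem_adjoinOdd [CharZero k] (hB : B.IsGradedComm) (A : Subalgebra k B)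
    (hA : ∀ a ∈ A, B.sgn a ∈ A) (e : B) (he : e ∈ B.gr 1) : e ∈ hB.adjoinOdd A hA e he :=
  ⟨0, zero_mem _, 1, one_mem _, by simp⟩

end GradedCommutative

/-! ### Representation algebras of the minimal resolution -/

section MinResRep

variable {k : Type u} [Field k]

/-- The universal property of the algebra underlying `corep S A`, disregarding differentials. -/
noncomputable def corepAlg {S : Pattern k} {A B : DGAlg k} (hB : B.IsGradedComm)
    (f : S.ι → A →ₗ[k] B) (hmem : ∀ s i a, a ∈ A.gr i → f s a ∈ B.gr i)
    (hmul : ∀ s a b, f s (a * b) = ∑ p, f (S.l s p) a * f (S.r s p) b)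
    (hone : ∀ s, f s 1 = algebraMap k B (S.one s)) : corep S A →ₐ[k] B :=
  clift (FreeAlgebra.lift k fun x => f x.2 x.1.2) (by
    have hg : ∀ (i : ℤ) (a : A.gr i) (s : S.ι),
        FreeAlgebra.lift k (fun x : CGen S A => f x.2 (x.1.2 : A)) (cgen i a s) = f s a :=
      fun i a s => FreeAlgebra.lift_ι_apply _ _
    intro x y h
    cases h with
    | add i a b s => rw [map_add, hg, hg, hg]; exact map_add _ _ _
    | smul i c a s => rw [map_smul, hg, hg]; exact map_smul _ _ _
    | mul i j a b s =>
      rw [map_sum, hg]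
      refine (hmul s a b).trans (Finset.sum_congr rfl fun p _ => ?_)
      rw [map_mul, hg, hg]
    | one s => rw [hg, AlgHom.commutes]; exact hone s
    | comm i j a b s t =>
      rw [Units.smul_def, map_zsmul, map_mul, map_mul, hg, hg, ← Units.smul_def]
      exact hB i j _ _ (hmem s i a a.2) (hmem t j b b.2))

theorem corepAlg_coord {S : Pattern k} {A B : DGAlg k} (hB : B.IsGradedComm)
    (f : S.ι → A →ₗ[k] B) (hmem : ∀ s i a, a ∈ A.gr i → f s a ∈ B.gr i)
    (hmul : ∀ s a b, f s (a * b) = ∑ p, f (S.l s p) a * f (S.r s p) b)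
    (hone : ∀ s, f s 1 = algebraMap k B (S.one s)) (s : S.ι) (a : A) :
    corepAlg hB f hmem hmul hone (coord S A s a) = f s a := by
  induction a using A.induction_hom with
  | h0 => simp
  | hadd a a' h h' => rw [map_add, map_add, map_add, h, h']
  | hhom i a ha =>
    lift a to A.gr i using ha
    rw [coord_of_mem]
    exact (clift_cmk _ _ _).trans (FreeAlgebra.lift_ι_apply _ _)

/-- The representation algebras of `k⟨x, y, θ⟩` are generated by the coordinates of `x`, `y`, `θ`. -/
theorem corep_adjoin (S : Pattern k) : Algebra.adjoin k
    (Set.range fun x : S.ι × Gen => coord S (minRes k) x.1 (minResGen k x.2)) = ⊤ := by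
  set A := Algebra.adjoin k
    (Set.range fun x : S.ι × Gen => coord S (minRes k) x.1 (minResGen k x.2))
  have h : ∀ (a : minRes k) (s : S.ι), coord S (minRes k) s a ∈ A := by
    intro a
    induction a using minRes_word_induction with
    | h0 => intro s; rw [map_zero]; exact zero_mem _
    | hadd a b ha hb => intro s; rw [map_add]; exact add_mem (ha s) (hb s)
    | hsmul c a ha => intro s; rw [map_smul]; exact Subalgebra.smul_mem _ (ha s) c
    | hnil => intro s; rw [coord_one]; exact Subalgebra.algebraMap_mem _ _
    | hcons g a ha =>
      intro s
      rw [coord_mul]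
      exact sum_mem fun p _ => mul_mem (Algebra.subset_adjoin ⟨(S.l s p, g), rfl⟩) (ha _)
  refine top_le_iff.1 ?_
  have h1 := adjoin_cgenQ S (minRes k)
  change ⊤ ≤ A
  refine (show (⊤ : Subalgebra k (corep S (minRes k))) = _ from h1.symm).trans_le
    (Algebra.adjoin_le ?_)
  rintro _ ⟨x, rfl⟩
  have h2 := h x.1.2 x.2
  rwa [coord_of_mem] at h2

theorem corep_algHom_ext {S : Pattern k} {R : Type*} [Semiring R] [Algebra k R]
    {f g : corep S (minRes k) →ₐ[k] R}
    (h : ∀ s t, f (coord S (minRes k) s (minResGen k t)) =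
      g (coord S (minRes k) s (minResGen k t))) : f = g := by
  refine AlgHom.ext_of_adjoin_eq_top (corep_adjoin S) ?_
  rintro _ ⟨x, rfl⟩
  exact h x.1 x.2

/-- The representation of `k⟨x, y, θ⟩` with given values on the generators. -/
noncomputable def matAlg {B : DGAlg k} {n : ℕ} (M : Gen → Matrix (Fin n) (Fin n) B) :
    minRes k →ₐ[k] Matrix (Fin n) (Fin n) B :=
  FreeAlgebra.lift k M

theorem matAlg_gen {B : DGAlg k} {n : ℕ} (M : Gen → Matrix (Fin n) (Fin n) B) (g : Gen) :
    matAlg M (minResGen k g) = M g :=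
  FreeAlgebra.lift_ι_apply M g

theorem matAlg_mem {B : DGAlg k} {n : ℕ} (M : Gen → Matrix (Fin n) (Fin n) B)
    (hM : ∀ g i j, M g i j ∈ B.gr g.deg) (i : ℤ) (a : minRes k) (ha : a ∈ (minRes k).gr i)
    (p q : Fin n) : matAlg M a p q ∈ B.gr i := by
  have ha' : a ∈ wordGr (k := k) (minResGen k) Gen.deg i := ha
  induction ha' using Submodule.span_induction generalizing p q with
  | zero => rw [map_zero]; exact zero_mem _
  | add a b ha' hb' h h' => rw [map_add]; exact add_mem (h ha' p q) (h' hb' p q)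
  | smul c a ha' h => rw [map_smul]; exact Submodule.smul_mem _ c (h ha' p q)
  | mem a ha' =>
    obtain ⟨l, rfl, rfl⟩ := ha'
    clear ha
    induction l generalizing p q with
    | nil =>
      change matAlg M (1 : minRes k) p q ∈ B.gr 0
      rw [map_one, Matrix.one_apply]
      split_ifs
      · exact SetLike.GradedOne.one_mem
      · exact zero_mem _
    | cons g l ih =>
      change matAlg M (minResGen k g * (l.map (minResGen k)).prod) p q ∈
        B.gr (g.deg + (l.map Gen.deg).sum)
      rw [map_mul, Matrix.mul_apply, matAlg_gen]
      exact sum_mem fun r _ => SetLike.GradedMul.mul_mem (hM g p r) (ih r q)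

/-- The matrix entries of a representation of `k⟨x, y, θ⟩`. -/
noncomputable def matEntry {B : DGAlg k} {n : ℕ} (M : Gen → Matrix (Fin n) (Fin n) B)
    (s : Fin n × Fin n) : minRes k →ₗ[k] B where
  toFun a := matAlg M a s.1 s.2
  map_add' a b := by rw [map_add, Matrix.add_apply]
  map_smul' c a := by rw [map_smul, Matrix.smul_apply, RingHom.id_apply]

theorem matEntry_mul {B : DGAlg k} {n : ℕ} (M : Gen → Matrix (Fin n) (Fin n) B)
    (s : Fin n × Fin n) (a b : minRes k) :
    matEntry M s (a * b) = ∑ p, matEntry M (s.1, p) a * matEntry M (p, s.2) b := by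
  change matAlg M (a * b) s.1 s.2 = _
  rw [map_mul, Matrix.mul_apply]
  rfl

theorem matEntry_one {B : DGAlg k} {n : ℕ} (M : Gen → Matrix (Fin n) (Fin n) B)
    (s : Fin n × Fin n) : matEntry M s 1 = algebraMap k B (if s.1 = s.2 then 1 else 0) := by
  change matAlg M 1 s.1 s.2 = _
  rw [map_one, Matrix.one_apply]
  split_ifs <;> simp

/-- The algebra morphism out of the `n`-th representation algebra of `k⟨x, y, θ⟩` given by the
images of the generic matrices. -/
noncomputable def repAlg {B : DGAlg k} (hB : B.IsGradedComm) {n : ℕ}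
    (M : Gen → Matrix (Fin n) (Fin n) B) (hM : ∀ g i j, M g i j ∈ B.gr g.deg) :
    rep n (minRes k) →ₐ[k] B :=
  corepAlg hB (S := matPattern k n) (A := minRes k) (matEntry M)
    (fun s i a ha => matAlg_mem M hM i a ha s.1 s.2)
    (matEntry_mul M) (matEntry_one M)

theorem repAlg_coord {B : DGAlg k} (hB : B.IsGradedComm) {n : ℕ}
    (M : Gen → Matrix (Fin n) (Fin n) B) (hM : ∀ g i j, M g i j ∈ B.gr g.deg)
    (s : Fin n × Fin n) (g : Gen) :
    repAlg hB M hM (coord (matPattern k n) (minRes k) s (minResGen k g)) = M g s.1 s.2 := by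
  have h := corepAlg_coord hB (S := matPattern k n) (A := minRes k) (matEntry M)
    (fun s i a ha => matAlg_mem M hM i a ha s.1 s.2) (matEntry_mul M) (matEntry_one M) s
    (minResGen k g)
  refine Eq.trans h ?_
  change matAlg M (minResGen k g) s.1 s.2 = _
  rw [matAlg_gen]

end MinResRep

/-! ### Coefficients in `k[x_1, …, x_n, y_1, …, y_n, θ_1, …, θ_n]` -/

section Coefficients

variable {k : Type u} [Field k] {n : ℕ}

/-- The inclusion of the polynomial ring. -/
noncomputable def polyIncl (k : Type u) [Field k] (n : ℕ) :
    MvPolynomial (Fin n ⊕ Fin n) k →ₐ[k] polyTheta k n :=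
  Algebra.TensorProduct.includeLeft

theorem polyIncl_mem (p : MvPolynomial (Fin n ⊕ Fin n) k) :
    polyIncl k n p ∈ (polyTheta k n).gr 0 := by
  refine algHom_mem_gr_zero (polyIncl k n) (fun i => ?_) p
  rcases i with i | i
  · exact polyVar_mem k n i .x
  · exact polyVar_mem k n i .y

/-- The odd variable `θ_i`. -/
noncomputable def thetaVar (k : Type u) [Field k] (n : ℕ) (i : Fin n) : polyTheta k n :=
  polyVar k n i .θ

theorem thetaVar_mem (i : Fin n) : thetaVar k n i ∈ (polyTheta k n).gr 1 :=
  polyVar_mem k n i .θ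

/-- The augmentation sending all `θ_i` to `0`. -/
noncomputable def polyAug (k : Type u) [Field k] (n : ℕ) :
    polyTheta k n →ₐ[k] MvPolynomial (Fin n ⊕ Fin n) k :=
  (Algebra.TensorProduct.rid k k (MvPolynomial (Fin n ⊕ Fin n) k)).toAlgHom.comp
    (Algebra.TensorProduct.map (AlgHom.id k _) ExteriorAlgebra.algebraMapInv)

theorem polyAug_incl (p : MvPolynomial (Fin n ⊕ Fin n) k) :
    polyAug k n (polyIncl k n p) = p := by
  change (Algebra.TensorProduct.rid k k (MvPolynomial (Fin n ⊕ Fin n) k))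
    (Algebra.TensorProduct.map (AlgHom.id k _) ExteriorAlgebra.algebraMapInv (p ⊗ₜ[k] 1)) = p
  simp

theorem polyAug_theta (i : Fin n) : polyAug k n (thetaVar k n i) = 0 := by
  change (Algebra.TensorProduct.rid k k (MvPolynomial (Fin n ⊕ Fin n) k))
    (Algebra.TensorProduct.map (AlgHom.id k _) ExteriorAlgebra.algebraMapInv
      (1 ⊗ₜ[k] ExteriorAlgebra.ι k (Pi.single i 1))) = 0
  simp [ExteriorAlgebra.algebraMapInv]

/-- The partial derivative with respect to `θ_i`, given by left contraction in the exterior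
algebra. -/
noncomputable def thetaDer (k : Type u) [Field k] {n : ℕ} (i : Fin n) :
    polyTheta k n →ₗ[k] polyTheta k n :=
  LinearMap.lTensor (MvPolynomial (Fin n ⊕ Fin n) k)
    (CliffordAlgebra.contractLeft (Q := (0 : QuadraticForm k (Fin n → k)))
      (LinearMap.proj i))

theorem lTensor_left_mul {R V : Type*} [CommRing R] [Algebra k R] [Ring V] [Algebra k V]
    (f : V →ₗ[k] V) (p : R) (z : R ⊗[k] V) :
    LinearMap.lTensor R f ((p ⊗ₜ[k] (1 : V)) * z) =
      (p ⊗ₜ[k] (1 : V)) * LinearMap.lTensor R f z := by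
  induction z using TensorProduct.induction_on with
  | zero => simp
  | tmul q v => simp
  | add x y h h' => rw [mul_add, map_add, h, h', map_add, mul_add]

theorem lTensor_right_mul {R V : Type*} [CommRing R] [Algebra k R] [Ring V] [Algebra k V]
    (f : V →ₗ[k] V) (e : V) (c : k) (h : ∀ v, f (e * v) = c • v - e * f v) (z : R ⊗[k] V) :
    LinearMap.lTensor R f (((1 : R) ⊗ₜ[k] e) * z) =
      c • z - ((1 : R) ⊗ₜ[k] e) * LinearMap.lTensor R f z := by
  induction z using TensorProduct.induction_on with
  | zero => simp
  | tmul q v => simp [h, TensorProduct.tmul_sub]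
  | add x y h h' => rw [mul_add, map_add, h, h', map_add, mul_add, smul_add]; abel

theorem thetaDer_incl_mul (i : Fin n) (p : MvPolynomial (Fin n ⊕ Fin n) k) (z : polyTheta k n) :
    thetaDer k i (polyIncl k n p * z) = polyIncl k n p * thetaDer k i z :=
  lTensor_left_mul _ p z

theorem thetaDer_theta_mul (i j : Fin n) (z : polyTheta k n) :
    thetaDer k i (thetaVar k n j * z) =
      (if i = j then (1 : k) else 0) • z - thetaVar k n j * thetaDer k i z :=
  lTensor_right_mul _ (ExteriorAlgebra.ι k (Pi.single j 1)) _ (fun v => by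
    refine (CliffordAlgebra.contractLeft_ι_mul (Q := (0 : QuadraticForm k (Fin n → k)))
      (d := LinearMap.proj i) (Pi.single j 1) v).trans ?_
    congr 2
    simp [Pi.single_apply]) z

theorem thetaDer_one (i : Fin n) : thetaDer k i (1 : polyTheta k n) = 0 := by
  change LinearMap.lTensor _ _ (1 ⊗ₜ[k] 1 : PolyTheta k n) = 0
  rw [LinearMap.lTensor_tmul, CliffordAlgebra.contractLeft_one, TensorProduct.tmul_zero]

theorem thetaDer_incl (i : Fin n) (p : MvPolynomial (Fin n ⊕ Fin n) k) :
    thetaDer k i (polyIncl k n p) = 0 := by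
  have h := thetaDer_incl_mul i p 1
  rwa [mul_one, thetaDer_one, mul_zero] at h

theorem thetaDer_theta (i j : Fin n) :
    thetaDer k i (thetaVar k n j) = (if i = j then (1 : k) else 0) • 1 := by
  have h := thetaDer_theta_mul (k := k) i j 1
  rwa [mul_one, thetaDer_one, mul_zero, sub_zero] at h

end Coefficients

end DGAlg

namespace DGAlg

/-! ### The Koszul complex of the commuting scheme of `2 × 2` matrices -/

section Koszul

open MvPolynomial

variable (k : Type u) [Field k]

/-- The entries of the generic matrices of the second representation algebra of `k⟨x, y, θ⟩`. -/
noncomputable def repGen (i j : Fin 2) (g : Gen) : rep 2 (minRes k) :=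
  coord (matPattern k 2) (minRes k) (i, j) (minResGen k g)

theorem repGen_mem (i j : Fin 2) (g : Gen) : repGen k i j g ∈ (rep 2 (minRes k)).gr g.deg :=
  coord_mem (S := matPattern k 2) (i, j) _ _ (minResGen_mem g)

theorem rep_comm : (rep 2 (minRes k)).IsGradedComm := corep_isGradedComm _ _

/-- The coordinates `(M_{11} + M_{22}) / 2, (M_{11} - M_{22}) / 2, M_{12}, M_{21}` of the generic
matrix `M` with index `g`. -/
noncomputable def repCoord (g : Gen) : Fin 4 → rep 2 (minRes k) :=
  ![(1 / 2 : k) • (repGen k 0 0 g + repGen k 1 1 g), (1 / 2 : k) • (repGen k 0 0 g - repGen k 1 1 g),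
    repGen k 0 1 g, repGen k 1 0 g]

theorem repCoord_mem (g : Gen) (i : Fin 4) : repCoord k g i ∈ (rep 2 (minRes k)).gr g.deg := by
  fin_cases i
  · exact Submodule.smul_mem _ _ (add_mem (repGen_mem k 0 0 g) (repGen_mem k 1 1 g))
  · exact Submodule.smul_mem _ _ (sub_mem (repGen_mem k 0 0 g) (repGen_mem k 1 1 g))
  · exact repGen_mem k 0 1 g
  · exact repGen_mem k 1 0 g

/-- The inclusion of the coordinate ring of pairs of matrices as the subalgebra generated by the
entries of `x` and `y`. -/
noncomputable def repIncl : PairPoly k →ₐ[k] rep 2 (minRes k) :=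
  (rep_comm k).polyHom (Sum.elim (repCoord k .x) (repCoord k .y)) (by
    rintro (i | i)
    · exact repCoord_mem k .x i
    · exact repCoord_mem k .y i)

theorem repIncl_px (i : Fin 4) : repIncl k (px k i) = repCoord k .x i :=
  IsGradedComm.polyHom_X _ _ _ _

theorem repIncl_py (i : Fin 4) : repIncl k (py k i) = repCoord k .y i :=
  IsGradedComm.polyHom_X _ _ _ _

theorem repIncl_mem (p : PairPoly k) : repIncl k p ∈ (rep 2 (minRes k)).gr 0 := by
  refine algHom_mem_gr_zero (repIncl k) (fun i => ?_) p
  rcases i with i | i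
  · exact (repIncl_px k i).symm ▸ repCoord_mem k .x i
  · exact (repIncl_py k i).symm ▸ repCoord_mem k .y i

noncomputable instance : Algebra (PairPoly k) (rep 2 (minRes k)) :=
  (repIncl k).toRingHom.toAlgebra' fun p z => (rep_comm k).even_mul (repIncl_mem k p) z

variable {k}

theorem rep_smul_def (p : PairPoly k) (z : rep 2 (minRes k)) : p • z = repIncl k p * z :=
  Algebra.smul_def p z

theorem rep_C_smul (c : k) (z : rep 2 (minRes k)) : (C c : PairPoly k) • z = c • z := by
  rw [rep_smul_def, ← algebraMap_eq, AlgHom.commutes, Algebra.smul_def]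

theorem rep_d_smul (p : PairPoly k) (z : rep 2 (minRes k)) :
    (rep 2 (minRes k)).d (p • z) = p • (rep 2 (minRes k)).d z := by
  have h : ∀ p : PairPoly k, (rep 2 (minRes k)).d (repIncl k p) = 0 := by
    have hx : ∀ i, (rep 2 (minRes k)).d (repIncl k (X i)) = 0 := by
      have hg : ∀ i j g, (minRes k).d (minResGen k g) = 0 →
          (rep 2 (minRes k)).d (repGen k i j g) = 0 := fun i j g hg => by
        rw [repGen, ← coord_d, hg, map_zero]
      have hc : ∀ i g, (minRes k).d (minResGen k g) = 0 →
          (rep 2 (minRes k)).d (repCoord k g i) = 0 := fun i g h => by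
        fin_cases i <;> simp [repCoord, hg _ _ g h]
      rintro (i | i)
      · exact (repIncl_px k i).symm ▸ hc i .x minRes_d_x
      · exact (repIncl_py k i).symm ▸ hc i .y minRes_d_y
    intro p
    induction p using MvPolynomial.induction_on with
    | C c => rw [← algebraMap_eq, AlgHom.commutes, d_algebraMap]
    | add p q hp hq => rw [map_add, map_add, hp, hq, add_zero]
    | mul_X p i hp => rw [map_mul, d_mul, hp, hx, zero_mul, mul_zero, add_zero]
  rw [rep_smul_def, rep_smul_def, d_mul, h, zero_mul, zero_add, sgn_even (repIncl_mem k p)]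

variable (k)

/-- The odd generators `η_0, η_1, η_2, η_3`: `η_0` is half the trace of `θ`, and the differentials
of `η_1`, `η_2`, `η_3` are the minors of the matrix with rows `x_1, x_2, x_3` and
`y_1, y_2, y_3`. -/
noncomputable def repEta : Fin 4 → rep 2 (minRes k) :=
  ![(1 / 2 : k) • (repGen k 0 0 .θ + repGen k 1 1 .θ),
    -((1 / 2 : k) • (repGen k 0 0 .θ - repGen k 1 1 .θ)),
    -((1 / 2 : k) • repGen k 1 0 .θ), -((1 / 2 : k) • repGen k 0 1 .θ)]

theorem repEta_mem (i : Fin 4) : repEta k i ∈ (rep 2 (minRes k)).gr 1 := by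
  fin_cases i
  · exact Submodule.smul_mem _ _ (add_mem (repGen_mem k 0 0 .θ) (repGen_mem k 1 1 .θ))
  · exact neg_mem (Submodule.smul_mem _ _ (sub_mem (repGen_mem k 0 0 .θ) (repGen_mem k 1 1 .θ)))
  · exact neg_mem (Submodule.smul_mem _ _ (repGen_mem k 1 0 .θ))
  · exact neg_mem (Submodule.smul_mem _ _ (repGen_mem k 0 1 .θ))

theorem repEta_mul (i j : Fin 4) : repEta k i * repEta k j = -(repEta k j * repEta k i) :=
  (rep_comm k).odd_mul_odd (repEta_mem k i) (repEta_mem k j)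

theorem repEta_mul_mul (i j : Fin 4) (z : rep 2 (minRes k)) :
    repEta k i * (repEta k j * z) = -(repEta k j * (repEta k i * z)) := by
  rw [← mul_assoc, repEta_mul, neg_mul, mul_assoc]

theorem repEta_sq [CharZero k] (i : Fin 4) : repEta k i * repEta k i = 0 :=
  (rep_comm k).odd_sq (repEta_mem k i)

theorem repEta_sq_mul [CharZero k] (i : Fin 4) (z : rep 2 (minRes k)) :
    repEta k i * (repEta k i * z) = 0 := by
  rw [← mul_assoc, repEta_sq, zero_mul]

section Generators

variable [CharZero k]

theorem repGen_x (i j : Fin 2) :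
    repGen k i j .x = ptMat (px k) i j • (1 : rep 2 (minRes k)) := by
  fin_cases i <;> fin_cases j <;>
    simp [ptMat, rep_smul_def, repIncl_px, repCoord, ← smul_add, ← smul_sub]
  · module
  · module

theorem repGen_y (i j : Fin 2) :
    repGen k i j .y = ptMat (py k) i j • (1 : rep 2 (minRes k)) := by
  fin_cases i <;> fin_cases j <;>
    simp [ptMat, rep_smul_def, repIncl_py, repCoord, ← smul_add, ← smul_sub]
  · module
  · module

theorem repGen_θ (i j : Fin 2) : repGen k i j .θ =
    !![repEta k 0 - repEta k 1, -((2 : k) • repEta k 3);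
      -((2 : k) • repEta k 2), repEta k 0 + repEta k 1] i j := by
  fin_cases i <;> fin_cases j <;> simp [repEta] <;> module

theorem repGen_d_θ (i j : Fin 2) : (rep 2 (minRes k)).d (repGen k i j .θ) =
    (-(ptMat (px k) * ptMat (py k) - ptMat (py k) * ptMat (px k)) i j) •
      (1 : rep 2 (minRes k)) := by
  rw [repGen, ← coord_d, minRes_d_θ, map_neg, map_sub, coord_mul, coord_mul]
  change -(∑ p, repGen k i p .x * repGen k p j .y - ∑ p, repGen k i p .y * repGen k p j .x) = _
  simp only [repGen_x, repGen_y, smul_mul_smul_comm, mul_one, ← Finset.sum_smul, ← sub_smul,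
    ← neg_smul, Matrix.sub_apply, Matrix.mul_apply]

theorem repEta_d_zero : (rep 2 (minRes k)).d (repEta k 0) = 0 := by
  have h : (rep 2 (minRes k)).d (repEta k 0) = (1 / 2 : k) • ((rep 2 (minRes k)).d (repGen k 0 0 .θ) +
    (rep 2 (minRes k)).d (repGen k 1 1 .θ)) := by
    rw [← map_add, ← map_smul]; rfl
  rw [h, repGen_d_θ, repGen_d_θ, ← add_smul]
  have e : -(ptMat (px k) * ptMat (py k) - ptMat (py k) * ptMat (px k)) 0 0 +
    -(ptMat (px k) * ptMat (py k) - ptMat (py k) * ptMat (px k)) 1 1 = 0 := by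
    simp [ptMat]; ring
  rw [e, zero_smul, smul_zero]

theorem half_smul_eq {p q : PairPoly k} (h : p = 2 * q) :
    (1 / 2 : k) • (p • (1 : rep 2 (minRes k))) = q • 1 := by
  have e : (C (1 / 2) * 2 : PairPoly k) = 1 := by
    rw [show (2 : PairPoly k) = C 2 from (map_ofNat C 2).symm, ← C_mul]
    norm_num
  rw [← rep_C_smul, smul_smul, h, ← mul_assoc, e, one_mul]

theorem repEta_d_one : (rep 2 (minRes k)).d (repEta k 1) = minor k 2 3 • 1 := by
  have h : (rep 2 (minRes k)).d (repEta k 1) = -((1 / 2 : k) • ((rep 2 (minRes k)).d (repGen k 0 0 .θ) -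
    (rep 2 (minRes k)).d (repGen k 1 1 .θ))) := by
    rw [← map_sub, ← map_smul, ← map_neg]; rfl
  rw [h, repGen_d_θ, repGen_d_θ, ← sub_smul, ← smul_neg, ← neg_smul]
  refine half_smul_eq k ?_
  simp [ptMat, minor]; ring

theorem repEta_d_two : (rep 2 (minRes k)).d (repEta k 2) = minor k 3 1 • 1 := by
  have h : (rep 2 (minRes k)).d (repEta k 2) =
      -((1 / 2 : k) • ((rep 2 (minRes k)).d (repGen k 1 0 .θ))) := by
    rw [← map_smul, ← map_neg]; rfl
  rw [h, repGen_d_θ, ← smul_neg, ← neg_smul]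
  refine half_smul_eq k ?_
  simp [ptMat, minor]; ring

theorem repEta_d_three : (rep 2 (minRes k)).d (repEta k 3) = minor k 1 2 • 1 := by
  have h : (rep 2 (minRes k)).d (repEta k 3) =
      -((1 / 2 : k) • ((rep 2 (minRes k)).d (repGen k 0 1 .θ))) := by
    rw [← map_smul, ← map_neg]; rfl
  rw [h, repGen_d_θ, ← smul_neg, ← neg_smul]
  refine half_smul_eq k ?_
  simp [ptMat, minor]; ring

end Generators

/-- The element of the Koszul complex with given coefficients at `1`, `η_1`, `η_2`, `η_3`,
`η_2 η_3`, `η_3 η_1`, `η_1 η_2`, `η_1 η_2 η_3`. -/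
noncomputable def koszul (f : Fin 8 → PairPoly k) : rep 2 (minRes k) :=
  f 0 • 1 + f 1 • repEta k 1 + f 2 • repEta k 2 + f 3 • repEta k 3 +
    f 4 • (repEta k 2 * repEta k 3) + f 5 • (repEta k 3 * repEta k 1) +
    f 6 • (repEta k 1 * repEta k 2) + f 7 • (repEta k 1 * (repEta k 2 * repEta k 3))

/-- The Koszul differential on coefficients, in the order of `koszul`. -/
noncomputable def koszulDiff (f : Fin 8 → PairPoly k) : Fin 8 → PairPoly k :=
  ![f 1 * minor k 2 3 + f 2 * minor k 3 1 + f 3 * minor k 1 2,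
    f 5 * minor k 1 2 - f 6 * minor k 3 1, f 6 * minor k 2 3 - f 4 * minor k 1 2,
    f 4 * minor k 3 1 - f 5 * minor k 2 3,
    f 7 * minor k 2 3, f 7 * minor k 3 1, f 7 * minor k 1 2, 0]

variable {k}

theorem rep_d_eta_mul [CharZero k] (i : Fin 4) (z : rep 2 (minRes k)) :
    (rep 2 (minRes k)).d (repEta k i * z) =
      (rep 2 (minRes k)).d (repEta k i) * z - repEta k i * (rep 2 (minRes k)).d z := by
  rw [d_mul, sgn_odd (repEta_mem k i), neg_mul, sub_eq_add_neg]

theorem koszul_d [CharZero k] (f : Fin 8 → PairPoly k) :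
    (rep 2 (minRes k)).d (koszul k f) = koszul k (koszulDiff k f) := by
  simp only [koszul, map_add, rep_d_smul, rep_d_eta_mul, repEta_d_one, repEta_d_two,
    repEta_d_three, d_one, smul_mul_assoc, mul_smul_comm, one_mul, mul_one, koszulDiff,
    Matrix.cons_val, mul_sub, repEta_mul k 3 1, map_neg, smul_neg]
  module

theorem koszul_add (f g : Fin 8 → PairPoly k) : koszul k (f + g) = koszul k f + koszul k g := by
  simp only [koszul, Pi.add_apply]; module

theorem koszul_neg (f : Fin 8 → PairPoly k) : koszul k (-f) = -koszul k f := by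
  simp only [koszul, Pi.neg_apply]; module

theorem koszul_sub (f g : Fin 8 → PairPoly k) : koszul k (f - g) = koszul k f - koszul k g := by
  rw [sub_eq_add_neg, koszul_add, koszul_neg, sub_eq_add_neg]

theorem rep_d_mul_eta_zero [CharZero k] (z : rep 2 (minRes k)) :
    (rep 2 (minRes k)).d (z * repEta k 0) = (rep 2 (minRes k)).d z * repEta k 0 := by
  rw [d_mul, repEta_d_zero, mul_zero, add_zero]

/-- Normal form: the representation algebra is spanned over the coordinate ring of pairs of
matrices by the products of the odd generators. -/
theorem exists_koszul [CharZero k] (z : rep 2 (minRes k)) :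
    ∃ f g, z = koszul k f + koszul k g * repEta k 0 := by
  have hB := rep_comm k
  have h0 : ∀ a ∈ (repIncl k).range, (rep 2 (minRes k)).sgn a ∈ (repIncl k).range := by
    rintro _ ⟨p, rfl⟩
    exact ⟨p, (sgn_even (repIncl_mem k p)).symm⟩
  have h1 := hB.adjoinOdd_sgn _ h0 _ (repEta_mem k 1)
  have h2 := hB.adjoinOdd_sgn _ h1 _ (repEta_mem k 2)
  have h3 := hB.adjoinOdd_sgn _ h2 _ (repEta_mem k 3)
  have hl1 := hB.le_adjoinOdd _ h0 _ (repEta_mem k 1)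
  have hl2 := hB.le_adjoinOdd _ h1 _ (repEta_mem k 2)
  have hl3 := hB.le_adjoinOdd _ h2 _ (repEta_mem k 3)
  have hl4 := hB.le_adjoinOdd _ h3 _ (repEta_mem k 0)
  have hm1 := hB.mem_adjoinOdd _ h0 _ (repEta_mem k 1)
  have hm2 := hB.mem_adjoinOdd _ h1 _ (repEta_mem k 2)
  have hm3 := hB.mem_adjoinOdd _ h2 _ (repEta_mem k 3)
  have hm4 := hB.mem_adjoinOdd _ h3 _ (repEta_mem k 0)
  have hz : z ∈ hB.adjoinOdd _ h3 _ (repEta_mem k 0) := by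
    refine (corep_adjoin (k := k) (matPattern k 2)).symm.trans_le (Algebra.adjoin_le ?_)
      (Algebra.mem_top (R := k) (x := z))
    have hp : ∀ p : PairPoly k, p • (1 : rep 2 (minRes k)) ∈ hB.adjoinOdd _ h3 _ (repEta_mem k 0) :=
      fun p => by
        rw [rep_smul_def, mul_one]
        exact hl4 (hl3 (hl2 (hl1 ⟨p, rfl⟩)))
    rintro _ ⟨⟨⟨i, j⟩, g⟩, rfl⟩
    change repGen k i j g ∈ hB.adjoinOdd _ h3 _ (repEta_mem k 0)
    cases g with
    | x => rw [repGen_x]; exact hp _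
    | y => rw [repGen_y]; exact hp _
    | θ =>
      have e1 := hl4 (hl3 (hl2 hm1))
      have e2 := hl4 (hl3 hm2)
      have e3 := hl4 hm3
      rw [repGen_θ]
      fin_cases i <;> fin_cases j
      · exact sub_mem hm4 e1
      · exact neg_mem (Subalgebra.smul_mem _ e3 _)
      · exact neg_mem (Subalgebra.smul_mem _ e2 _)
      · exact add_mem hm4 e1
  have key : ∀ a ∈ hB.adjoinOdd _ h2 _ (repEta_mem k 3), ∃ f, a = koszul k f := by
    rintro _ ⟨_, ⟨_, ⟨_, ⟨p1, rfl⟩, _, ⟨p2, rfl⟩, rfl⟩, _, ⟨_, ⟨p3, rfl⟩, _, ⟨p4, rfl⟩, rfl⟩, rfl⟩,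
      _, ⟨_, ⟨_, ⟨p5, rfl⟩, _, ⟨p6, rfl⟩, rfl⟩, _, ⟨_, ⟨p7, rfl⟩, _, ⟨p8, rfl⟩, rfl⟩, rfl⟩, rfl⟩
    refine ⟨![p1, p2, p3, p5, p7, -p6, p4, p8], ?_⟩
    have e : ∀ p : PairPoly k, (repIncl k).toRingHom p = p • (1 : rep 2 (minRes k)) := fun p => by
      rw [rep_smul_def, mul_one]; rfl
    rw [e, e, e, e, e, e, e, e]
    simp only [koszul, Matrix.cons_val, repEta_mul k 3 1, add_mul, smul_mul_assoc, one_mul,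
      mul_assoc]
    module
  obtain ⟨a, ha, b, hb, rfl⟩ := hz
  obtain ⟨f, rfl⟩ := key a ha
  obtain ⟨g, rfl⟩ := key b hb
  exact ⟨f, g, rfl⟩

variable (k)

/-- The comparison map with `k[x_0, …, y_3] ⊗ Λ(θ_0, …, θ_3)`, sending `η_i` to `θ_i`; it ignores
the differentials. -/
noncomputable def repToPoly : rep 2 (minRes k) →ₐ[k] polyTheta k 4 :=
  repAlg (polyTheta_isGradedComm k 4)
    (fun g => match g with
      | .x => ptMat fun i => polyIncl k 4 (px k i)
      | .y => ptMat fun i => polyIncl k 4 (py k i)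
      | .θ => !![thetaVar k 4 0 - thetaVar k 4 1, -((2 : k) • thetaVar k 4 3);
          -((2 : k) • thetaVar k 4 2), thetaVar k 4 0 + thetaVar k 4 1])
    (fun g i j => by
      have hp : ∀ i, polyIncl k 4 (px k i) ∈ (polyTheta k 4).gr 0 := fun i => polyIncl_mem _
      have hq : ∀ i, polyIncl k 4 (py k i) ∈ (polyTheta k 4).gr 0 := fun i => polyIncl_mem _
      have ht : ∀ i, thetaVar k 4 i ∈ (polyTheta k 4).gr 1 := thetaVar_mem
      cases g with
      | x =>
        fin_cases i <;> fin_cases j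
        · exact add_mem (hp 0) (hp 1)
        · exact hp 2
        · exact hp 3
        · exact sub_mem (hp 0) (hp 1)
      | y =>
        fin_cases i <;> fin_cases j
        · exact add_mem (hq 0) (hq 1)
        · exact hq 2
        · exact hq 3
        · exact sub_mem (hq 0) (hq 1)
      | θ =>
        fin_cases i <;> fin_cases j
        · exact sub_mem (ht 0) (ht 1)
        · exact neg_mem (Submodule.smul_mem _ _ (ht 3))
        · exact neg_mem (Submodule.smul_mem _ _ (ht 2))
        · exact add_mem (ht 0) (ht 1))

variable {k}

theorem repToPoly_gen (i j : Fin 2) (g : Gen) : repToPoly k (repGen k i j g) =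
    (match g with
      | .x => ptMat fun i => polyIncl k 4 (px k i)
      | .y => ptMat fun i => polyIncl k 4 (py k i)
      | .θ => !![thetaVar k 4 0 - thetaVar k 4 1, -((2 : k) • thetaVar k 4 3);
          -((2 : k) • thetaVar k 4 2), thetaVar k 4 0 + thetaVar k 4 1] :
      Matrix (Fin 2) (Fin 2) (polyTheta k 4)) i j :=
  repAlg_coord _ _ _ (i, j) g

theorem repToPoly_smul [CharZero k] (p : PairPoly k) (z : rep 2 (minRes k)) :
    repToPoly k (p • z) = polyIncl k 4 p * repToPoly k z := by
  have h : (repToPoly k).comp (repIncl k) = polyIncl k 4 := by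
    refine algHom_poly_ext fun i => ?_
    rw [AlgHom.comp_apply]
    rcases i with i | i
    · rw [repIncl_px]
      fin_cases i <;> simp [repCoord, repToPoly_gen, ptMat] <;> module
    · rw [repIncl_py]
      fin_cases i <;> simp [repCoord, repToPoly_gen, ptMat] <;> module
  rw [rep_smul_def, map_mul, ← h]
  rfl

theorem repToPoly_eta [CharZero k] (i : Fin 4) : repToPoly k (repEta k i) = thetaVar k 4 i := by
  fin_cases i <;> simp [repEta, repToPoly_gen] <;> module

/-- The normal form is unique. -/
theorem koszul_eq_zero [CharZero k] {f g : Fin 8 → PairPoly k}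
    (h : koszul k f + koszul k g * repEta k 0 = 0) : f = 0 ∧ g = 0 := by
  have h1 := congrArg (repToPoly k) h
  simp only [koszul, map_add, map_mul, repToPoly_smul, repToPoly_eta, map_zero, map_one,
    add_mul, mul_assoc, mul_one] at h1
  -- the coefficients are recovered by partial derivatives followed by the augmentation
  have d1 := congrArg (thetaDer k (1 : Fin 4)) h1
  simp [thetaDer_incl_mul, thetaDer_theta_mul, thetaDer_theta, thetaDer_incl] at d1
  have d2 := congrArg (thetaDer k (2 : Fin 4)) h1
  simp [thetaDer_incl_mul, thetaDer_theta_mul, thetaDer_theta, thetaDer_incl] at d2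
  have d3 := congrArg (thetaDer k (3 : Fin 4)) h1
  simp [thetaDer_incl_mul, thetaDer_theta_mul, thetaDer_theta, thetaDer_incl] at d3
  have d12 := congrArg (thetaDer k (2 : Fin 4)) d1
  simp [thetaDer_incl_mul, thetaDer_theta_mul, thetaDer_theta, thetaDer_incl] at d12
  have d13 := congrArg (thetaDer k (3 : Fin 4)) d1
  simp [thetaDer_incl_mul, thetaDer_theta_mul, thetaDer_theta, thetaDer_incl] at d13
  have d23 := congrArg (thetaDer k (3 : Fin 4)) d2
  simp [thetaDer_incl_mul, thetaDer_theta_mul, thetaDer_theta, thetaDer_incl] at d23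
  have d123 := congrArg (thetaDer k (3 : Fin 4)) d12
  simp [thetaDer_incl_mul, thetaDer_theta_mul, thetaDer_theta, thetaDer_incl] at d123
  have e := congrArg (thetaDer k (0 : Fin 4)) h1
  simp [thetaDer_incl_mul, thetaDer_theta_mul, thetaDer_theta, thetaDer_incl] at e
  have e1 := congrArg (thetaDer k (0 : Fin 4)) d1
  simp [thetaDer_incl_mul, thetaDer_theta_mul, thetaDer_theta, thetaDer_incl] at e1
  have e2 := congrArg (thetaDer k (0 : Fin 4)) d2
  simp [thetaDer_incl_mul, thetaDer_theta_mul, thetaDer_theta, thetaDer_incl] at e2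
  have e3 := congrArg (thetaDer k (0 : Fin 4)) d3
  simp [thetaDer_incl_mul, thetaDer_theta_mul, thetaDer_theta, thetaDer_incl] at e3
  have e12 := congrArg (thetaDer k (0 : Fin 4)) d12
  simp [thetaDer_incl_mul, thetaDer_theta_mul, thetaDer_theta, thetaDer_incl] at e12
  have e13 := congrArg (thetaDer k (0 : Fin 4)) d13
  simp [thetaDer_incl_mul, thetaDer_theta_mul, thetaDer_theta, thetaDer_incl] at e13
  have e23 := congrArg (thetaDer k (0 : Fin 4)) d23
  simp [thetaDer_incl_mul, thetaDer_theta_mul, thetaDer_theta, thetaDer_incl] at e23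
  have e123 := congrArg (thetaDer k (0 : Fin 4)) d123
  simp [thetaDer_incl_mul, thetaDer_theta, thetaDer_incl] at e123
  have hc : ∀ {z : polyTheta k 4}, z = 0 → polyAug k 4 z = 0 := fun h => by rw [h, map_zero]
  replace h1 := hc h1
  replace d1 := hc d1
  replace d2 := hc d2
  replace d3 := hc d3
  replace d23 := hc d23
  replace d13 := hc d13
  replace d12 := hc d12
  replace d123 := hc d123
  replace e := hc e
  replace e1 := hc e1
  replace e2 := hc e2
  replace e3 := hc e3
  replace e23 := hc e23
  replace e13 := hc e13
  replace e12 := hc e12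
  replace e123 := hc e123
  simp only [map_add, map_neg, map_mul, polyAug_incl, polyAug_theta, mul_zero, add_zero, neg_zero,
    neg_eq_zero] at h1 d1 d2 d3 d23 d13 d12 d123 e e1 e2 e3 e23 e13 e12 e123
  constructor
  · funext i
    fin_cases i <;> assumption
  · funext i
    fin_cases i <;> assumption

theorem koszul_injective [CharZero k] {f g f' g' : Fin 8 → PairPoly k}
    (h : koszul k f + koszul k g * repEta k 0 = koszul k f' + koszul k g' * repEta k 0) :
    f = f' ∧ g = g' := by
  have h1 := koszul_eq_zero (f := f - f') (g := g - g') (by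
    rw [koszul_sub, koszul_sub, sub_mul, sub_add_sub_comm, h, sub_self])
  exact ⟨sub_eq_zero.1 h1.1, sub_eq_zero.1 h1.2⟩

end Koszul

end DGAlg

namespace DGAlg

/-! ### Conjugation on the Koszul complex -/

section Conjugation

open MvPolynomial

variable {k : Type u} [Field k]

theorem glAct_coord (n : ℕ) (A : DGAlg k) (g : GL (Fin n) k) (s : Fin n × Fin n) (a : A) :
    glAct n A g (coord (matPattern k n) A s a) =
      ∑ q, ∑ p, ((g : Matrix (Fin n) (Fin n) k) s.1 p *
        ((g⁻¹ : GL (Fin n) k) : Matrix (Fin n) (Fin n) k) q s.2) • coord (matPattern k n) A (p, q) a := by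
  rw [glAct, corepLift_coord]
  simp [conjPoint]

/-- Traces of the universal representation are invariant. -/
theorem glAct_trace (n : ℕ) (A : DGAlg k) (g : GL (Fin n) k) (a : A) :
    glAct n A g (∑ i, coord (matPattern k n) A (i, i) a) =
      ∑ i, coord (matPattern k n) A (i, i) a := by
  simp only [map_sum, glAct_coord]
  rw [Finset.sum_comm]
  refine Finset.sum_congr rfl fun q _ => ?_
  rw [Finset.sum_comm]
  have h : ∀ p, ∑ i, ((g : Matrix (Fin n) (Fin n) k) i p *
      ((g⁻¹ : GL (Fin n) k) : Matrix (Fin n) (Fin n) k) q i) = if q = p then 1 else 0 := by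
    intro p
    have h1 : ((g⁻¹ : GL (Fin n) k) : Matrix (Fin n) (Fin n) k) * (g : Matrix (Fin n) (Fin n) k) = 1 := by
      rw [← Units.val_mul, inv_mul_cancel, Units.val_one]
    have h2 := congrFun (congrFun h1 q) p
    rw [Matrix.mul_apply, Matrix.one_apply] at h2
    rw [← h2]
    exact Finset.sum_congr rfl fun i _ => mul_comm _ _
  simp only [← Finset.sum_smul, h]
  simp

/-- The conjugate of the matrix with coordinates `v`. -/
noncomputable def conjMat (g : GL (Fin 2) k) {R : Type*} [CommRing R] [Algebra k R] (v : Fin 4 → R)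
    (i j : Fin 2) : R :=
  ∑ q, ∑ p, ((g : Matrix (Fin 2) (Fin 2) k) i p *
    ((g⁻¹ : GL (Fin 2) k) : Matrix (Fin 2) (Fin 2) k) q j) • ptMat v p q

/-- The coordinates of the conjugate of the matrix with coordinates `v`. -/
noncomputable def conjCoord (g : GL (Fin 2) k) {R : Type*} [CommRing R] [Algebra k R]
    (v : Fin 4 → R) : Fin 4 → R :=
  ![(1 / 2 : k) • (conjMat g v 0 0 + conjMat g v 1 1),
    (1 / 2 : k) • (conjMat g v 0 0 - conjMat g v 1 1), conjMat g v 0 1, conjMat g v 1 0]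

/-- The action of `GL_2` on polynomials on pairs of matrices. -/
noncomputable def glPoly (g : GL (Fin 2) k) : PairPoly k →ₐ[k] PairPoly k :=
  aeval (Sum.elim (conjCoord g (px k)) (conjCoord g (py k)))

theorem glAct_repIncl [CharZero k] (g : GL (Fin 2) k) (p : PairPoly k) :
    glAct 2 (minRes k) g (repIncl k p) = repIncl k (glPoly g p) := by
  have hx : ∀ i j, glAct 2 (minRes k) g (repGen k i j .x) = repIncl k (conjMat g (px k) i j) := by
    intro i j
    refine (glAct_coord 2 (minRes k) g (i, j) _).trans ?_
    simp only [conjMat, map_sum, map_smul]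
    refine Finset.sum_congr rfl fun q _ => Finset.sum_congr rfl fun p _ => ?_
    have h := repGen_x k p q
    rw [rep_smul_def, mul_one] at h
    rw [← h]; rfl
  have hy : ∀ i j, glAct 2 (minRes k) g (repGen k i j .y) = repIncl k (conjMat g (py k) i j) := by
    intro i j
    refine (glAct_coord 2 (minRes k) g (i, j) _).trans ?_
    simp only [conjMat, map_sum, map_smul]
    refine Finset.sum_congr rfl fun q _ => Finset.sum_congr rfl fun p _ => ?_
    have h := repGen_y k p q
    rw [rep_smul_def, mul_one] at h
    rw [← h]; rfl
  have h : (glAct 2 (minRes k) g).toAlgHom.comp (repIncl k) = (repIncl k).comp (glPoly g) := by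
    refine algHom_poly_ext fun i => ?_
    rw [AlgHom.comp_apply, AlgHom.comp_apply, glPoly, aeval_X]
    rcases i with i | i
    · rw [repIncl_px]
      fin_cases i <;> simp [repCoord, conjCoord, hx]
    · rw [repIncl_py]
      fin_cases i <;> simp [repCoord, conjCoord, hy]
  exact DFunLike.congr_fun h p

theorem glAct_smul [CharZero k] (g : GL (Fin 2) k) (p : PairPoly k) (z : rep 2 (minRes k)) :
    glAct 2 (minRes k) g (p • z) = glPoly g p • glAct 2 (minRes k) g z := by
  rw [rep_smul_def, map_mul, glAct_repIncl, rep_smul_def]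

theorem eval_glPoly [CharZero k] (g : GL (Fin 2) k) (pt pt' : Fin 4 ⊕ Fin 4 → k)
    (hx : ptMat (pt' ∘ Sum.inl) * (g : Matrix (Fin 2) (Fin 2) k) = g * ptMat (pt ∘ Sum.inl))
    (hy : ptMat (pt' ∘ Sum.inr) * (g : Matrix (Fin 2) (Fin 2) k) = g * ptMat (pt ∘ Sum.inr))
    (p : PairPoly k) : eval pt (glPoly g p) = eval pt' p := by
  have key : ∀ v v' : Fin 4 → k, ptMat v' * (g : Matrix (Fin 2) (Fin 2) k) = g * ptMat v →
      conjCoord g v = v' := by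
    intro v v' h
    have h1 : ∀ i j, conjMat g v i j = ptMat v' i j := by
      intro i j
      have h2 : ptMat v' = g * ptMat v * ((g⁻¹ : GL (Fin 2) k) : Matrix (Fin 2) (Fin 2) k) := by
        rw [← h, mul_assoc, ← Units.val_mul, mul_inv_cancel, Units.val_one, mul_one]
      rw [h2, conjMat, Matrix.mul_apply]
      refine Finset.sum_congr rfl fun q _ => ?_
      rw [Matrix.mul_apply, Finset.sum_mul]
      refine Finset.sum_congr rfl fun p _ => ?_
      rw [smul_eq_mul]; ring
    funext i
    fin_cases i <;> simp [conjCoord, h1, ptMat]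
    · ring
    · ring
  have hev : ∀ (v : Fin 4 → PairPoly k) (i : Fin 4),
      eval pt (conjCoord g v i) = conjCoord g (fun j => eval pt (v j)) i := by
    intro v i
    have h1 : ∀ i j, eval pt (conjMat g v i j) = conjMat g (fun j => eval pt (v j)) i j := by
      intro i j
      simp only [conjMat, map_sum]
      refine Finset.sum_congr rfl fun q _ => Finset.sum_congr rfl fun p _ => ?_
      rw [smul_eval]
      congr 1
      fin_cases p <;> fin_cases q <;> simp [ptMat]
    fin_cases i <;> simp [conjCoord, h1, smul_eval]
    ring
  have h : (aeval pt : PairPoly k →ₐ[k] k).comp (glPoly g) = aeval pt' := by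
    refine MvPolynomial.algHom_ext fun i => ?_
    rw [AlgHom.comp_apply, glPoly, aeval_X, aeval_X]
    rcases i with i | i
    · exact (hev (px k) i).trans ((congrArg (fun v => conjCoord g v i)
        (funext fun j => eval_X _)).trans (congrFun (key (pt ∘ Sum.inl) (pt' ∘ Sum.inl) hx) i))
    · exact (hev (py k) i).trans ((congrArg (fun v => conjCoord g v i)
        (funext fun j => eval_X _)).trans (congrFun (key (pt ∘ Sum.inr) (pt' ∘ Sum.inr) hy) i))
  exact DFunLike.congr_fun h p

theorem isConjInv_of_glPoly [CharZero k] {p : PairPoly k} (h : ∀ g, glPoly g p = p) :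
    IsConjInv p := by
  intro g pt pt' hg hx hy
  have h1 := eval_glPoly (Matrix.GeneralLinearGroup.mkOfDetNeZero g hg) pt pt' hx hy p
  rw [h] at h1
  exact h1.symm

end Conjugation

section InvariantElements

open MvPolynomial

variable {k : Type u} [Field k]

/-- The trace of the universal representation. -/
noncomputable def repTr (a : minRes k) : rep 2 (minRes k) :=
  ∑ i, coord (matPattern k 2) (minRes k) (i, i) a

theorem repTr_gen (g : Gen) : repTr (minResGen k g) = ∑ i, repGen k i i g := rfl

theorem coord_gen_mul (i j : Fin 2) (g : Gen) (a : minRes k) :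
    coord (matPattern k 2) (minRes k) (i, j) (minResGen k g * a) =
      ∑ p, repGen k i p g * coord (matPattern k 2) (minRes k) (p, j) a :=
  coord_mul (S := matPattern k 2) (i, j) _ a

theorem repTr_mul (g h : Gen) : repTr (minResGen k g * minResGen k h) =
    ∑ i, ∑ j, repGen k i j g * repGen k j i h :=
  Finset.sum_congr rfl fun i _ => coord_gen_mul i i g _

theorem repTr_mul_mul (g h l : Gen) : repTr (minResGen k g * (minResGen k h * minResGen k l)) =
    ∑ i, ∑ j, repGen k i j g * ∑ p, repGen k j p h * repGen k p i l :=
  Finset.sum_congr rfl fun i _ => (coord_gen_mul i i g _).trans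
    (Finset.sum_congr rfl fun j _ => congrArg _ (coord_gen_mul j i h _))

variable [CharZero k]

omit [CharZero k] in
theorem repTr_even (v w : Fin 4 → PairPoly k) (g h : Gen)
    (hg : ∀ i j, repGen k i j g = ptMat v i j • (1 : rep 2 (minRes k)))
    (hh : ∀ i j, repGen k i j h = ptMat w i j • (1 : rep 2 (minRes k))) :
    repTr (minResGen k g * minResGen k h) =
      (2 * (v 0 * w 0 + v 1 * w 1) + v 2 * w 3 + v 3 * w 2) • (1 : rep 2 (minRes k)) := by
  rw [repTr_mul]
  simp only [Fin.sum_univ_two, hg, hh, ptMat, Matrix.of_apply, Matrix.cons_val', Matrix.cons_val_zero, Matrix.cons_val_one,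
    Matrix.cons_val_fin_one,
    smul_mul_assoc, one_mul]
  module

theorem repTr_odd (v : Fin 4 → PairPoly k) (g : Gen)
    (hg : ∀ i j, repGen k i j g = ptMat v i j • (1 : rep 2 (minRes k))) :
    repTr (minResGen k g * minResGen k .θ) = (2 * v 0) • repEta k 0 -
      (2 : PairPoly k) • (v 1 • repEta k 1 + v 2 • repEta k 2 + v 3 • repEta k 3) := by
  rw [repTr_mul]
  simp only [Fin.sum_univ_two, hg, repGen_θ, ptMat, Matrix.of_apply, Matrix.cons_val', Matrix.cons_val_zero, Matrix.cons_val_one,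
    Matrix.cons_val_fin_one,
    smul_mul_assoc, one_mul, ← rep_C_smul, map_ofNat C]
  module

theorem repTr_odd_odd (v : Fin 4 → PairPoly k) (g : Gen)
    (hg : ∀ i j, repGen k i j g = ptMat v i j • (1 : rep 2 (minRes k))) :
    repTr (minResGen k g * (minResGen k .θ * minResGen k .θ)) =
      (-4 : PairPoly k) • ((2 * v 1) • (repEta k 2 * repEta k 3) +
        v 3 • (repEta k 3 * repEta k 1) + v 2 • (repEta k 1 * repEta k 2)) := by
  rw [repTr_mul_mul]
  simp only [Fin.sum_univ_two, hg, repGen_θ, ptMat, Matrix.of_apply, Matrix.cons_val', Matrix.cons_val_zero, Matrix.cons_val_one,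
    Matrix.cons_val_fin_one,
    smul_mul_assoc, mul_smul_comm, one_mul, ← rep_C_smul, map_ofNat C, mul_add, add_mul, mul_sub,
    sub_mul, mul_neg, neg_mul, repEta_sq, repEta_mul k 1 0,
    repEta_mul k 2 0, repEta_mul k 3 0, repEta_mul k 2 1, repEta_mul k 3 1, repEta_mul k 3 2]
  module

theorem repTr_even_even_odd (v w : Fin 4 → PairPoly k) (g h : Gen)
    (hg : ∀ i j, repGen k i j g = ptMat v i j • (1 : rep 2 (minRes k)))
    (hh : ∀ i j, repGen k i j h = ptMat w i j • (1 : rep 2 (minRes k))) :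
    repTr (minResGen k g * (minResGen k h * minResGen k .θ)) -
      repTr (minResGen k h * (minResGen k g * minResGen k .θ)) =
      (-2 : PairPoly k) • ((v 2 * w 3 - v 3 * w 2) • repEta k 1 +
        (2 * (v 1 * w 2 - v 2 * w 1)) • repEta k 2 +
        (2 * (v 3 * w 1 - v 1 * w 3)) • repEta k 3) := by
  rw [repTr_mul_mul, repTr_mul_mul]
  simp only [Fin.sum_univ_two, hg, hh, repGen_θ, ptMat, Matrix.of_apply, Matrix.cons_val', Matrix.cons_val_zero, Matrix.cons_val_one,
    Matrix.cons_val_fin_one,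
    smul_mul_assoc, one_mul, ← rep_C_smul, map_ofNat C]
  module

theorem repTr_odd_odd_odd : repTr (minResGen k .θ * (minResGen k .θ * minResGen k .θ)) =
    (24 : PairPoly k) • (repEta k 1 * (repEta k 2 * repEta k 3)) := by
  rw [repTr_mul_mul]
  simp only [Fin.sum_univ_two, repGen_θ, Matrix.of_apply, Matrix.cons_val', Matrix.cons_val_zero, Matrix.cons_val_one,
    Matrix.cons_val_fin_one,
    smul_mul_assoc, mul_smul_comm, ← rep_C_smul, map_ofNat C, mul_add, add_mul, mul_sub,
    sub_mul, mul_neg, neg_mul, mul_zero, repEta_sq, repEta_sq_mul, repEta_mul k 1 0,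
    repEta_mul k 2 0, repEta_mul k 3 0, repEta_mul k 2 1, repEta_mul k 3 1, repEta_mul k 3 2,
    repEta_mul_mul k 1 0, repEta_mul_mul k 2 0, repEta_mul_mul k 3 0, repEta_mul_mul k 2 1,
    repEta_mul_mul k 3 1]
  module

variable (k)

/-- The subalgebra of conjugation invariant elements of the Koszul complex. -/
noncomputable abbrev repFixed : Subalgebra k (rep 2 (minRes k)) :=
  (rep 2 (minRes k)).fixedSubalgebra (glAct 2 (minRes k))

variable {k}

omit [CharZero k] in
theorem repTr_mem (a : minRes k) : repTr a ∈ repFixed k := fun g => glAct_trace 2 (minRes k) g a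

omit [CharZero k] in
theorem mem_repFixed_of_smul {c : k} (hc : c ≠ 0) {z : rep 2 (minRes k)}
    (h : (C c : PairPoly k) • z ∈ repFixed k) : z ∈ repFixed k := by
  have h1 := Subalgebra.smul_mem _ h c⁻¹
  rwa [rep_C_smul, smul_smul, inv_mul_cancel₀ hc, one_smul] at h1

theorem mem_repFixed_of_ofNat_smul {n : ℕ} [n.AtLeastTwo] {z : rep 2 (minRes k)}
    (h : (OfNat.ofNat n : PairPoly k) • z ∈ repFixed k) : z ∈ repFixed k := by
  refine mem_repFixed_of_smul (c := OfNat.ofNat n) (OfNat.ofNat_ne_zero n) ?_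
  rwa [map_ofNat C]

theorem px_zero_mem : px k 0 • (1 : rep 2 (minRes k)) ∈ repFixed k := by
  refine mem_repFixed_of_ofNat_smul (n := 2) ?_
  have h := repTr_mem (minResGen k .x)
  rw [repTr_gen, Fin.sum_univ_two, repGen_x, repGen_x] at h
  convert h using 1
  simp only [ptMat, Matrix.of_apply, Matrix.cons_val', Matrix.cons_val_zero, Matrix.cons_val_one,
    Matrix.cons_val_fin_one]
  module

theorem py_zero_mem : py k 0 • (1 : rep 2 (minRes k)) ∈ repFixed k := by
  refine mem_repFixed_of_ofNat_smul (n := 2) ?_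
  have h := repTr_mem (minResGen k .y)
  rw [repTr_gen, Fin.sum_univ_two, repGen_y, repGen_y] at h
  convert h using 1
  simp only [ptMat, Matrix.of_apply, Matrix.cons_val', Matrix.cons_val_zero, Matrix.cons_val_one,
    Matrix.cons_val_fin_one]
  module

theorem repEta_zero_mem : repEta k 0 ∈ repFixed k := by
  refine mem_repFixed_of_ofNat_smul (n := 2) ?_
  have h := repTr_mem (minResGen k .θ)
  rw [repTr_gen, Fin.sum_univ_two, repGen_θ, repGen_θ] at h
  convert h using 1
  simp only [Matrix.of_apply, Matrix.cons_val', Matrix.cons_val_zero, Matrix.cons_val_one,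
    Matrix.cons_val_fin_one]
  module

theorem two_mul_C_half : (2 * C (1 / 2) : PairPoly k) = 1 := by
  rw [show (2 : PairPoly k) = C 2 from (map_ofNat C 2).symm, ← C_mul]
  norm_num

theorem invHom_smul_mem (P : InvPoly k) :
    invHom k P • (1 : rep 2 (minRes k)) ∈ repFixed k := by
  have hA : invA k • (1 : rep 2 (minRes k)) ∈ repFixed k := by
    refine mem_repFixed_of_ofNat_smul (n := 2) ?_
    have h := sub_mem (repTr_mem (minResGen k .x * minResGen k .x))
      (mul_mem px_zero_mem (add_mem px_zero_mem px_zero_mem))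
    rw [repTr_even (px k) (px k) .x .x (repGen_x k) (repGen_x k)] at h
    convert h using 1
    simp only [invA, mul_add, smul_mul_smul_comm, mul_one]
    module
  have hC : invC k • (1 : rep 2 (minRes k)) ∈ repFixed k := by
    refine mem_repFixed_of_ofNat_smul (n := 2) ?_
    have h := sub_mem (repTr_mem (minResGen k .y * minResGen k .y))
      (mul_mem py_zero_mem (add_mem py_zero_mem py_zero_mem))
    rw [repTr_even (py k) (py k) .y .y (repGen_y k) (repGen_y k)] at h
    convert h using 1
    simp only [invC, mul_add, smul_mul_smul_comm, mul_one]
    module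
  have hB : invB k • (1 : rep 2 (minRes k)) ∈ repFixed k := by
    refine mem_repFixed_of_ofNat_smul (n := 2) ?_
    have h := sub_mem (repTr_mem (minResGen k .x * minResGen k .y))
      (mul_mem px_zero_mem (add_mem py_zero_mem py_zero_mem))
    rw [repTr_even (px k) (py k) .x .y (repGen_x k) (repGen_y k)] at h
    convert h using 1
    have e : 2 * invB k = 2 * (px k 1 * py k 1) + px k 2 * py k 3 + px k 3 * py k 2 := by
      rw [invB]
      linear_combination (px k 2 * py k 3 + px k 3 * py k 2) * two_mul_C_half (k := k)
    rw [smul_smul, e]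
    simp only [mul_add, smul_mul_smul_comm, mul_one]
    module
  induction P using MvPolynomial.induction_on with
  | C c =>
    rw [← algebraMap_eq, AlgHom.commutes, algebraMap_eq, rep_C_smul]
    exact Subalgebra.smul_mem _ (one_mem _) c
  | add P Q hP hQ => rw [map_add, add_smul]; exact add_mem hP hQ
  | mul_X P i hP =>
    have hi : invHom k (X i) • (1 : rep 2 (minRes k)) ∈ repFixed k := by
      rw [invHom, aeval_X]
      fin_cases i
      · exact px_zero_mem
      · exact py_zero_mem
      · exact hA
      · exact hB
      · exact hC
    have h := mul_mem hP hi
    rwa [smul_mul_smul_comm, mul_one, ← map_mul] at h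

theorem invHom_smul_mem' (P : InvPoly k) {z : rep 2 (minRes k)} (hz : z ∈ repFixed k) :
    invHom k P • z ∈ repFixed k := by
  have h := mul_mem (invHom_smul_mem P) hz
  rwa [smul_mul_assoc, one_mul] at h

/-- The element `v_1 η_1 + v_2 η_2 + v_3 η_3`. -/
noncomputable def oneForm (v : Fin 4 → PairPoly k) : rep 2 (minRes k) :=
  v 1 • repEta k 1 + v 2 • repEta k 2 + v 3 • repEta k 3

/-- The element corresponding to the trace of `v θ²`. -/
noncomputable def twoForm (v : Fin 4 → PairPoly k) : rep 2 (minRes k) :=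
  (2 * v 1) • (repEta k 2 * repEta k 3) + v 3 • (repEta k 3 * repEta k 1) +
    v 2 • (repEta k 1 * repEta k 2)

variable (k) in
/-- The element `η_1 η_2 η_3`. -/
noncomputable def topForm : rep 2 (minRes k) := repEta k 1 * (repEta k 2 * repEta k 3)

variable (k) in
/-- The element corresponding to the trace of `[x, y] θ`. -/
noncomputable def commForm : rep 2 (minRes k) :=
  minor k 2 3 • repEta k 1 + (2 * minor k 1 2) • repEta k 2 + (2 * minor k 3 1) • repEta k 3

theorem oneForm_px_mem : oneForm (px k) ∈ repFixed k := by
  refine mem_repFixed_of_ofNat_smul (n := 2) ?_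
  have h := sub_mem (mul_mem (add_mem px_zero_mem px_zero_mem) repEta_zero_mem)
    (repTr_mem (minResGen k .x * minResGen k .θ))
  rw [repTr_odd (px k) .x (repGen_x k)] at h
  convert h using 1
  simp only [oneForm, add_mul, smul_mul_assoc, one_mul]
  module

theorem oneForm_py_mem : oneForm (py k) ∈ repFixed k := by
  refine mem_repFixed_of_ofNat_smul (n := 2) ?_
  have h := sub_mem (mul_mem (add_mem py_zero_mem py_zero_mem) repEta_zero_mem)
    (repTr_mem (minResGen k .y * minResGen k .θ))
  rw [repTr_odd (py k) .y (repGen_y k)] at h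
  convert h using 1
  simp only [oneForm, add_mul, smul_mul_assoc, one_mul]
  module

theorem twoForm_px_mem : twoForm (px k) ∈ repFixed k := by
  refine mem_repFixed_of_ofNat_smul (n := 4) ?_
  have h := neg_mem (repTr_mem (minResGen k .x * (minResGen k .θ * minResGen k .θ)))
  rw [repTr_odd_odd (px k) .x (repGen_x k)] at h
  convert h using 1
  simp only [twoForm]
  module

theorem twoForm_py_mem : twoForm (py k) ∈ repFixed k := by
  refine mem_repFixed_of_ofNat_smul (n := 4) ?_
  have h := neg_mem (repTr_mem (minResGen k .y * (minResGen k .θ * minResGen k .θ)))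
  rw [repTr_odd_odd (py k) .y (repGen_y k)] at h
  convert h using 1
  simp only [twoForm]
  module

theorem topForm_mem : topForm k ∈ repFixed k := by
  refine mem_repFixed_of_ofNat_smul (n := 24) ?_
  have h := repTr_mem (minResGen k .θ * (minResGen k .θ * minResGen k .θ))
  rwa [repTr_odd_odd_odd] at h

theorem commForm_mem : commForm k ∈ repFixed k := by
  refine mem_repFixed_of_ofNat_smul (n := 2) ?_
  have h := sub_mem (repTr_mem (minResGen k .y * (minResGen k .x * minResGen k .θ)))
    (repTr_mem (minResGen k .x * (minResGen k .y * minResGen k .θ)))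
  rw [repTr_even_even_odd (py k) (px k) .y .x (repGen_y k) (repGen_x k)] at h
  convert h using 1
  simp only [commForm, minor]
  module

theorem twoForm_d (v : Fin 4 → PairPoly k) : (rep 2 (minRes k)).d (twoForm v) =
    (v 3 * minor k 1 2 - v 2 * minor k 3 1) • repEta k 1 +
      (v 2 * minor k 2 3 - 2 * v 1 * minor k 1 2) • repEta k 2 +
      (2 * v 1 * minor k 3 1 - v 3 * minor k 2 3) • repEta k 3 := by
  simp only [twoForm, map_add, rep_d_smul, rep_d_eta_mul, repEta_d_one, repEta_d_two,
    repEta_d_three, smul_mul_assoc, mul_smul_comm, one_mul, mul_one]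
  module

theorem two_mul_invB : 2 * invB k = 2 * (px k 1 * py k 1) + px k 2 * py k 3 + px k 3 * py k 2 := by
  rw [invB]
  linear_combination (px k 2 * py k 3 + px k 3 * py k 2) * two_mul_C_half (k := k)

theorem twoForm_px_d : (rep 2 (minRes k)).d (twoForm (px k)) =
    (2 : PairPoly k) • (invB k • oneForm (px k) - invA k • oneForm (py k)) := by
  rw [smul_sub, smul_smul, smul_smul, two_mul_invB, twoForm_d, invA]
  simp only [oneForm, minor]
  module

theorem twoForm_py_d : (rep 2 (minRes k)).d (twoForm (py k)) =
    (2 : PairPoly k) • (invC k • oneForm (px k) - invB k • oneForm (py k)) := by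
  rw [smul_sub, smul_smul, smul_smul, two_mul_invB, twoForm_d, invC]
  simp only [oneForm, minor]
  module

theorem commForm_d : (rep 2 (minRes k)).d (commForm k) =
    (-4 * (invA k * invC k - invB k ^ 2)) • (1 : rep 2 (minRes k)) := by
  have e : -4 * (invA k * invC k - invB k ^ 2) =
      minor k 2 3 ^ 2 + 4 * (minor k 1 2 * minor k 3 1) := by
    have h : 4 * invB k ^ 2 = (2 * (px k 1 * py k 1) + px k 2 * py k 3 + px k 3 * py k 2) ^ 2 := by
      rw [← two_mul_invB]; ring
    rw [invA, invC, minor, minor, minor]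
    linear_combination h
  rw [e]
  simp only [commForm, map_add, rep_d_smul, repEta_d_one, repEta_d_two, repEta_d_three]
  module

theorem topForm_d : (rep 2 (minRes k)).d (topForm k) =
    minor k 2 3 • (repEta k 2 * repEta k 3) + minor k 3 1 • (repEta k 3 * repEta k 1) +
      minor k 1 2 • (repEta k 1 * repEta k 2) := by
  simp only [topForm, rep_d_eta_mul, repEta_d_one, repEta_d_two,
    repEta_d_three, smul_mul_assoc, mul_smul_comm, one_mul, mul_one, mul_sub, repEta_mul k 3 1]
  module

end InvariantElements

end DGAlg

namespace DGAlg

/-! ### Cycles and boundaries in the second representation algebra -/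

section Cycles

open MvPolynomial

variable {k : Type u} [Field k]

/-- The cycle `p + F (x · η) + G (y · η) + l d(η_1 η_2 η_3)`, where `x · η` is
`x_1 η_1 + x_2 η_2 + x_3 η_3`. The polynomials `p`, `F`, `G`, `l` are determined by the cycle. -/
noncomputable def koszulCycle (p F G l : PairPoly k) : rep 2 (minRes k) :=
  p • 1 + F • oneForm (px k) + G • oneForm (py k) + l • (rep 2 (minRes k)).d (topForm k)

variable [CharZero k]

theorem koszulCycle_eq_koszul (p F G l : PairPoly k) : koszulCycle p F G l =
    koszul k ![p, F * px k 1 + G * py k 1, F * px k 2 + G * py k 2, F * px k 3 + G * py k 3,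
      l * minor k 2 3, l * minor k 3 1, l * minor k 1 2, 0] := by
  rw [koszulCycle, topForm_d]
  simp only [koszul, oneForm, Matrix.cons_val]
  module

/-- Every cycle of the Koszul complex is of the form `koszulCycle p F G l`. -/
theorem exists_koszulCycle_of_koszulDiff {f : Fin 8 → PairPoly k} (h : koszulDiff k f = 0) :
    ∃ p F G l, koszul k f = koszulCycle p F G l := by
  have h0 := congrFun h 0
  have h2 := congrFun h 2
  have h3 := congrFun h 3
  have h4 := congrFun h 4
  simp only [koszulDiff, Matrix.cons_val, Pi.zero_apply] at h0 h2 h3 h4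
  obtain ⟨F, G, e1, e2, e3⟩ := exists_of_dot_minor_eq_zero h0
  obtain ⟨l, e4, e5, e6⟩ := exists_of_cross_minor_eq_zero (sub_eq_zero.1 h2) (sub_eq_zero.1 h3)
  have e7 : f 7 = 0 := (mul_eq_zero.1 h4).resolve_right (minor_ne_zero (by decide))
  refine ⟨f 0, F, G, l, ?_⟩
  rw [koszulCycle_eq_koszul]
  congr 1
  funext i
  fin_cases i <;> first | rfl | assumption

theorem exists_koszulCycle {z : rep 2 (minRes k)} (hz : (rep 2 (minRes k)).d z = 0) :
    ∃ p F G l p' F' G' l',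
      z = koszulCycle p F G l + koszulCycle p' F' G' l' * repEta k 0 := by
  obtain ⟨f, g, rfl⟩ := exists_koszul z
  rw [map_add, rep_d_mul_eta_zero, koszul_d, koszul_d] at hz
  obtain ⟨hf, hg⟩ := koszul_eq_zero hz
  obtain ⟨p, F, G, l, e⟩ := exists_koszulCycle_of_koszulDiff hf
  obtain ⟨p', F', G', l', e'⟩ := exists_koszulCycle_of_koszulDiff hg
  exact ⟨p, F, G, l, p', F', G', l', by rw [e, e']⟩

theorem koszulCycle_d (p F G l : PairPoly k) :
    (rep 2 (minRes k)).d (koszulCycle p F G l) = 0 := by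
  have h : ∀ v : Fin 4 → PairPoly k, (rep 2 (minRes k)).d (oneForm v) =
      (v 1 * minor k 2 3 + v 2 * minor k 3 1 + v 3 * minor k 1 2) • 1 := fun v => by
    simp only [oneForm, map_add, rep_d_smul, repEta_d_one, repEta_d_two, repEta_d_three, add_smul,
      mul_smul]
  simp only [koszulCycle, map_add, rep_d_smul, d_one, d_d, h, px_dot_minor, py_dot_minor]
  simp

omit [CharZero k] in
theorem koszulCycle_sub (p F G l p' F' G' l' : PairPoly k) :
    koszulCycle p F G l - koszulCycle p' F' G' l' =
      koszulCycle (p - p') (F - F') (G - G') (l - l') := by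
  simp only [koszulCycle]; module

omit [CharZero k] in
theorem eq_zero_of_px_add_py {a b : PairPoly k} (h : ∀ i : Fin 3, a * px k i.succ + b * py k i.succ = 0) :
    a = 0 ∧ b = 0 := by
  have h1 := h 0
  have h2 := h 1
  have hm := minor_ne_zero (k := k) (i := 1) (j := 2) (by decide)
  simp only [Fin.succ_zero_eq_one, Fin.succ_one_eq_two] at h1 h2
  constructor
  · refine (mul_eq_zero.1 ?_).resolve_right hm
    rw [minor]
    linear_combination py k 2 * h1 - py k 1 * h2
  · refine (mul_eq_zero.1 ?_).resolve_right hm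
    rw [minor]
    linear_combination px k 1 * h2 - px k 2 * h1

omit [CharZero k] in
/-- If `koszulCycle p F G l` is a boundary, then `p` lies in the ideal of minors and `(F, G)` in the
submodule generated by the `(y_i, -x_i)`. -/
theorem of_koszul_eq_koszulCycle {f h : Fin 8 → PairPoly k} {p F G l : PairPoly k}
    (hf : f = ![p, F * px k 1 + G * py k 1, F * px k 2 + G * py k 2, F * px k 3 + G * py k 3,
      l * minor k 2 3, l * minor k 3 1, l * minor k 1 2, 0]) (hh : koszulDiff k h = f) :
    p ∈ minorIdeal k ∧ ∃ u1 u2 u3 : PairPoly k, F = u1 * py k 1 + u2 * py k 2 + u3 * py k 3 ∧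
      G = -(u1 * px k 1 + u2 * px k 2 + u3 * px k 3) := by
  subst hf
  have h0 := congrFun hh 0
  have h1 := congrFun hh 1
  have h2 := congrFun hh 2
  have h3 := congrFun hh 3
  simp only [koszulDiff, Matrix.cons_val, minor] at h0 h1 h2 h3
  refine ⟨mem_minorIdeal.2 ⟨h 1, h 2, h 3, h0.symm⟩, h 4, h 5, h 6, ?_⟩
  have e := eq_zero_of_px_add_py (a := F - (h 4 * py k 1 + h 5 * py k 2 + h 6 * py k 3))
    (b := G + (h 4 * px k 1 + h 5 * px k 2 + h 6 * px k 3)) (fun i => by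
      fin_cases i
      · change _ * px k 1 + _ * py k 1 = 0
        linear_combination -h1
      · change _ * px k 2 + _ * py k 2 = 0
        linear_combination -h2
      · change _ * px k 3 + _ * py k 3 = 0
        linear_combination -h3)
  exact ⟨sub_eq_zero.1 e.1, eq_neg_of_add_eq_zero_left e.2⟩

theorem of_koszulCycle_eq_d {p F G l p' F' G' l' : PairPoly k} {c : rep 2 (minRes k)}
    (h : (rep 2 (minRes k)).d c = koszulCycle p F G l + koszulCycle p' F' G' l' * repEta k 0) :
    (p ∈ minorIdeal k ∧ ∃ u1 u2 u3 : PairPoly k, F = u1 * py k 1 + u2 * py k 2 + u3 * py k 3 ∧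
      G = -(u1 * px k 1 + u2 * px k 2 + u3 * px k 3)) ∧
    (p' ∈ minorIdeal k ∧ ∃ u1 u2 u3 : PairPoly k, F' = u1 * py k 1 + u2 * py k 2 + u3 * py k 3 ∧
      G' = -(u1 * px k 1 + u2 * px k 2 + u3 * px k 3)) := by
  obtain ⟨f, g, rfl⟩ := exists_koszul c
  rw [map_add, rep_d_mul_eta_zero, koszul_d, koszul_d, koszulCycle_eq_koszul,
    koszulCycle_eq_koszul] at h
  obtain ⟨hf, hg⟩ := koszul_injective h
  exact ⟨of_koszul_eq_koszulCycle rfl hf, of_koszul_eq_koszulCycle rfl hg⟩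

/-- Converse to `of_koszul_eq_koszulCycle`; there is no condition on `l`, as the corresponding
summand is the boundary of `l η_1 η_2 η_3`. -/
theorem exists_d_eq_koszulCycle {p F G : PairPoly k} (l : PairPoly k) (hp : p ∈ minorIdeal k)
    (hFG : ∃ u1 u2 u3 : PairPoly k, F = u1 * py k 1 + u2 * py k 2 + u3 * py k 3 ∧
      G = -(u1 * px k 1 + u2 * px k 2 + u3 * px k 3)) :
    ∃ c, (rep 2 (minRes k)).d c = koszulCycle p F G l := by
  obtain ⟨c1, c2, c3, rfl⟩ := mem_minorIdeal.1 hp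
  obtain ⟨u1, u2, u3, rfl, rfl⟩ := hFG
  refine ⟨koszul k ![0, c1, c2, c3, u1, u2, u3, l], ?_⟩
  rw [koszul_d, koszulCycle_eq_koszul]
  congr 1
  funext i
  fin_cases i <;> simp [koszulDiff, minor] <;> ring

theorem koszulCycle_eq_zero {p F G l p' F' G' l' : PairPoly k}
    (h : koszulCycle p F G l + koszulCycle p' F' G' l' * repEta k 0 = 0) :
    (p = 0 ∧ F = 0 ∧ G = 0 ∧ l = 0) ∧ (p' = 0 ∧ F' = 0 ∧ G' = 0 ∧ l' = 0) := by
  have key : ∀ {p F G l : PairPoly k}, ![p, F * px k 1 + G * py k 1, F * px k 2 + G * py k 2,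
      F * px k 3 + G * py k 3, l * minor k 2 3, l * minor k 3 1, l * minor k 1 2, 0] = 0 →
      p = 0 ∧ F = 0 ∧ G = 0 ∧ l = 0 := by
    intro p F G l h
    have e := eq_zero_of_px_add_py (a := F) (b := G) (fun i => by
      fin_cases i
      · exact congrFun h 1
      · exact congrFun h 2
      · exact congrFun h 3)
    exact ⟨congrFun h 0, e.1, e.2,
      (mul_eq_zero.1 (show l * minor k 2 3 = 0 from congrFun h 4)).resolve_right
        (minor_ne_zero (by decide))⟩
  rw [koszulCycle_eq_koszul, koszulCycle_eq_koszul] at h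
  obtain ⟨hf, hg⟩ := koszul_eq_zero h
  exact ⟨key hf, key hg⟩

theorem glAct_koszulCycle (g : GL (Fin 2) k) (p F G l : PairPoly k) :
    glAct 2 (minRes k) g (koszulCycle p F G l) =
      koszulCycle (glPoly g p) (glPoly g F) (glPoly g G) (glPoly g l) := by
  have h1 := oneForm_px_mem (k := k) g
  have h2 := oneForm_py_mem (k := k) g
  have h3 := topForm_mem (k := k) g
  simp only [koszulCycle, map_add, glAct_smul, map_one, (glAct 2 (minRes k) g).map_d, h1, h2, h3]

theorem glAct_koszulCycle_sub (g : GL (Fin 2) k) (p F G l p' F' G' l' : PairPoly k) :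
    glAct 2 (minRes k) g (koszulCycle p F G l + koszulCycle p' F' G' l' * repEta k 0) -
      (koszulCycle p F G l + koszulCycle p' F' G' l' * repEta k 0) =
    koszulCycle (glPoly g p - p) (glPoly g F - F) (glPoly g G - G) (glPoly g l - l) +
      koszulCycle (glPoly g p' - p') (glPoly g F' - F') (glPoly g G' - G') (glPoly g l' - l') *
        repEta k 0 := by
  have h := repEta_zero_mem (k := k) g
  rw [map_add, map_mul, glAct_koszulCycle, glAct_koszulCycle, h, ← koszulCycle_sub,
    ← koszulCycle_sub]
  noncomm_ring

end Cycles

end DGAlg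

namespace DGAlg

/-! ### The diagonal representation algebra of the minimal resolution -/

section Diagonal

variable {k : Type u} [Field k] {n : ℕ}

theorem polyTheta_algHom_ext {R : Type*} [Ring R] [Algebra k R] {f g : polyTheta k n →ₐ[k] R}
    (h : ∀ i t, f (polyVar k n i t) = g (polyVar k n i t)) : f = g := by
  refine Algebra.TensorProduct.ext (R := k) (S := k)
    (A := MvPolynomial (Fin n ⊕ Fin n) k) (B := ExteriorAlgebra k (Fin n → k)) ?_ ?_
  · refine algHom_poly_ext ?_
    rintro (i | i)
    · exact h i .x
    · exact h i .y
  · refine ExteriorAlgebra.hom_ext (LinearMap.pi_ext' fun i => LinearMap.ext_ring ?_)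
    exact h i .θ

/-- The generators of the diagonal representation algebra of `k⟨x, y, θ⟩`. -/
noncomputable def diagGen (k : Type u) [Field k] (n : ℕ) (i : Fin n) (t : Gen) :
    diag n (minRes k) :=
  coord (diagPattern k n) (minRes k) i (minResGen k t)

theorem diagGen_mem (i : Fin n) (t : Gen) : diagGen k n i t ∈ (diag n (minRes k)).gr t.deg :=
  coord_mem (S := diagPattern k n) i _ _ (minResGen_mem t)

theorem diagToPoly_gen (i : Fin n) (t : Gen) :
    diagToPoly k n (diagGen k n i t) = polyVar k n i t := by
  rw [diagGen, diagToPoly_coord]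
  exact minResLift_gen _ _ _ _ _ _ t

/-- The subalgebra generated by the coordinates of `x` and `y`. -/
noncomputable def diagIncl (k : Type u) [Field k] (n : ℕ) :
    MvPolynomial (Fin n ⊕ Fin n) k →ₐ[k] diag n (minRes k) :=
  (corep_isGradedComm _ _ : (diag n (minRes k)).IsGradedComm).polyHom
    (Sum.elim (fun i => diagGen k n i .x) (fun i => diagGen k n i .y)) (by
      rintro (i | i)
      · exact diagGen_mem i .x
      · exact diagGen_mem i .y)

theorem diagIncl_mem (p : MvPolynomial (Fin n ⊕ Fin n) k) :
    diagIncl k n p ∈ (diag n (minRes k)).gr 0 := by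
  refine algHom_mem_gr_zero _ (fun i => ?_) p
  rw [diagIncl, IsGradedComm.polyHom_X]
  rcases i with i | i
  · exact diagGen_mem i .x
  · exact diagGen_mem i .y

/-- The subalgebra generated by the coordinates of `θ`. -/
noncomputable def diagExt [CharZero k] (n : ℕ) :
    ExteriorAlgebra k (Fin n → k) →ₐ[k] diag n (minRes k) :=
  ExteriorAlgebra.lift k ⟨Fintype.linearCombination k fun i => diagGen k n i .θ, fun m => by
    refine (corep_isGradedComm _ _ : (diag n (minRes k)).IsGradedComm).odd_sq ?_
    rw [Fintype.linearCombination_apply]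
    exact sum_mem fun i _ => Submodule.smul_mem _ _ (diagGen_mem i .θ)⟩

theorem diagIncl_commute [CharZero k] (p : MvPolynomial (Fin n ⊕ Fin n) k)
    (v : ExteriorAlgebra k (Fin n → k)) : Commute (diagIncl k n p) (diagExt n v) :=
  (corep_isGradedComm _ _ : (diag n (minRes k)).IsGradedComm).even_mul (diagIncl_mem p) _

/-- The inverse of `diagToPoly`. -/
noncomputable def polyToDiag [CharZero k] (n : ℕ) : polyTheta k n →ₐ[k] diag n (minRes k) :=
  Algebra.TensorProduct.lift (R := k) (S := k) (A := MvPolynomial (Fin n ⊕ Fin n) k)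
    (B := ExteriorAlgebra k (Fin n → k)) (C := diag n (minRes k))
    (diagIncl k n) (diagExt n) diagIncl_commute

theorem polyToDiag_var [CharZero k] (i : Fin n) (t : Gen) :
    polyToDiag n (polyVar k n i t) = diagGen k n i t := by
  cases t with
  | x =>
    refine (Algebra.TensorProduct.lift_tmul _ _ diagIncl_commute _ _).trans ?_
    rw [map_one, mul_one, diagIncl, IsGradedComm.polyHom_X, Sum.elim_inl]
  | y =>
    refine (Algebra.TensorProduct.lift_tmul _ _ diagIncl_commute _ _).trans ?_
    rw [map_one, mul_one, diagIncl, IsGradedComm.polyHom_X, Sum.elim_inr]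
  | θ =>
    refine (Algebra.TensorProduct.lift_tmul _ _ diagIncl_commute _ _).trans ?_
    rw [map_one, one_mul, diagExt, ExteriorAlgebra.lift_ι_apply]
    refine (Fintype.linearCombination_apply_single k _ i 1).trans ?_
    rw [one_smul]

theorem diagToPoly_bijective [CharZero k] (n : ℕ) : Function.Bijective (diagToPoly k n) := by
  have h1 : (polyToDiag n).comp (diagToPoly k n).toAlgHom = AlgHom.id k _ :=
    corep_algHom_ext fun i t =>
      (congrArg (polyToDiag n) (diagToPoly_gen i t)).trans (polyToDiag_var i t)
  have h2 : (diagToPoly k n).toAlgHom.comp (polyToDiag n) = AlgHom.id k _ :=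
    polyTheta_algHom_ext fun i t =>
      (congrArg (diagToPoly k n) (polyToDiag_var i t)).trans (diagToPoly_gen i t)
  exact ⟨Function.LeftInverse.injective (DFunLike.congr_fun h1),
    Function.RightInverse.surjective (DFunLike.congr_fun h2)⟩

/-- The variables generate `k[x_1, …, θ_n]`. -/
theorem mem_of_polyVar_mem [CharZero k] (A : Subalgebra k (polyTheta k n))
    (h : ∀ i t, (polyVar k n i t : polyTheta k n) ∈ A) (z : polyTheta k n) : z ∈ A := by
  obtain ⟨w, rfl⟩ := (diagToPoly_bijective n).2 z
  have h1 : w ∈ A.comap (diagToPoly k n).toAlgHom := by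
    refine (corep_adjoin (k := k) (diagPattern k n)).symm.trans_le (Algebra.adjoin_le ?_)
      (Algebra.mem_top (R := k) (x := w))
    rintro _ ⟨⟨i, t⟩, rfl⟩
    change diagToPoly k n (diagGen k n i t) ∈ A
    rw [diagToPoly_gen]
    exact h i t
  exact h1

/-- Normal form of the elements of `k[x_1, x_2, y_1, y_2, θ_1, θ_2]`. -/
theorem exists_polyTheta_two [CharZero k] (z : polyTheta k 2) : ∃ a b c d, z = polyIncl k 2 a +
    polyIncl k 2 b * thetaVar k 2 0 + polyIncl k 2 c * thetaVar k 2 1 +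
      polyIncl k 2 d * (thetaVar k 2 0 * thetaVar k 2 1) := by
  have hB := polyTheta_isGradedComm k 2
  have h0 : ∀ a ∈ (polyIncl k 2).range, (polyTheta k 2).sgn a ∈ (polyIncl k 2).range := by
    rintro _ ⟨p, rfl⟩
    exact ⟨p, (sgn_even (polyIncl_mem p)).symm⟩
  have h1 := hB.adjoinOdd_sgn _ h0 _ (thetaVar_mem (k := k) (n := 2) 0)
  have hl1 := hB.le_adjoinOdd _ h0 _ (thetaVar_mem (k := k) (n := 2) 0)
  have hl2 := hB.le_adjoinOdd _ h1 _ (thetaVar_mem (k := k) (n := 2) 1)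
  have hm1 := hB.mem_adjoinOdd _ h0 _ (thetaVar_mem (k := k) (n := 2) 0)
  have hm2 := hB.mem_adjoinOdd _ h1 _ (thetaVar_mem (k := k) (n := 2) 1)
  have hz : z ∈ hB.adjoinOdd _ h1 _ (thetaVar_mem (k := k) (n := 2) 1) := by
    refine mem_of_polyVar_mem _ (fun i t => ?_) z
    cases t with
    | x => exact hl2 (hl1 ⟨MvPolynomial.X (Sum.inl i), rfl⟩)
    | y => exact hl2 (hl1 ⟨MvPolynomial.X (Sum.inr i), rfl⟩)
    | θ =>
      fin_cases i
      · exact hl2 hm1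
      · exact hm2
  obtain ⟨_, ⟨_, ⟨a, rfl⟩, _, ⟨b, rfl⟩, rfl⟩, _, ⟨_, ⟨c, rfl⟩, _, ⟨d, rfl⟩, rfl⟩, rfl⟩ := hz
  refine ⟨a, b, c, d, ?_⟩
  change polyIncl k 2 a + polyIncl k 2 b * thetaVar k 2 0 +
    (polyIncl k 2 c + polyIncl k 2 d * thetaVar k 2 0) * thetaVar k 2 1 = _
  rw [add_mul, mul_assoc, ← add_assoc]

/-- The normal form in `k[x_1, x_2, y_1, y_2, θ_1, θ_2]` is unique. -/
theorem polyTheta_two_eq_zero {a b c d : MvPolynomial (Fin 2 ⊕ Fin 2) k}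
    (h : polyIncl k 2 a + polyIncl k 2 b * thetaVar k 2 0 + polyIncl k 2 c * thetaVar k 2 1 +
      polyIncl k 2 d * (thetaVar k 2 0 * thetaVar k 2 1) = 0) :
    a = 0 ∧ b = 0 ∧ c = 0 ∧ d = 0 := by
  have d0 := congrArg (thetaDer k (0 : Fin 2)) h
  simp [thetaDer_incl_mul, thetaDer_theta_mul, thetaDer_theta, thetaDer_incl] at d0
  have d1 := congrArg (thetaDer k (1 : Fin 2)) h
  simp [thetaDer_incl_mul, thetaDer_theta_mul, thetaDer_theta, thetaDer_incl] at d1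
  have d01 := congrArg (thetaDer k (1 : Fin 2)) d0
  simp [thetaDer_incl_mul, thetaDer_theta, thetaDer_incl] at d01
  have hc : ∀ {z : polyTheta k 2}, z = 0 → polyAug k 2 z = 0 := fun h => by rw [h, map_zero]
  replace h := hc h
  replace d0 := hc d0
  replace d1 := hc d1
  replace d01 := hc d01
  simp only [map_add, map_neg, map_mul, polyAug_incl, polyAug_theta, mul_zero, add_zero, neg_zero]
    at h d0 d1 d01
  exact ⟨h, d0, d1, d01⟩

end Diagonal

end DGAlg

namespace DGAlg

/-! ### Restriction to diagonal matrices -/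

section Restriction

open MvPolynomial

variable (k : Type u) [Field k]

/-- The variables, as elements of the DG algebra `k[x_1, …, θ_n]`. -/
noncomputable def polyGen (n : ℕ) (i : Fin n) (t : Gen) : polyTheta k n := polyVar k n i t

/-- The map `x_{ij} ↦ δ_{ij} x_i`, `y_{ij} ↦ δ_{ij} y_i`, `θ_{ij} ↦ δ_{ij} θ_i` on the whole second
representation algebra. -/
noncomputable def diagEval : Hom (rep 2 (minRes k)) (polyTheta k 2) :=
  (diagToPoly k 2).comp (toDiag 2 (minRes k))

theorem diagEval_gen (i j : Fin 2) (t : Gen) :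
    diagEval k (repGen k i j t) = if i = j then polyGen k 2 i t else 0 := by
  change diagToPoly k 2 (toDiag 2 (minRes k) (coord _ _ _ _)) = _
  rw [toDiag_coord]
  by_cases h : i = j
  · rw [if_pos h, if_pos h]
    exact diagToPoly_gen i t
  · rw [if_neg h, if_neg h, map_zero]

/-- Restriction of polynomials to pairs of diagonal matrices. -/
noncomputable def diagRes : PairPoly k →ₐ[k] MvPolynomial (Fin 2 ⊕ Fin 2) k :=
  aeval (Sum.elim
    ![C (1 / 2) * (X (Sum.inl 0) + X (Sum.inl 1)), C (1 / 2) * (X (Sum.inl 0) - X (Sum.inl 1)), 0, 0]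
    ![C (1 / 2) * (X (Sum.inr 0) + X (Sum.inr 1)), C (1 / 2) * (X (Sum.inr 0) - X (Sum.inr 1)), 0, 0])

theorem polyIncl_inl (i : Fin 2) : polyIncl k 2 (X (Sum.inl i)) = polyGen k 2 i .x := rfl

theorem polyIncl_inr (i : Fin 2) : polyIncl k 2 (X (Sum.inr i)) = polyGen k 2 i .y := rfl

variable {k}

theorem polyIncl_C_mul (c : k) (p : MvPolynomial (Fin 2 ⊕ Fin 2) k) :
    polyIncl k 2 (C c * p) = c • polyIncl k 2 p := by
  rw [← smul_eq_C_mul, map_smul]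

theorem diagEval_smul (p : PairPoly k) (z : rep 2 (minRes k)) :
    diagEval k (p • z) = polyIncl k 2 (diagRes k p) * diagEval k z := by
  have h : (diagEval k).toAlgHom.comp (repIncl k) = (polyIncl k 2).comp (diagRes k) := by
    refine algHom_poly_ext fun i => ?_
    rw [AlgHom.comp_apply, AlgHom.comp_apply, diagRes, aeval_X]
    rcases i with i | i
    · rw [repIncl_px]
      fin_cases i <;> simp [repCoord, diagEval_gen, polyIncl_C_mul, polyIncl_inl]
    · rw [repIncl_py]
      fin_cases i <;> simp [repCoord, diagEval_gen, polyIncl_C_mul, polyIncl_inr]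
  rw [rep_smul_def, map_mul]
  exact congrArg (· * diagEval k z) (DFunLike.congr_fun h p)

theorem diagEval_eta (i : Fin 4) : diagEval k (repEta k i) =
    (![(1 / 2 : k) • (thetaVar k 2 0 + thetaVar k 2 1),
      -((1 / 2 : k) • (thetaVar k 2 0 - thetaVar k 2 1)), 0, 0] : Fin 4 → polyTheta k 2) i := by
  fin_cases i <;> simp [repEta, diagEval_gen] <;> rfl

variable [CharZero k]

omit [CharZero k] in
theorem diagEval_koszulCycle (p F G l : PairPoly k) : diagEval k (koszulCycle p F G l) =
    polyIncl k 2 (diagRes k p) - polyIncl k 2 (C (1 / 2) * diagRes k (px k 1 * F + py k 1 * G)) *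
      (thetaVar k 2 0 - thetaVar k 2 1) := by
  have hz : ∀ z : polyTheta k 2, (polyTheta k 2).d z = 0 := fun _ => rfl
  have h2 : ∀ i : Fin 4, i ≠ 0 → i ≠ 1 → diagRes k (px k i) = 0 ∧ diagRes k (py k i) = 0 := by
    intro i h h'
    rw [diagRes, aeval_X, aeval_X]
    fin_cases i
    · exact absurd rfl h
    · exact absurd rfl h'
    · exact ⟨rfl, rfl⟩
    · exact ⟨rfl, rfl⟩
  rw [polyIncl_C_mul]
  simp only [koszulCycle, oneForm, map_add, diagEval_smul, map_one, (diagEval k).map_d, hz,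
    diagEval_eta, h2 2 (by decide) (by decide), h2 3 (by decide) (by decide), map_zero, map_mul]
  simp only [Matrix.cons_val, mul_one, mul_zero, add_zero, mul_neg, smul_mul_assoc,
    mul_smul_comm]
  have e : ∀ v F : PairPoly k, polyIncl k 2 (diagRes k F) * (polyIncl k 2 (diagRes k v) *
      (thetaVar k 2 0 - thetaVar k 2 1)) =
      polyIncl k 2 (diagRes k v) * polyIncl k 2 (diagRes k F) *
        (thetaVar k 2 0 - thetaVar k 2 1) := fun v F => by
    rw [← mul_assoc, ← map_mul, mul_comm, map_mul]
  rw [e, e]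
  simp only [add_mul, smul_add]
  abel

theorem diagEval_koszulCycle_add (p F G l p' F' G' l' : PairPoly k) :
    diagEval k (koszulCycle p F G l + koszulCycle p' F' G' l' * repEta k 0) =
      polyIncl k 2 (diagRes k p) +
      polyIncl k 2 (C (1 / 2) * (diagRes k p' - diagRes k (px k 1 * F + py k 1 * G))) *
        thetaVar k 2 0 +
      polyIncl k 2 (C (1 / 2) * (diagRes k p' + diagRes k (px k 1 * F + py k 1 * G))) *
        thetaVar k 2 1 +
      polyIncl k 2 (-(C (1 / 2) * diagRes k (px k 1 * F' + py k 1 * G'))) *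
        (thetaVar k 2 0 * thetaVar k 2 1) := by
  rw [map_add, map_mul, diagEval_koszulCycle, diagEval_koszulCycle, diagEval_eta]
  have hB := polyTheta_isGradedComm k 2
  have h0 := hB.odd_sq (thetaVar_mem (k := k) (n := 2) 0)
  have h1 := hB.odd_sq (thetaVar_mem (k := k) (n := 2) 1)
  have h10 := hB.odd_mul_odd (thetaVar_mem (k := k) (n := 2) 1) (thetaVar_mem (k := k) (n := 2) 0)
  generalize diagRes k (px k 1 * F + py k 1 * G) = q
  generalize diagRes k (px k 1 * F' + py k 1 * G') = q'
  simp only [Matrix.cons_val, map_neg, polyIncl_C_mul, map_add, map_sub]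
  have e : (thetaVar k 2 0 - thetaVar k 2 1) * (thetaVar k 2 0 + thetaVar k 2 1) =
      (2 : k) • (thetaVar k 2 0 * thetaVar k 2 1) := by
    rw [sub_mul, mul_add, mul_add, h0, h1, h10]
    module
  simp only [mul_smul_comm, smul_mul_assoc, sub_mul, mul_assoc, e]
  simp only [mul_add, mul_sub, add_mul, neg_mul, smul_mul_assoc]
  module

/-- A cycle restricts to zero if and only if its coefficients restrict to zero. -/
theorem diagEval_eq_zero {p F G l p' F' G' l' : PairPoly k}
    (h : diagEval k (koszulCycle p F G l + koszulCycle p' F' G' l' * repEta k 0) = 0) :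
    (diagRes k p = 0 ∧ diagRes k (px k 1 * F + py k 1 * G) = 0) ∧
      (diagRes k p' = 0 ∧ diagRes k (px k 1 * F' + py k 1 * G') = 0) := by
  rw [diagEval_koszulCycle_add] at h
  obtain ⟨h1, h2, h3, h4⟩ := polyTheta_two_eq_zero h
  have hc : (C (1 / 2) : MvPolynomial (Fin 2 ⊕ Fin 2) k) ≠ 0 :=
    (map_ne_zero_iff _ (C_injective _ _)).2 (by norm_num)
  rw [neg_eq_zero] at h4
  replace h2 := (mul_eq_zero.1 h2).resolve_left hc
  replace h3 := (mul_eq_zero.1 h3).resolve_left hc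
  replace h4 := (mul_eq_zero.1 h4).resolve_left hc
  have h5 := sub_eq_zero.1 h2
  rw [h5, ← two_mul] at h3
  have h6 := (mul_eq_zero.1 h3).resolve_left two_ne_zero
  exact ⟨⟨h1, h6⟩, h5.trans h6, h4⟩

/-- The values of the restriction, in terms of the pairs of matrices with proportional traceless
parts. -/
theorem eval_diagRes (a b s t : k) (p : PairPoly k) :
    eval (Sum.elim ![a + s, a - s] ![b + t, b - t]) (diagRes k p) =
      eval (toricPt a b s t ![1, 0, 0]) p := by
  have h : (aeval (Sum.elim ![a + s, a - s] ![b + t, b - t]) :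
      MvPolynomial (Fin 2 ⊕ Fin 2) k →ₐ[k] k).comp (diagRes k) =
      aeval (toricPt a b s t ![1, 0, 0]) := by
    refine MvPolynomial.algHom_ext fun i => ?_
    rw [AlgHom.comp_apply, diagRes, aeval_X, aeval_X]
    rcases i with i | i <;> fin_cases i <;> simp [toricPt, ← algebraMap_eq]
    · ring
    · ring
    · exact (mul_zero s).symm
    · exact (mul_zero s).symm
    · ring
    · ring
    · exact (mul_zero t).symm
    · exact (mul_zero t).symm
  exact DFunLike.congr_fun h p

theorem eval_toricPt_of_diagRes {p : PairPoly k} (h : diagRes k p = 0) (a b s t : k) :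
    eval (toricPt a b s t ![1, 0, 0]) p = 0 := by
  rw [← eval_diagRes, h, map_zero]

omit [CharZero k] in
theorem eval_toricPt_invHom (a b s t : k) (P : InvPoly k) :
    eval (toricPt a b s t ![1, 0, 0]) (invHom k P) = eval ![a, b, s ^ 2, s * t, t ^ 2] P := by
  rw [eval_invHom]
  have e1 : toricPt a b s t ![1, 0, 0] (Sum.inl 1) = s := mul_one s
  have e2 : toricPt a b s t ![1, 0, 0] (Sum.inl 2) = 0 := mul_zero s
  have e3 : toricPt a b s t ![1, 0, 0] (Sum.inl 3) = 0 := mul_zero s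
  have f1 : toricPt a b s t ![1, 0, 0] (Sum.inr 1) = t := mul_one t
  have f2 : toricPt a b s t ![1, 0, 0] (Sum.inr 2) = 0 := mul_zero t
  have f3 : toricPt a b s t ![1, 0, 0] (Sum.inr 3) = 0 := mul_zero t
  rw [e1, e2, e3, f1, f2, f3]
  congr 2
  simp
  constructor <;> rfl

end Restriction

end DGAlg

namespace DGAlg

/-! ### The Harish-Chandra homomorphism of the minimal resolution -/

section MinResHarishChandra

open MvPolynomial

variable {k : Type u} [Field k] [CharZero k]

theorem C_half_mul_smul (q : PairPoly k) (z : rep 2 (minRes k)) :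
    (q * C (1 / 2)) • (2 : PairPoly k) • z = q • z := by
  rw [smul_smul]
  congr 1
  linear_combination q * two_mul_C_half (k := k)

omit [CharZero k] in
theorem invHom_C (c : k) : invHom k (C c) = C c := (invHom k).commutes c

omit [CharZero k] in
theorem eval_toricPt_px_mul_add (a b s t : k) (w : Fin 3 → k) (F G : PairPoly k) :
    eval (toricPt a b s t w) (px k 1 * F + py k 1 * G) =
      s * w 0 * eval (toricPt a b s t w) F + t * w 0 * eval (toricPt a b s t w) G := by
  have e1 : toricPt a b s t w (Sum.inl 1) = s * w 0 := rfl
  have e2 : toricPt a b s t w (Sum.inr 1) = t * w 0 := rfl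
  rw [map_add, map_mul, map_mul, eval_X, eval_X, e1, e2]

/-- An invariant cycle that restricts to zero on diagonal matrices bounds an invariant element: by
the description of the invariant polynomials it is a combination of the boundaries of the invariant
elements `commForm`, `twoForm`, `topForm`. -/
theorem exists_fixed_d_eq_koszulCycle {p F G l : PairPoly k} (hp : ∀ g, glPoly g p = p)
    (hF : ∀ g, glPoly g F = F) (hG : ∀ g, glPoly g G = G) (hl : ∀ g, glPoly g l = l)
    (h0 : diagRes k p = 0) (h1 : diagRes k (px k 1 * F + py k 1 * G) = 0) :
    ∃ c ∈ repFixed k, (rep 2 (minRes k)).d c = koszulCycle p F G l := by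
  obtain ⟨p, rfl⟩ := (isConjInv_of_glPoly hp).exists_invHom
  obtain ⟨F, rfl⟩ := (isConjInv_of_glPoly hF).exists_invHom
  obtain ⟨G, rfl⟩ := (isConjInv_of_glPoly hG).exists_invHom
  obtain ⟨l, rfl⟩ := (isConjInv_of_glPoly hl).exists_invHom
  obtain ⟨R, rfl⟩ := dvd_of_eval_squares (F := p) fun a b s t => by
    rw [← eval_toricPt_invHom]
    exact eval_toricPt_of_diagRes h0 a b s t
  obtain ⟨m, n, rfl, rfl⟩ := exists_of_square_relation (F := F) (G := G) fun a b s t => by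
    have h := eval_toricPt_of_diagRes h1 a b s t
    rw [eval_toricPt_px_mul_add, eval_toricPt_invHom, eval_toricPt_invHom] at h
    simpa using h
  refine ⟨invHom k (R * C (-1 / 4)) • commForm k + (invHom k (m * C (1 / 2)) • twoForm (px k) +
    invHom k (n * C (1 / 2)) • twoForm (py k)) + invHom k l • topForm k, ?_, ?_⟩
  · exact add_mem (add_mem (invHom_smul_mem' _ commForm_mem)
      (add_mem (invHom_smul_mem' _ twoForm_px_mem) (invHom_smul_mem' _ twoForm_py_mem)))
      (invHom_smul_mem' _ topForm_mem)
  · have h2 : invHom k (X 2) = invA k := aeval_X _ _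
    have h3 : invHom k (X 3) = invB k := aeval_X _ _
    have h4 : invHom k (X 4) = invC k := aeval_X _ _
    have e : invHom k R * C (-1 / 4) * (-4 * (invA k * invC k - invB k ^ 2)) =
        (invA k * invC k - invB k ^ 2) * invHom k R := by
      have e1 : (C (-1 / 4) * -4 : PairPoly k) = 1 := by
        rw [show (-4 : PairPoly k) = C (-4) by rw [map_neg, map_ofNat], ← C_mul]
        norm_num
      linear_combination (invA k * invC k - invB k ^ 2) * invHom k R * e1
    simp only [map_add, rep_d_smul, map_mul, invHom_C, commForm_d, twoForm_px_d, twoForm_py_d,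
      C_half_mul_smul, koszulCycle, map_sub, map_pow, map_neg, h2, h3, h4]
    rw [smul_smul, e]
    module

/-- Injectivity of the Harish-Chandra homomorphism in homology. The coefficients of an invariant
cycle are invariant, as they are uniquely determined. -/
theorem exists_fixed_d_eq {z : rep 2 (minRes k)} (hz : z ∈ repFixed k)
    (hd : (rep 2 (minRes k)).d z = 0) (h : diagEval k z = 0) :
    ∃ c ∈ repFixed k, (rep 2 (minRes k)).d c = z := by
  obtain ⟨p, F, G, l, p', F', G', l', rfl⟩ := exists_koszulCycle hd
  obtain ⟨⟨h0, h1⟩, h0', h1'⟩ := diagEval_eq_zero h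
  have hg := fun g => koszulCycle_eq_zero
    ((glAct_koszulCycle_sub g p F G l p' F' G' l').symm.trans (sub_eq_zero.2 (hz g)))
  obtain ⟨c, hc, e⟩ := exists_fixed_d_eq_koszulCycle (fun g => sub_eq_zero.1 (hg g).1.1)
    (fun g => sub_eq_zero.1 (hg g).1.2.1) (fun g => sub_eq_zero.1 (hg g).1.2.2.1)
    (fun g => sub_eq_zero.1 (hg g).1.2.2.2) h0 h1
  obtain ⟨c', hc', e'⟩ := exists_fixed_d_eq_koszulCycle (fun g => sub_eq_zero.1 (hg g).2.1)
    (fun g => sub_eq_zero.1 (hg g).2.2.1) (fun g => sub_eq_zero.1 (hg g).2.2.2.1)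
    (fun g => sub_eq_zero.1 (hg g).2.2.2.2) h0' h1'
  refine ⟨c + c' * repEta k 0, add_mem hc (mul_mem hc' repEta_zero_mem), ?_⟩
  rw [map_add, rep_d_mul_eta_zero, e, e']

theorem koszulCycle_invHom_mem (p F G : InvPoly k) :
    koszulCycle (invHom k p) (invHom k F) (invHom k G) 0 ∈ repFixed k := by
  rw [koszulCycle, zero_smul, add_zero]
  exact add_mem (add_mem (invHom_smul_mem p) (invHom_smul_mem' F oneForm_px_mem))
    (invHom_smul_mem' G oneForm_py_mem)

omit [CharZero k] in
theorem diagRes_px_one_sq : diagRes k (px k 1) * diagRes k (px k 1) = diagRes k (invA k) := by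
  simp [invA, diagRes, pow_two]

omit [CharZero k] in
theorem diagRes_py_one_sq : diagRes k (py k 1) * diagRes k (py k 1) = diagRes k (invC k) := by
  simp [invC, diagRes, pow_two]

omit [CharZero k] in
theorem diagRes_px_mul_py : diagRes k (px k 1) * diagRes k (py k 1) = diagRes k (invB k) := by
  simp [invB, diagRes]

/-- Every polynomial in `x_1, x_2, y_1, y_2` is a combination of `1`, `x_1 - x_2`, `y_1 - y_2` with
coefficients in the restrictions of invariant polynomials. -/
theorem exists_diagRes_invHom (q : MvPolynomial (Fin 2 ⊕ Fin 2) k) : ∃ P F G : InvPoly k,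
    q = diagRes k (invHom k P) +
      diagRes k (px k 1 * invHom k F + py k 1 * invHom k G) := by
  have h0 : invHom k (X 0) = px k 0 := aeval_X _ _
  have h1 : invHom k (X 1) = py k 0 := aeval_X _ _
  have h2 : invHom k (X 2) = invA k := aeval_X _ _
  have h3 : invHom k (X 3) = invB k := aeval_X _ _
  have h4 : invHom k (X 4) = invC k := aeval_X _ _
  have hc : (2 * C 2⁻¹ : MvPolynomial (Fin 2 ⊕ Fin 2) k) = 1 := by
    rw [show (2 : MvPolynomial (Fin 2 ⊕ Fin 2) k) = C 2 from (map_ofNat C 2).symm, ← C_mul]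
    norm_num
  have hx0 : (X (Sum.inl 0) : MvPolynomial (Fin 2 ⊕ Fin 2) k) =
      diagRes k (px k 0) + diagRes k (px k 1) := by
    simp [diagRes]; linear_combination -X (Sum.inl 0) * hc
  have hx1 : (X (Sum.inl 1) : MvPolynomial (Fin 2 ⊕ Fin 2) k) =
      diagRes k (px k 0) - diagRes k (px k 1) := by
    simp [diagRes]; linear_combination -X (Sum.inl 1) * hc
  have hy0 : (X (Sum.inr 0) : MvPolynomial (Fin 2 ⊕ Fin 2) k) =
      diagRes k (py k 0) + diagRes k (py k 1) := by
    simp [diagRes]; linear_combination -X (Sum.inr 0) * hc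
  have hy1 : (X (Sum.inr 1) : MvPolynomial (Fin 2 ⊕ Fin 2) k) =
      diagRes k (py k 0) - diagRes k (py k 1) := by
    simp [diagRes]; linear_combination -X (Sum.inr 1) * hc
  have hss := diagRes_px_one_sq (k := k)
  have hst := diagRes_px_mul_py (k := k)
  have htt := diagRes_py_one_sq (k := k)
  induction q using MvPolynomial.induction_on with
  | C c => exact ⟨C c, 0, 0, by rw [invHom_C]; simp [diagRes, ← algebraMap_eq]⟩
  | add q q' hq hq' =>
    obtain ⟨P, F, G, rfl⟩ := hq
    obtain ⟨P', F', G', rfl⟩ := hq'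
    exact ⟨P + P', F + F', G + G', by simp only [map_add, map_mul]; ring⟩
  | mul_X q i hq =>
    obtain ⟨P, F, G, rfl⟩ := hq
    rcases i with i | i <;> fin_cases i
    · refine ⟨P * X 0 + (F * X 2 + G * X 3), F * X 0 + P, G * X 0, ?_⟩
      change _ * X (Sum.inl 0) = _
      simp only [hx0, map_add, map_mul, h0, h2, h3, ← hss, ← hst]
      ring
    · refine ⟨P * X 0 - (F * X 2 + G * X 3), F * X 0 - P, G * X 0, ?_⟩
      change _ * X (Sum.inl 1) = _
      simp only [hx1, map_add, map_sub, map_mul, h0, h2, h3, ← hss, ← hst]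
      ring
    · refine ⟨P * X 1 + (F * X 3 + G * X 4), F * X 1, G * X 1 + P, ?_⟩
      change _ * X (Sum.inr 0) = _
      simp only [hy0, map_add, map_mul, h1, h3, h4, ← hst, ← htt]
      ring
    · refine ⟨P * X 1 - (F * X 3 + G * X 4), F * X 1, G * X 1 - P, ?_⟩
      change _ * X (Sum.inr 1) = _
      simp only [hy1, map_add, map_sub, map_mul, h1, h3, h4, ← hst, ← htt]
      ring

/-- The exchange of the two points. -/
noncomputable def polySwap (k : Type u) [Field k] :
    MvPolynomial (Fin 2 ⊕ Fin 2) k →ₐ[k] MvPolynomial (Fin 2 ⊕ Fin 2) k :=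
  rename (Sum.map (Equiv.swap 0 1) (Equiv.swap 0 1))

theorem polySwap_diagRes_invHom (P : InvPoly k) :
    polySwap k (diagRes k (invHom k P)) = diagRes k (invHom k P) := by
  have h : ((polySwap k).comp ((diagRes k).comp (invHom k))) = (diagRes k).comp (invHom k) := by
    refine MvPolynomial.algHom_ext fun i => ?_
    fin_cases i <;> simp [invHom, invA, invB, invC, diagRes, polySwap] <;> ring
  exact DFunLike.congr_fun h P

theorem polySwap_diagRes_odd (F G : InvPoly k) :
    polySwap k (diagRes k (px k 1 * invHom k F + py k 1 * invHom k G)) =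
      -diagRes k (px k 1 * invHom k F + py k 1 * invHom k G) := by
  have h1 : polySwap k (diagRes k (px k 1)) = -diagRes k (px k 1) := by
    simp [diagRes, polySwap]; ring
  have h2 : polySwap k (diagRes k (py k 1)) = -diagRes k (py k 1) := by
    simp [diagRes, polySwap]; ring
  simp only [map_add, map_mul, h1, h2, polySwap_diagRes_invHom]
  ring

theorem exists_of_polySwap_eq {q : MvPolynomial (Fin 2 ⊕ Fin 2) k} (h : polySwap k q = q) :
    ∃ P : InvPoly k, q = diagRes k (invHom k P) := by
  obtain ⟨P, F, G, rfl⟩ := exists_diagRes_invHom q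
  rw [map_add, polySwap_diagRes_invHom, polySwap_diagRes_odd] at h
  have h1 : 2 * diagRes k (px k 1 * invHom k F + py k 1 * invHom k G) = 0 := by
    linear_combination -h
  exact ⟨P, by rw [(mul_eq_zero.1 h1).resolve_left two_ne_zero, add_zero]⟩

theorem exists_of_polySwap_eq_neg {q : MvPolynomial (Fin 2 ⊕ Fin 2) k} (h : polySwap k q = -q) :
    ∃ F G : InvPoly k, q = diagRes k (px k 1 * invHom k F + py k 1 * invHom k G) := by
  obtain ⟨P, F, G, rfl⟩ := exists_diagRes_invHom q
  rw [map_add, polySwap_diagRes_invHom, polySwap_diagRes_odd] at h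
  have h1 : 2 * diagRes k (invHom k P) = 0 := by linear_combination h
  exact ⟨F, G, by rw [(mul_eq_zero.1 h1).resolve_left two_ne_zero, zero_add]⟩

omit [CharZero k] in
theorem permPoly_swap_incl (p : MvPolynomial (Fin 2 ⊕ Fin 2) k) :
    permPoly k 2 (Equiv.swap 0 1) (polyIncl k 2 p) = polyIncl k 2 (polySwap k p) := by
  refine (Algebra.TensorProduct.map_tmul _ _ _ _).trans ?_
  rw [map_one]
  rfl

omit [CharZero k] in
theorem permPoly_theta (σ : Equiv.Perm (Fin 2)) (i : Fin 2) :
    permPoly k 2 σ (thetaVar k 2 i) = thetaVar k 2 (σ i) :=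
  permPolyAlg_var k 2 σ i .θ

/-- Surjectivity of the Harish-Chandra homomorphism in homology, already on the level of invariant
cycles. -/
theorem exists_fixed_diagEval_eq {b : polyTheta k 2} (hb : ∀ σ, permPoly k 2 σ b = b) :
    ∃ z ∈ repFixed k, (rep 2 (minRes k)).d z = 0 ∧ diagEval k z = b := by
  obtain ⟨a0, a1, a2, a3, rfl⟩ := exists_polyTheta_two b
  have h := sub_eq_zero.2 (hb (Equiv.swap 0 1))
  simp only [map_add, map_mul, permPoly_swap_incl, permPoly_theta, Equiv.swap_apply_left,
    Equiv.swap_apply_right] at h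
  have h10 := (polyTheta_isGradedComm k 2).odd_mul_odd (thetaVar_mem (k := k) (n := 2) 1)
    (thetaVar_mem (k := k) (n := 2) 0)
  have h' : polyIncl k 2 (polySwap k a0 - a0) +
      polyIncl k 2 (polySwap k a2 - a1) * thetaVar k 2 0 +
      polyIncl k 2 (polySwap k a1 - a2) * thetaVar k 2 1 +
      polyIncl k 2 (-polySwap k a3 - a3) * (thetaVar k 2 0 * thetaVar k 2 1) = 0 := by
    refine Eq.trans ?_ h
    rw [h10]
    simp only [map_sub, map_neg, sub_mul, neg_mul, mul_neg]
    abel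
  obtain ⟨e0, e2, e1, e3⟩ := polyTheta_two_eq_zero h'
  obtain ⟨P, hP⟩ := exists_of_polySwap_eq (sub_eq_zero.1 e0)
  obtain ⟨P', hP'⟩ := exists_of_polySwap_eq (q := a1 + a2) (by
    rw [map_add, sub_eq_zero.1 e1, sub_eq_zero.1 e2, add_comm])
  obtain ⟨F, G, hFG⟩ := exists_of_polySwap_eq_neg (q := a2 - a1) (by
    rw [map_sub, sub_eq_zero.1 e1, sub_eq_zero.1 e2, neg_sub])
  obtain ⟨F', G', hFG'⟩ := exists_of_polySwap_eq_neg (q := -2 * a3) (by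
    simp only [map_mul, map_neg, map_ofNat]
    linear_combination 2 * e3)
  refine ⟨koszulCycle (invHom k P) (invHom k F) (invHom k G) 0 +
    koszulCycle (invHom k P') (invHom k F') (invHom k G') 0 * repEta k 0,
    add_mem (koszulCycle_invHom_mem _ _ _) (mul_mem (koszulCycle_invHom_mem _ _ _) repEta_zero_mem),
    ?_, ?_⟩
  · rw [map_add, rep_d_mul_eta_zero, koszulCycle_d, koszulCycle_d, zero_mul, add_zero]
  · have hc : (2 * C (1 / 2) : MvPolynomial (Fin 2 ⊕ Fin 2) k) = 1 := by
      rw [show (2 : MvPolynomial (Fin 2 ⊕ Fin 2) k) = C 2 from (map_ofNat C 2).symm, ← C_mul]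
      norm_num
    rw [diagEval_koszulCycle_add, ← hP, ← hP', ← hFG, ← hFG']
    congr 3
    · congr 2
      linear_combination a1 * hc
    · congr 1
      linear_combination a2 * hc
    · linear_combination a3 * hc

/-- The value at a generic pair of matrices with proportional traceless parts, as a polynomial in
`a, b, s, t` and the coordinates of the traceless matrix. -/
noncomputable def toricHom (k : Type u) [Field k] : PairPoly k →ₐ[k] MvPolynomial (Fin 4 ⊕ Fin 3) k :=
  aeval (Sum.elim (Fin.cons (X (Sum.inl 0)) fun i => X (Sum.inl 2) * X (Sum.inr i))
    (Fin.cons (X (Sum.inl 1)) fun i => X (Sum.inl 3) * X (Sum.inr i)))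

omit [CharZero k] in
theorem eval_toricHom (v : Fin 4 → k) (w : Fin 3 → k) (p : PairPoly k) :
    eval (Sum.elim v w) (toricHom k p) = eval (toricPt (v 0) (v 1) (v 2) (v 3) w) p := by
  have h : (aeval (Sum.elim v w) : MvPolynomial (Fin 4 ⊕ Fin 3) k →ₐ[k] k).comp (toricHom k) =
      aeval (toricPt (v 0) (v 1) (v 2) (v 3) w) := by
    refine MvPolynomial.algHom_ext fun i => ?_
    rw [AlgHom.comp_apply, toricHom, aeval_X, aeval_X]
    rcases i with i | i <;> refine Fin.cases ?_ (fun i => ?_) i <;> simp [toricPt]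
  exact DFunLike.congr_fun h p

/-- Conjugation of the traceless part. -/
theorem eval_toricPt_glPoly (g : GL (Fin 2) k) (a b s t : k) (w w' : Fin 3 → k)
    (h : !![w' 0, w' 1; w' 2, -w' 0] * (g : Matrix (Fin 2) (Fin 2) k) =
      g * !![w 0, w 1; w 2, -w 0]) (p : PairPoly k) :
    eval (toricPt a b s t w) (glPoly g p) = eval (toricPt a b s t w') p := by
  have key : ∀ a s : k, ∀ v : Fin 3 → k, ptMat (Fin.cons a fun i => s * v i : Fin 4 → k) =
      algebraMap k (Matrix (Fin 2) (Fin 2) k) a + s • !![v 0, v 1; v 2, -v 0] := by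
    intro a s v
    ext i j
    have e0 : (Fin.cons a fun i => s * v i : Fin 4 → k) 1 = s * v 0 := rfl
    have e1 : (Fin.cons a fun i => s * v i : Fin 4 → k) 2 = s * v 1 := rfl
    have e2 : (Fin.cons a fun i => s * v i : Fin 4 → k) 3 = s * v 2 := rfl
    fin_cases i <;> fin_cases j <;>
      simp [ptMat, e0, e1, e2, Matrix.algebraMap_matrix_apply, sub_eq_add_neg]
  have key' : ∀ a s : k, ptMat (Fin.cons a fun i => s * w' i : Fin 4 → k) *
      (g : Matrix (Fin 2) (Fin 2) k) = g * ptMat (Fin.cons a fun i => s * w i : Fin 4 → k) := by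
    intro a s
    rw [key, key, add_mul, mul_add, Algebra.commutes, smul_mul_assoc, mul_smul_comm, h]
  refine eval_glPoly g (toricPt a b s t w) (toricPt a b s t w') ?_ ?_ p
  · rw [toricPt, toricPt, Sum.elim_comp_inl, Sum.elim_comp_inl]
    exact key' a s
  · rw [toricPt, toricPt, Sum.elim_comp_inr, Sum.elim_comp_inr]
    exact key' b t

omit [CharZero k] in
theorem toricPt_diag (a b s t c : k) :
    toricPt a b s t ![c, 0, 0] = toricPt a b (s * c) (t * c) ![1, 0, 0] := by
  have h : ∀ (s : k) (i : Fin 3), s * (![c, 0, 0] : Fin 3 → k) i =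
      s * c * (![1, 0, 0] : Fin 3 → k) i := fun s i => by fin_cases i <;> simp
  simp only [toricPt, h]

/-- A polynomial invariant modulo the ideal of minors that restricts to zero on diagonal matrices
belongs to this ideal. -/
theorem mem_minorIdeal_of_diagRes {p : PairPoly k} (hp : ∀ g, glPoly g p - p ∈ minorIdeal k)
    (h0 : diagRes k p = 0) : p ∈ minorIdeal k := by
  refine mem_minorIdeal_of_eval_eq_zero fun a b s t w => ?_
  have h := eval_eq_zero_of_conj (toricHom k p) ?_ ?_ ![a, b, s, t] w
  · rwa [eval_toricHom] at h
  · intro v g w w' hg hw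
    have h1 := eval_toricPt_of_mem_minorIdeal
      (hp (Matrix.GeneralLinearGroup.mkOfDetNeZero g hg)) (v 0) (v 1) (v 2) (v 3) w
    rw [map_sub, eval_toricPt_glPoly _ _ _ _ _ w w' hw] at h1
    rw [eval_toricHom, eval_toricHom]
    exact sub_eq_zero.1 h1
  · intro v c
    rw [eval_toricHom, toricPt_diag]
    exact eval_toricPt_of_diagRes h0 _ _ _ _

/-- The analogue of `mem_minorIdeal_of_diagRes` for the coefficients `(F, G)` of a cycle. -/
theorem exists_of_diagRes {F G : PairPoly k} (hFG : ∀ g, ∃ u1 u2 u3 : PairPoly k,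
      glPoly g F - F = u1 * py k 1 + u2 * py k 2 + u3 * py k 3 ∧
      glPoly g G - G = -(u1 * px k 1 + u2 * px k 2 + u3 * px k 3))
    (h0 : diagRes k (px k 1 * F + py k 1 * G) = 0) :
    ∃ u1 u2 u3 : PairPoly k, F = u1 * py k 1 + u2 * py k 2 + u3 * py k 3 ∧
      G = -(u1 * px k 1 + u2 * px k 2 + u3 * px k 3) := by
  refine exists_of_toric_relation fun a b s t w => ?_
  let H : MvPolynomial (Fin 4 ⊕ Fin 3) k :=
    X (Sum.inl 2) * toricHom k F + X (Sum.inl 3) * toricHom k G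
  have hH : ∀ v w, eval (Sum.elim v w) H =
      v 2 * eval (toricPt (v 0) (v 1) (v 2) (v 3) w) F +
      v 3 * eval (toricPt (v 0) (v 1) (v 2) (v 3) w) G := fun v w => by
    simp only [H, map_add, map_mul, eval_X, eval_toricHom, Sum.elim_inl]
  -- the hypothesis gives `c * H = 0` at `![c, 0, 0]`; the factor `c` is absorbed by the conjugation
  -- invariant function `w_0² + w_1 w_2`
  have h1 : (X (Sum.inr 0) ^ 2 + X (Sum.inr 1) * X (Sum.inr 2)) * H = 0 := by
    refine MvPolynomial.funext fun pt => ?_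
    rw [map_zero, ← Sum.elim_comp_inl_inr pt]
    refine eval_eq_zero_of_conj _ ?_ ?_ _ _
    · intro v g w w' hg hw
      obtain ⟨u1, u2, u3, e1, e2⟩ := hFG (Matrix.GeneralLinearGroup.mkOfDetNeZero g hg)
      have f1 := congrArg (eval (toricPt (v 0) (v 1) (v 2) (v 3) w)) e1
      have f2 := congrArg (eval (toricPt (v 0) (v 1) (v 2) (v 3) w)) e2
      rw [map_sub, eval_toricPt_glPoly _ _ _ _ _ w w' hw] at f1 f2
      have hdet : w' 0 ^ 2 + w' 1 * w' 2 = w 0 ^ 2 + w 1 * w 2 := by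
        have h2 := congrArg Matrix.det hw
        rw [Matrix.det_mul, Matrix.det_mul, mul_comm] at h2
        have h3 := mul_left_cancel₀ hg h2
        rw [Matrix.det_fin_two_of, Matrix.det_fin_two_of] at h3
        linear_combination -h3
      have p1 : toricPt (v 0) (v 1) (v 2) (v 3) w (Sum.inl 1) = v 2 * w 0 := rfl
      have p2 : toricPt (v 0) (v 1) (v 2) (v 3) w (Sum.inl 2) = v 2 * w 1 := rfl
      have p3 : toricPt (v 0) (v 1) (v 2) (v 3) w (Sum.inl 3) = v 2 * w 2 := rfl
      have q1 : toricPt (v 0) (v 1) (v 2) (v 3) w (Sum.inr 1) = v 3 * w 0 := rfl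
      have q2 : toricPt (v 0) (v 1) (v 2) (v 3) w (Sum.inr 2) = v 3 * w 1 := rfl
      have q3 : toricPt (v 0) (v 1) (v 2) (v 3) w (Sum.inr 3) = v 3 * w 2 := rfl
      simp only [map_add, map_mul, map_neg, eval_X, p1, p2, p3, q1, q2, q3] at f1 f2
      simp only [map_add, map_mul, map_pow, eval_X, hH, Sum.elim_inr, hdet]
      linear_combination (w 0 ^ 2 + w 1 * w 2) * (v 2 * f1 + v 3 * f2)
    · intro v c
      have h2 := eval_toricPt_of_diagRes h0 (v 0) (v 1) (v 2 * c) (v 3 * c)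
      rw [eval_toricPt_px_mul_add, ← toricPt_diag] at h2
      simp only [Matrix.cons_val_zero] at h2
      simp only [map_add, map_mul, map_pow, eval_X, hH, Sum.elim_inr, Matrix.cons_val]
      linear_combination c * h2
  have h2 : H = 0 := by
    refine (mul_eq_zero.1 h1).resolve_left fun h3 => ?_
    have h4 := congrArg (eval (Sum.elim (0 : Fin 4 → k) ![1, 0, 0])) h3
    simp at h4
  have h3 := hH ![a, b, s, t] w
  rw [h2, map_zero] at h3
  exact h3.symm

/-- Injectivity on the invariants of the homology of the second representation algebra: a cycle
whose class is invariant has coefficients that are invariant modulo boundaries. -/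
theorem exists_d_eq_of_diagEval {z : rep 2 (minRes k)} (hd : (rep 2 (minRes k)).d z = 0)
    (hg : ∀ g, ∃ c, (rep 2 (minRes k)).d c = glAct 2 (minRes k) g z - z)
    (h : diagEval k z = 0) : ∃ c, (rep 2 (minRes k)).d c = z := by
  obtain ⟨p, F, G, l, p', F', G', l', rfl⟩ := exists_koszulCycle hd
  obtain ⟨⟨h0, h1⟩, h0', h1'⟩ := diagEval_eq_zero h
  have hg' := fun g => of_koszulCycle_eq_d
    ((hg g).choose_spec.trans (glAct_koszulCycle_sub g p F G l p' F' G' l'))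
  obtain ⟨c, e⟩ := exists_d_eq_koszulCycle l (mem_minorIdeal_of_diagRes (fun g => (hg' g).1.1) h0)
    (exists_of_diagRes (fun g => (hg' g).1.2) h1)
  obtain ⟨c', e'⟩ := exists_d_eq_koszulCycle l'
    (mem_minorIdeal_of_diagRes (fun g => (hg' g).2.1) h0')
    (exists_of_diagRes (fun g => (hg' g).2.2) h1')
  refine ⟨c + c' * repEta k 0, ?_⟩
  rw [map_add, rep_d_mul_eta_zero, e, e']

end MinResHarishChandra

end DGAlg

namespace DGAlg

/-! ### Naturality of representation algebras -/

section Naturality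

variable {k : Type u} [Field k]

theorem corepMap_comp (S : Pattern k) {A B C : DGAlg k} (g : Hom B C) (f : Hom A B)
    (z : corep S A) : corepMap S (g.comp f) z = corepMap S g (corepMap S f z) := by
  refine corep_hom_ext (corepMap S (g.comp f)) ((corepMap S g).comp (corepMap S f))
    (fun s a => ?_) z
  change _ = corepMap S g (corepMap S f (coord S A s a))
  rw [corepMap_coord, corepMap_coord, corepMap_coord]
  rfl

theorem corepMap_id (S : Pattern k) {A : DGAlg k} (z : corep S A) :
    corepMap S (Hom.id A) z = z :=
  corep_hom_ext (corepMap S (Hom.id A)) (Hom.id _) (fun s a => corepMap_coord S _ s a) z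

theorem glAct_coord' (n : ℕ) (A : DGAlg k) (g : GL (Fin n) k) (s : Fin n × Fin n) (a : A) :
    glAct n A g (coord (matPattern k n) A s a) =
      ∑ t : Fin n × Fin n, ((g : Matrix (Fin n) (Fin n) k) s.1 t.1 *
        ((g⁻¹ : GL (Fin n) k) : Matrix (Fin n) (Fin n) k) t.2 s.2) •
          coord (matPattern k n) A t a := by
  rw [glAct_coord, Finset.sum_comm, Fintype.sum_prod_type]

theorem permAct_coord' (n : ℕ) (A : DGAlg k) (σ : Equiv.Perm (Fin n)) (s : Fin n) (a : A) :
    permAct n A σ (coord (diagPattern k n) A s a) =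
      ∑ t : Fin n, (if t = σ s then (1 : k) else 0) • coord (diagPattern k n) A t a := by
  rw [permAct_coord]
  simp

theorem corepMap_glAct (n : ℕ) {A B : DGAlg k} (f : Hom A B) (g : GL (Fin n) k) (z : rep n A) :
    corepMap (matPattern k n) f (glAct n A g z) = glAct n B g (corepMap (matPattern k n) f z) := by
  refine corep_hom_ext ((corepMap (matPattern k n) f).comp (glAct n A g))
    ((glAct n B g).comp (corepMap (matPattern k n) f)) (fun s a => ?_) z
  change corepMap (matPattern k n) f (glAct n A g (coord (matPattern k n) A s a)) =
    glAct n B g (corepMap (matPattern k n) f (coord (matPattern k n) A s a))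
  rw [corepMap_coord, glAct_coord', glAct_coord', map_sum]
  refine Finset.sum_congr rfl fun t _ => ?_
  rw [map_smul, corepMap_coord]

theorem corepMap_permAct (n : ℕ) {A B : DGAlg k} (f : Hom A B) (σ : Equiv.Perm (Fin n))
    (z : diag n A) : corepMap (diagPattern k n) f (permAct n A σ z) =
      permAct n B σ (corepMap (diagPattern k n) f z) := by
  refine corep_hom_ext ((corepMap (diagPattern k n) f).comp (permAct n A σ))
    ((permAct n B σ).comp (corepMap (diagPattern k n) f)) (fun s a => ?_) z
  change corepMap (diagPattern k n) f (permAct n A σ (coord (diagPattern k n) A s a)) =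
    permAct n B σ (corepMap (diagPattern k n) f (coord (diagPattern k n) A s a))
  rw [permAct_coord, corepMap_coord, corepMap_coord, permAct_coord]

theorem toDiag_corepMap (n : ℕ) {A B : DGAlg k} (f : Hom A B) (z : rep n A) :
    toDiag n B (corepMap (matPattern k n) f z) = corepMap (diagPattern k n) f (toDiag n A z) := by
  refine corep_hom_ext ((toDiag n B).comp (corepMap (matPattern k n) f))
    ((corepMap (diagPattern k n) f).comp (toDiag n A)) (fun s a => ?_) z
  change toDiag n B (corepMap (matPattern k n) f (coord (matPattern k n) A s a)) =
    corepMap (diagPattern k n) f (toDiag n A (coord (matPattern k n) A s a))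
  rw [corepMap_coord, toDiag_coord, toDiag_coord]
  split_ifs
  · rw [corepMap_coord]
  · rw [map_zero]

theorem permAct_toDiag (n : ℕ) (A : DGAlg k) (σ : Equiv.Perm (Fin n)) (z : rep n A) :
    permAct n A σ (toDiag n A z) = toDiag n A (glAct n A (permGL k n σ) z) := by
  refine corep_hom_ext ((permAct n A σ).comp (toDiag n A))
    ((toDiag n A).comp (glAct n A (permGL k n σ))) (fun s a => ?_) z
  change permAct n A σ (toDiag n A (coord (matPattern k n) A s a)) =
    toDiag n A (glAct n A (permGL k n σ) (coord (matPattern k n) A s a))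
  rw [glAct_perm_coord, toDiag_coord, toDiag_coord]
  by_cases hs : s.1 = s.2
  · rw [if_pos hs, permAct_coord, if_pos (congrArg σ hs)]
  · rw [if_neg hs, map_zero, if_neg (fun h => hs (σ.injective h))]

theorem permPoly_diagToPoly (n : ℕ) (σ : Equiv.Perm (Fin n)) (z : diag n (minRes k)) :
    permPoly k n σ (diagToPoly k n z) = diagToPoly k n (permAct n (minRes k) σ z) := by
  refine corep_hom_ext ((permPoly k n σ).comp (diagToPoly k n))
    ((diagToPoly k n).comp (permAct n (minRes k) σ)) (fun i a => ?_) z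
  change permPoly k n σ (diagToPoly k n (coord (diagPattern k n) (minRes k) i a)) =
    diagToPoly k n (permAct n (minRes k) σ (coord (diagPattern k n) (minRes k) i a))
  rw [permAct_coord, diagToPoly_coord, diagToPoly_coord, permPoly_point]

theorem permPoly_diagEval (σ : Equiv.Perm (Fin 2)) (z : rep 2 (minRes k)) :
    permPoly k 2 σ (diagEval k z) = diagEval k (glAct 2 (minRes k) (permGL k 2 σ) z) := by
  change permPoly k 2 σ (diagToPoly k 2 (toDiag 2 (minRes k) z)) =
    diagToPoly k 2 (toDiag 2 (minRes k) (glAct 2 (minRes k) (permGL k 2 σ) z))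
  rw [permPoly_diagToPoly, permAct_toDiag]

variable [CharZero k]

/-- A morphism homotopic to the identity induces the identity in the homology of `A_n`, up to
boundaries that are invariant for invariant cycles. -/
theorem rep_homotopic_id (n : ℕ) {A : DGAlg k} (f : Hom A A) (H : Hom A (path A))
    (h0 : ∀ a, pathEval A 0 (H a) = f a) (h1 : ∀ a, pathEval A 1 (H a) = a) (z : rep n A)
    (hz : (rep n A).d z = 0) :
    ∃ c, (rep n A).d c = z - corepMap (matPattern k n) f z ∧
      ((∀ g, glAct n A g z = z) → ∀ g, glAct n A g c = c) := by
  obtain ⟨c, hc, hi⟩ := corepMap_homotopic (matPattern k n) H f (Hom.id A) h0 h1 z hz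
  rw [corepMap_id] at hc
  exact ⟨c, hc, fun h g => hi _ (glAct n A g) (glAct n A g) (glAct_coord' n A g)
    (glAct_coord' n A g) (h g)⟩

/-- A morphism homotopic to the identity induces the identity in the homology of
`(A_♮♮)^{⊗ n}`, up to boundaries that are invariant for invariant cycles. -/
theorem diag_homotopic_id (n : ℕ) {A : DGAlg k} (f : Hom A A) (H : Hom A (path A))
    (h0 : ∀ a, pathEval A 0 (H a) = f a) (h1 : ∀ a, pathEval A 1 (H a) = a) (z : diag n A)
    (hz : (diag n A).d z = 0) :
    ∃ c, (diag n A).d c = z - corepMap (diagPattern k n) f z ∧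
      ((∀ σ, permAct n A σ z = z) → ∀ σ, permAct n A σ c = c) := by
  obtain ⟨c, hc, hi⟩ := corepMap_homotopic (diagPattern k n) H f (Hom.id A) h0 h1 z hz
  rw [corepMap_id] at hc
  exact ⟨c, hc, fun h σ => hi _ (permAct n A σ) (permAct n A σ) (permAct_coord' n A σ)
    (permAct_coord' n A σ) (h σ)⟩

end Naturality

/-! ### Comparison of resolutions -/

section Comparison

variable {k : Type u} [Field k] [CharZero k]

theorem phiPoly_quasiIso (k : Type u) [Field k] [CharZero k] : (phiPoly k 2).QuasiIso := by
  refine (quasiIso_iff _).2 ⟨?_, ?_⟩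
  · rintro ⟨z, hz⟩ hd ⟨c, hc⟩
    obtain ⟨c', hc', e⟩ := exists_fixed_d_eq hz (congrArg Subtype.val hd)
      (congrArg Subtype.val hc).symm
    exact ⟨⟨c', hc'⟩, Subtype.ext e⟩
  · rintro ⟨b, hb⟩ -
    obtain ⟨z, hz, hd, e⟩ := exists_fixed_diagEval_eq hb
    refine ⟨⟨z, hz⟩, 0, Subtype.ext hd, Subtype.ext ?_⟩
    change diagEval k z = b + (polyTheta k 2).d 0
    rw [map_zero, add_zero, e]

omit [CharZero k] in
/-- Any cofibrant resolution of `k[x, y]` is homotopy equivalent to the minimal one. -/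
theorem exists_comparison {Q : DGAlg k} {p : Hom Q (kxy k)} (hQ : Q.IsCofibrant)
    (hp : p.QuasiIso) : ∃ (f : Hom Q (minRes k)) (g : Hom (minRes k) Q) (H : Hom Q (path Q))
      (H' : Hom (minRes k) (path (minRes k))), (∀ a, pathEval Q 0 (H a) = g.comp f a) ∧
      (∀ a, pathEval Q 1 (H a) = a) ∧ (∀ a, pathEval (minRes k) 0 (H' a) = f.comp g a) ∧
      ∀ a, pathEval (minRes k) 1 (H' a) = a := by
  have hs : Function.Surjective p := fun w => by
    obtain ⟨z, c, -, h⟩ := ((quasiIso_iff p).1 hp).2 w rfl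
    exact ⟨z, h.trans (add_zero w)⟩
  obtain ⟨f, hf⟩ := hQ _ _ (minResProj k) (minResProj_surjective k) (minResProj_quasiIso k) p
  obtain ⟨g, hg⟩ := minRes_isCofibrant k _ _ p hs hp (minResProj k)
  obtain ⟨H, h0, h1⟩ := exists_homotopy hQ p hs hp (g.comp f) (Hom.id Q)
    fun a => (hg (f a)).trans (hf a)
  obtain ⟨H', h0', h1'⟩ := exists_homotopy (minRes_isCofibrant k) (minResProj k)
    (minResProj_surjective k) (minResProj_quasiIso k) (f.comp g) (Hom.id _)
    fun a => (hf (g a)).trans (hg a)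
  exact ⟨f, g, H, H', h0, h1, h0', h1'⟩

theorem harishChandra_quasiIso {Q : DGAlg k} {p : Hom Q (kxy k)} (hQ : Q.IsCofibrant)
    (hp : p.QuasiIso) : (harishChandra 2 Q).QuasiIso := by
  obtain ⟨f, g, H, H', h0, h1, h0', h1'⟩ := exists_comparison hQ hp
  refine (quasiIso_iff _).2 ⟨?_, ?_⟩
  · rintro ⟨z, hz⟩ hd ⟨⟨c, _⟩, hc⟩
    replace hd : (rep 2 Q).d z = 0 := congrArg Subtype.val hd
    replace hc : (diag 2 Q).d c = toDiag 2 Q z := congrArg Subtype.val hc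
    obtain ⟨c1, hc1, e1⟩ := exists_fixed_d_eq (z := corepMap (matPattern k 2) f z)
      (fun g' => by rw [← corepMap_glAct, hz g']) (by rw [← Hom.map_d, hd, map_zero]) (by
        change diagToPoly k 2 (toDiag 2 (minRes k) (corepMap (matPattern k 2) f z)) = 0
        rw [toDiag_corepMap, ← hc, Hom.map_d, Hom.map_d]
        rfl)
    obtain ⟨c2, e2, hc2⟩ := rep_homotopic_id 2 _ H h0 h1 z hd
    refine ⟨⟨corepMap (matPattern k 2) g c1 + c2, fun g' => ?_⟩, Subtype.ext ?_⟩
    · rw [map_add, ← corepMap_glAct, hc1 g', hc2 hz g']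
    · change (rep 2 Q).d (corepMap (matPattern k 2) g c1 + c2) = z
      rw [map_add, ← Hom.map_d, e1, e2, corepMap_comp]
      abel
  · rintro ⟨w, hw⟩ hd
    replace hd : (diag 2 Q).d w = 0 := congrArg Subtype.val hd
    obtain ⟨z, hz, hdz, e⟩ := exists_fixed_diagEval_eq
      (b := diagToPoly k 2 (corepMap (diagPattern k 2) f w)) fun σ => by
        rw [permPoly_diagToPoly, ← corepMap_permAct, hw σ]
    replace e : toDiag 2 (minRes k) z = corepMap (diagPattern k 2) f w :=
      (diagToPoly_bijective 2).1 e
    obtain ⟨c, ec, hc⟩ := diag_homotopic_id 2 _ H h0 h1 w hd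
    refine ⟨⟨corepMap (matPattern k 2) g z, fun g' => ?_⟩, ⟨-c, fun σ => by rw [map_neg, hc hw σ]⟩,
      Subtype.ext ?_, Subtype.ext ?_⟩
    · rw [← corepMap_glAct, hz g']
    · change (rep 2 Q).d (corepMap (matPattern k 2) g z) = 0
      rw [← Hom.map_d, hdz, map_zero]
    · change toDiag 2 Q (corepMap (matPattern k 2) g z) = w + (diag 2 Q).d (-c)
      rw [map_neg, toDiag_corepMap, e, ec, corepMap_comp]
      abel

/-- A morphism to a DG algebra with zero differential factors through homology. -/
noncomputable def homologyLift {A B : DGAlg k} (f : Hom A B) (hB : ∀ b, B.d b = 0) :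
    A.homology →ₐ[k] B :=
  Ideal.Quotient.liftₐ A.boundaries (f.toAlgHom.comp A.cycles.val) (by
    rintro z ⟨c, hc⟩
    change f (z : A) = 0
    rw [← hc, f.map_d, hB])

omit [CharZero k] in
theorem homologyLift_cls {A B : DGAlg k} (f : Hom A B) (hB : ∀ b, B.d b = 0) (z : A)
    (hz : A.d z = 0) : homologyLift f hB (A.cls z hz) = f z := rfl

/-- The invariants of the homology of the second representation algebra of a cofibrant resolution.
The isomorphism is restriction to diagonal matrices, after comparison with the minimal
resolution. -/
theorem exists_homologyFixed_equiv {Q : DGAlg k} {p : Hom Q (kxy k)} (hQ : Q.IsCofibrant)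
    (hp : p.QuasiIso) : ∃ e : (rep 2 Q).homologyFixed (glAct 2 Q) ≃ₐ[k] polyInv k 2,
      ∀ (i : ℤ) (a : (rep 2 Q).homologyFixed (glAct 2 Q)),
        (a : (rep 2 Q).homology) ∈ (rep 2 Q).homologyGr i ↔ e a ∈ (polyInv k 2).gr i := by
  obtain ⟨f, g, H, H', h0, h1, h0', h1'⟩ := exists_comparison hQ hp
  let E : Hom (rep 2 Q) (polyTheta k 2) := (diagEval k).comp (corepMap (matPattern k 2) f)
  have hE : ∀ σ z, permPoly k 2 σ (E z) = E (glAct 2 Q (permGL k 2 σ) z) := fun σ z => by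
    change permPoly k 2 σ (diagEval k (corepMap (matPattern k 2) f z)) =
      diagEval k (corepMap (matPattern k 2) f (glAct 2 Q (permGL k 2 σ) z))
    rw [permPoly_diagEval, corepMap_glAct]
  have hd : ∀ b : polyTheta k 2, (polyTheta k 2).d b = 0 := fun _ => rfl
  -- every invariant polynomial is the image of an invariant cycle
  have hlift : ∀ b : polyTheta k 2, (∀ σ, permPoly k 2 σ b = b) →
      ∃ z, (rep 2 Q).d z = 0 ∧ (∀ g', glAct 2 Q g' z = z) ∧ E z = b := by
    intro b hb
    obtain ⟨z, hz, hdz, e⟩ := exists_fixed_diagEval_eq hb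
    obtain ⟨c, ec, -⟩ := rep_homotopic_id 2 _ H' h0' h1' z hdz
    refine ⟨corepMap (matPattern k 2) g z, by rw [← Hom.map_d, hdz, map_zero],
      fun g' => by rw [← corepMap_glAct, hz g'], ?_⟩
    have e2 := congrArg (diagEval k) ec
    rw [corepMap_comp, (diagEval k).map_d, hd, map_sub, e] at e2
    exact (sub_eq_zero.1 e2.symm).symm
  let φ : (rep 2 Q).homologyFixed (glAct 2 Q) →ₐ[k] polyInv k 2 :=
    ((homologyLift E hd).comp ((rep 2 Q).homologyFixed (glAct 2 Q)).val).codRestrict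
      ((polyTheta k 2).fixedSubalgebra (permPoly k 2)) (by
        rintro ⟨a, ha⟩ σ
        obtain ⟨z, hz, rfl⟩ := (rep 2 Q).cls_surjective a
        have h := congrArg (homologyLift E hd) (ha (permGL k 2 σ))
        rw [homologyMap_cls, homologyLift_cls, homologyLift_cls] at h
        change permPoly k 2 σ (E z) = E z
        rw [hE, h])
  have hφ : ∀ z hz ha, (φ ⟨(rep 2 Q).cls z hz, ha⟩).1 = E z :=
    fun _ _ _ => rfl
  have hinj : Function.Injective φ := by
    rw [injective_iff_map_eq_zero]
    rintro ⟨a, ha⟩ h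
    obtain ⟨z, hz, rfl⟩ := (rep 2 Q).cls_surjective a
    have h2 : E z = 0 := congrArg Subtype.val h
    obtain ⟨c, hc⟩ := exists_d_eq_of_diagEval (z := corepMap (matPattern k 2) f z)
      (by rw [← Hom.map_d, hz, map_zero]) (fun g' => by
        have h3 := ha g'
        rw [homologyMap_cls, cls_eq_iff] at h3
        obtain ⟨c, hc⟩ := h3
        exact ⟨corepMap (matPattern k 2) f c, by
          rw [← Hom.map_d, hc, map_sub, corepMap_glAct]⟩) h2
    obtain ⟨c', hc', -⟩ := rep_homotopic_id 2 _ H h0 h1 z hz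
    refine Subtype.ext (((rep 2 Q).cls_eq_iff hz (map_zero _)).2
      ⟨corepMap (matPattern k 2) g c + c', ?_⟩)
    rw [map_add, ← Hom.map_d, hc, hc', corepMap_comp]
    abel
  have hfix : ∀ z hz, (∀ g', glAct 2 Q g' z = z) →
      (rep 2 Q).cls z hz ∈ (rep 2 Q).homologyFixed (glAct 2 Q) := fun z hz h g' => by
    rw [homologyMap_cls]
    exact ((rep 2 Q).cls_eq_iff _ _).2 ⟨0, by rw [h g', map_zero, sub_self]⟩
  have hsurj : Function.Surjective φ := by
    rintro ⟨b, hb⟩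
    obtain ⟨z, hz, hz', e⟩ := hlift b hb
    exact ⟨⟨_, hfix z hz hz'⟩, Subtype.ext e⟩
  refine ⟨AlgEquiv.ofBijective φ ⟨hinj, hsurj⟩, ?_⟩
  rintro i ⟨a, ha⟩
  constructor
  · rintro ⟨⟨z, hz⟩, hzi, rfl⟩
    exact E.map_mem i z hzi
  · -- by injectivity the class is represented by the component of degree `i` of an invariant cycle
    intro hi
    obtain ⟨z, hz, hz', e⟩ := hlift _ (φ ⟨a, ha⟩).2
    have hi' : E z ∈ (polyTheta k 2).gr i := e.symm ▸ hi
    have hpz : (rep 2 Q).d ((rep 2 Q).proj i z) = 0 := by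
      rw [d_proj, hz, map_zero]
    have hpz' : ∀ g', glAct 2 Q g' ((rep 2 Q).proj i z) = (rep 2 Q).proj i z := fun g' => by
      rw [Hom.map_proj, hz' g']
    have h2 : (⟨a, ha⟩ : (rep 2 Q).homologyFixed (glAct 2 Q)) =
        ⟨(rep 2 Q).cls _ hpz, hfix _ hpz hpz'⟩ := by
      refine hinj (Subtype.ext ?_)
      rw [hφ, Hom.map_proj, proj_of_mem _ hi', e]
    rw [congrArg Subtype.val h2]
    exact ⟨⟨_, hpz⟩, proj_mem (rep 2 Q) i z, rfl⟩

end Comparison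

end DGAlg

theorem theorem4p5 {k : Type u} [Field k] [CharZero k] :
    ((DGAlg.minRes k).IsCofibrant ∧ (DGAlg.minResProj k).QuasiIso ∧
      Function.Bijective (DGAlg.diagToPoly k 2) ∧ (DGAlg.phiPoly k 2).QuasiIso) ∧
    ∀ (Q : DGAlg.{u} k) (p : DGAlg.Hom Q (DGAlg.kxy k)), Q.IsCofibrant → p.QuasiIso →
      (DGAlg.harishChandra 2 Q).QuasiIso ∧
      ∃ e : (DGAlg.rep 2 Q).homologyFixed (DGAlg.glAct 2 Q) ≃ₐ[k] DGAlg.polyInv k 2,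
        ∀ (i : ℤ) (a : (DGAlg.rep 2 Q).homologyFixed (DGAlg.glAct 2 Q)),
          (a : (DGAlg.rep 2 Q).homology) ∈ (DGAlg.rep 2 Q).homologyGr i ↔
            e a ∈ (DGAlg.polyInv k 2).gr i :=
  ⟨⟨DGAlg.minRes_isCofibrant k, DGAlg.minResProj_quasiIso k, DGAlg.diagToPoly_bijective 2,
    DGAlg.phiPoly_quasiIso k⟩, fun _ _ hQ hp =>
    ⟨DGAlg.harishChandra_quasiIso hQ hp, DGAlg.exists_homologyFixed_equiv hQ hp⟩⟩
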